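/- **Setting.** Let $\mathbb K$ be a complete local noetherian integral domain, $(W,S)$ a Coxeter system with length function $\ell$ and Bruhat order $\le$, and $(V,\{\alpha_s\}_{s\in S},\{\alpha_s^\vee\}_{s\in S})$ a realization of $(W,S)$ over $\mathbb K$: $V$ is a free $\mathbb K$-module of finite rank, $\alpha_s\in V$, $\alpha_s^\vee\in\operatorname{Hom}(V,\mathbb K)$, $\langle\alpha_s^\vee,\alpha_s\rangle=2$, the formula $s(v)=v-\langle\alpha_s^\vee,v\rangle\alpha_s$ defines an action of $W$ on $V$, and for $s\ne t$ with $m_{st}=\operatorname{ord}(st)<\infty$ the two-coloured quantum numbers $[m_{st}]_x,[m_{st}]_y$ vanish at $x=-\langle\alpha_s^\vee,\alpha_t\rangle$, $y=-\langle\alpha_t^\vee,\alpha_s\rangle$. Assume $\alpha_s\neq0$ and $\alpha_s^\vee\colon V\to\mathbb K$ surjective for all $s$. For a reflection $t=wsw^{-1}$ put $\alpha_t=w(\alpha_s)$ for a fixed choice of $(w,s)$. Let $R=\operatorname{Sym}(V)$, graded with $\deg V=2$, let $Q$ be its fraction field, and write $M(k)^i=M^{i+k}$. Let $\mathcal C$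 be the category of graded $R$-bimodules $M$ with a decomposition $M\otimes_RQ=\bigoplus_{x\in W}M_Q^x$ such that $fm=m\,x^{-1}(f)$ for $m\in M_Q^x$, $f\in R$; morphisms are the degree-zero bimodule homomorphisms that map $M_Q^x$ to $N_Q^x$ for every $x$. Put $\operatorname{supp}_W(M)=\{x\mid M_Q^x\ne0\}$, let $M^x$ be the image of $M$ in $M_Q^x$, and let $R_x\in\mathcal C$ be $R$ as a right module, with left action $f\cdot r=x^{-1}(f)r$, concentrated in $x$. The tensor product is $M\otimes N=M\otimes_RN$ with $(M\otimes N)_Q^w=\bigoplus_{yx=w}M_Q^y\otimes_QN_Q^x$. For $s\in S$ let $B_s=R\otimes_{R^s}R(1)$, with its unique structure of an object of $\mathcal C$ with support $\{e,s\}$. The category of Soergel bimodules is the smallest full subcategory of $\mathcal C$ which contains $R_e$ and all $B_s$ and is closed under $\oplus$, shifts, $\otimes$ and direct summands. For $w\in W$ let $B(w)$ be the indecomposable Soergel bimodule with $\operatorname{supp}_W(B(w))\subset\{x\mid x\le w\}$ and $B(w)^w\simeq R_w(\ell(w))$. Let $S_0\subset S$, and let $W_{S_0}=\langle S_0\rangle$.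 Assume: 1. $W_{S_0}$ is finite and acts faithfully on $V$; 2. for distinct reflections $t_1,t_2\in W_{S_0}$ and every maximal ideal $\mathfrak m\subset\mathbb K$, $\alpha_{t_1},\alpha_{t_2}$ are linearly independent in the $\mathbb K/\mathfrak m$-vector space $V/\mathfrak mV$; 3. $R\simeq\bigoplus_{w\in W_{S_0}}R^{W_{S_0}}(-2\ell(w))$ as graded $R^{W_{S_0}}$-modules; 4. for all $s\ne t$ in $S$ with $m=m_{st}<\infty$ there is a morphism $B_s\otimes B_t\otimes\cdots\to B_t\otimes B_s\otimes\cdots$ ($m$ factors on each side) in $\mathcal C$ which maps $(1\otimes1)\otimes\cdots\otimes(1\otimes1)$ to $(1\otimes1)\otimes\cdots\otimes(1\otimes1)$. Let $T_{S_0}$ be the set of reflections in $W_{S_0}$ and $$\mathcal Z_{S_0}=\Big\{(z_w)\in\bigoplus_{w\in W_{S_0}}R\ \Big|\ z_{wt}\equiv z_w\pmod{\alpha_t}\ \text{ for all } w\in W_{S_0},\ t\in T_{S_0}\Big\},$$ an $R$-bimodule via $f(z_w)g=(w^{-1}(f)z_wg)$, where $(\mathcal Z_{S_0})_Q^x$ is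 the part of $\mathcal Z_{S_0}\otimes_RQ\simeq\bigoplus_{w\in W_{S_0}}Q$ supported at $x$. Regard $R\otimes_{R^{W_{S_0}}}R$ with $(R\otimes_{R^{W_{S_0}}}R)_Q^x=\{\xi\mid f\xi=\xi x^{-1}(f)\ \forall f\in R\}$ for $x\in W_{S_0}$, and $0$ for $x\notin W_{S_0}$. **Proposition.** Let $w_{S_0}$ be the longest element of $W_{S_0}$. Then $R\otimes_{R^{W_{S_0}}}R$ and $\mathcal Z_{S_0}$ are objects of $\mathcal C$, and in $\mathcal C$ $$B(w_{S_0})\ \simeq\ R\otimes_{R^{W_{S_0}}}R(\ell(w_{S_0}))\ \simeq\ \mathcal Z_{S_0}(\ell(w_{S_0})).$$ That is, $R\otimes_{R^{W_{S_0}}}R(\ell(w_{S_0}))$ has the properties that define $B(w_{S_0})$, and every object with these properties is isomorphic to it. In particular, $R\otimes_{R^{W_{S_0}}}R$ is an indecomposable Soergel bimodule. -/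

import Mathlib

open scoped TensorProduct

noncomputable section

universe u v

/-- The two-coloured quantum numbers: `quantumNumber x y n` is `[n]_x` and `quantumNumber y x n`
is `[n]_y`. They satisfy `[0]_x = 0`, `[1]_x = 1` and `x [n+1]_y = [n+2]_x + [n]_x`. -/
def quantumNumber {K : Type*} [CommRing K] : K → K → ℕ → K
  | _, _, 0 => 0
  | _, _, 1 => 1
  | x, y, n + 2 => x * quantumNumber y x (n + 1) - quantumNumber x y n

/-- A realization of the Coxeter system `cs` on the `K`-module `V` (which is meant to be free of
finite rank): roots `α_s ∈ V`, coroots `α_s^∨ : V → K` with `⟨α_s^∨, α_s⟩ = 2`, such that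
`s(v) = v - ⟨α_s^∨, v⟩ α_s` defines an action of `W` on `V`, and such that
`[m_{st}]_x = [m_{st}]_y = 0` for `x = -⟨α_s^∨, α_t⟩`, `y = -⟨α_t^∨, α_s⟩`.
(If `m_{st} = ∞`, which Mathlib encodes as `0`, the last condition is empty.) -/
structure CoxeterRealization (K V : Type*) [CommRing K] [AddCommGroup V] [Module K V]
    {B W : Type*} [Group W] {M : CoxeterMatrix B} (cs : CoxeterSystem M W) where
  act : Representation K W V
  root : B → V
  coroot : B → V →ₗ[K] K
  coroot_root : ∀ i, coroot i (root i) = 2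
  act_simple : ∀ i v, act (cs.simple i) v = v - coroot i v • root i
  quantum : ∀ i j, i ≠ j →
    quantumNumber (-(coroot i (root j))) (-(coroot j (root i))) (M i j) = 0 ∧
    quantumNumber (-(coroot j (root i))) (-(coroot i (root j))) (M i j) = 0

namespace CoxeterSystem

variable {B W : Type*} [Group W] {M : CoxeterMatrix B} (cs : CoxeterSystem M W)

/-- The parabolic subgroup `W_{S₀}` generated by the simple reflections in `S₀`. -/
def parabolic (S₀ : Set B) : Subgroup W := Subgroup.closure (cs.simple '' S₀)

/-- The Bruhat order on `W`. -/
def BruhatLE : W → W → Prop :=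
  Relation.ReflTransGen fun x y => ∃ t, cs.IsReflection t ∧ y = x * t ∧ cs.length x < cs.length y

/-- `w₀` is the longest element of the (finite) parabolic subgroup `W_{S₀}`. -/
def IsLongest (S₀ : Set B) (w₀ : W) : Prop :=
  w₀ ∈ cs.parabolic S₀ ∧ ∀ w ∈ cs.parabolic S₀, cs.length w ≤ cs.length w₀

end CoxeterSystem

namespace CoxeterRealization

variable {K : Type u} {V : Type v} [CommRing K] [AddCommGroup V] [Module K V]
  {B W : Type*} [Group W] {M : CoxeterMatrix B} {cs : CoxeterSystem M W}

section Ring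

/-- The symmetric algebra `R` of `V`. -/
abbrev R (_ : CoxeterRealization K V cs) : Type (max u v) := SymmetricAlgebra K V

/-- The fraction field `Q` of `R`. -/
abbrev Q (X : CoxeterRealization K V cs) : Type (max u v) := FractionRing X.R

variable (X : CoxeterRealization K V cs)

/-- The degree `i` part of `R`, where `V` sits in degree `2`. -/
def degR (i : ℤ) : AddSubgroup X.R :=
  ⨆ (n : ℕ) (_ : 2 * (n : ℤ) = i),
    ((LinearMap.range (SymmetricAlgebra.ι K V)) ^ n).toAddSubgroup

/-- The action of `w ∈ W` on `R` by algebra automorphisms. -/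
def actR (w : W) : X.R →ₐ[K] X.R :=
  SymmetricAlgebra.lift (SymmetricAlgebra.ι K V ∘ₗ X.act w)

/-- The algebra `R^H` of invariants of a subgroup `H` of `W`. -/
def invariants (H : Subgroup W) : Subalgebra K X.R where
  carrier := {f | ∀ w ∈ H, X.actR w f = f}
  mul_mem' ha hb w hw := by rw [map_mul, ha w hw, hb w hw]
  add_mem' ha hb w hw := by rw [map_add, ha w hw, hb w hw]
  algebraMap_mem' r w _ := by rw [AlgHom.commutes]

open Classical in
/-- The root `α_t = w(α_s)` of a reflection `t`, for a fixed choice of `(w, s)` with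
`t = w s w⁻¹` (and `0` if `t` is not a reflection). -/
def reflRoot (t : W) : V :=
  if h : cs.IsReflection t then X.act h.choose (X.root h.choose_spec.choose) else 0

theorem actR_ι (w : W) (v : V) :
    X.actR w (SymmetricAlgebra.ι K V v) = SymmetricAlgebra.ι K V (X.act w v) := by
  simp [actR]

theorem actR_one : X.actR 1 = AlgHom.id K X.R := by
  apply SymmetricAlgebra.algHom_ext
  ext v
  simp [actR_ι]

theorem actR_mul (w w' : W) (f : X.R) : X.actR (w * w') f = X.actR w (X.actR w' f) := by
  have : X.actR (w * w') = (X.actR w).comp (X.actR w') := by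
    apply SymmetricAlgebra.algHom_ext
    ext v
    simp [actR_ι]
  rw [this]; rfl

/-- `t(f) ≡ f` modulo `α_t`. -/
theorem actR_sub_mem {t : W} (ht : cs.IsReflection t) (f : X.R) :
    X.actR t f - f ∈ Ideal.span {SymmetricAlgebra.ι K V (X.reflRoot t)} := by
  set I := Ideal.span {SymmetricAlgebra.ι K V (X.reflRoot t)} with hI
  have key : (Ideal.Quotient.mkₐ K I).comp (X.actR t) = Ideal.Quotient.mkₐ K I := by
    apply SymmetricAlgebra.algHom_ext
    ext v
    change Ideal.Quotient.mk I (X.actR t (SymmetricAlgebra.ι K V v)) =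
      Ideal.Quotient.mk I (SymmetricAlgebra.ι K V v)
    rw [actR_ι, Ideal.Quotient.eq, ← map_sub]
    have h1 : X.reflRoot t = X.act ht.choose (X.root ht.choose_spec.choose) := by
      simp [reflRoot, ht]
    have h2 : t = ht.choose * cs.simple ht.choose_spec.choose * (ht.choose)⁻¹ :=
      ht.choose_spec.choose_spec
    generalize ht.choose_spec.choose = s at h1 h2
    generalize ht.choose = w at h1 h2
    have h3 : X.act t v - v = (-(X.coroot s (X.act w⁻¹ v))) • X.reflRoot t := by
      rw [h1, h2, map_mul, map_mul, Module.End.mul_apply, Module.End.mul_apply, X.act_simple,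
        map_sub, map_smul, ← Module.End.mul_apply (X.act w) (X.act w⁻¹), ← map_mul]
      simp
    rw [h3, map_smul, Algebra.smul_def]
    exact I.mul_mem_left _ (Ideal.subset_span rfl)
  have := DFunLike.congr_fun key f
  exact Ideal.Quotient.eq.1 this

end Ring

universe w w'

/-- The data underlying an object of the category `𝒞`: an `R`-bimodule, a family of additive
subgroups `deg i` (`i ∈ ℤ`), and a family of `Q`-subspaces `loc x` (`x ∈ W`) of the localization
`M_Q = M ⊗_R Q`. The right action of `R` is the `R`-module structure on `carrier`, so that
`M ⊗_R Q` is `Q ⊗[R] carrier`; the left action is `left`. The axioms on `deg` and `loc` are stated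
in `PreObj.IsObj`. -/
structure PreObj (X : CoxeterRealization K V cs) where
  carrier : Type w
  [addCommGroup : AddCommGroup carrier]
  [module : Module X.R carrier]
  left : X.R →+* Module.End X.R carrier
  deg : ℤ → AddSubgroup carrier
  loc : W → Submodule X.Q (X.Q ⊗[X.R] carrier)

attribute [instance] PreObj.addCommGroup PreObj.module

namespace PreObj

variable {X : CoxeterRealization K V cs}

open Classical in
/-- `N` is an object of `𝒞`: it is a graded bimodule, `N ⊗_R Q = ⨁_x N_Q^x`, and
`f n = n x⁻¹(f)` for `n ∈ N_Q^x`. -/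
structure IsObj (N : PreObj.{u, v, w} X) : Prop where
  deg_internal : DirectSum.IsInternal N.deg
  right_deg : ∀ i j r n, r ∈ X.degR i → n ∈ N.deg j → r • n ∈ N.deg (i + j)
  left_deg : ∀ i j r n, r ∈ X.degR i → n ∈ N.deg j → N.left r n ∈ N.deg (i + j)
  loc_internal : DirectSum.IsInternal N.loc
  left_loc : ∀ x, ∀ ξ ∈ N.loc x, ∀ f : X.R,
    (N.left f).baseChange X.Q ξ = algebraMap X.R X.Q (X.actR x⁻¹ f) • ξ

/-- Morphisms of `𝒞`: degree zero bimodule homomorphisms `φ` with `φ(N_Q^x) ⊆ P_Q^x`. -/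
structure Hom (N : PreObj.{u, v, w} X) (P : PreObj.{u, v, w'} X) where
  toLin : N.carrier →ₗ[X.R] P.carrier
  map_left : ∀ f n, toLin (N.left f n) = P.left f (toLin n)
  map_deg : ∀ i, ∀ n ∈ N.deg i, toLin n ∈ P.deg i
  map_loc : ∀ x, ∀ ξ ∈ N.loc x, toLin.baseChange X.Q ξ ∈ P.loc x

/-- Isomorphisms of `𝒞`. -/
structure Iso (N : PreObj.{u, v, w} X) (P : PreObj.{u, v, w'} X) where
  hom : Hom N P
  inv : Hom P N
  hom_inv : ∀ n, inv.toLin (hom.toLin n) = n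
  inv_hom : ∀ p, hom.toLin (inv.toLin p) = p

/-- The support `{x ∈ W | N_Q^x ≠ 0}`. -/
def supp (N : PreObj.{u, v, w} X) : Set W := {x | N.loc x ≠ ⊥}

/-- The shift `N(k)`, with `N(k)^i = N^{i+k}`. -/
def shift (N : PreObj.{u, v, w} X) (k : ℤ) : PreObj.{u, v, w} X :=
  { N with deg := fun i => N.deg (i + k) }

/-- The direct sum `N ⊕ P`. -/
def dsum (N : PreObj.{u, v, w} X) (P : PreObj.{u, v, w'} X) : PreObj.{u, v, max w w'} X where
  carrier := N.carrier × P.carrier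
  left :=
    { toFun := fun f => (N.left f).prodMap (P.left f)
      map_one' := by ext <;> simp
      map_mul' := fun a b => by ext <;> simp
      map_zero' := by ext <;> simp
      map_add' := fun a b => by ext <;> simp }
  deg := fun i => (N.deg i).prod (P.deg i)
  loc := fun x =>
    (N.loc x).map ((LinearMap.inl X.R N.carrier P.carrier).baseChange X.Q) ⊔
    (P.loc x).map ((LinearMap.inr X.R N.carrier P.carrier).baseChange X.Q)

/-- `P.LeftMod` is `P`, viewed as a left `R`-module. -/
def LeftMod (P : PreObj.{u, v, w} X) : Type w := P.carrier

instance (P : PreObj.{u, v, w} X) : AddCommGroup P.LeftMod := P.addCommGroup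

instance (P : PreObj.{u, v, w} X) : Module X.R P.LeftMod :=
  Module.compHom P.carrier P.left

/-- The identity map from `P` to `P.LeftMod`. -/
def toLeft {P : PreObj.{u, v, w} X} (p : P.carrier) : P.LeftMod := p

/-- The identity map from `P.LeftMod` to `P`. -/
def ofLeft {P : PreObj.{u, v, w} X} (p : P.LeftMod) : P.carrier := p

/-- The right action of `R` on `P`, through endomorphisms of the left module `P.LeftMod`. -/
def rightEnd (P : PreObj.{u, v, w} X) : X.R →+* Module.End X.R P.LeftMod where
  toFun r :=
    { toFun := fun p => toLeft (r • ofLeft p)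
      map_add' := fun a b => smul_add r (ofLeft a) (ofLeft b)
      map_smul' := fun f p => ((P.left f).map_smul r (ofLeft p)).symm }
  map_one' := LinearMap.ext fun p => one_smul X.R (ofLeft p)
  map_mul' a b := LinearMap.ext fun p => mul_smul a b (ofLeft p)
  map_zero' := LinearMap.ext fun p => zero_smul X.R (ofLeft p)
  map_add' a b := LinearMap.ext fun p => add_smul a b (ofLeft p)

/-- The abelian group `N ⊗_R P`: the right action on `N` is balanced against the left action
on `P`. -/
def TensorCarrier (N : PreObj.{u, v, w} X) (P : PreObj.{u, v, w'} X) : Type (max w w') :=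
  N.carrier ⊗[X.R] P.LeftMod

instance (N : PreObj.{u, v, w} X) (P : PreObj.{u, v, w'} X) : AddCommGroup (TensorCarrier N P) :=
  inferInstanceAs (AddCommGroup (N.carrier ⊗[X.R] P.LeftMod))

/-- The element `n ⊗ p` of `N ⊗_R P`. -/
def tmul {N : PreObj.{u, v, w} X} {P : PreObj.{u, v, w'} X} (n : N.carrier) (p : P.carrier) :
    TensorCarrier N P :=
  TensorProduct.tmul X.R n (toLeft p)

/-- The right action of `R` on `N ⊗_R P`, by `(n ⊗ p) r = n ⊗ p r`. -/
def tensorRight (N : PreObj.{u, v, w} X) (P : PreObj.{u, v, w'} X) :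
    X.R →+* Module.End X.R (N.carrier ⊗[X.R] P.LeftMod) :=
  (Module.End.lTensorAlgHom X.R P.LeftMod N.carrier).toRingHom.comp P.rightEnd

/-- The left action of `R` on `N ⊗_R P`, by `f (n ⊗ p) = f n ⊗ p`. -/
def tensorLeft (N : PreObj.{u, v, w} X) (P : PreObj.{u, v, w'} X) :
    X.R →+* Module.End X.R (N.carrier ⊗[X.R] P.LeftMod) :=
  (Module.End.rTensorAlgHom X.R N.carrier P.LeftMod).toRingHom.comp N.left

instance (N : PreObj.{u, v, w} X) (P : PreObj.{u, v, w'} X) : Module X.R (TensorCarrier N P) :=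
  Module.compHom (N.carrier ⊗[X.R] P.LeftMod) (tensorRight N P)

theorem tensorLeft_right (N : PreObj.{u, v, w} X) (P : PreObj.{u, v, w'} X) (f r : X.R)
    (z : N.carrier ⊗[X.R] P.LeftMod) :
    tensorLeft N P f (tensorRight N P r z) = tensorRight N P r (tensorLeft N P f z) := by
  induction z using TensorProduct.induction_on with
  | zero => simp
  | tmul n p => rfl
  | add a b ha hb => simp only [map_add, ha, hb]

/-- The tensor product `N ⊗ P` of `𝒞`, with underlying bimodule `N ⊗_R P`. The subspace
`(N ⊗ P)_Q^x = ⨁_{y z = x} N_Q^y ⊗_Q P_Q^z` is spanned over `Q` by the images of the `n ⊗ p`, where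
`n ∈ N` has image in `N_Q^y` and `p ∈ P` has image in `P_Q^z`: up to denominators, each element of
`N_Q^y` and of `P_Q^z` comes from `N` and `P`. -/
def tensor (N : PreObj.{u, v, w} X) (P : PreObj.{u, v, w'} X) :
    PreObj.{u, v, max w w'} X where
  carrier := TensorCarrier N P
  left :=
    { toFun := fun f =>
        { toFun := fun z => tensorLeft N P f z
          map_add' := fun a b => (tensorLeft N P f).map_add a b
          map_smul' := fun r z => tensorLeft_right N P f r z }
      map_one' := LinearMap.ext fun z => by
        change tensorLeft N P 1 z = z
        rw [map_one]; rfl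
      map_mul' := fun a b => LinearMap.ext fun z => by
        change tensorLeft N P (a * b) z = tensorLeft N P a (tensorLeft N P b z)
        rw [map_mul]; rfl
      map_zero' := LinearMap.ext fun z => by
        change tensorLeft N P 0 z = (0 : N.carrier ⊗[X.R] P.LeftMod)
        rw [map_zero]; rfl
      map_add' := fun a b => LinearMap.ext fun z => by
        change tensorLeft N P (a + b) z = tensorLeft N P a z + tensorLeft N P b z
        rw [map_add]; rfl }
  deg := fun k => AddSubgroup.closure
    {z | ∃ i j n p, i + j = k ∧ n ∈ N.deg i ∧ p ∈ P.deg j ∧ z = tmul n p}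
  loc := fun x => Submodule.span X.Q
    {ξ | ∃ y z n p, y * z = x ∧ (1 : X.Q) ⊗ₜ[X.R] n ∈ N.loc y ∧ (1 : X.Q) ⊗ₜ[X.R] p ∈ P.loc z ∧
      ξ = (1 : X.Q) ⊗ₜ[X.R] (tmul n p : TensorCarrier N P)}

/-- The kernel of `N → N ⊗_R Q → ⨁_{x ∈ I} N_Q^x`. -/
def kerUpper (N : PreObj.{u, v, w} X) (I : Set W) : Submodule X.R N.carrier :=
  ((⨆ (x : W) (_ : x ∉ I), N.loc x).restrictScalars X.R).comap
    (TensorProduct.mk X.R X.Q N.carrier 1)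

theorem IsObj.left_mem_kerUpper {N : PreObj.{u, v, w} X} (hN : N.IsObj) (I : Set W) (f : X.R) :
    N.kerUpper I ≤ (N.kerUpper I).comap (N.left f) := by
  intro n hn
  change (1 : X.Q) ⊗ₜ[X.R] n ∈ (⨆ (x : W) (_ : x ∉ I), N.loc x) at hn
  change (1 : X.Q) ⊗ₜ[X.R] (N.left f n) ∈ (⨆ (x : W) (_ : x ∉ I), N.loc x)
  rw [← LinearMap.baseChange_tmul]
  have hle : (⨆ (x : W) (_ : x ∉ I), N.loc x) ≤
      (⨆ (x : W) (_ : x ∉ I), N.loc x).comap ((N.left f).baseChange X.Q) := by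
    refine iSup₂_le fun x hx ξ hξ => ?_
    rw [Submodule.mem_comap, hN.left_loc x ξ hξ f]
    exact Submodule.smul_mem _ _ (Submodule.mem_iSup_of_mem x (Submodule.mem_iSup_of_mem hx hξ))
  exact hle hn

/-- The object `N^I` for `I ⊆ W`: the image of `N → ⨁_{x ∈ I} N_Q^x`, as a quotient of `N`. -/
def upper (N : PreObj.{u, v, w} X) (hN : N.IsObj) (I : Set W) : PreObj.{u, v, w} X where
  carrier := N.carrier ⧸ N.kerUpper I
  left :=
    { toFun := fun f => (N.kerUpper I).mapQ (N.kerUpper I) (N.left f) (hN.left_mem_kerUpper I f)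
      map_one' := by ext n; simp
      map_mul' := fun a b => by ext n; simp
      map_zero' := by ext n; simp
      map_add' := fun a b => by ext n; simp }
  deg := fun i => (N.deg i).map (N.kerUpper I).mkQ.toAddMonoidHom
  loc := fun x => (N.loc x).map ((N.kerUpper I).mkQ.baseChange X.Q)

/-- `N` is an indecomposable object of `𝒞`. (For an object of a full subcategory closed under
direct summands, this is indecomposability in that subcategory.) -/
def Indecomposable (N : PreObj.{u, v, w} X) : Prop :=
  Nontrivial N.carrier ∧ ∀ P P' : PreObj.{u, v, w} X, P.IsObj → P'.IsObj →
    Nonempty (Iso N (dsum P P')) → Subsingleton P.carrier ∨ Subsingleton P'.carrier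

end PreObj

section Objects

variable (X : CoxeterRealization K V cs)

/-- For an `R`-bimodule `C` with left action `left`, the space of all `ξ ∈ C ⊗_R Q` such that
`f ξ = ξ x⁻¹(f)` for all `f ∈ R`. -/
def eigenspace {C : Type*} [AddCommGroup C] [Module X.R C] (left : X.R →+* Module.End X.R C)
    (x : W) : Submodule X.Q (X.Q ⊗[X.R] C) where
  carrier := {ξ | ∀ f, (left f).baseChange X.Q ξ = algebraMap X.R X.Q (X.actR x⁻¹ f) • ξ}
  zero_mem' f := by simp
  add_mem' ha hb f := by rw [map_add, ha f, hb f, smul_add]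
  smul_mem' q ξ h f := by rw [map_smul, h f, smul_comm]

/-- The object `R_x` (`x ∈ W`): as a right module it is `R`, the left action is
`f r = r x⁻¹(f)`, and it is concentrated in `x`. -/
def stdObj (x : W) : PreObj.{u, v, max u v} X where
  carrier := X.R
  left := (Algebra.lmul X.R X.R).toRingHom.comp (X.actR x⁻¹).toRingHom
  deg := X.degR
  loc := fun y => ⨆ (_ : y = x), ⊤

/-- The abelian group `R ⊗_{R^H} R`. -/
def InvTensor (H : Subgroup W) : Type (max u v) := X.R ⊗[X.invariants H] X.R

instance (H : Subgroup W) : CommRing (X.InvTensor H) :=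
  inferInstanceAs (CommRing (X.R ⊗[X.invariants H] X.R))

/-- The right `R`-module structure of `R ⊗_{R^H} R`, by `(f ⊗ g) r = f ⊗ g r`. -/
instance (H : Subgroup W) : Algebra X.R (X.InvTensor H) :=
  Algebra.TensorProduct.rightAlgebra (R := X.invariants H) (A := X.R) (B := X.R)

/-- The element `f ⊗ g` of `R ⊗_{R^H} R`. -/
def invTmul (H : Subgroup W) (f g : X.R) : X.InvTensor H := TensorProduct.tmul (X.invariants H) f g

/-- The left action of `R` on `R ⊗_{R^H} R`, by `r (f ⊗ g) = r f ⊗ g`. -/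
def invLeft (H : Subgroup W) : X.R →+* Module.End X.R (X.InvTensor H) :=
  (Algebra.lmul X.R (X.InvTensor H)).toRingHom.comp
    (Algebra.TensorProduct.includeLeftRingHom : X.R →+* X.R ⊗[X.invariants H] X.R)

/-- The bimodule `R ⊗_{R^H} R`, with `(R ⊗_{R^H} R)_Q^x` for `x ∈ H` the space of all `ξ` such
that `f ξ = ξ x⁻¹(f)` for `f ∈ R`, and `(R ⊗_{R^H} R)_Q^x = 0` for `x ∉ H`. When `H` is finite and
acts faithfully, this is the decomposition obtained from the isomorphism
`R ⊗_{R^H} Q ≅ ⨁_{x ∈ H} Q`, `f ⊗ g ↦ (x⁻¹(f) g)`, and it is the only one with support `H`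
that makes `R ⊗_{R^H} R` an object of `𝒞`. -/
def invObj (H : Subgroup W) : PreObj.{u, v, max u v} X where
  carrier := X.InvTensor H
  left := X.invLeft H
  deg := fun k => AddSubgroup.closure
    {z | ∃ i j f g, i + j = k ∧ f ∈ X.degR i ∧ g ∈ X.degR j ∧ z = X.invTmul H f g}
  loc := fun x => ⨆ (_ : x ∈ H), X.eigenspace (X.invLeft H) x

/-- `B_s = R ⊗_{R^s} R (1)`, with support `{e, s}`. -/
def simpleObj (s : B) : PreObj.{u, v, max u v} X :=
  (X.invObj (cs.parabolic {s})).shift 1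

/-- The Soergel bimodules: the smallest full subcategory of `𝒞` which contains `R_e` and the `B_s`,
and is closed under direct sums, shifts, tensor products and direct summands. -/
inductive IsSoergel : PreObj.{u, v, max u v} X → Prop
  | unit : IsSoergel (X.stdObj 1)
  | simple (s : B) : IsSoergel (X.simpleObj s)
  | dsum {N P} : IsSoergel N → IsSoergel P → IsSoergel (N.dsum P)
  | shift {N} (k : ℤ) : IsSoergel N → IsSoergel (N.shift k)
  | tensor {N P} : IsSoergel N → IsSoergel P → IsSoergel (N.tensor P)
  | summand {N P} : IsSoergel N → P.IsObj → (i : PreObj.Hom P N) → (p : PreObj.Hom N P) →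
      (∀ z, p.toLin (i.toLin z) = z) → IsSoergel P

/-- The Bott-Samelson bimodule `B_{s₁} ⊗ ⋯ ⊗ B_{s_l}`. -/
def bottSamelson : List B → PreObj.{u, v, max u v} X
  | [] => X.stdObj 1
  | s :: l => (X.simpleObj s).tensor (bottSamelson l)

/-- The element `(1 ⊗ 1) ⊗ ⋯ ⊗ (1 ⊗ 1)` of `B_{s₁} ⊗ ⋯ ⊗ B_{s_l}`. -/
def bottSamelsonOne : (l : List B) → (X.bottSamelson l).carrier
  | [] => (1 : X.R)
  | s :: l => PreObj.tmul (N := X.simpleObj s) (P := X.bottSamelson l)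
      (X.invTmul (cs.parabolic {s}) 1 1) (bottSamelsonOne l)

/-- For `s ≠ t` with `m = m_{st}` finite there is a morphism `B_s ⊗ B_t ⊗ ⋯ → B_t ⊗ B_s ⊗ ⋯`
(`m` factors on both sides) in `𝒞` which maps `(1 ⊗ 1) ⊗ ⋯ ⊗ (1 ⊗ 1)` to
`(1 ⊗ 1) ⊗ ⋯ ⊗ (1 ⊗ 1)`. -/
def HasBraidMorphisms : Prop :=
  ∀ s t : B, s ≠ t → M s t ≠ 0 →
    ∃ φ : PreObj.Hom (X.bottSamelson (CoxeterSystem.alternatingWord s t (M s t)))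
        (X.bottSamelson (CoxeterSystem.alternatingWord t s (M s t))),
      φ.toLin (X.bottSamelsonOne _) = X.bottSamelsonOne _

/-- `N` is (isomorphic to) the Soergel bimodule `B(x)`: it is an indecomposable Soergel bimodule,
`supp_W(N) ⊆ {y | y ≤ x}` and `N^x ≅ R_x(ℓ(x))`. -/
def IsB (x : W) (N : PreObj.{u, v, max u v} X) : Prop :=
  X.IsSoergel N ∧ N.Indecomposable ∧ (∀ y ∈ N.supp, cs.BruhatLE y x) ∧
    ∃ hN : N.IsObj, Nonempty (PreObj.Iso (N.upper hN {x}) ((X.stdObj x).shift (cs.length x)))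

/-- The right `R`-module `𝒵_{S₀}` of all families `(z_x)`, `x ∈ W_{S₀}`, in `R` with
`z_{xt} ≡ z_x mod α_t` for all reflections `t ∈ W_{S₀}`. -/
def zMod (S₀ : Set B) : Submodule X.R (cs.parabolic S₀ → X.R) where
  carrier := {z | ∀ x t : cs.parabolic S₀, cs.IsReflection (t : W) →
    z (x * t) - z x ∈ Ideal.span {SymmetricAlgebra.ι K V (X.reflRoot t)}}
  zero_mem' x t _ := by simp
  add_mem' ha hb x t ht := by
    have := Ideal.add_mem _ (ha x t ht) (hb x t ht)
    simpa [add_sub_add_comm] using this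
  smul_mem' r z hz x t ht := by
    have := Ideal.mul_mem_left _ r (hz x t ht)
    simpa [mul_sub] using this

theorem zMod_left_mem (S₀ : Set B) (f : X.R) {z : cs.parabolic S₀ → X.R} (hz : z ∈ X.zMod S₀) :
    (fun x : cs.parabolic S₀ => X.actR (x : W)⁻¹ f * z x) ∈ X.zMod S₀ := by
  intro x t ht
  set I := Ideal.span {SymmetricAlgebra.ι K V (X.reflRoot t)} with hI
  have ht' : ((x * t : cs.parabolic S₀) : W)⁻¹ = (t : W) * (x : W)⁻¹ := by
    rw [Subgroup.coe_mul, mul_inv_rev, ht.inv]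
  have h1 : X.actR ((x * t : cs.parabolic S₀) : W)⁻¹ f - X.actR (x : W)⁻¹ f ∈ I := by
    rw [ht', actR_mul]
    exact X.actR_sub_mem ht _
  have h2 := hz x t ht
  have h3 := I.add_mem (I.mul_mem_right (z (x * t)) h1)
    (I.mul_mem_left (X.actR (x : W)⁻¹ f) h2)
  convert h3 using 1
  ring

/-- The projection `𝒵_{S₀} → R`, `(z_x) ↦ z_y`. -/
def zEval (S₀ : Set B) (y : cs.parabolic S₀) : X.zMod S₀ →ₗ[X.R] X.R :=
  (LinearMap.proj y).comp (X.zMod S₀).subtype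

/-- The object `𝒵_{S₀}` of `𝒞`, with `f (z_x) g = (x⁻¹(f) z_x g)`. The subspaces
`(𝒵_{S₀})_Q^x` come from `𝒵_{S₀} ⊗_R Q ≅ ⨁_{x ∈ W_{S₀}} Q`: they consist of those `ξ` whose
components at all `y ≠ x` vanish. -/
def zObj (S₀ : Set B) : PreObj.{u, v} X where
  carrier := X.zMod S₀
  left :=
    { toFun := fun f =>
        { toFun := fun z => ⟨_, X.zMod_left_mem S₀ f z.2⟩
          map_add' := fun a b => by ext x; simp [mul_add]
          map_smul' := fun r a => by ext x; simp [mul_left_comm] }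
      map_one' := by ext z x; simp
      map_mul' := fun a b => by ext z x; simp [mul_assoc]
      map_zero' := by ext z x; simp
      map_add' := fun a b => by ext z x; simp [add_mul] }
  deg := fun i =>
    { carrier := {z | ∀ x, z.1 x ∈ X.degR i}
      zero_mem' := fun x => (X.degR i).zero_mem
      add_mem' := fun ha hb x => (X.degR i).add_mem (ha x) (hb x)
      neg_mem' := fun ha x => (X.degR i).neg_mem (ha x) }
  loc := fun x => ⨅ (y : cs.parabolic S₀) (_ : (y : W) ≠ x),
    LinearMap.ker ((X.zEval S₀ y).baseChange X.Q)

/-- The GKM condition for `W_{S₀}`: for distinct reflections `t₁, t₂ ∈ W_{S₀}`, the roots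
`α_{t₁}, α_{t₂}` are linearly independent in `V / 𝔪 V` for every maximal ideal `𝔪` of `K`. -/
def IsGKM (S₀ : Set B) : Prop :=
  ∀ t₁ ∈ cs.parabolic S₀, ∀ t₂ ∈ cs.parabolic S₀, cs.IsReflection t₁ → cs.IsReflection t₂ →
    t₁ ≠ t₂ → ∀ 𝔪 : Ideal K, 𝔪.IsMaximal →
      LinearIndependent (K ⧸ 𝔪)
        ![(𝔪 • (⊤ : Submodule K V)).mkQ (X.reflRoot t₁),
          (𝔪 • (⊤ : Submodule K V)).mkQ (X.reflRoot t₂)]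

/-- `R ≅ ⨁_{x ∈ W_{S₀}} R^{W_{S₀}}(-2ℓ(x))` as graded `R^{W_{S₀}}`-modules: there is a basis
of `R` over `R^{W_{S₀}}`, indexed by `W_{S₀}`, whose element at `x` has degree `2ℓ(x)`. -/
def IsGradedFreeOver (S₀ : Set B) : Prop :=
  ∃ b : Module.Basis (cs.parabolic S₀) (X.invariants (cs.parabolic S₀)) X.R,
    ∀ x : cs.parabolic S₀, b x ∈ X.degR (2 * cs.length (x : W))

end Objects

end CoxeterRealization

end

/-!
Write `H = W_{S₀}` and let `l` be a reduced word of the longest element `w₀` of `H`.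

**A Frobenius form.** By degree reasons the composition `∂_l` of Demazure operators along `l` maps
`R` to `R^H`; it kills all basis elements of `R` over `R^H` except the one of top degree. The
bilinear form `(f, g) ↦ ∂_l(f g)` is perfect (`hasDualBases_dem`): its Gram determinant has degree
`0`, hence is a constant, and it suffices that this constant is nonzero modulo the maximal ideal
of `K`. There the antisymmetrization of a basis element is divisible by the product of all roots
(`prod_root_dvd_altSum`), so that it vanishes for degree reasons except for the top one, and an
argument with the group of operators induced by `H` shows that `H` still acts faithfully on the
reduction, that the top coefficient of `∂_l` does not vanish, and that the Gram matrix is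
invertible. If `H` has at most one reflection, then dual bases are written down directly
(`hasDualBases_dem_nil`, `hasDualBases_dem_singleton`). So `R` has homogeneous dual bases `b_i`,
`b'_i` with `f = ∑ b_i ∂_l(b'_i f)` (`FrobeniusForm`). Over `Q` the form is a combination of the automorphisms `y⁻¹`, `y ∈ H`; by
independence of characters the elements `∑ k_x b_i ⊗ x⁻¹(b'_i)` are orthogonal idempotents of
`R ⊗_{R^H} Q` (`FrobeniusForm.coeff_mul_sum`), which gives the decomposition of `R ⊗_{R^H} R`.

**A direct summand of a Bott-Samelson bimodule.** A form `τ` on an object `N` of `𝒞` that is linear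
over `R^H` induces a homomorphism `n ↦ ∑ b_i ⊗ τ(b'_i n)` to `R ⊗_{R^H} R` (`isHom_toInv`).
Iterated Demazure operators give such a form on `BS(l) = B_{s₁} ⊗ ⋯ ⊗ B_{s_n}`, and the resulting
homomorphism splits the map `R ⊗_{R^H} R → BS(l)` which sends `1 ⊗ 1` to the tensor of the
elements `1 ⊗ 1` (`ofBS_toBS`). The part of lowest degree of `R ⊗_{R^H} R` consists of the scalar
multiples of the generator `1 ⊗ 1`, so that an idempotent endomorphism is `0` or the identity
(`invObj_idempotent`).

**Uniqueness.** For a Soergel bimodule `N`, each homomorphism `N → R_w` factors through the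
canonical homomorphism `BS(l) → R_w` for a reduced word `l` of `w`
(`IsSoergel.torsionFree_and_lifts`). This is proved by induction over the tensor factors; the
braid morphisms and Matsumoto's theorem make the choice of the reduced word irrelevant. If `N` has
the defining properties of `B(w₀)`, then the projection `N → R_{w₀}(ℓ(w₀))` lifts to
`N → BS(l) → R ⊗_{R^H} R(ℓ(w₀))`. A preimage in `N` of the generator of `R_{w₀}` is mapped to
`1 ⊗ 1`, and defines a section `R ⊗_{R^H} R(ℓ(w₀)) → N`. As `N` is indecomposable, this is an
isomorphism (`IsB.nonempty_iso`).

**Comparison with `𝒵`.** The Demazure operators `z ↦ ((z_x - z_{sx}) / x⁻¹(α_s))_x` preserve `𝒵`,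
since `α_t` is prime in `R` and does not divide `x⁻¹(α_s)` unless `t = x⁻¹ s x`
(`exists_zMod_demazure`). Hence the Frobenius form extends to `𝒵`, and the induced homomorphism
`𝒵 → R ⊗_{R^H} R` is inverse to `f ⊗ g ↦ (x⁻¹(f) g)_x` (`exists_zToInv`).
-/

set_option linter.unusedSectionVars false

noncomputable section

universe u v w₁ w₂ w₃ w₄

/-! ### Exchange and longest elements in Coxeter groups -/

namespace CoxeterSystem

variable {B W : Type*} [Group W] {M : CoxeterMatrix B} (cs : CoxeterSystem M W)

open List

open Classical in
/-- The permutation `(t, z) ↦ (s t s, z + [t = s])` of `W × ℤ/2` attached to a simple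
reflection `s`. -/
def inversionPerm (i : B) : Equiv.Perm (W × ZMod 2) :=
  Function.Involutive.toPerm
    (fun p => (cs.simple i * p.1 * cs.simple i, p.2 + if p.1 = cs.simple i then 1 else 0)) (by
      rintro ⟨t, z⟩
      have h : cs.simple i * t * cs.simple i = cs.simple i ↔ t = cs.simple i := by
        constructor
        · intro h
          have := congrArg (fun x => cs.simple i * x * cs.simple i) h
          simpa [mul_assoc] using this
        · rintro rfl; simp
      ext
      · simp [mul_assoc]
      · simp only [h, add_assoc]
        split_ifs <;> simp
        decide)

open Classical in
theorem inversionPerm_apply (i : B) (t : W) (z : ZMod 2) :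
    cs.inversionPerm i (t, z) =
      (cs.simple i * t * cs.simple i, z + if t = cs.simple i then 1 else 0) := rfl

open Classical in
theorem inversionPerm_word (ω : List B) (t : W) (z : ZMod 2) :
    (ω.reverse.map cs.inversionPerm).prod (t, z) =
      ((cs.wordProd ω)⁻¹ * t * cs.wordProd ω, z + ((cs.leftInvSeq ω).count t : ℕ)) := by
  induction ω generalizing t z with
  | nil => simp
  | cons i ω ih =>
    rw [reverse_cons, map_append, prod_append, Equiv.Perm.mul_apply]
    simp only [map_cons, map_nil, prod_cons, prod_nil, mul_one]
    rw [inversionPerm_apply, ih]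
    ext
    · simp [wordProd_cons, mul_assoc]
    · have h1 : (cs.leftInvSeq (i :: ω)).count t =
          (if t = cs.simple i then 1 else 0) +
            (cs.leftInvSeq ω).count (cs.simple i * t * cs.simple i) := by
        rw [leftInvSeq, count_cons, add_comm]
        congr 1
        · by_cases h : t = cs.simple i
          · simp [h]
          · simp [h, Ne.symm h]
        · have h2 : t = MulAut.conj (cs.simple i) (cs.simple i * t * cs.simple i) := by
            simp [mul_assoc]
          conv_lhs => rw [h2]
          exact count_map_of_injective _ _ (MulAut.conj (cs.simple i)).injective _
      rw [h1]
      push_cast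
      simp only [add_assoc]

theorem inversionPerm_isLiftable : M.IsLiftable cs.inversionPerm := by
  classical
  intro i j
  have h1 : ∀ m : ℕ, (cs.inversionPerm i * cs.inversionPerm j) ^ m =
      ((alternatingWord j i (2 * m)).reverse.map cs.inversionPerm).prod := by
    intro m
    induction m with
    | zero => simp [alternatingWord]
    | succ m ih =>
      rw [pow_succ', ih, show 2 * (m + 1) = 2 * m + 1 + 1 by ring, alternatingWord_succ,
        alternatingWord_succ]
      simp [mul_assoc]
  rw [h1]
  ext ⟨t, z⟩ : 1
  rw [inversionPerm_word, prod_alternatingWord_eq_mul_pow]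
  set L := cs.leftInvSeq (alternatingWord j i (2 * M i j)) with hL
  have hlen : L.length = 2 * M i j := by simp [hL]
  have h2 : L.drop (M i j) = L.take (M i j) := by
    apply List.ext_getElem
    · simp [hlen]; omega
    · intro k hk hk'
      simp only [length_drop, hlen] at hk
      rw [getElem_drop, getElem_take]
      simp only [hL]
      rw [getElem_leftInvSeq_alternatingWord _ _ _ _ _ (by omega),
        getElem_leftInvSeq_alternatingWord _ _ _ _ _ (by omega),
        prod_alternatingWord_eq_mul_pow, prod_alternatingWord_eq_mul_pow]
      have e1 : (2 * (M i j + k) + 1) / 2 = M i j + k := by omega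
      have e2 : (2 * k + 1) / 2 = k := by omega
      have e3 : ¬ Even (2 * (M i j + k) + 1) := by simp
      have e4 : ¬ Even (2 * k + 1) := by simp
      rw [e1, e2, if_neg e3, if_neg e4, pow_add]
      simp
  have h3 : L.count t = 2 * (L.take (M i j)).count t := by
    conv_lhs => rw [← take_append_drop (M i j) L, count_append, h2]
    ring
  have h4 : ((2 : ℕ) : ZMod 2) = 0 := by decide
  rw [h3]
  ext
  · simp
  · simp only [Nat.cast_mul, h4, zero_mul, add_zero, Equiv.Perm.coe_one, id_eq]

/-- The action of `W` on `W × ℤ/2` that records the parity of inversions. -/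
def inversionHom : W →* Equiv.Perm (W × ZMod 2) :=
  cs.lift ⟨cs.inversionPerm, cs.inversionPerm_isLiftable⟩

open Classical in
theorem inversionHom_inv_wordProd (ω : List B) (t : W) (z : ZMod 2) :
    cs.inversionHom (cs.wordProd ω)⁻¹ (t, z) =
      ((cs.wordProd ω)⁻¹ * t * cs.wordProd ω, z + ((cs.leftInvSeq ω).count t : ℕ)) := by
  rw [← inversionPerm_word, ← wordProd_reverse, wordProd, map_list_prod, map_map]
  congr 3
  funext i
  exact cs.lift_apply_simple cs.inversionPerm_isLiftable i

theorem inversionHom_apply (w t : W) : ∃ c : ZMod 2, ∀ z,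
    cs.inversionHom w (t, z) = (w * t * w⁻¹, z + c) := by
  classical
  obtain ⟨ω, hω⟩ := cs.wordProd_surjective w⁻¹
  refine ⟨((cs.leftInvSeq ω).count t : ℕ), fun z => ?_⟩
  have := cs.inversionHom_inv_wordProd ω t z
  rw [hω] at this
  simpa using this

theorem inversionHom_reflection {t : W} (ht : cs.IsReflection t) (z : ZMod 2) :
    cs.inversionHom t (t, z) = (t, z + 1) := by
  obtain ⟨w, i, rfl⟩ := ht
  obtain ⟨c, hc⟩ := cs.inversionHom_apply w⁻¹ (w * cs.simple i * w⁻¹)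
  have h1 : ∀ z, cs.inversionHom w (cs.simple i, z) = (w * cs.simple i * w⁻¹, z - c) := by
    intro z
    have := hc (z - c)
    rw [map_inv, Equiv.Perm.inv_eq_iff_eq] at this
    rw [this]
    simp [mul_assoc]
  have h2 : ∀ z, cs.inversionHom (cs.simple i) (cs.simple i, z) = (cs.simple i, z + 1) := by
    intro z
    have : cs.inversionHom (cs.simple i) = cs.inversionPerm i :=
      cs.lift_apply_simple cs.inversionPerm_isLiftable i
    rw [this, inversionPerm_apply]
    simp
  rw [map_mul, map_mul, Equiv.Perm.mul_apply, Equiv.Perm.mul_apply, hc]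
  simp only [inv_inv, mul_assoc, inv_mul_cancel_left, inv_mul_cancel, mul_one]
  rw [h2, h1]
  simp only [mul_assoc]
  congr 1
  ring

/-- The strong exchange property: a left inversion of `π ω` occurs in the left inversion
sequence of `ω`. -/
theorem mem_leftInvSeq_of_isLeftInversion (ω : List B) {t : W}
    (ht : cs.IsLeftInversion (cs.wordProd ω) t) : t ∈ cs.leftInvSeq ω := by
  classical
  by_contra hmem
  have h0 := cs.inversionHom_inv_wordProd ω t 1
  rw [count_eq_zero_of_not_mem hmem] at h0
  obtain ⟨ω', hred, hω'⟩ := cs.exists_isReduced (t * cs.wordProd ω)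
  have h1 := cs.inversionHom_inv_wordProd ω' t 0
  rw [← hω', mul_inv_rev, map_mul, Equiv.Perm.mul_apply, ht.1.inv, inversionHom_reflection _ ht.1,
    zero_add, h0] at h1
  have h2 : (cs.leftInvSeq ω').count t ≠ 0 := by
    intro h
    rw [h] at h1
    simpa using congrArg Prod.snd h1
  have h3 := cs.isLeftInversion_of_mem_leftInvSeq hred
    (one_le_count_iff.mp (Nat.one_le_iff_ne_zero.mpr h2))
  rw [← hω'] at h3
  have h4 := h3.2
  rw [← mul_assoc, ht.1.mul_self, one_mul] at h4
  exact lt_asymm h4 ht.2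

/-- Strong exchange: multiplying by a left inversion deletes a letter. -/
theorem exists_eraseIdx_of_isLeftInversion (ω : List B) {t : W}
    (ht : cs.IsLeftInversion (cs.wordProd ω) t) :
    ∃ j < ω.length, t * cs.wordProd ω = cs.wordProd (ω.eraseIdx j) := by
  obtain ⟨j, hj, rfl⟩ := List.mem_iff_getElem.mp (cs.mem_leftInvSeq_of_isLeftInversion ω ht)
  refine ⟨j, by simpa using hj, ?_⟩
  rw [← getD_leftInvSeq_mul_wordProd, List.getD_eq_getElem _ 1 hj]

theorem exists_eraseIdx_of_isRightInversion (ω : List B) {t : W}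
    (ht : cs.IsRightInversion (cs.wordProd ω) t) :
    ∃ j < ω.length, cs.wordProd ω * t = cs.wordProd (ω.eraseIdx j) := by
  have h1 : cs.IsLeftInversion (cs.wordProd ω) (cs.wordProd ω * t * (cs.wordProd ω)⁻¹) := by
    refine ⟨ht.1.conj _, ?_⟩
    simpa using ht.2
  obtain ⟨j, hj, h⟩ := cs.exists_eraseIdx_of_isLeftInversion ω h1
  exact ⟨j, hj, by simpa using h⟩

end CoxeterSystem

/-! ### The order of a product of two simple reflections -/

namespace CoxeterMatrix

variable {B : Type*} (M : CoxeterMatrix B)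

/-- The entries `-2 cos (π / m_{ij})` of the Cartan matrix of the geometric representation
(`-2` if `m_{ij} = ∞`). -/
def geomCartan (i j : B) : ℝ :=
  if M i j = 0 then -2 else -2 * Real.cos (Real.pi / M i j)

theorem geomCartan_self (i : B) : M.geomCartan i i = 2 := by
  simp [geomCartan]

theorem geomCartan_comm (i j : B) : M.geomCartan i j = M.geomCartan j i := by
  simp [geomCartan, M.symmetric i j]

/-- The simple coroots of the geometric representation. -/
def geomCoroot (i : B) : Module.Dual ℝ (B →₀ ℝ) :=
  Finsupp.linearCombination ℝ (fun j => M.geomCartan i j)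

theorem geomCoroot_single (i j : B) :
    M.geomCoroot i (Finsupp.single j 1) = M.geomCartan i j := by
  simp [geomCoroot]

theorem geomCoroot_self (i : B) : M.geomCoroot i (Finsupp.single i 1) = 2 := by
  rw [geomCoroot_single, geomCartan_self]

/-- The simple reflections of the geometric representation. -/
def geomReflection (i : B) : (B →₀ ℝ) ≃ₗ[ℝ] (B →₀ ℝ) :=
  Module.reflection (M.geomCoroot_self i)

theorem geomCartan_sq (i j : B) (h : M i j ≠ 0) :
    M.geomCartan i j * M.geomCartan j i - 2 = 2 * Real.cos (2 * Real.pi / M i j) := by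
  rw [M.geomCartan_comm j i, geomCartan, if_neg h, mul_div_assoc, Real.cos_two_mul]
  ring

open Polynomial.Chebyshev in
theorem geomReflection_isLiftable : M.IsLiftable M.geomReflection := by
  intro i j
  by_cases hm : M i j = 0
  · simp [hm]
  by_cases hij : i = j
  · subst hij
    simp only [diagonal, pow_one]
    ext1 v
    exact Module.involutive_reflection (M.geomCoroot_self i) v
  have h2 : 2 ≤ M i j := by
    have := M.off_diagonal i j hij
    omega
  ext1 z
  rw [geomReflection, geomReflection, Module.reflection_mul_reflection_pow_apply _ _ _ _ _ rfl]
  simp only [geomCoroot_single]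
  rw [geomCartan_sq _ _ _ hm]
  set θ : ℝ := 2 * Real.pi / M i j with hθ
  have hS := fun n : ℤ => S_two_mul_real_cos θ n
  have hm0 : (M i j : ℝ) ≠ 0 := by exact_mod_cast hm
  have hmθ : (M i j : ℝ) * θ = 2 * Real.pi := by rw [hθ]; field_simp
  rcases h2.eq_or_lt with h2 | h2
  · -- for `m = 2` the two reflections commute because the Cartan entries vanish
    have hk : M.geomCartan i j = 0 := by
      simp [geomCartan, ← h2]
    have hθ' : θ = Real.pi := by rw [hθ, ← h2]; push_cast; ring
    rw [M.geomCartan_comm j i, hk, hθ', ← h2]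
    norm_num [S_neg_one]
    module
  · have hsin : Real.sin θ ≠ 0 := by
      apply ne_of_gt
      apply Real.sin_pos_of_pos_of_lt_pi
      · positivity
      · rw [hθ, div_lt_iff₀ (by positivity)]
        have : (2 : ℝ) < M i j := by exact_mod_cast h2
        nlinarith [Real.pi_pos]
    rcases Nat.even_or_odd' (M i j) with ⟨k, hk | hk⟩
    · have hkθ : (k : ℝ) * θ = Real.pi := by
        rw [hk] at hmθ
        push_cast at hmθ
        linarith
      have h0 : (S ℝ ((k : ℤ) - 1)).eval (2 * Real.cos θ) = 0 := by
        have := hS ((k : ℤ) - 1)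
        rw [show (((((k : ℤ) - 1 : ℤ)) : ℝ) + 1) * θ = k * θ by push_cast; ring, hkθ,
          Real.sin_pi] at this
        exact (mul_eq_zero.mp this).resolve_right hsin
      have e1 : ((M i j : ℤ) - 2) / 2 = (k : ℤ) - 1 := by omega
      have e2 : ((M i j : ℤ) - 1) / 2 = (k : ℤ) - 1 := by omega
      rw [e1, e2, h0]
      simp
    · have hkθ : ((k : ℝ) + 1) * θ = 2 * Real.pi - k * θ := by
        rw [hk] at hmθ
        push_cast at hmθ
        linarith
      have h0 : (S ℝ (k : ℤ)).eval (2 * Real.cos θ) + (S ℝ ((k : ℤ) - 1)).eval (2 * Real.cos θ)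
          = 0 := by
        have h1 := hS (k : ℤ)
        have h2 := hS ((k : ℤ) - 1)
        rw [show ((((k : ℤ) : ℝ)) + 1) * θ = 2 * Real.pi - k * θ by push_cast; exact hkθ,
          Real.sin_two_pi_sub] at h1
        rw [show (((((k : ℤ) - 1 : ℤ)) : ℝ) + 1) * θ = k * θ by push_cast; ring] at h2
        have := congrArg₂ (· + ·) h1 h2
        simp only [← add_mul] at this
        rw [neg_add_cancel] at this
        exact (mul_eq_zero.mp this).resolve_right hsin
      have e1 : ((M i j : ℤ) - 3) / 2 = (k : ℤ) - 1 := by omega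
      have e2 : ((M i j : ℤ) - 1) / 2 = (k : ℤ) := by omega
      have e3 : ((M i j : ℤ) - 2) / 2 = (k : ℤ) - 1 := by omega
      have e4 : ((M i j : ℤ)) / 2 = (k : ℤ) := by omega
      rw [e1, e2, e3, e4, h0]
      simp

end CoxeterMatrix

namespace CoxeterSystem

variable {B W : Type*} [Group W] {M : CoxeterMatrix B} (cs : CoxeterSystem M W)

open Polynomial.Chebyshev in
/-- The order of `s_i s_j` is at least `m_{ij}`. -/
theorem le_of_simple_mul_simple_pow_eq_one {i j : B} (hij : i ≠ j) {n : ℕ} (hn : 0 < n)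
    (h : (cs.simple i * cs.simple j) ^ n = 1) : M i j ≠ 0 ∧ M i j ≤ n := by
  classical
  set ρ : W →* ((B →₀ ℝ) ≃ₗ[ℝ] (B →₀ ℝ)) := cs.lift ⟨_, M.geomReflection_isLiftable⟩ with hρ
  have hρs : ∀ i, ρ (cs.simple i) = M.geomReflection i :=
    fun i => cs.lift_apply_simple M.geomReflection_isLiftable i
  have h1 := congrArg ρ h
  rw [map_pow, map_mul, hρs, hρs, map_one] at h1
  have h2 := congrArg (fun e : (B →₀ ℝ) ≃ₗ[ℝ] (B →₀ ℝ) => e (Finsupp.single i 1)) h1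
  simp only [CoxeterMatrix.geomReflection] at h2
  rw [Module.reflection_mul_reflection_pow_apply_self _ _ _ _ rfl] at h2
  simp only [CoxeterMatrix.geomCoroot_single] at h2
  have hi := DFunLike.congr_fun h2 i
  have hj := DFunLike.congr_fun h2 j
  simp [hij, hij.symm] at hi hj
  by_cases hm : M i j = 0
  · exfalso
    have hk : M.geomCartan i j = -2 := by simp [CoxeterMatrix.geomCartan, hm]
    rw [M.geomCartan_comm j i, hk] at hj
    norm_num [S_eval_two] at hj
    omega
  refine ⟨hm, ?_⟩
  rw [M.geomCartan_sq i j hm] at hi hj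
  by_contra hlt
  push Not at hlt
  set θ : ℝ := 2 * Real.pi / M i j with hθ
  have hm0 : (M i j : ℝ) ≠ 0 := by exact_mod_cast hm
  have hmpos : (0 : ℝ) < M i j := by positivity
  by_cases h3 : M i j = 2
  · have : n = 1 := by omega
    subst this
    have hθ' : θ = Real.pi := by rw [hθ, h3]; push_cast; ring
    rw [hθ'] at hi
    norm_num at hi
  have h3' : 2 < M i j := by
    have := M.off_diagonal i j hij
    omega
  have hsin : Real.sin θ ≠ 0 := by
    apply ne_of_gt
    apply Real.sin_pos_of_pos_of_lt_pi
    · positivity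
    · rw [hθ, div_lt_iff₀ (by positivity)]
      have : (2 : ℝ) < M i j := by exact_mod_cast h3'
      nlinarith [Real.pi_pos]
  have hk : M.geomCartan j i ≠ 0 := by
    rw [M.geomCartan_comm j i, CoxeterMatrix.geomCartan, if_neg hm]
    have : 0 < Real.cos (Real.pi / M i j) := by
      apply Real.cos_pos_of_mem_Ioo
      constructor
      · have : 0 < Real.pi / M i j := by positivity
        linarith [Real.pi_pos]
      · apply div_lt_div_of_pos_left Real.pi_pos two_pos
        exact_mod_cast h3'
    simp [this.ne']
  have hj' := hj.resolve_right hk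
  rw [hj', add_zero] at hi
  have h4 := S_two_mul_real_cos θ ((n : ℤ) - 1)
  have h5 := S_two_mul_real_cos θ (n : ℤ)
  rw [hj', zero_mul] at h4
  rw [hi, one_mul] at h5
  have h6 : Real.sin (n * θ) = 0 := by
    rw [h4]; congr 1; push_cast; ring
  -- `sin (n θ) = 0` and `sin ((n + 1) θ) = sin θ` force `cos (n θ) = 1`
  have h7 : Real.cos (n * θ) = 1 := by
    have : Real.sin θ = Real.sin (n * θ + θ) := by
      rw [h5]; congr 1; push_cast; ring
    rw [Real.sin_add, h6, zero_mul, zero_add] at this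
    have h8 : (Real.cos (n * θ) - 1) * Real.sin θ = 0 := by linarith
    rcases mul_eq_zero.mp h8 with h8 | h8
    · linarith
    · exact absurd h8 hsin
  have h9 := (Real.cos_eq_one_iff_of_lt_of_lt (x := n * θ) (by
      have : 0 < (n : ℝ) * θ := by positivity
      linarith [Real.pi_pos]) (by
      rw [hθ, mul_div_assoc', div_lt_iff₀ hmpos]
      have : (n : ℝ) < M i j := by exact_mod_cast hlt
      nlinarith [Real.pi_pos])).mp h7
  have : 0 < (n : ℝ) * θ := by positivity
  linarith

/-! ### Matsumoto's theorem -/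

/-- The alternating word `s t s ⋯` with `k` letters, starting with `s`. -/
def altWord (s t : B) : ℕ → List B
  | 0 => []
  | k + 1 => s :: altWord t s k

@[simp] theorem length_altWord (s t : B) (k : ℕ) : (altWord s t k).length = k := by
  induction k generalizing s t with
  | zero => rfl
  | succ k ih => simp [altWord, ih]

theorem altWord_eq (s t : B) (k : ℕ) :
    altWord s t k = if Even k then alternatingWord s t k else alternatingWord t s k := by
  induction k generalizing s t with
  | zero => simp [altWord, alternatingWord]
  | succ k ih =>
    rw [altWord, ih]
    by_cases h : Even k
    · simp [h, Nat.even_add_one, alternatingWord_succ']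
    · simp [h, Nat.even_add_one, alternatingWord_succ']

theorem wordProd_altWord (s t : B) :
    cs.wordProd (altWord s t (M s t)) = cs.wordProd (altWord t s (M s t)) := by
  rw [altWord_eq, altWord_eq]
  have h1 := cs.wordProd_braidWord_eq s t
  have h2 : braidWord M t s = alternatingWord t s (M s t) := by
    rw [braidWord, M.symmetric]
  rw [h2] at h1
  split_ifs
  · exact h1
  · exact h1.symm

theorem getD_leftInvSeq_altWord (s t : B) (k j : ℕ) (h : j < k) :
    (cs.leftInvSeq (altWord s t k)).getD j 1 = (cs.simple s * cs.simple t) ^ j * cs.simple s := by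
  induction k generalizing s t j with
  | zero => omega
  | succ k ih =>
    cases j with
    | zero => simp [altWord, leftInvSeq]
    | succ j =>
      rw [altWord, leftInvSeq, List.getD_cons_succ,
        show (1 : W) = MulAut.conj (cs.simple s) 1 by simp, List.getD_map, ih t s j (by omega)]
      rw [MulAut.conj_apply, inv_simple]
      have : ∀ n : ℕ, cs.simple s * (cs.simple t * cs.simple s) ^ n =
          (cs.simple s * cs.simple t) ^ n * cs.simple s := by
        intro n
        induction n with
        | zero => simp
        | succ n ihn => rw [pow_succ, ← mul_assoc, ihn, pow_succ]; simp only [mul_assoc]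
      rw [← mul_assoc, this, pow_succ]
      simp only [mul_assoc]

theorem IsReduced.tail {cs : CoxeterSystem M W} {i : B} {ω : List B}
    (h : cs.IsReduced (i :: ω)) : cs.IsReduced ω := h.drop 1

theorem isReduced_of_length {ω ω' : List B} (h : cs.IsReduced ω)
    (hp : cs.wordProd ω = cs.wordProd ω') (hl : ω.length = ω'.length) : cs.IsReduced ω' := by
  unfold IsReduced at *
  rw [← hp, h, hl]

/-- If `s` and `t` are left descents of `x`, a reduced word of `x` can be chosen to start with
long alternating words in `s` and `t`. -/
theorem exists_altWord_append {s t : B} (hst : s ≠ t) {x : W} (hs : cs.IsLeftDescent x s)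
    (ht : cs.IsLeftDescent x t) (k : ℕ) (hk : M s t = 0 ∨ k ≤ M s t) :
    ∃ l, cs.IsReduced (altWord s t k ++ l) ∧ x = cs.wordProd (altWord s t k ++ l) := by
  induction k generalizing s t with
  | zero =>
    obtain ⟨l, h, h'⟩ := cs.exists_isReduced x
    exact ⟨l, h, h'⟩
  | succ k ih =>
    obtain ⟨l, hl, hx⟩ := ih hst.symm ht hs (by rw [M.symmetric]; omega)
    have h1 : cs.IsLeftInversion (cs.wordProd (altWord t s k ++ l)) (cs.simple s) := by
      rw [← hx]
      exact (cs.isLeftInversion_simple_iff_isLeftDescent x s).mpr hs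
    obtain ⟨j, hj, he⟩ := cs.exists_eraseIdx_of_isLeftInversion _ h1
    rw [List.length_append, length_altWord] at hj
    by_cases hjk : j < k
    · exfalso
      rw [List.eraseIdx_append_of_lt_length (by simpa using hjk), wordProd_append,
        wordProd_append, ← mul_assoc] at he
      have he := mul_right_cancel he
      rw [← getD_leftInvSeq_mul_wordProd] at he
      have he := mul_right_cancel he
      rw [getD_leftInvSeq_altWord _ _ _ _ _ hjk] at he
      have h2 : (cs.simple t * cs.simple s) ^ (j + 1) = 1 := by
        rw [pow_succ, ← mul_assoc, ← he, simple_mul_simple_self]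
      have h3 := cs.le_of_simple_mul_simple_pow_eq_one hst.symm (Nat.succ_pos j) h2
      rw [M.symmetric t s] at h3
      omega
    · rw [List.eraseIdx_append_of_length_le (by simpa using hjk), length_altWord] at he
      have hp : cs.wordProd (altWord t s k ++ l) =
          cs.wordProd (altWord s t (k + 1) ++ l.eraseIdx (j - k)) := by
        rw [altWord, List.cons_append, wordProd_cons, ← he, simple_mul_simple_cancel_left]
      refine ⟨l.eraseIdx (j - k), cs.isReduced_of_length hl hp ?_, hx.trans hp⟩
      simp only [List.length_append, length_altWord]
      rw [List.length_eraseIdx_of_lt (by omega)]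
      omega

/-- Matsumoto's theorem: a preorder on words that is compatible with adding a letter in front and
contains the braid moves at the beginning of a word relates any two reduced words of the same
element. -/
theorem matsumoto (r : List B → List B → Prop) (refl : ∀ l, r l l)
    (trans : ∀ l l' l'', r l l' → r l' l'' → r l l'')
    (cons : ∀ i l l', r l l' → r (i :: l) (i :: l'))
    (braid : ∀ s t, s ≠ t → M s t ≠ 0 → ∀ l,
      r (altWord s t (M s t) ++ l) (altWord t s (M s t) ++ l))
    {l l' : List B} (hl : cs.IsReduced l) (hl' : cs.IsReduced l')
    (h : cs.wordProd l = cs.wordProd l') : r l l' := by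
  have hlen : l.length = l'.length := by rw [← hl.eq, ← hl'.eq, h]
  induction hn : l.length generalizing l l' with
  | zero =>
    rw [hn] at hlen
    rw [List.length_eq_zero_iff.mp hn, List.length_eq_zero_iff.mp hlen.symm]
    exact refl _
  | succ n ih =>
    obtain ⟨s, l₁, rfl⟩ := List.exists_cons_of_length_eq_add_one hn
    obtain ⟨t, l₂, rfl⟩ := List.exists_cons_of_length_eq_add_one (hlen.symm.trans hn)
    have key : ∀ (i : B) (a b : List B), cs.IsReduced (i :: a) → cs.IsReduced (i :: b) →
        cs.wordProd (i :: a) = cs.wordProd (i :: b) → (i :: a).length = n + 1 →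
        r (i :: a) (i :: b) := by
      intro i a b ha hb hab hla
      have hab' : cs.wordProd a = cs.wordProd b := by
        rw [wordProd_cons, wordProd_cons] at hab
        exact mul_left_cancel hab
      exact cons _ _ _ (ih ha.tail hb.tail hab' (by
        rw [← ha.tail.eq, ← hb.tail.eq, hab']) (by simpa using hla))
    by_cases hst : s = t
    · subst hst
      exact key s l₁ l₂ hl hl' h hn
    have desc : ∀ (i : B) (a : List B), cs.IsReduced (i :: a) →
        cs.IsLeftDescent (cs.wordProd (i :: a)) i := by
      intro i a ha
      unfold IsLeftDescent
      rw [ha.eq, wordProd_cons, simple_mul_simple_cancel_left]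
      exact (cs.length_wordProd_le a).trans_lt (by simp)
    have hs := desc s l₁ hl
    have ht := desc t l₂ hl'
    rw [← h] at ht
    have hm : M s t ≠ 0 := by
      intro hm
      obtain ⟨a, ha, hx⟩ := cs.exists_altWord_append hst hs ht (n + 2) (Or.inl hm)
      have := ha.eq
      rw [← hx, hl.eq, hn, List.length_append, length_altWord] at this
      omega
    obtain ⟨m, hm'⟩ := Nat.exists_eq_succ_of_ne_zero hm
    obtain ⟨a, ha, hx⟩ := cs.exists_altWord_append hst hs ht (M s t) (Or.inr le_rfl)
    have hx' : cs.wordProd (altWord s t (M s t) ++ a) = cs.wordProd (altWord t s (M s t) ++ a) := by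
      rw [wordProd_append, wordProd_append, wordProd_altWord]
    have ha' := cs.isReduced_of_length ha hx' (by simp)
    have hb := braid s t hst hm a
    simp only [hm', Nat.succ_eq_add_one, altWord, List.cons_append] at hb ha ha' hx' hx
    refine trans _ _ _ (key s _ _ hl ha hx hn) (trans _ _ _ hb (key t _ _ ha' hl' ?_ ?_))
    · rw [← hx', ← hx, h]
    · rw [← ha'.eq, ← hx', ← hx, hl.eq, hn]

/-! ### Parabolic subgroups and their longest elements -/

variable {S₀ : Set B}

theorem simple_mem_parabolic {i : B} (hi : i ∈ S₀) : cs.simple i ∈ cs.parabolic S₀ :=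
  Subgroup.subset_closure ⟨i, hi, rfl⟩

theorem wordProd_mem_parabolic {ω : List B} (h : ∀ i ∈ ω, i ∈ S₀) :
    cs.wordProd ω ∈ cs.parabolic S₀ := by
  induction ω with
  | nil => simp
  | cons i ω ih =>
    rw [wordProd_cons]
    exact mul_mem (cs.simple_mem_parabolic (h i (by simp))) (ih fun j hj => h j (by simp [hj]))

theorem exists_isReduced_mul {i : B} (hi : i ∈ S₀) {ω : List B} (hω : cs.IsReduced ω)
    (h : ∀ j ∈ ω, j ∈ S₀) :
    ∃ ω', cs.IsReduced ω' ∧ (∀ j ∈ ω', j ∈ S₀) ∧ cs.simple i * cs.wordProd ω = cs.wordProd ω' := by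
  rcases cs.length_simple_mul (cs.wordProd ω) i with hl | hl
  · refine ⟨i :: ω, ?_, ?_, (cs.wordProd_cons i ω).symm⟩
    · unfold IsReduced
      rw [wordProd_cons, hl, hω.eq, List.length_cons]
    · simpa [hi] using h
  · have h1 : cs.IsLeftInversion (cs.wordProd ω) (cs.simple i) :=
      ⟨cs.isReflection_simple i, by omega⟩
    obtain ⟨j, hj, he⟩ := cs.exists_eraseIdx_of_isLeftInversion _ h1
    refine ⟨ω.eraseIdx j, ?_, fun k hk => h k (List.mem_of_mem_eraseIdx hk), he⟩
    unfold IsReduced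
    rw [← he, List.length_eraseIdx_of_lt hj, ← hω.eq]
    omega

/-- Elements of `W_{S₀}` have reduced words with letters in `S₀`. -/
theorem exists_isReduced_of_mem_parabolic {w : W} (hw : w ∈ cs.parabolic S₀) :
    ∃ ω, cs.IsReduced ω ∧ (∀ i ∈ ω, i ∈ S₀) ∧ w = cs.wordProd ω := by
  induction hw using Subgroup.closure_induction_left with
  | one => exact ⟨[], by simp [IsReduced], by simp, by simp⟩
  | mul_left x hx y hy ih =>
    obtain ⟨i, hi, rfl⟩ := hx
    obtain ⟨ω, h1, h2, rfl⟩ := ih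
    exact cs.exists_isReduced_mul hi h1 h2
  | inv_mul_cancel x hx y hy ih =>
    obtain ⟨i, hi, rfl⟩ := hx
    obtain ⟨ω, h1, h2, rfl⟩ := ih
    rw [inv_simple]
    exact cs.exists_isReduced_mul hi h1 h2

variable {w₀ : W}

theorem IsLongest.length_mul_lt {cs : CoxeterSystem M W} (h : cs.IsLongest S₀ w₀) {t : W}
    (ht : t ∈ cs.parabolic S₀) (hr : cs.IsReflection t) : cs.length (w₀ * t) < cs.length w₀ :=
  lt_of_le_of_ne (h.2 _ (mul_mem h.1 ht)) (hr.length_mul_left_ne w₀)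

/-- The longest element of `W_{S₀}` ends with a reduced word of any element of `W_{S₀}`. -/
theorem IsLongest.length_mul {cs : CoxeterSystem M W} (h : cs.IsLongest S₀ w₀) {u : W}
    (hu : u ∈ cs.parabolic S₀) : cs.length (w₀ * u⁻¹) + cs.length u = cs.length w₀ := by
  have step : ∀ i ∈ S₀, ∀ u ∈ cs.parabolic S₀,
      cs.length (w₀ * u⁻¹) + cs.length u = cs.length w₀ →
      cs.length (w₀ * (cs.simple i * u)⁻¹) + cs.length (cs.simple i * u) = cs.length w₀ := by
    intro i hi u hu ih
    have e : w₀ * (cs.simple i * u)⁻¹ = w₀ * u⁻¹ * cs.simple i := by simp [mul_assoc]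
    rw [e]
    have hge : cs.length w₀ ≤
        cs.length (w₀ * u⁻¹ * cs.simple i) + cs.length (cs.simple i * u) := by
      calc cs.length w₀ = cs.length ((w₀ * u⁻¹ * cs.simple i) * (cs.simple i * u)) := by
            simp [mul_assoc]
        _ ≤ _ := cs.length_mul_le _ _
    rcases cs.length_simple_mul u i with hl | hl
    · obtain ⟨ω, hω, hv⟩ := cs.exists_isReduced (w₀ * u⁻¹)
      obtain ⟨ω', hω', hu'⟩ := cs.exists_isReduced u
      have hw : w₀ = cs.wordProd (ω ++ ω') := by
        rw [wordProd_append, ← hv, ← hu']; simp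
      have ht : u⁻¹ * cs.simple i * u ∈ cs.parabolic S₀ :=
        mul_mem (mul_mem (inv_mem hu) (cs.simple_mem_parabolic hi)) hu
      have hr : cs.IsReflection (u⁻¹ * cs.simple i * u) := ⟨u⁻¹, i, by simp⟩
      have hinv : cs.IsRightInversion (cs.wordProd (ω ++ ω')) (u⁻¹ * cs.simple i * u) :=
        ⟨hr, by rw [← hw]; exact h.length_mul_lt ht hr⟩
      obtain ⟨j, hj, he⟩ := cs.exists_eraseIdx_of_isRightInversion _ hinv
      rw [← hw] at he
      by_cases hjl : j < ω.length
      · rw [List.eraseIdx_append_of_lt_length hjl, wordProd_append, ← hu', ← mul_assoc,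
          ← mul_assoc] at he
        have he := mul_right_cancel he
        have h1 : cs.length (w₀ * u⁻¹ * cs.simple i) + 1 ≤ cs.length (w₀ * u⁻¹) := by
          rw [he]
          conv_rhs => rw [hv, hω.eq]
          have := cs.length_wordProd_le (ω.eraseIdx j)
          rw [List.length_eraseIdx_of_lt hjl] at this
          omega
        omega
      · exfalso
        rw [List.eraseIdx_append_of_length_le (by omega), wordProd_append, ← hv] at he
        have he' : cs.simple i * u = cs.wordProd (ω'.eraseIdx (j - ω.length)) := by
          apply mul_left_cancel (a := w₀ * u⁻¹)
          rw [← he]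
          simp [mul_assoc]
        have := cs.length_wordProd_le (ω'.eraseIdx (j - ω.length))
        rw [List.length_append] at hj
        rw [← he', hl, List.length_eraseIdx_of_lt (by omega), hu', hω'.eq] at this
        omega
    · have := cs.length_mul_le (w₀ * u⁻¹) (cs.simple i)
      rw [length_simple] at this
      omega
  induction hu using Subgroup.closure_induction_left with
  | one => simp
  | mul_left x hx y hy ih =>
    obtain ⟨i, hi, rfl⟩ := hx
    exact step i hi y hy ih
  | inv_mul_cancel x hx y hy ih =>
    obtain ⟨i, hi, rfl⟩ := hx
    rw [inv_simple]
    exact step i hi y hy ih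

theorem IsLongest.length_lt {cs : CoxeterSystem M W} (h : cs.IsLongest S₀ w₀) {u : W}
    (hu : u ∈ cs.parabolic S₀) (hne : u ≠ w₀) : cs.length u < cs.length w₀ := by
  have h1 := h.length_mul hu
  have h2 : cs.length (w₀ * u⁻¹) ≠ 0 := by
    rw [ne_eq, length_eq_zero_iff, mul_inv_eq_one]
    exact hne.symm
  omega

theorem IsLongest.bruhatLE {cs : CoxeterSystem M W} (h : cs.IsLongest S₀ w₀) {u : W}
    (hu : u ∈ cs.parabolic S₀) : cs.BruhatLE u w₀ := by
  induction hn : cs.length w₀ - cs.length u using Nat.strong_induction_on generalizing u with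
  | _ n ih =>
    by_cases hne : u = w₀
    · subst hne; exact Relation.ReflTransGen.refl
    have hlt := h.length_lt hu hne
    -- some simple reflection of `S₀` lengthens `u` on the right
    obtain ⟨ω, hω, hS, hv⟩ := cs.exists_isReduced_of_mem_parabolic
      (mul_mem (inv_mem hu) h.1 : u⁻¹ * w₀ ∈ _)
    have : ∃ i ∈ S₀, cs.length u < cs.length (u * cs.simple i) := by
      cases ω with
      | nil =>
        rw [wordProd_nil, inv_mul_eq_one] at hv
        exact absurd hv hne
      | cons i ω =>
        have hω' : ∀ j ∈ ω, j ∈ S₀ := fun j hj => hS j (by simp [hj])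
        refine ⟨i, hS i (by simp), ?_⟩
        have h1 := h.length_mul (cs.wordProd_mem_parabolic hS)
        have h2 := h.length_mul (cs.wordProd_mem_parabolic hω')
        rw [hω.eq, ← hv] at h1
        rw [hω.tail.eq] at h2
        rw [wordProd_cons] at hv
        have h3 : w₀ * (cs.wordProd ω)⁻¹ = u * cs.simple i := by
          rw [show w₀ = u * (cs.simple i * cs.wordProd ω) by rw [← hv]; simp]
          simp [mul_assoc]
        rw [h3] at h2
        simp only [mul_inv_rev, inv_inv, mul_inv_cancel_left, List.length_cons] at h1
        omega
    obtain ⟨i, hi, hil⟩ := this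
    refine Relation.ReflTransGen.head ⟨cs.simple i, cs.isReflection_simple i, rfl, hil⟩
      (ih _ ?_ (mul_mem hu (cs.simple_mem_parabolic hi)) rfl)
    have := h.2 _ (mul_mem hu (cs.simple_mem_parabolic hi))
    omega

theorem mem_parabolic_of_bruhatLE {x y : W} (h : cs.BruhatLE x y) (hy : y ∈ cs.parabolic S₀) :
    x ∈ cs.parabolic S₀ := by
  induction h using Relation.ReflTransGen.head_induction_on with
  | refl => exact hy
  | @head a c hab _ ih =>
    obtain ⟨t, ht, hc, hlt⟩ := hab
    obtain ⟨ω, hω, hS, hv⟩ := cs.exists_isReduced_of_mem_parabolic ih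
    have h1 : c * t = a := by rw [hc, mul_assoc, ht.mul_self, mul_one]
    have hinv : cs.IsRightInversion (cs.wordProd ω) t := by
      rw [← hv]; exact ⟨ht, by rw [h1]; exact hlt⟩
    obtain ⟨j, hj, he⟩ := cs.exists_eraseIdx_of_isRightInversion _ hinv
    rw [← hv, h1] at he
    rw [he]
    exact cs.wordProd_mem_parabolic fun i hi => hS i (List.mem_of_mem_eraseIdx hi)

end CoxeterSystem

/-! ### Internal direct sums -/

section Internal

variable {ι : Type*} [DecidableEq ι] {P M₁ S S₁ : Type*}
  [AddCommGroup P] [AddCommGroup M₁]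
  [SetLike S P] [AddSubmonoidClass S P] [SetLike S₁ M₁] [AddSubmonoidClass S₁ M₁]

/-- The map of direct sums induced by an additive map which respects the summands. -/
def DirectSum.mapOfMem {E : ι → S} {A : ι → S₁} (p : P →+ M₁) (hp : ∀ k, ∀ x ∈ E k, p x ∈ A k) :
    (DirectSum ι fun k => E k) →+ DirectSum ι fun k => A k :=
  DirectSum.map fun k =>
    { toFun := fun x => ⟨p (x : P), hp k x x.2⟩
      map_zero' := Subtype.ext (map_zero p)
      map_add' := fun a b => Subtype.ext (map_add p (a : P) (b : P)) }

theorem DirectSum.coe_mapOfMem {E : ι → S} {A : ι → S₁} (p : P →+ M₁)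
    (hp : ∀ k, ∀ x ∈ E k, p x ∈ A k) (x : DirectSum ι fun k => E k) :
    DirectSum.coeAddMonoidHom A (DirectSum.mapOfMem p hp x) =
      p (DirectSum.coeAddMonoidHom E x) := by
  induction x using DirectSum.induction_on with
  | zero => simp
  | of k x => simp [DirectSum.mapOfMem, DirectSum.coeAddMonoidHom_of]
  | add a b ha hb => simp only [map_add, ha, hb]

/-- If `P` is embedded in a finite direct sum `⨁ M_a` as a retract, compatibly with families of
subgroups, then the family in `P` is an internal direct sum decomposition as soon as those in the
`M_a` are. -/
theorem DirectSum.isInternal_of_retract_family {J : Type*} [Fintype J] {E : ι → S}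
    {A : J → ι → S₁} (p : J → P →+ M₁) (j : J → M₁ →+ P)
    (hp : ∀ a k, ∀ x ∈ E k, p a x ∈ A a k) (hj : ∀ a k, ∀ x ∈ A a k, j a x ∈ E k)
    (h : ∀ x, ∑ a, j a (p a x) = x)
    (hA : ∀ a, DirectSum.IsInternal (A a)) : DirectSum.IsInternal E := by
  constructor
  · intro x y hxy
    have e : ∀ a, DirectSum.mapOfMem (p a) (hp a) x = DirectSum.mapOfMem (p a) (hp a) y :=
      fun a => (hA a).1 <| by rw [DirectSum.coe_mapOfMem, hxy, DirectSum.coe_mapOfMem]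
    ext k
    have f : ∀ a, p a (x k) = p a (y k) := fun a =>
      congrArg (fun y => ((y k : A a k) : M₁)) (e a)
    rw [← h (x k), Finset.sum_congr rfl fun a _ => congrArg (j a) (f a), h]
  · intro y
    choose z hz using fun a => (hA a).2 (p a y)
    refine ⟨∑ a, DirectSum.mapOfMem (j a) (hj a) (z a), ?_⟩
    rw [map_sum, Finset.sum_congr rfl fun a _ =>
      (DirectSum.coe_mapOfMem (j a) (hj a) (z a)).trans (congrArg (j a) (hz a)), h]

theorem DirectSum.isInternal_of_retract {E : ι → S} {A : ι → S₁}
    (p : P →+ M₁) (j : M₁ →+ P) (hp : ∀ k, ∀ x ∈ E k, p x ∈ A k) (hj : ∀ k, ∀ x ∈ A k, j x ∈ E k)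
    (h : ∀ x, j (p x) = x) (hA : DirectSum.IsInternal A) : DirectSum.IsInternal E :=
  DirectSum.isInternal_of_retract_family (J := Unit) (A := fun _ => A) (fun _ => p) (fun _ => j)
    (fun _ => hp) (fun _ => hj) (fun x => by simp [h]) (fun _ => hA)

theorem DirectSum.isInternal_reindex {κ : Type*} [DecidableEq κ] {A : ι → S₁}
    (h : DirectSum.IsInternal A) (e : κ ≃ ι) : DirectSum.IsInternal fun k => A (e k) := by
  have key : ∀ x : DirectSum ι fun k => A k,
      DirectSum.coeAddMonoidHom (fun k => A (e k))
        (DirectSum.equivCongrLeft e.symm x) = DirectSum.coeAddMonoidHom A x := by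
    intro x
    induction x using DirectSum.induction_on with
    | zero => simp
    | of k x =>
      obtain ⟨j, rfl⟩ := e.surjective k
      have : DirectSum.equivCongrLeft e.symm (DirectSum.of (fun k => A k) (e j) x) =
          DirectSum.of (fun k => A (e k)) j x := by
        ext i
        simp only [DirectSum.equivCongrLeft_apply, Equiv.symm_symm, DirectSum.of_apply]
        by_cases hij : j = i
        · subst hij; simp
        · simp [hij]
      rw [this, DirectSum.coeAddMonoidHom_of, DirectSum.coeAddMonoidHom_of]
    | add a b ha hb => simp only [map_add, ha, hb]
  have hc : (DirectSum.coeAddMonoidHom fun k => A (e k)) ∘ (DirectSum.equivCongrLeft e.symm) =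
      DirectSum.coeAddMonoidHom A := funext key
  have h' : Function.Bijective (DirectSum.coeAddMonoidHom A) := h
  rw [← hc] at h'
  exact (Function.Bijective.of_comp_iff _ (DirectSum.equivCongrLeft e.symm).bijective).1 h'

/-- A decomposition is detected by projections: additive maps `q k` that are the identity on the
`k`-th summand and vanish on the others, such that every element is a finite sum of members. -/
theorem DirectSum.isInternal_of_proj {E : ι → S} (q : ι → P → P)
    (hq_add : ∀ k x y, q k (x + y) = q k x + q k y) (hq_self : ∀ k, ∀ x ∈ E k, q k x = x)
    (hq_ne : ∀ k l, k ≠ l → ∀ x ∈ E k, q l x = 0)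
    (hspan : ∀ x : P, x ∈ AddSubmonoid.closure (⋃ k, (E k : Set P))) :
    DirectSum.IsInternal E := by
  have hq0 : ∀ k, q k 0 = 0 := fun k => by
    have := hq_add k 0 0
    simpa using this
  have key : ∀ (x : DirectSum ι fun k => E k) k, q k (DirectSum.coeAddMonoidHom E x) = x k := by
    intro x k
    induction x using DirectSum.induction_on with
    | zero => simp [hq0]
    | of l x =>
      rw [DirectSum.coeAddMonoidHom_of, DirectSum.of_apply]
      split_ifs with h
      · subst h; exact hq_self l _ x.2
      · exact hq_ne l k h _ x.2
    | add a b ha hb => rw [map_add, hq_add, ha, hb, DirectSum.add_apply]; rfl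
  constructor
  · intro x y hxy
    ext k
    rw [← key x k, ← key y k, hxy]
  · intro x
    induction hspan x using AddSubmonoid.closure_induction with
    | mem x hx =>
      obtain ⟨k, hk⟩ := Set.mem_iUnion.1 hx
      exact ⟨DirectSum.of (fun k => E k) k ⟨x, hk⟩, DirectSum.coeAddMonoidHom_of E k ⟨x, hk⟩⟩
    | zero => exact ⟨0, map_zero _⟩
    | add a b _ _ ha hb =>
      obtain ⟨a', rfl⟩ := ha
      obtain ⟨b', rfl⟩ := hb
      exact ⟨a' + b', map_add _ _ _⟩

/-- Induction on a decomposition. -/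
theorem DirectSum.IsInternal.induction {E : ι → S} (h : DirectSum.IsInternal E)
    {p : P → Prop} (zero : p 0) (mem : ∀ k, ∀ x ∈ E k, p x) (add : ∀ x y, p x → p y → p (x + y))
    (x : P) : p x := by
  obtain ⟨a, rfl⟩ := h.2 x
  induction a using DirectSum.induction_on with
  | zero => simpa using zero
  | of l x => rw [DirectSum.coeAddMonoidHom_of]; exact mem l _ x.2
  | add a b ha hb => rw [map_add]; exact add _ _ ha hb

end Internal

namespace CoxeterRealization

variable {K : Type u} {V : Type v} [CommRing K] [AddCommGroup V] [Module K V]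
  {B W : Type*} [Group W] {M : CoxeterMatrix B} {cs : CoxeterSystem M W}
  (X : CoxeterRealization K V cs)

/-! ### The grading of the symmetric algebra -/

/-- The algebra map `R → R[T]` which multiplies an element of `V` by `T`: the coefficient of `T ^ n`
is the projection to the part of degree `2 n`. -/
def gradPoly : X.R →ₐ[K] Polynomial X.R :=
  SymmetricAlgebra.lift
    (((Polynomial.monomial 1 : X.R →ₗ[X.R] Polynomial X.R).restrictScalars K).comp
      (SymmetricAlgebra.ι K V))

@[simp] theorem gradPoly_ι (v : V) :
    X.gradPoly (SymmetricAlgebra.ι K V v) = Polynomial.monomial 1 (SymmetricAlgebra.ι K V v) := by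
  simp [gradPoly]

theorem eval_gradPoly (f : X.R) : (X.gradPoly f).eval 1 = f := by
  have : ((Polynomial.aeval (1 : X.R)).restrictScalars K).comp X.gradPoly = AlgHom.id K X.R := by
    apply SymmetricAlgebra.algHom_ext
    ext v
    simp
  have := DFunLike.congr_fun this f
  simpa [Polynomial.aeval_def] using this

theorem gradPoly_of_mem_pow {n : ℕ} {f : X.R}
    (hf : f ∈ (LinearMap.range (SymmetricAlgebra.ι K V)) ^ n) :
    X.gradPoly f = Polynomial.monomial n f := by
  induction n generalizing f with
  | zero =>
    rw [pow_zero, Submodule.mem_one] at hf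
    obtain ⟨c, rfl⟩ := hf
    rw [AlgHom.commutes]
    rfl
  | succ n ih =>
    rw [pow_succ] at hf
    induction hf using Submodule.mul_induction_on' with
    | mem_mul_mem a ha b hb =>
      obtain ⟨v, rfl⟩ := hb
      rw [map_mul, ih ha, gradPoly_ι, Polynomial.monomial_mul_monomial]
    | add a _ b _ ha hb => rw [map_add, ha, hb, map_add]

theorem coeff_gradPoly_mem (f : X.R) (n : ℕ) :
    (X.gradPoly f).coeff n ∈ (LinearMap.range (SymmetricAlgebra.ι K V)) ^ n := by
  induction f using SymmetricAlgebra.induction generalizing n with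
  | algebraMap c =>
    rw [AlgHom.commutes]
    change (Polynomial.C (algebraMap K X.R c)).coeff n ∈ _
    rw [Polynomial.coeff_C]
    split_ifs with h
    · subst h; rw [pow_zero]; exact Submodule.mem_one.2 ⟨c, rfl⟩
    · exact zero_mem _
  | ι v =>
    rw [gradPoly_ι, Polynomial.coeff_monomial]
    split_ifs with h
    · subst h; rw [pow_one]; exact ⟨v, rfl⟩
    · exact zero_mem _
  | mul a b ha hb =>
    rw [map_mul, Polynomial.coeff_mul]
    refine sum_mem fun p hp => ?_
    rw [← Finset.HasAntidiagonal.mem_antidiagonal.1 hp, pow_add]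
    exact Submodule.mul_mem_mul (ha _) (hb _)
  | add a b ha hb => rw [map_add, Polynomial.coeff_add]; exact add_mem (ha n) (hb n)

theorem mem_degR_two_mul {n : ℕ} {f : X.R} :
    f ∈ X.degR (2 * n) ↔ X.gradPoly f = Polynomial.monomial n f := by
  have h1 : X.degR (2 * n) = ((LinearMap.range (SymmetricAlgebra.ι K V)) ^ n).toAddSubgroup := by
    refine le_antisymm (iSup₂_le fun m hm => ?_) (le_iSup₂_of_le n rfl le_rfl)
    rw [show m = n by omega]
  rw [h1]
  refine ⟨X.gradPoly_of_mem_pow, fun h => ?_⟩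
  have := X.coeff_gradPoly_mem f n
  rwa [h, Polynomial.coeff_monomial, if_pos rfl] at this

/-- `R` is concentrated in the degrees `2 n`, `n ∈ ℕ`. -/
theorem degR_cases {k : ℤ} {f : X.R} (hf : f ∈ X.degR k) : f = 0 ∨ ∃ n : ℕ, k = 2 * n := by
  by_cases h : ∃ n : ℕ, k = 2 * n
  · exact Or.inr h
  · left
    have : X.degR k = ⊥ := by
      refine le_bot_iff.1 (iSup₂_le fun m hm => (h ⟨m, hm.symm⟩).elim)
    rwa [this] at hf

theorem eq_zero_of_mem_degR_neg {k : ℤ} {f : X.R} (hf : f ∈ X.degR k) (hk : k < 0) : f = 0 := by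
  rcases X.degR_cases hf with h | ⟨n, rfl⟩
  · exact h
  · omega

theorem mul_mem_degR {i j : ℤ} {f g : X.R} (hf : f ∈ X.degR i) (hg : g ∈ X.degR j) :
    f * g ∈ X.degR (i + j) := by
  rcases X.degR_cases hf with rfl | ⟨n, rfl⟩
  · simp
  rcases X.degR_cases hg with rfl | ⟨m, rfl⟩
  · simp
  rw [show (2 * n + 2 * m : ℤ) = 2 * ((n + m : ℕ) : ℤ) by push_cast; ring]
  rw [mem_degR_two_mul] at *
  rw [map_mul, hf, hg, Polynomial.monomial_mul_monomial]

theorem algebraMap_mem_degR (c : K) : algebraMap K X.R c ∈ X.degR 0 := by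
  rw [show (0 : ℤ) = 2 * ((0 : ℕ) : ℤ) by simp, mem_degR_two_mul, AlgHom.commutes]
  rfl

theorem one_mem_degR : (1 : X.R) ∈ X.degR 0 := by
  simpa using X.algebraMap_mem_degR 1

theorem ι_mem_degR (v : V) : SymmetricAlgebra.ι K V v ∈ X.degR 2 := by
  rw [show (2 : ℤ) = 2 * ((1 : ℕ) : ℤ) by simp, mem_degR_two_mul, gradPoly_ι]

theorem exists_of_mem_degR_zero {f : X.R} (hf : f ∈ X.degR 0) : ∃ c, f = algebraMap K X.R c := by
  rw [show (0 : ℤ) = 2 * ((0 : ℕ) : ℤ) by simp, mem_degR_two_mul] at hf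
  have := X.coeff_gradPoly_mem f 0
  rw [hf, Polynomial.coeff_monomial, if_pos rfl, pow_zero, Submodule.mem_one] at this
  obtain ⟨c, hc⟩ := this
  exact ⟨c, hc.symm⟩

theorem prod_mem_degR {ι : Type*} (s : Finset ι) (f : ι → X.R) (d : ι → ℤ)
    (h : ∀ i ∈ s, f i ∈ X.degR (d i)) : ∏ i ∈ s, f i ∈ X.degR (∑ i ∈ s, d i) := by
  classical
  induction s using Finset.induction_on with
  | empty => simpa using X.one_mem_degR
  | insert a s ha ih =>
    rw [Finset.prod_insert ha, Finset.sum_insert ha]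
    exact X.mul_mem_degR (h a (Finset.mem_insert_self a s))
      (ih fun i hi => h i (Finset.mem_insert_of_mem hi))

theorem gradPoly_actR (w : W) (f : X.R) :
    X.gradPoly (X.actR w f) = (X.gradPoly f).map (X.actR w).toRingHom := by
  have : X.gradPoly.comp (X.actR w) = (Polynomial.mapAlgHom (X.actR w)).comp X.gradPoly := by
    apply SymmetricAlgebra.algHom_ext
    ext v
    simp [actR_ι]
  exact DFunLike.congr_fun this f

theorem actR_mem_degR (w : W) {k : ℤ} {f : X.R} (hf : f ∈ X.degR k) : X.actR w f ∈ X.degR k := by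
  rcases X.degR_cases hf with rfl | ⟨n, rfl⟩
  · simp
  rw [mem_degR_two_mul] at *
  rw [gradPoly_actR, hf]
  simp

theorem degR_internal [DecidableEq ℤ] : DirectSum.IsInternal X.degR := by
  refine DirectSum.isInternal_of_proj
    (fun k f => if 0 ≤ k ∧ k % 2 = 0 then (X.gradPoly f).coeff (k / 2).toNat else 0) ?_ ?_ ?_ ?_
  · intro k x y
    split_ifs <;> simp
  · intro k f hf
    rcases X.degR_cases hf with rfl | ⟨n, rfl⟩
    · simp
    · rw [mem_degR_two_mul] at hf
      simp [hf]
  · intro k l hkl f hf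
    rcases X.degR_cases hf with rfl | ⟨n, rfl⟩
    · simp
    · rw [mem_degR_two_mul] at hf
      simp only [hf, Polynomial.coeff_monomial]
      split_ifs <;> first | rfl | omega
  · intro f
    rw [← X.eval_gradPoly f, Polynomial.eval_eq_sum, Polynomial.sum]
    refine sum_mem fun n _ => AddSubmonoid.subset_closure (Set.mem_iUnion.2 ⟨2 * (n : ℤ), ?_⟩)
    have := X.coeff_gradPoly_mem f n
    rw [SetLike.mem_coe, mem_degR_two_mul, one_pow, mul_one]
    exact X.gradPoly_of_mem_pow this

/-- A right factor of a homogeneous product with a homogeneous nonzero left factor is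
homogeneous. -/
theorem mem_degR_of_mul_mem [IsDomain K] [Module.Free K V] {n k : ℕ} {f g : X.R}
    (hf : f ∈ X.degR (2 * n)) (hf0 : f ≠ 0) (h : f * g ∈ X.degR (2 * ((n + k : ℕ) : ℤ))) :
    g ∈ X.degR (2 * k) := by
  rw [mem_degR_two_mul] at *
  rw [map_mul, hf] at h
  have h0 : (Polynomial.monomial n f : Polynomial X.R) ≠ 0 := by simpa using hf0
  apply mul_left_cancel₀ h0
  rw [h, Polynomial.monomial_mul_monomial]

/-! ### Roots and Demazure operators -/

theorem actR_mul_apply (w w' : W) (f : X.R) : X.actR w (X.actR w' f) = X.actR (w * w') f :=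
  (X.actR_mul w w' f).symm

@[simp] theorem actR_one_apply (f : X.R) : X.actR 1 f = f := by rw [actR_one]; rfl

@[simp] theorem actR_inv_actR (w : W) (f : X.R) : X.actR w⁻¹ (X.actR w f) = f := by
  rw [actR_mul_apply, inv_mul_cancel, actR_one_apply]

@[simp] theorem actR_actR_inv (w : W) (f : X.R) : X.actR w (X.actR w⁻¹ f) = f := by
  rw [actR_mul_apply, mul_inv_cancel, actR_one_apply]

theorem actR_injective (w : W) : Function.Injective (X.actR w) :=
  Function.LeftInverse.injective (X.actR_inv_actR w)

theorem actR_coe_invariants {H : Subgroup W} (c : X.invariants H) {w : W} (hw : w ∈ H) :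
    X.actR w (c : X.R) = c := c.2 w hw

theorem ι_injective [Module.Free K V] : Function.Injective (SymmetricAlgebra.ι K V) := by
  rw [injective_iff_map_eq_zero]
  intro v hv
  let b := Module.Free.chooseBasis K V
  have h : ∀ i, b.repr v i = 0 := fun i => by
    classical
    -- The algebra map to `K[T]` given by the `i`-th coordinate.
    let φ : SymmetricAlgebra K V →ₐ[K] Polynomial K :=
      SymmetricAlgebra.lift ((Polynomial.monomial 1).comp (b.coord i))
    have := congrArg φ hv
    simpa [φ] using this
  exact b.repr.map_eq_zero_iff.1 (Finsupp.ext h)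

/-- The roots are nonzero and the coroots are surjective. -/
class IsRegular : Prop where
  root_ne_zero : ∀ s, X.root s ≠ 0
  coroot_surjective : ∀ s, Function.Surjective (X.coroot s)

/-- The root `α_s` as an element of `R`. -/
def rootR (s : B) : X.R := SymmetricAlgebra.ι K V (X.root s)

theorem rootR_mem_degR (s : B) : X.rootR s ∈ X.degR 2 := X.ι_mem_degR _

theorem rootR_ne_zero [Module.Free K V] [hX : X.IsRegular] (s : B) : X.rootR s ≠ 0 := fun h =>
  hX.root_ne_zero s (ι_injective (h.trans (map_zero _).symm))

@[simp] theorem actR_simple_rootR (s : B) : X.actR (cs.simple s) (X.rootR s) = -X.rootR s := by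
  rw [rootR, actR_ι, X.act_simple, X.coroot_root, ← map_neg, two_smul]
  congr 1
  abel

/-- `f ≡ s(f)` modulo `α_s`. -/
theorem rootR_dvd_sub (s : B) (f : X.R) : X.rootR s ∣ f - X.actR (cs.simple s) f := by
  rw [← Ideal.mem_span_singleton, ← Ideal.Quotient.eq]
  have : (Ideal.Quotient.mkₐ K (Ideal.span {X.rootR s})) =
      (Ideal.Quotient.mkₐ K (Ideal.span {X.rootR s})).comp (X.actR (cs.simple s)) := by
    apply SymmetricAlgebra.algHom_ext
    ext v
    change Ideal.Quotient.mk _ (SymmetricAlgebra.ι K V v) =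
      Ideal.Quotient.mk _ (X.actR (cs.simple s) (SymmetricAlgebra.ι K V v))
    rw [Ideal.Quotient.eq, actR_ι, X.act_simple, ← map_sub, sub_sub_cancel, map_smul,
      Algebra.smul_def]
    exact Ideal.mul_mem_left _ _ (Ideal.mem_span_singleton_self _)
  exact DFunLike.congr_fun this f

theorem mem_parabolic_singleton (s : B) {w : W} :
    w ∈ cs.parabolic {s} ↔ w = 1 ∨ w = cs.simple s := by
  constructor
  · intro h
    rw [CoxeterSystem.parabolic, Set.image_singleton, ← Subgroup.zpowers_eq_closure] at h
    obtain ⟨k, rfl⟩ := h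
    rcases Int.even_or_odd' k with ⟨n, rfl | rfl⟩
    · left; simp [zpow_mul, sq]
    · right; simp [zpow_add, zpow_mul, sq]
  · rintro (rfl | rfl)
    · exact one_mem _
    · exact CoxeterSystem.simple_mem_parabolic cs rfl

theorem mem_invariants_singleton (s : B) {f : X.R} :
    f ∈ X.invariants (cs.parabolic {s}) ↔ X.actR (cs.simple s) f = f := by
  constructor
  · intro h; exact h _ ((mem_parabolic_singleton s).2 (Or.inr rfl))
  · intro h w hw
    rcases (mem_parabolic_singleton s).1 hw with rfl | rfl
    · simp
    · exact h

@[simp] theorem actR_coe_invariants_singleton {s : B} (c : X.invariants (cs.parabolic {s})) :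
    X.actR (cs.simple s) (c : X.R) = c := (X.mem_invariants_singleton s).1 c.2

variable [IsDomain K] [Module.Free K V] [X.IsRegular]

/-- The quotient of `f - s(f)` by `α_s`. -/
def demazureFun (s : B) (f : X.R) : X.R := (X.rootR_dvd_sub s f).choose

omit [IsDomain K] [Module.Free K V] [X.IsRegular] in
theorem rootR_mul_demazureFun (s : B) (f : X.R) :
    X.rootR s * X.demazureFun s f = f - X.actR (cs.simple s) f :=
  (X.rootR_dvd_sub s f).choose_spec.symm

/-- The Demazure operator `∂_s`, with `α_s ∂_s(f) = f - s(f)`; it is linear over the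
`s`-invariants. -/
def demazure (s : B) : X.R →ₗ[X.invariants (cs.parabolic {s})] X.R where
  toFun := X.demazureFun s
  map_add' f g := mul_left_cancel₀ (X.rootR_ne_zero s) <| by
    rw [mul_add, rootR_mul_demazureFun, rootR_mul_demazureFun, rootR_mul_demazureFun, map_add]
    ring
  map_smul' c f := mul_left_cancel₀ (X.rootR_ne_zero s) <| by
    rw [RingHom.id_apply, Subalgebra.smul_def, Subalgebra.smul_def, smul_eq_mul, smul_eq_mul,
      mul_left_comm, rootR_mul_demazureFun, rootR_mul_demazureFun, map_mul,
      actR_coe_invariants_singleton]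
    ring

theorem rootR_mul_demazure (s : B) (f : X.R) :
    X.rootR s * X.demazure s f = f - X.actR (cs.simple s) f :=
  X.rootR_mul_demazureFun s f

omit [IsDomain K] [Module.Free K V] [X.IsRegular] in
theorem actR_simple_simple (s : B) (f : X.R) :
    X.actR (cs.simple s) (X.actR (cs.simple s) f) = f := by
  rw [actR_mul_apply, CoxeterSystem.simple_mul_simple_self, actR_one_apply]

theorem demazure_mem_invariants (s : B) (f : X.R) :
    X.demazure s f ∈ X.invariants (cs.parabolic {s}) := by
  rw [mem_invariants_singleton]
  apply mul_left_cancel₀ (neg_ne_zero.2 (X.rootR_ne_zero s))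
  rw [← actR_simple_rootR, ← map_mul, rootR_mul_demazure, map_sub, actR_simple_rootR,
    neg_mul, rootR_mul_demazure, actR_simple_simple, neg_sub]

@[simp] theorem actR_demazure (s : B) (f : X.R) :
    X.actR (cs.simple s) (X.demazure s f) = X.demazure s f :=
  (X.mem_invariants_singleton s).1 (X.demazure_mem_invariants s f)

theorem demazure_mem_degR (s : B) {k : ℤ} {f : X.R} (hf : f ∈ X.degR k) :
    X.demazure s f ∈ X.degR (k - 2) := by
  rcases X.degR_cases hf with rfl | ⟨n, rfl⟩
  · simp
  rcases n with - | n
  · obtain ⟨c, rfl⟩ := X.exists_of_mem_degR_zero (by simpa using hf)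
    have : X.demazure s (algebraMap K X.R c) = 0 := mul_left_cancel₀ (X.rootR_ne_zero s) <| by
      rw [rootR_mul_demazure, AlgHom.commutes, sub_self, mul_zero]
    rw [this]; exact zero_mem _
  · rw [show (2 * ((n + 1 : ℕ) : ℤ) - 2) = 2 * (n : ℤ) by push_cast; ring]
    refine X.mem_degR_of_mul_mem (n := 1) (f := X.rootR s) (by simpa using X.rootR_mem_degR s)
      (X.rootR_ne_zero s) ?_
    rw [rootR_mul_demazure, Nat.add_comm]
    exact sub_mem hf (X.actR_mem_degR _ hf)

omit [IsDomain K] [Module.Free K V] in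
theorem exists_coroot_eq_one (s : B) : ∃ v, X.coroot s v = 1 :=
  IsRegular.coroot_surjective (X := X) s 1

/-- An element `δ_s` of `V ⊆ R` with `⟨α_s^∨, δ_s⟩ = 1`. -/
def fund (s : B) : X.R := SymmetricAlgebra.ι K V (X.exists_coroot_eq_one s).choose

omit [IsDomain K] [Module.Free K V] in
theorem fund_mem_degR (s : B) : X.fund s ∈ X.degR 2 := X.ι_mem_degR _

omit [IsDomain K] [Module.Free K V] in
@[simp] theorem actR_fund (s : B) : X.actR (cs.simple s) (X.fund s) = X.fund s - X.rootR s := by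
  rw [fund, actR_ι, X.act_simple, (X.exists_coroot_eq_one s).choose_spec, one_smul, map_sub]
  rfl

@[simp] theorem demazure_fund (s : B) : X.demazure s (X.fund s) = 1 :=
  mul_left_cancel₀ (X.rootR_ne_zero s) <| by
    rw [rootR_mul_demazure, actR_fund]
    ring

theorem demazure_mul_of_mem (s : B) {c : X.R} (hc : c ∈ X.invariants (cs.parabolic {s}))
    (f : X.R) : X.demazure s (c * f) = c * X.demazure s f :=
  (X.demazure s).map_smul (⟨c, hc⟩ : X.invariants (cs.parabolic {s})) f

/-- The twisted Leibniz rule. -/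
theorem demazure_mul (s : B) (f g : X.R) :
    X.demazure s (f * g) = X.demazure s f * g + X.actR (cs.simple s) f * X.demazure s g :=
  mul_left_cancel₀ (X.rootR_ne_zero s) <| by
    rw [mul_add, ← mul_assoc, mul_left_comm, rootR_mul_demazure, rootR_mul_demazure,
      rootR_mul_demazure, map_mul]
    ring

theorem sub_fund_mul_demazure_mem (s : B) (f : X.R) :
    f - X.fund s * X.demazure s f ∈ X.invariants (cs.parabolic {s}) := by
  rw [mem_invariants_singleton, map_sub, map_mul, actR_fund, actR_demazure]
  have := X.rootR_mul_demazure s f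
  linear_combination this

end CoxeterRealization

namespace CoxeterRealization

variable {K : Type u} {V : Type v} [CommRing K] [AddCommGroup V] [Module K V]
  {B W : Type*} [Group W] {M : CoxeterMatrix B} {cs : CoxeterSystem M W}

namespace PreObj

variable {X : CoxeterRealization K V cs}

/-! ### Homomorphisms of arbitrary degree -/

/-- The elements of `N` whose image in `N_Q` lies in `N_Q^x`. -/
def locSub (N : PreObj.{u, v, w₁} X) (x : W) : Submodule X.R N.carrier :=
  ((N.loc x).restrictScalars X.R).comap (TensorProduct.mk X.R X.Q N.carrier 1)

theorem mem_locSub {N : PreObj.{u, v, w₁} X} {x : W} {n : N.carrier} :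
    n ∈ N.locSub x ↔ (1 : X.Q) ⊗ₜ[X.R] n ∈ N.loc x := Iff.rfl

/-- `f` is a bimodule homomorphism of degree `d` that respects the decompositions of the
localizations, i.e. a morphism `N → P(d)` of `𝒞`. -/
structure IsHom (N : PreObj.{u, v, w₁} X) (P : PreObj.{u, v, w₂} X) (d : ℤ)
    (f : N.carrier →ₗ[X.R] P.carrier) : Prop where
  map_left : ∀ r n, f (N.left r n) = P.left r (f n)
  map_deg : ∀ i, ∀ n ∈ N.deg i, f n ∈ P.deg (i + d)
  map_loc : ∀ x, ∀ n ∈ N.locSub x, f n ∈ P.locSub x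

theorem Hom.isHom {N : PreObj.{u, v, w₁} X} {P : PreObj.{u, v, w₂} X} (f : Hom N P) :
    IsHom N P 0 f.toLin where
  map_left := f.map_left
  map_deg i n hn := by simpa using f.map_deg i n hn
  map_loc x n hn := by
    exact f.map_loc x _ hn

namespace IsHom

variable {N : PreObj.{u, v, w₁} X} {P : PreObj.{u, v, w₂} X} {L : PreObj.{u, v, w₃} X} {d e : ℤ}
  {f g : N.carrier →ₗ[X.R] P.carrier}

theorem add (hf : IsHom N P d f) (hg : IsHom N P d g) : IsHom N P d (f + g) where
  map_left r n := by simp [hf.map_left, hg.map_left]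
  map_deg i n hn := add_mem (hf.map_deg i n hn) (hg.map_deg i n hn)
  map_loc x n hn := add_mem (hf.map_loc x n hn) (hg.map_loc x n hn)

theorem neg (hf : IsHom N P d f) : IsHom N P d (-f) where
  map_left r n := by simp [hf.map_left]
  map_deg i n hn := neg_mem (hf.map_deg i n hn)
  map_loc x n hn := neg_mem (hf.map_loc x n hn)

theorem sub (hf : IsHom N P d f) (hg : IsHom N P d g) : IsHom N P d (f - g) := by
  rw [sub_eq_add_neg]; exact hf.add hg.neg

theorem zero : IsHom N P d 0 where
  map_left r n := by simp
  map_deg i n hn := zero_mem _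
  map_loc x n hn := zero_mem _

theorem comp {g : P.carrier →ₗ[X.R] L.carrier} {k : ℤ} (hg : IsHom P L e g) (hf : IsHom N P d f)
    (hk : d + e = k) : IsHom N L k (g ∘ₗ f) where
  map_left r n := by simp [hf.map_left, hg.map_left]
  map_deg i n hn := by
    rw [← hk, ← add_assoc]; exact hg.map_deg _ _ (hf.map_deg i n hn)
  map_loc x n hn := hg.map_loc x _ (hf.map_loc x n hn)

theorem id : IsHom N N 0 LinearMap.id where
  map_left r n := rfl
  map_deg i n hn := by simpa using hn
  map_loc x n hn := hn

end IsHom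

variable [IsDomain K] [Module.Free K V]

omit [IsDomain K] [Module.Free K V] in
theorem algebraMap_smul_tmul {C : Type*} [AddCommGroup C] [Module X.R C] (r : X.R) (q : X.Q)
    (c : C) : algebraMap X.R X.Q r • (q ⊗ₜ[X.R] c) = q ⊗ₜ[X.R] (r • c) := by
  rw [algebraMap_smul, TensorProduct.tmul_smul]

theorem algebraMap_Q_ne_zero {r : X.R} (hr : r ≠ 0) : algebraMap X.R X.Q r ≠ 0 := by
  simpa using hr

theorem eq_zero_of_algebraMap_smul {C : Type*} [AddCommGroup C] [Module X.R C] {r : X.R}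
    (hr : r ≠ 0) {ξ : X.Q ⊗[X.R] C} (h : algebraMap X.R X.Q r • ξ = 0) : ξ = 0 := by
  rw [← inv_smul_smul₀ (algebraMap_Q_ne_zero hr) ξ, h, smul_zero]

theorem exists_smul_eq_tmul {C : Type*} [AddCommGroup C] [Module X.R C] (ξ : X.Q ⊗[X.R] C) :
    ∃ r : X.R, r ≠ 0 ∧ ∃ c : C, algebraMap X.R X.Q r • ξ = (1 : X.Q) ⊗ₜ[X.R] c := by
  induction ξ using TensorProduct.induction_on with
  | zero => exact ⟨1, one_ne_zero, 0, by simp⟩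
  | tmul q c =>
    obtain ⟨a, b, hb, rfl⟩ := IsFractionRing.div_surjective X.R q
    have hb0 := nonZeroDivisors.ne_zero hb
    refine ⟨b, hb0, a • c, ?_⟩
    rw [TensorProduct.smul_tmul', smul_eq_mul, mul_div_cancel₀ _ (algebraMap_Q_ne_zero hb0),
      TensorProduct.tmul_smul, TensorProduct.smul_tmul', Algebra.smul_def, mul_one]
  | add ξ η hξ hη =>
    obtain ⟨r, hr, c, h⟩ := hξ
    obtain ⟨r', hr', c', h'⟩ := hη
    refine ⟨r * r', mul_ne_zero hr hr', r' • c + r • c', ?_⟩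
    rw [TensorProduct.tmul_add, ← algebraMap_smul_tmul, ← algebraMap_smul_tmul, ← h, ← h',
      smul_add, smul_smul, smul_smul, ← map_mul, ← map_mul, mul_comm r' r]

omit [IsDomain K] [Module.Free K V] in
theorem one_tmul_eq_zero_iff {C : Type*} [AddCommGroup C] [Module X.R C] (c : C) :
    (1 : X.Q) ⊗ₜ[X.R] c = 0 ↔ ∃ r ∈ nonZeroDivisors X.R, r • c = 0 := by
  have : IsLocalizedModule (nonZeroDivisors X.R) (TensorProduct.mk X.R X.Q C 1) :=
    (isLocalizedModule_iff_isBaseChange (nonZeroDivisors X.R) X.Q _).2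
      (TensorProduct.isBaseChange X.R C X.Q)
  have h := IsLocalizedModule.eq_zero_iff (nonZeroDivisors X.R) (TensorProduct.mk X.R X.Q C 1)
    (m := c)
  rw [TensorProduct.mk_apply] at h
  rw [h]
  exact ⟨fun ⟨r, hr⟩ => ⟨r, r.2, hr⟩, fun ⟨r, hr, h⟩ => ⟨⟨r, hr⟩, h⟩⟩

/-- Each `N_Q^x` is spanned over `Q` by images of elements of `N`. -/
theorem loc_eq_span (N : PreObj.{u, v, w₁} X) (x : W) :
    N.loc x = Submodule.span X.Q
      ((fun n => (1 : X.Q) ⊗ₜ[X.R] n) '' (N.locSub x : Set N.carrier)) := by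
  apply le_antisymm
  · intro ξ hξ
    obtain ⟨r, hr, n, h⟩ := exists_smul_eq_tmul ξ
    have h0 := algebraMap_Q_ne_zero hr
    rw [← inv_smul_smul₀ h0 ξ, h]
    refine Submodule.smul_mem _ _ (Submodule.subset_span ⟨n, ?_, rfl⟩)
    rw [SetLike.mem_coe, mem_locSub, ← h]
    exact Submodule.smul_mem _ _ hξ
  · rw [Submodule.span_le]
    rintro _ ⟨n, hn, rfl⟩
    exact hn

theorem mem_locSub_of_smul {N : PreObj.{u, v, w₁} X} {x : W} {n : N.carrier} {r : X.R} (hr : r ≠ 0)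
    (h : r • n ∈ N.locSub x) : n ∈ N.locSub x := by
  rw [mem_locSub, ← algebraMap_smul_tmul] at h
  rw [mem_locSub]
  rw [← inv_smul_smul₀ (algebraMap_Q_ne_zero hr) ((1 : X.Q) ⊗ₜ[X.R] n)]
  exact Submodule.smul_mem _ _ h

theorem baseChange_mem_loc {N : PreObj.{u, v, w₁} X} {P : PreObj.{u, v, w₂} X}
    {f : N.carrier →ₗ[X.R] P.carrier} {x y : W}
    (h : ∀ n ∈ N.locSub x, f n ∈ P.locSub y) {ξ : X.Q ⊗[X.R] N.carrier} (hξ : ξ ∈ N.loc x) :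
    f.baseChange X.Q ξ ∈ P.loc y := by
  rw [loc_eq_span] at hξ
  induction hξ using Submodule.span_induction with
  | mem ξ hξ =>
    obtain ⟨n, hn, rfl⟩ := hξ
    exact h n hn
  | zero => rw [map_zero]; exact zero_mem _
  | add ξ η _ _ h₁ h₂ => rw [map_add]; exact add_mem h₁ h₂
  | smul q ξ _ h => rw [map_smul]; exact Submodule.smul_mem _ _ h

/-- A homomorphism of degree `d`, as a morphism of `𝒞` between suitable shifts. -/
def IsHom.toHom {N : PreObj.{u, v, w₁} X} {P : PreObj.{u, v, w₂} X} {d : ℤ}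
    {f : N.carrier →ₗ[X.R] P.carrier} (hf : IsHom N P d f) (a b : ℤ) (h : a + d = b) :
    Hom (N.shift a) (P.shift b) where
  toLin := f
  map_left := hf.map_left
  map_deg i n hn := by
    have := hf.map_deg _ n hn
    rwa [add_assoc, h] at this
  map_loc x ξ hξ := baseChange_mem_loc (hf.map_loc x) hξ

/-- A homomorphism of degree `0`, as a morphism of `𝒞`. -/
def IsHom.toHom₀ {N : PreObj.{u, v, w₁} X} {P : PreObj.{u, v, w₂} X}
    {f : N.carrier →ₗ[X.R] P.carrier} (hf : IsHom N P 0 f) : Hom N P where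
  toLin := f
  map_left := hf.map_left
  map_deg i n hn := by simpa using hf.map_deg _ n hn
  map_loc x ξ hξ := baseChange_mem_loc (hf.map_loc x) hξ

/-- `R` acts from the left on the elements of `N` in `N_Q^x` through `x⁻¹` (up to torsion). -/
def LocLeft (N : PreObj.{u, v, w₁} X) : Prop :=
  ∀ x, ∀ n ∈ N.locSub x, ∀ f : X.R,
    (1 : X.Q) ⊗ₜ[X.R] (N.left f n) = (1 : X.Q) ⊗ₜ[X.R] (X.actR x⁻¹ f • n)

/-- `N` is torsion free as a right `R`-module. -/
def TorsionFree (N : PreObj.{u, v, w₁} X) : Prop :=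
  ∀ (r : X.R) (n : N.carrier), r • n = 0 → r = 0 ∨ n = 0

omit [IsDomain K] [Module.Free K V] in
theorem IsObj.locLeft {N : PreObj.{u, v, w₁} X} (hN : N.IsObj) : N.LocLeft := fun x n hn f => by
  exact (hN.left_loc x _ hn f).trans (algebraMap_smul_tmul _ _ _)

theorem TorsionFree.one_tmul_injective {N : PreObj.{u, v, w₁} X} (hN : N.TorsionFree)
    {n n' : N.carrier} (h : (1 : X.Q) ⊗ₜ[X.R] n = (1 : X.Q) ⊗ₜ[X.R] n') : n = n' := by
  rw [← sub_eq_zero, ← TensorProduct.tmul_sub, one_tmul_eq_zero_iff] at h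
  obtain ⟨r, hr, h⟩ := h
  rcases hN r _ h with h | h
  · exact (nonZeroDivisors.ne_zero hr h).elim
  · exact sub_eq_zero.1 h

theorem LocLeft.left_eq {N : PreObj.{u, v, w₁} X} (hL : N.LocLeft) (hN : N.TorsionFree) {x : W}
    {n : N.carrier} (hn : n ∈ N.locSub x) (f : X.R) : N.left f n = X.actR x⁻¹ f • n :=
  hN.one_tmul_injective (hL x n hn f)

theorem LocLeft.left_mem {N : PreObj.{u, v, w₁} X} (hL : N.LocLeft) {x : W}
    {n : N.carrier} (hn : n ∈ N.locSub x) (f : X.R) : N.left f n ∈ N.locSub x := by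
  rw [mem_locSub, hL x n hn f]
  exact Submodule.smul_mem _ _ hn

/-- The elements of a `Q`-subspace spanned by an `R`-submodule lie in this submodule up to
denominators. -/
theorem exists_smul_mem_of_one_tmul_mem_span {C : Type*} [AddCommGroup C] [Module X.R C]
    (S : Submodule X.R C) {c : C}
    (h : (1 : X.Q) ⊗ₜ[X.R] c ∈ Submodule.span X.Q ((fun c => (1 : X.Q) ⊗ₜ[X.R] c) '' (S : Set C))) :
    ∃ r : X.R, r ≠ 0 ∧ r • c ∈ S := by
  have key : ∀ ξ ∈ Submodule.span X.Q ((fun c => (1 : X.Q) ⊗ₜ[X.R] c) '' (S : Set C)),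
      ∃ r : X.R, r ≠ 0 ∧ ∃ s ∈ S, algebraMap X.R X.Q r • ξ = (1 : X.Q) ⊗ₜ[X.R] s := by
    intro ξ hξ
    induction hξ using Submodule.span_induction with
    | mem ξ hξ =>
      obtain ⟨s, hs, rfl⟩ := hξ
      exact ⟨1, one_ne_zero, s, hs, by simp⟩
    | zero => exact ⟨1, one_ne_zero, 0, zero_mem _, by simp⟩
    | add ξ η _ _ h₁ h₂ =>
      obtain ⟨r, hr, c, hc, h⟩ := h₁
      obtain ⟨r', hr', c', hc', h'⟩ := h₂
      refine ⟨r * r', mul_ne_zero hr hr', r' • c + r • c',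
        add_mem (S.smul_mem _ hc) (S.smul_mem _ hc'), ?_⟩
      rw [TensorProduct.tmul_add, ← algebraMap_smul_tmul, ← algebraMap_smul_tmul, ← h, ← h',
        smul_add, smul_smul, smul_smul, ← map_mul, ← map_mul, mul_comm r' r]
    | smul q ξ _ h =>
      obtain ⟨r, hr, c, hc, h⟩ := h
      obtain ⟨a, b, hb, rfl⟩ := IsFractionRing.div_surjective X.R q
      have hb0 := nonZeroDivisors.ne_zero hb
      refine ⟨r * b, mul_ne_zero hr hb0, a • c, S.smul_mem _ hc, ?_⟩
      rw [← algebraMap_smul_tmul, ← h, map_mul, smul_smul, smul_smul]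
      congr 1
      field_simp [algebraMap_Q_ne_zero hb0]
  obtain ⟨r, hr, s, hs, h'⟩ := key _ h
  rw [algebraMap_smul_tmul, ← sub_eq_zero, ← TensorProduct.tmul_sub, one_tmul_eq_zero_iff] at h'
  obtain ⟨r', hr', h'⟩ := h'
  refine ⟨r' * r, mul_ne_zero (nonZeroDivisors.ne_zero hr') hr, ?_⟩
  rw [smul_sub, sub_eq_zero, smul_smul] at h'
  rw [h']
  exact S.smul_mem _ hs

/-! ### The tensor product -/

section Tensor

variable {N : PreObj.{u, v, w₁} X} {P : PreObj.{u, v, w₂} X} {L : PreObj.{u, v, w₃} X}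

/-- `n ⊗ p` as an additive function of `n` with values in the linear functions of `p`. -/
def tmulHom (N : PreObj.{u, v, w₁} X) (P : PreObj.{u, v, w₂} X) :
    N.carrier →+ (P.carrier →ₗ[X.R] (N.tensor P).carrier) where
  toFun n :=
    { toFun := fun p => tmul n p
      map_add' := fun a b => TensorProduct.tmul_add n (toLeft a) (toLeft b)
      map_smul' := fun _ _ => rfl }
  map_zero' := LinearMap.ext fun p => TensorProduct.zero_tmul _ (toLeft p)
  map_add' a b := LinearMap.ext fun p => TensorProduct.add_tmul a b (toLeft p)

/-- The element `n ⊗ p` of the object `N ⊗ P`. -/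
def tm (n : N.carrier) (p : P.carrier) : (N.tensor P).carrier := tmulHom N P n p

theorem tm_add (n : N.carrier) (p p' : P.carrier) : tm n (p + p') = tm n p + tm n p' :=
  map_add (tmulHom N P n) p p'

theorem add_tm (n n' : N.carrier) (p : P.carrier) : tm (n + n') p = tm n p + tm n' p :=
  DFunLike.congr_fun (map_add (tmulHom N P) n n') p

theorem sub_tm (n n' : N.carrier) (p : P.carrier) : tm (n - n') p = tm n p - tm n' p :=
  DFunLike.congr_fun (map_sub (tmulHom N P) n n') p

@[simp] theorem zero_tm (p : P.carrier) : tm (0 : N.carrier) p = 0 :=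
  DFunLike.congr_fun (map_zero (tmulHom N P)) p

@[simp] theorem tm_zero (n : N.carrier) : tm n (0 : P.carrier) = 0 := map_zero (tmulHom N P n)

theorem smul_tm (r : X.R) (n : N.carrier) (p : P.carrier) : r • tm n p = tm n (r • p) := rfl

theorem smul_tm_left (r : X.R) (n : N.carrier) (p : P.carrier) :
    tm (r • n) p = tm n (P.left r p) :=
  TensorProduct.smul_tmul (R := X.R) r n (toLeft p)

theorem left_tm (r : X.R) (n : N.carrier) (p : P.carrier) :
    (N.tensor P).left r (tm n p) = tm (N.left r n) p := rfl

@[elab_as_elim]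
theorem tensor_induction {motive : (N.tensor P).carrier → Prop} (z : (N.tensor P).carrier)
    (tm : ∀ n p, motive (tm n p)) (add : ∀ a b, motive a → motive b → motive (a + b)) :
    motive z := by
  refine TensorProduct.induction_on (R := X.R) (M := N.carrier) (N := P.LeftMod)
    (motive := motive) z ?_ (fun n p => tm n p) (fun a b => add a b)
  have := tm 0 0
  rwa [zero_tm] at this

/-- The additive map out of `N ⊗ P` given by a balanced biadditive map. -/
def tensorLiftAdd {C : Type*} [AddCommGroup C]
    (h : N.carrier →+ (P.carrier →+ C)) (hb : ∀ r n p, h (r • n) p = h n (P.left r p)) :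
    (N.tensor P).carrier →+ C :=
  let φ : N.carrier ⊗[X.R] P.LeftMod →+ C :=
    TensorProduct.liftAddHom (show N.carrier →+ P.LeftMod →+ C from h) hb
  { toFun := fun z => φ z
    map_zero' := map_zero φ
    map_add' := fun a b => map_add φ a b }

/-- The linear map out of `N ⊗ P` given by a balanced biadditive map. -/
def tensorLift {C : Type*} [AddCommGroup C] [Module X.R C]
    (h : N.carrier →+ (P.carrier →ₗ[X.R] C)) (hb : ∀ r n p, h (r • n) p = h n (P.left r p)) :
    (N.tensor P).carrier →ₗ[X.R] C :=
  { tensorLiftAdd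
      { toFun := fun n => (h n).toAddMonoidHom
        map_zero' := by rw [map_zero]; rfl
        map_add' := fun a b => by rw [map_add]; rfl } hb with
    map_smul' := fun r z => by
      change tensorLiftAdd _ hb (r • z) = r • tensorLiftAdd _ hb z
      induction z using tensor_induction with
      | tm n p => exact (h n).map_smul r p
      | add a b ha hb => rw [smul_add, map_add, ha, hb, map_add, smul_add] }

theorem tensor_hom_ext {C : Type*} [AddCommGroup C] [Module X.R C]
    {f g : (N.tensor P).carrier →ₗ[X.R] C} (h : ∀ n p, f (tm n p) = g (tm n p)) : f = g := by
  ext z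
  induction z using tensor_induction with
  | tm n p => exact h n p
  | add a b ha hb => rw [map_add, map_add, ha, hb]

theorem tensor_deg_le {k : ℤ} {S : AddSubgroup (N.tensor P).carrier}
    (h : ∀ i j, i + j = k → ∀ n ∈ N.deg i, ∀ p ∈ P.deg j, tm n p ∈ S) :
    (N.tensor P).deg k ≤ S := by
  refine (AddSubgroup.closure_le (G := (N.tensor P).carrier) (K := S)).2 ?_
  rintro _ ⟨i, j, n, p, hij, hn, hp, rfl⟩
  exact h i j hij n hn p hp

theorem tm_mem_deg {i j k : ℤ} (hk : i + j = k) {n : N.carrier} (hn : n ∈ N.deg i) {p : P.carrier}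
    (hp : p ∈ P.deg j) : tm n p ∈ (N.tensor P).deg k :=
  AddSubgroup.subset_closure ⟨i, j, n, p, hk, hn, hp, rfl⟩

theorem tm_mem_locSub {x y z : W} (h : y * z = x) {n : N.carrier} (hn : n ∈ N.locSub y)
    {p : P.carrier} (hp : p ∈ P.locSub z) : tm n p ∈ (N.tensor P).locSub x :=
  Submodule.subset_span ⟨y, z, n, p, h, hn, hp, rfl⟩

/-- A property of elements of `N ⊗ P` that is inherited by `r`-th roots (`r ≠ 0`), sums and
multiples holds for the elements of `(N ⊗ P)_Q^x` if it holds for the obvious ones. -/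
theorem tensor_locSub_le {x : W} {S : Submodule X.R (N.tensor P).carrier}
    (hS : ∀ (r : X.R) z, r ≠ 0 → r • z ∈ S → z ∈ S)
    (h : ∀ y z, y * z = x → ∀ n ∈ N.locSub y, ∀ p ∈ P.locSub z, tm n p ∈ S) :
    (N.tensor P).locSub x ≤ S := by
  intro c hc
  obtain ⟨r, hr, h'⟩ := exists_smul_mem_of_one_tmul_mem_span S (c := c) (by
    refine (Submodule.span_mono ?_ : (N.tensor P).loc x ≤ _) hc
    rintro _ ⟨y, z, n, p, hyz, hn, hp, rfl⟩
    exact ⟨tm n p, h y z hyz n hn p hp, rfl⟩)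
  exact hS r c hr h'

/-- Conclusions about localizations need only be checked on the elements `n ⊗ p`. -/
theorem tensor_map_loc {f : (N.tensor P).carrier →ₗ[X.R] L.carrier} {x x' : W}
    (h : ∀ y z, y * z = x → ∀ n ∈ N.locSub y, ∀ p ∈ P.locSub z, f (tm n p) ∈ L.locSub x') :
    ∀ c ∈ (N.tensor P).locSub x, f c ∈ L.locSub x' :=
  tensor_locSub_le (S := (L.locSub x').comap f)
    (fun r z hr hz => by
      rw [Submodule.mem_comap, map_smul] at hz
      exact mem_locSub_of_smul hr hz) h

theorem LocLeft.tensor (hN : N.LocLeft) (hP : P.LocLeft) : (N.tensor P).LocLeft := by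
  intro x c hc f
  let T := (N.tensor P).left f - X.actR x⁻¹ f • (LinearMap.id : Module.End X.R (N.tensor P).carrier)
  have hT : ∀ c, c ∈ LinearMap.ker ((TensorProduct.mk X.R X.Q _ 1).comp T) ↔
      (1 : X.Q) ⊗ₜ[X.R] ((N.tensor P).left f c) = (1 : X.Q) ⊗ₜ[X.R] (X.actR x⁻¹ f • c) := by
    intro c
    rw [LinearMap.mem_ker, LinearMap.comp_apply, TensorProduct.mk_apply]
    change (1 : X.Q) ⊗ₜ[X.R] ((N.tensor P).left f c - X.actR x⁻¹ f • c) = 0 ↔ _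
    rw [TensorProduct.tmul_sub, sub_eq_zero]
  refine (hT c).1 (tensor_locSub_le ?_ ?_ hc)
  · intro r z hr hz
    rw [LinearMap.mem_ker, map_smul, ← algebraMap_smul (A := X.Q)] at hz
    rw [LinearMap.mem_ker]
    exact eq_zero_of_algebraMap_smul hr hz
  · intro y z hyz n hn p hp
    rw [hT, left_tm]
    have h1 := hN y n hn f
    rw [← sub_eq_zero, ← TensorProduct.tmul_sub, one_tmul_eq_zero_iff] at h1
    obtain ⟨r, hr, h1⟩ := h1
    -- Move `r` across the tensor sign, where it acts through `z⁻¹`.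
    have h2 : tm (N.left f n - X.actR y⁻¹ f • n) (P.left r p) = 0 := by
      rw [← smul_tm_left, h1, zero_tm]
    have h3 : ∀ (n' : N.carrier) (g : X.R), (1 : X.Q) ⊗ₜ[X.R] tm n' (P.left g p) =
        (1 : X.Q) ⊗ₜ[X.R] (X.actR z⁻¹ g • tm n' p) := by
      intro n' g
      have := congrArg ((tmulHom N P n').baseChange X.Q) (hP z p hp g)
      rw [LinearMap.baseChange_tmul, LinearMap.baseChange_tmul, map_smul] at this
      exact this
    have h4 := h3 (N.left f n - X.actR y⁻¹ f • n) r
    rw [h2, TensorProduct.tmul_zero, ← algebraMap_smul_tmul] at h4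
    have h5 := eq_zero_of_algebraMap_smul
      ((map_ne_zero_iff _ (X.actR_injective z⁻¹)).2 (nonZeroDivisors.ne_zero hr)) h4.symm
    rw [sub_tm, TensorProduct.tmul_sub, sub_eq_zero, smul_tm_left, h3, actR_mul_apply,
      ← mul_inv_rev, hyz] at h5
    exact h5

/-- The map `f ⊗ g : N ⊗ P → N' ⊗ P'`. -/
def tensorMap {N' : PreObj.{u, v, w₃} X} {P' : PreObj.{u, v, w₄} X}
    (f : N.carrier →ₗ[X.R] N'.carrier) (g : P.carrier →ₗ[X.R] P'.carrier)
    (hg : ∀ r p, g (P.left r p) = P'.left r (g p)) :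
    (N.tensor P).carrier →ₗ[X.R] (N'.tensor P').carrier :=
  tensorLift
    { toFun := fun n => (tmulHom N' P' (f n)) ∘ₗ g
      map_zero' := by ext p; simp
      map_add' := fun a b => by ext p; simp }
    (fun r n p => by
      change tm (f (r • n)) (g p) = tm (f n) (g (P.left r p))
      rw [map_smul, smul_tm_left, hg])

@[simp] theorem tensorMap_tm {N' : PreObj.{u, v, w₃} X} {P' : PreObj.{u, v, w₄} X}
    (f : N.carrier →ₗ[X.R] N'.carrier) (g : P.carrier →ₗ[X.R] P'.carrier)
    (hg : ∀ r p, g (P.left r p) = P'.left r (g p)) (n : N.carrier) (p : P.carrier) :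
    tensorMap f g hg (tm n p) = tm (f n) (g p) := rfl

theorem IsHom.tensorMap {N' : PreObj.{u, v, w₃} X} {P' : PreObj.{u, v, w₄} X}
    {f : N.carrier →ₗ[X.R] N'.carrier} {g : P.carrier →ₗ[X.R] P'.carrier} {d e k : ℤ}
    (hf : IsHom N N' d f) (hg : IsHom P P' e g) (hk : d + e = k) :
    IsHom (N.tensor P) (N'.tensor P') k (tensorMap f g hg.map_left) where
  map_left r z := by
    refine tensor_induction z (fun n p => ?_) (fun a b ha hb => ?_)
    · rw [left_tm, tensorMap_tm, tensorMap_tm, left_tm, hf.map_left]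
    · simp only [map_add, ha, hb]
  map_deg i := by
    refine tensor_deg_le (S := ((N'.tensor P').deg (i + k)).comap
      (PreObj.tensorMap f g hg.map_left).toAddMonoidHom) fun a b hab n hn p hp => ?_
    exact tm_mem_deg (by omega) (hf.map_deg a n hn) (hg.map_deg b p hp)
  map_loc x := tensor_map_loc fun y z hyz n hn p hp =>
    tm_mem_locSub hyz (hf.map_loc y n hn) (hg.map_loc z p hp)

/-- The map `n ⊗ p ↦ (l ↦ n ⊗ (p ⊗ l))`. -/
def assocAux (N : PreObj.{u, v, w₁} X) (P : PreObj.{u, v, w₂} X) (L : PreObj.{u, v, w₃} X) :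
    (N.tensor P).carrier →+ (L.carrier →ₗ[X.R] (N.tensor (P.tensor L)).carrier) :=
  tensorLiftAdd
    { toFun := fun n =>
        { toFun := fun p => (tmulHom N (P.tensor L) n) ∘ₗ (tmulHom P L p)
          map_zero' := by ext l; simp
          map_add' := fun a b => by ext l; simp }
      map_zero' := by ext p l; simp
      map_add' := fun a b => by ext p l; simp }
    (fun r n p => by
      ext l
      change tm (r • n) (tm p l) = tm n (tm (P.left r p) l)
      rw [smul_tm_left, left_tm])

theorem assocAux_smul (r : X.R) (z : (N.tensor P).carrier) (l : L.carrier) :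
    assocAux N P L (r • z) l = assocAux N P L z (L.left r l) := by
  induction z using tensor_induction with
  | tm n p =>
    change tm n (tm (r • p) l) = tm n (tm p (L.left r l))
    rw [smul_tm_left]
  | add a b ha hb =>
    rw [smul_add, map_add, LinearMap.add_apply, ha, hb, map_add, LinearMap.add_apply]

/-- The associativity map `(N ⊗ P) ⊗ L → N ⊗ (P ⊗ L)`. -/
def assoc (N : PreObj.{u, v, w₁} X) (P : PreObj.{u, v, w₂} X) (L : PreObj.{u, v, w₃} X) :
    ((N.tensor P).tensor L).carrier →ₗ[X.R] (N.tensor (P.tensor L)).carrier :=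
  tensorLift (assocAux N P L) assocAux_smul

/-- The associativity map `N ⊗ (P ⊗ L) → (N ⊗ P) ⊗ L`. -/
def assocInv (N : PreObj.{u, v, w₁} X) (P : PreObj.{u, v, w₂} X) (L : PreObj.{u, v, w₃} X) :
    (N.tensor (P.tensor L)).carrier →ₗ[X.R] ((N.tensor P).tensor L).carrier :=
  tensorLift
    { toFun := fun n => tensorLift
        { toFun := fun p => tmulHom (N.tensor P) L (tm n p)
          map_zero' := by rw [tm_zero, map_zero]
          map_add' := fun a b => by rw [tm_add, map_add] }
        (fun r p l => by
          change tm (r • tm n p) l = tm (tm n p) (L.left r l)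
          rw [smul_tm_left])
      map_zero' := tensor_hom_ext fun p l => by
        change tm (tm (0 : N.carrier) p) l = 0
        simp
      map_add' := fun a b => tensor_hom_ext fun p l => by
        change tm (tm (a + b) p) l = tm (tm a p) l + tm (tm b p) l
        rw [add_tm, add_tm] }
    (fun r n z => by
      refine tensor_induction z (fun p l => ?_) (fun a b ha hb => ?_)
      · change tm (tm (r • n) p) l = tm (tm n (P.left r p)) l
        rw [smul_tm_left]
      · simp only [map_add, ha, hb])

theorem assocInv_assoc (z : ((N.tensor P).tensor L).carrier) :
    assocInv N P L (assoc N P L z) = z := by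
  induction z using tensor_induction with
  | add a b ha hb => rw [map_add, map_add, ha, hb]
  | tm y l =>
    induction y using tensor_induction with
    | add a b ha hb => rw [add_tm, map_add, map_add, ha, hb]
    | tm p l => rfl

theorem isHom_assocInv : IsHom _ _ 0 (assocInv N P L) where
  map_left r z := by
    induction z using tensor_induction with
    | add a b ha hb => simp only [map_add, ha, hb]
    | tm n y =>
      induction y using tensor_induction with
      | add a b ha hb => simp only [tm_add, map_add, ha, hb]
      | tm p l => rfl
  map_deg i := by
    refine tensor_deg_le (S := (((N.tensor P).tensor L).deg (i + 0)).comap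
      (assocInv N P L).toAddMonoidHom) fun a b hab n hn y hy => ?_
    revert y
    refine tensor_deg_le (S := (((N.tensor P).tensor L).deg (i + 0)).comap
      ((assocInv N P L).comp (tmulHom _ _ n)).toAddMonoidHom) fun c e hce p hp l hl => ?_
    exact tm_mem_deg (by omega : (a + c) + e = i + 0) (tm_mem_deg rfl hn hp) hl
  map_loc x := tensor_map_loc fun y z hyz n hn c hc => by
    refine tensor_map_loc (f := (assocInv N P L).comp (tmulHom _ _ n)) (x := z) ?_ c hc
    intro s t hst p hp l hl
    exact tm_mem_locSub (y := y * s) (z := t) (by rw [mul_assoc, hst, hyz])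
      (tm_mem_locSub rfl hn hp) hl

theorem isHom_assoc (hL : L.LocLeft) : IsHom _ _ 0 (assoc N P L) where
  map_left r z := by
    induction z using tensor_induction with
    | add a b ha hb => simp only [map_add, ha, hb]
    | tm y l =>
      induction y using tensor_induction with
      | add a b ha hb => simp only [add_tm, map_add, ha, hb]
      | tm p l => rfl
  map_deg i := by
    refine tensor_deg_le (S := ((N.tensor (P.tensor L)).deg (i + 0)).comap
      (assoc N P L).toAddMonoidHom) fun a b hab y hy l hl => ?_
    revert y
    refine tensor_deg_le (S := ((N.tensor (P.tensor L)).deg (i + 0)).comap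
      ((assoc N P L).toAddMonoidHom.comp ((LinearMap.applyₗ l).toAddMonoidHom.comp
        (tmulHom (N.tensor P) L)))) fun c e hce n hn p hp => ?_
    exact tm_mem_deg (by omega : c + (e + b) = i + 0) hn (tm_mem_deg rfl hp hl)
  map_loc x := tensor_map_loc fun y z hyz c hc l hl => by
    -- The elements `c` with `c ⊗ l` in the right place form a submodule, as `R` acts on `l`
    -- from the left through `z⁻¹`.
    have h3 : ∀ (c : (N.tensor P).carrier) (g : X.R),
        (1 : X.Q) ⊗ₜ[X.R] assoc N P L (tm (g • c) l) =
        (1 : X.Q) ⊗ₜ[X.R] (X.actR z⁻¹ g • assoc N P L (tm c l)) := by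
      intro c g
      have := congrArg (((assoc N P L).comp (tmulHom (N.tensor P) L c)).baseChange X.Q)
        (hL z l hl g)
      rw [LinearMap.baseChange_tmul, LinearMap.baseChange_tmul, map_smul] at this
      rw [smul_tm_left]
      exact this
    let S : Submodule X.R (N.tensor P).carrier :=
      { carrier := {c | assoc N P L (tm c l) ∈ (N.tensor (P.tensor L)).locSub x}
        zero_mem' := by simp
        add_mem' := fun {a b} ha hb => by
          change assoc N P L (tm (a + b) l) ∈ (N.tensor (P.tensor L)).locSub x
          rw [add_tm, map_add]
          exact add_mem ha hb
        smul_mem' := fun r c hc => by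
          change assoc N P L (tm (r • c) l) ∈ (N.tensor (P.tensor L)).locSub x
          rw [mem_locSub, h3, ← mem_locSub]
          exact Submodule.smul_mem _ _ hc }
    refine tensor_locSub_le (S := S) (x := y) (fun r c hr hc => ?_) ?_ hc
    · change assoc N P L (tm (r • c) l) ∈ (N.tensor (P.tensor L)).locSub x at hc
      rw [mem_locSub, h3, ← mem_locSub] at hc
      exact mem_locSub_of_smul ((map_ne_zero_iff _ (X.actR_injective _)).2 hr) hc
    · intro s t hst n hn p hp
      exact tm_mem_locSub (y := s) (z := t * z) (by rw [← mul_assoc, hst, hyz]) hn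
        (tm_mem_locSub rfl hp hl)

end Tensor

end PreObj

end CoxeterRealization

namespace CoxeterRealization

variable {K : Type u} {V : Type v} [CommRing K] [AddCommGroup V] [Module K V]
  {B W : Type*} [Group W] {M : CoxeterMatrix B} {cs : CoxeterSystem M W}

namespace PreObj

variable {X : CoxeterRealization K V cs} [IsDomain K] [Module.Free K V]

/-! ### The unit object -/

/-- The underlying right module of `R_x` is `R`. -/
def unStd (x : W) : (X.stdObj x).carrier ≃ₗ[X.R] X.R := LinearEquiv.refl X.R X.R

theorem unStd_left (x : W) (f : X.R) (n : (X.stdObj x).carrier) :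
    unStd x ((X.stdObj x).left f n) = X.actR x⁻¹ f * unStd x n := rfl

theorem unStd_smul (x : W) (f : X.R) (n : (X.stdObj x).carrier) :
    unStd x (f • n) = f * unStd x n := rfl

theorem stdObj_left (x : W) (f : X.R) (n : (X.stdObj x).carrier) :
    (X.stdObj x).left f n = X.actR x⁻¹ f • n := rfl

theorem stdObj_torsionFree (x : W) : (X.stdObj x).TorsionFree := fun r n h => by
  have := congrArg (unStd x) h
  rwa [unStd_smul, map_zero, mul_eq_zero, LinearEquiv.map_eq_zero_iff] at this

theorem stdObj_loc_self (x : W) : (X.stdObj x).loc x = ⊤ := iSup_pos rfl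

theorem stdObj_loc_of_ne {x y : W} (h : y ≠ x) : (X.stdObj x).loc y = ⊥ := iSup_neg h

/-- `R_x` is concentrated in `x`. -/
theorem stdObj_mem_locSub {x y : W} {f : (X.stdObj x).carrier} :
    f ∈ (X.stdObj x).locSub y ↔ y = x ∨ f = 0 := by
  constructor
  · intro h
    by_cases hy : y = x
    · exact Or.inl hy
    · right
      rw [mem_locSub, stdObj_loc_of_ne hy, Submodule.mem_bot] at h
      exact (stdObj_torsionFree x).one_tmul_injective (h.trans (TensorProduct.tmul_zero _ _).symm)
  · rintro (rfl | rfl)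
    · rw [mem_locSub, stdObj_loc_self]
      exact Submodule.mem_top
    · exact zero_mem _

theorem stdObj_locLeft (x : W) : (X.stdObj x).LocLeft := by
  intro y n hn f
  rcases stdObj_mem_locSub.1 hn with rfl | rfl
  · rfl
  · simp

/-- The element `1` of `R_x`. -/
def stdOne (X : CoxeterRealization K V cs) (x : W) : (X.stdObj x).carrier := (unStd x).symm 1

@[simp] theorem unStd_stdOne (x : W) : unStd x (stdOne X x) = 1 := rfl

theorem stdOne_mem_deg (x : W) : stdOne X x ∈ (X.stdObj x).deg 0 := X.one_mem_degR

theorem stdOne_mem_locSub (x : W) : stdOne X x ∈ (X.stdObj x).locSub x :=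
  stdObj_mem_locSub.2 (Or.inl rfl)

theorem unStd_smul_stdOne {x : W} (n : (X.stdObj x).carrier) : unStd x n • stdOne X x = n :=
  (unStd x).injective (by rw [unStd_smul, unStd_stdOne, mul_one])

variable {N : PreObj.{u, v, w₁} X} {P : PreObj.{u, v, w₂} X} {L : PreObj.{u, v, w₃} X}

/-- The map `R_e ⊗ N → N`, `r ⊗ n ↦ r n`. -/
def leftUnit (N : PreObj.{u, v, w₁} X) : ((X.stdObj 1).tensor N).carrier →ₗ[X.R] N.carrier :=
  tensorLift
    { toFun := fun r => N.left (unStd 1 r)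
      map_zero' := by rw [map_zero, map_zero]
      map_add' := fun a b => by rw [map_add, map_add] }
    (fun r n p => by
      change N.left (unStd 1 (r • n)) p = N.left (unStd 1 n) (N.left r p)
      rw [unStd_smul, mul_comm, map_mul]; rfl)

@[simp] theorem leftUnit_tm (r : (X.stdObj 1).carrier) (n : N.carrier) :
    leftUnit N (tm r n) = N.left (unStd 1 r) n := rfl

theorem isHom_leftUnit (hN : N.LocLeft) (hdeg : ∀ i j r n, r ∈ X.degR i → n ∈ N.deg j →
    N.left r n ∈ N.deg (i + j)) : IsHom _ N 0 (leftUnit N) where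
  map_left f z := by
    induction z using tensor_induction with
    | tm r n =>
      rw [left_tm, leftUnit_tm, leftUnit_tm, unStd_left, inv_one, actR_one_apply, map_mul]; rfl
    | add a b ha hb => simp only [map_add, ha, hb]
  map_deg i := by
    refine tensor_deg_le (S := (N.deg (i + 0)).comap
      (leftUnit N).toAddMonoidHom) fun a b hab r hr n hn => ?_
    have := hdeg a b (unStd 1 r) n hr hn
    rwa [hab, ← add_zero i] at this
  map_loc x := tensor_map_loc fun y z hyz r hr n hn => by
    rcases stdObj_mem_locSub.1 hr with rfl | rfl
    · rw [one_mul] at hyz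
      subst hyz
      exact hN.left_mem hn _
    · rw [zero_tm, map_zero]; exact zero_mem _

/-- The map `N → R_e ⊗ N`, `n ↦ 1 ⊗ n`. -/
theorem isHom_tm_one_left : IsHom N _ 0 (tmulHom (X.stdObj 1) N (stdOne X 1)) where
  map_left f n := by
    change tm (stdOne X 1) (N.left f n) = tm ((X.stdObj 1).left f (stdOne X 1)) n
    rw [← smul_tm_left, stdObj_left, inv_one, actR_one_apply]
  map_deg i n hn := tm_mem_deg (by ring) (stdOne_mem_deg 1) hn
  map_loc x n hn := tm_mem_locSub (one_mul x) (stdOne_mem_locSub 1) hn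

/-- The map `N ⊗ R_e → N`, `n ⊗ r ↦ n r`. -/
def rightUnit (N : PreObj.{u, v, w₁} X) : (N.tensor (X.stdObj 1)).carrier →ₗ[X.R] N.carrier :=
  tensorLift
    { toFun := fun n => LinearMap.toSpanSingleton X.R N.carrier n ∘ₗ (unStd (X := X) 1).toLinearMap
      map_zero' := by ext; simp
      map_add' := fun a b => by ext; exact smul_add _ a b }
    (fun r n p => by
      change unStd 1 p • (r • n) = unStd 1 ((X.stdObj 1).left r p) • n
      rw [unStd_left, inv_one, actR_one_apply, smul_smul, mul_comm])

@[simp] theorem rightUnit_tm (r : (X.stdObj 1).carrier) (n : N.carrier) :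
    rightUnit N (tm n r) = unStd 1 r • n := rfl

theorem isHom_rightUnit (hdeg : ∀ i j r n, r ∈ X.degR i → n ∈ N.deg j →
    r • n ∈ N.deg (i + j)) : IsHom _ N 0 (rightUnit N) where
  map_left f z := by
    induction z using tensor_induction with
    | tm n r => exact ((N.left f).map_smul (unStd 1 r) n).symm
    | add a b ha hb => simp only [map_add, ha, hb]
  map_deg i := by
    refine tensor_deg_le (S := (N.deg (i + 0)).comap
      (rightUnit N).toAddMonoidHom) fun a b hab n hn r hr => ?_
    have := hdeg b a (unStd 1 r) n hr hn
    rwa [add_comm b a, hab, ← add_zero i] at this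
  map_loc x := tensor_map_loc fun y z hyz n hn r hr => by
    rcases stdObj_mem_locSub.1 hr with rfl | rfl
    · rw [mul_one] at hyz
      subst hyz
      exact Submodule.smul_mem _ _ hn
    · rw [tm_zero, map_zero]; exact zero_mem _

/-- The map `N → N ⊗ R_e`, `n ↦ n ⊗ 1`. -/
def tmOneRight (N : PreObj.{u, v, w₁} X) : N.carrier →ₗ[X.R] (N.tensor (X.stdObj 1)).carrier where
  toFun n := tm n (stdOne X 1)
  map_add' a b := add_tm a b _
  map_smul' r n := by
    rw [smul_tm_left, RingHom.id_apply, smul_tm, stdObj_left, inv_one, actR_one_apply]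

theorem isHom_tmOneRight : IsHom N _ 0 (tmOneRight N) where
  map_left f n := rfl
  map_deg i n hn := tm_mem_deg (by ring) hn (stdOne_mem_deg 1)
  map_loc x n hn := tm_mem_locSub (mul_one x) hn (stdOne_mem_locSub 1)

/-! ### Graded bimodules -/

/-- The degrees of `N` are compatible with both actions. -/
structure IsGraded (N : PreObj.{u, v, w₁} X) : Prop where
  right_deg : ∀ i j r n, r ∈ X.degR i → n ∈ N.deg j → r • n ∈ N.deg (i + j)
  left_deg : ∀ i j r n, r ∈ X.degR i → n ∈ N.deg j → N.left r n ∈ N.deg (i + j)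

theorem IsObj.isGraded (hN : N.IsObj) : N.IsGraded := ⟨hN.right_deg, hN.left_deg⟩

theorem stdObj_isGraded (x : W) : (X.stdObj x).IsGraded where
  right_deg _ _ _ _ hr hn := X.mul_mem_degR hr hn
  left_deg _ _ _ _ hr hn := X.mul_mem_degR (X.actR_mem_degR _ hr) hn

theorem IsGraded.shift (hN : N.IsGraded) (k : ℤ) : (N.shift k).IsGraded where
  right_deg i j r n hr hn := by
    have := hN.right_deg i _ r n hr hn
    rwa [← add_assoc] at this
  left_deg i j r n hr hn := by
    have := hN.left_deg i _ r n hr hn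
    rwa [← add_assoc] at this

/-- The element `f ⊗ g` of the object `R ⊗_{R^H} R`. -/
def itm (X : CoxeterRealization K V cs) (H : Subgroup W) (f g : X.R) : (X.invObj H).carrier :=
  X.invTmul H f g

theorem itm_add (H : Subgroup W) (f g g' : X.R) : itm X H f (g + g') = itm X H f g + itm X H f g' :=
  TensorProduct.tmul_add (R := X.invariants H) f g g'

theorem add_itm (H : Subgroup W) (f f' g : X.R) : itm X H (f + f') g = itm X H f g + itm X H f' g :=
  TensorProduct.add_tmul (R := X.invariants H) f f' g

theorem itm_sub (H : Subgroup W) (f g g' : X.R) : itm X H f (g - g') = itm X H f g - itm X H f g' :=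
  TensorProduct.tmul_sub (R := X.invariants H) f g g'

theorem sub_itm (H : Subgroup W) (f f' g : X.R) : itm X H (f - f') g = itm X H f g - itm X H f' g :=
  TensorProduct.sub_tmul (R := X.invariants H) f f' g

theorem mul_itm {H : Subgroup W} {c : X.R} (hc : c ∈ X.invariants H) (f g : X.R) :
    itm X H (c * f) g = itm X H f (c * g) :=
  TensorProduct.smul_tmul (R := X.invariants H) (⟨c, hc⟩ : X.invariants H) f g

@[elab_as_elim]
theorem inv_induction {H : Subgroup W} {motive : (X.invObj H).carrier → Prop}
    (z : (X.invObj H).carrier) (itm : ∀ f g, motive (itm X H f g))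
    (add : ∀ a b, motive a → motive b → motive (a + b)) : motive z := by
  refine TensorProduct.induction_on (R := X.invariants H) (M := X.R) (N := X.R)
    (motive := motive) z ?_ (fun n p => itm n p) (fun a b => add a b)
  have := itm 0 0
  have h0 : PreObj.itm X H 0 0 = 0 := TensorProduct.zero_tmul (R := X.invariants H) X.R (0 : X.R)
  rwa [h0] at this

theorem left_itm {H : Subgroup W} (r f g : X.R) :
    (X.invObj H).left r (itm X H f g) = itm X H (r * f) g := by
  change (TensorProduct.tmul (X.invariants H) r (1 : X.R) : X.R ⊗[X.invariants H] X.R) *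
    (TensorProduct.tmul (X.invariants H) f g : X.R ⊗[X.invariants H] X.R) = _
  exact (Algebra.TensorProduct.tmul_mul_tmul _ _ _ _).trans (by rw [one_mul]; rfl)

theorem smul_itm {H : Subgroup W} (r f g : X.R) : r • itm X H f g = itm X H f (r * g) := by
  change r • X.invTmul H f g = _
  rw [Algebra.smul_def]
  change (TensorProduct.tmul (X.invariants H) (1 : X.R) r : X.R ⊗[X.invariants H] X.R) *
    (TensorProduct.tmul (X.invariants H) f g : X.R ⊗[X.invariants H] X.R) = _
  exact (Algebra.TensorProduct.tmul_mul_tmul _ _ _ _).trans (by rw [one_mul]; rfl)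

theorem invObj_deg_le {H : Subgroup W} {k : ℤ} {S : AddSubgroup (X.invObj H).carrier}
    (h : ∀ i j, i + j = k → ∀ f ∈ X.degR i, ∀ g ∈ X.degR j, itm X H f g ∈ S) :
    (X.invObj H).deg k ≤ S := by
  refine (AddSubgroup.closure_le (G := (X.invObj H).carrier) (K := S)).2 ?_
  rintro _ ⟨i, j, f, g, hij, hf, hg, rfl⟩
  exact h i j hij f hf g hg

theorem itm_mem_deg {H : Subgroup W} {i j k : ℤ} (hk : i + j = k) {f g : X.R}
    (hf : f ∈ X.degR i) (hg : g ∈ X.degR j) : itm X H f g ∈ (X.invObj H).deg k :=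
  AddSubgroup.subset_closure ⟨i, j, f, g, hk, hf, hg, rfl⟩

theorem invObj_isGraded (H : Subgroup W) : (X.invObj H).IsGraded where
  right_deg i j r n hr hn := by
    revert n
    refine invObj_deg_le (S := ((X.invObj H).deg (i + j)).comap
      (LinearMap.lsmul X.R (X.invObj H).carrier r).toAddMonoidHom) fun a b hab f hf g hg => ?_
    change r • itm X H f g ∈ (X.invObj H).deg (i + j)
    rw [smul_itm]
    exact itm_mem_deg (by omega) hf (X.mul_mem_degR hr hg)
  left_deg i j r n hr hn := by
    revert n
    refine invObj_deg_le (S := ((X.invObj H).deg (i + j)).comap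
      ((X.invObj H).left r).toAddMonoidHom) fun a b hab f hf g hg => ?_
    change (X.invObj H).left r (itm X H f g) ∈ (X.invObj H).deg (i + j)
    rw [left_itm]
    exact itm_mem_deg (by omega) (X.mul_mem_degR hr hf) hg

theorem IsGraded.dsum (hN : N.IsGraded) (hP : P.IsGraded) : (N.dsum P).IsGraded where
  right_deg i j r _ hr hn := ⟨hN.right_deg i j r _ hr hn.1, hP.right_deg i j r _ hr hn.2⟩
  left_deg i j r _ hr hn := ⟨hN.left_deg i j r _ hr hn.1, hP.left_deg i j r _ hr hn.2⟩

theorem IsGraded.tensor (hN : N.IsGraded) (hP : P.IsGraded) : (N.tensor P).IsGraded where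
  right_deg i j r n hr hn := by
    revert n
    refine tensor_deg_le (S := ((N.tensor P).deg (i + j)).comap
      (LinearMap.lsmul X.R (N.tensor P).carrier r).toAddMonoidHom) fun a b hab n hn p hp => ?_
    change r • tm n p ∈ (N.tensor P).deg (i + j)
    rw [smul_tm]
    exact tm_mem_deg (by omega) hn (hP.right_deg _ _ r p hr hp)
  left_deg i j r n hr hn := by
    revert n
    refine tensor_deg_le (S := ((N.tensor P).deg (i + j)).comap
      ((N.tensor P).left r).toAddMonoidHom) fun a b hab n hn p hp => ?_
    change (N.tensor P).left r (tm n p) ∈ (N.tensor P).deg (i + j)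
    rw [left_tm]
    exact tm_mem_deg (by omega) (hN.left_deg _ _ r n hr hn) hp

theorem invObj_loc_of_mem {H : Subgroup W} {x : W} (hx : x ∈ H) :
    (X.invObj H).loc x = X.eigenspace (X.invObj H).left x := iSup_pos hx

theorem invObj_loc_of_not_mem {H : Subgroup W} {x : W} (hx : x ∉ H) :
    (X.invObj H).loc x = ⊥ := iSup_neg hx

theorem mem_invObj_locSub {H : Subgroup W} {x : W} (hx : x ∈ H) {n : (X.invObj H).carrier} :
    n ∈ (X.invObj H).locSub x ↔ ∀ f, (1 : X.Q) ⊗ₜ[X.R] ((X.invObj H).left f n) =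
      (1 : X.Q) ⊗ₜ[X.R] (X.actR x⁻¹ f • n) := by
  rw [mem_locSub, invObj_loc_of_mem hx]
  refine forall_congr' fun f => ?_
  rw [LinearMap.baseChange_tmul, algebraMap_smul_tmul]

theorem invObj_locLeft (H : Subgroup W) : (X.invObj H).LocLeft := by
  intro x n hn f
  by_cases hx : x ∈ H
  · exact (mem_invObj_locSub hx).1 hn f
  · rw [mem_locSub, invObj_loc_of_not_mem hx, Submodule.mem_bot] at hn
    have := congrArg (((X.invObj H).left f).baseChange X.Q) hn
    rw [LinearMap.baseChange_tmul, map_zero] at this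
    rw [this, ← algebraMap_smul_tmul, hn, smul_zero]

/-! ### Retracts of sums, and induction over Soergel bimodules -/

/-- `N` is, up to a shift, a direct summand of `P ⊕ L`. -/
def IsRetractOfPair (N : PreObj.{u, v, w₁} X) (P : PreObj.{u, v, w₂} X)
    (L : PreObj.{u, v, w₃} X) : Prop :=
  ∃ (d : ℤ) (p₁ : N.carrier →ₗ[X.R] P.carrier) (p₂ : N.carrier →ₗ[X.R] L.carrier)
    (j₁ : P.carrier →ₗ[X.R] N.carrier) (j₂ : L.carrier →ₗ[X.R] N.carrier),
    IsHom N P d p₁ ∧ IsHom N L d p₂ ∧ IsHom P N (-d) j₁ ∧ IsHom L N (-d) j₂ ∧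
    ∀ n, j₁ (p₁ n) + j₂ (p₂ n) = n

theorem isRetractOfPair_of_retract {i : N.carrier →ₗ[X.R] P.carrier}
    {p : P.carrier →ₗ[X.R] N.carrier} {d : ℤ} (hi : IsHom N P d i) (hp : IsHom P N (-d) p)
    (h : ∀ n, p (i n) = n) : IsRetractOfPair N P P :=
  ⟨d, i, i, p, 0, hi, hi, hp, IsHom.zero, fun n => by simp [h]⟩

theorem isHom_shift (k : ℤ) :
    IsHom (N.shift k) N k (LinearMap.id : N.carrier →ₗ[X.R] N.carrier) where
  map_left _ _ := rfl
  map_deg _ _ hn := hn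
  map_loc _ _ hn := hn

theorem isHom_unshift (k : ℤ) :
    IsHom N (N.shift k) (-k) (LinearMap.id : N.carrier →ₗ[X.R] N.carrier) where
  map_left _ _ := rfl
  map_deg i n hn := by
    change n ∈ N.deg (i + -k + k)
    simpa using hn
  map_loc _ _ hn := hn

theorem isRetractOfPair_shift (N : PreObj.{u, v, w₁} X) (k : ℤ) :
    IsRetractOfPair (N.shift k) N N :=
  isRetractOfPair_of_retract (isHom_shift k) (isHom_unshift k) fun _ => rfl

/-- The first projection of a direct sum. -/
def dfst (N : PreObj.{u, v, w₁} X) (P : PreObj.{u, v, w₂} X) :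
    (N.dsum P).carrier →ₗ[X.R] N.carrier := LinearMap.fst X.R N.carrier P.carrier

/-- The second projection of a direct sum. -/
def dsnd (N : PreObj.{u, v, w₁} X) (P : PreObj.{u, v, w₂} X) :
    (N.dsum P).carrier →ₗ[X.R] P.carrier := LinearMap.snd X.R N.carrier P.carrier

/-- The first inclusion into a direct sum. -/
def dinl (N : PreObj.{u, v, w₁} X) (P : PreObj.{u, v, w₂} X) :
    N.carrier →ₗ[X.R] (N.dsum P).carrier := LinearMap.inl X.R N.carrier P.carrier

/-- The second inclusion into a direct sum. -/
def dinr (N : PreObj.{u, v, w₁} X) (P : PreObj.{u, v, w₂} X) :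
    P.carrier →ₗ[X.R] (N.dsum P).carrier := LinearMap.inr X.R N.carrier P.carrier

@[simp] theorem dfst_dinr (p : P.carrier) : dfst N P (dinr N P p) = 0 := rfl
theorem dinl_dfst_add (n : (N.dsum P).carrier) :
    dinl N P (dfst N P n) + dinr N P (dsnd N P n) = n :=
  Prod.ext (add_zero (n : N.carrier × P.carrier).1) (zero_add (n : N.carrier × P.carrier).2)

theorem dsum_loc (x : W) : (N.dsum P).loc x = (N.loc x).map ((dinl N P).baseChange X.Q) ⊔
    (P.loc x).map ((dinr N P).baseChange X.Q) := rfl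

theorem isHom_dfst : IsHom (N.dsum P) N 0 (dfst N P) where
  map_left _ _ := rfl
  map_deg i n hn := by
    rw [add_zero]; exact hn.1
  map_loc x n hn := by
    rw [mem_locSub, dsum_loc] at hn
    obtain ⟨_, ⟨a, ha, rfl⟩, _, ⟨b, hb, rfl⟩, h⟩ := Submodule.mem_sup.1 hn
    have := congrArg ((dfst N P).baseChange X.Q) h
    rw [map_add, ← LinearMap.comp_apply, ← LinearMap.comp_apply, ← LinearMap.baseChange_comp,
      ← LinearMap.baseChange_comp, show dfst N P ∘ₗ dinl N P = LinearMap.id from rfl,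
      show dfst N P ∘ₗ dinr N P = 0 from rfl, LinearMap.baseChange_id, LinearMap.baseChange_zero,
      LinearMap.zero_apply, add_zero, LinearMap.id_apply, LinearMap.baseChange_tmul] at this
    rw [mem_locSub, ← this]
    exact ha

theorem isHom_dsnd : IsHom (N.dsum P) P 0 (dsnd N P) where
  map_left _ _ := rfl
  map_deg i n hn := by
    rw [add_zero]; exact hn.2
  map_loc x n hn := by
    rw [mem_locSub, dsum_loc] at hn
    obtain ⟨_, ⟨a, ha, rfl⟩, _, ⟨b, hb, rfl⟩, h⟩ := Submodule.mem_sup.1 hn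
    have := congrArg ((dsnd N P).baseChange X.Q) h
    rw [map_add, ← LinearMap.comp_apply, ← LinearMap.comp_apply, ← LinearMap.baseChange_comp,
      ← LinearMap.baseChange_comp, show dsnd N P ∘ₗ dinl N P = 0 from rfl,
      show dsnd N P ∘ₗ dinr N P = LinearMap.id from rfl, LinearMap.baseChange_id,
      LinearMap.baseChange_zero, LinearMap.zero_apply, zero_add, LinearMap.id_apply,
      LinearMap.baseChange_tmul] at this
    rw [mem_locSub, ← this]
    exact hb

theorem isHom_dinl : IsHom N (N.dsum P) 0 (dinl N P) where
  map_left r n := Prod.ext rfl (map_zero (P.left r)).symm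
  map_deg i n hn := by
    rw [add_zero]; exact ⟨hn, zero_mem _⟩
  map_loc x n hn := by
    rw [mem_locSub, dsum_loc]
    exact Submodule.mem_sup_left ⟨_, hn, rfl⟩

theorem isHom_dinr : IsHom P (N.dsum P) 0 (dinr N P) where
  map_left r n := Prod.ext (map_zero (N.left r)).symm rfl
  map_deg i n hn := by
    rw [add_zero]; exact ⟨zero_mem _, hn⟩
  map_loc x n hn := by
    rw [mem_locSub, dsum_loc]
    exact Submodule.mem_sup_right ⟨_, hn, rfl⟩

theorem isRetractOfPair_dsum (N : PreObj.{u, v, w₁} X) (P : PreObj.{u, v, w₂} X) :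
    IsRetractOfPair (N.dsum P) N P :=
  ⟨0, dfst N P, dsnd N P, dinl N P, dinr N P, isHom_dfst, isHom_dsnd, by simpa using isHom_dinl,
    by simpa using isHom_dinr, dinl_dfst_add⟩

theorem IsRetractOfPair.tensor (h : IsRetractOfPair N P L) (N' : PreObj.{u, v, w₄} X) :
    IsRetractOfPair (N.tensor N') (P.tensor N') (L.tensor N') := by
  obtain ⟨d, p₁, p₂, j₁, j₂, hp₁, hp₂, hj₁, hj₂, h⟩ := h
  refine ⟨d, _, _, _, _, hp₁.tensorMap IsHom.id (add_zero d), hp₂.tensorMap IsHom.id (add_zero d),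
    hj₁.tensorMap IsHom.id (add_zero _), hj₂.tensorMap IsHom.id (add_zero _), fun z => ?_⟩
  induction z using tensor_induction with
  | tm n n' =>
    change tm (j₁ (p₁ n)) n' + tm (j₂ (p₂ n)) n' = _
    rw [← add_tm, h]
  | add a b ha hb =>
    simp only [map_add]
    rw [add_add_add_comm, ha, hb]

theorem IsRetractOfPair.locLeft (h : IsRetractOfPair N P L) (hP : P.LocLeft) (hL : L.LocLeft) :
    N.LocLeft := by
  obtain ⟨d, p₁, p₂, j₁, j₂, hp₁, hp₂, hj₁, hj₂, h⟩ := h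
  intro x n hn f
  have e₁ := congrArg (j₁.baseChange X.Q) (hP x _ (hp₁.map_loc x n hn) f)
  have e₂ := congrArg (j₂.baseChange X.Q) (hL x _ (hp₂.map_loc x n hn) f)
  simp only [LinearMap.baseChange_tmul, map_smul, ← hp₁.map_left, ← hp₂.map_left] at e₁ e₂
  rw [← h (N.left f n), TensorProduct.tmul_add, e₁, e₂, ← TensorProduct.tmul_add, ← smul_add, h]

theorem IsRetractOfPair.torsionFree (h : IsRetractOfPair N P L) (hP : P.TorsionFree)
    (hL : L.TorsionFree) : N.TorsionFree := by
  obtain ⟨d, p₁, p₂, j₁, j₂, hp₁, hp₂, hj₁, hj₂, h⟩ := h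
  intro r n hn
  by_cases hr : r = 0
  · exact Or.inl hr
  · right
    have e₁ := (hP r (p₁ n) (by rw [← map_smul, hn, map_zero])).resolve_left hr
    have e₂ := (hL r (p₂ n) (by rw [← map_smul, hn, map_zero])).resolve_left hr
    rw [← h n, e₁, e₂]
    simp

end PreObj

open PreObj

variable (X : CoxeterRealization K V cs) [IsDomain K] [Module.Free K V]

theorem simpleObj_isGraded (s : B) : (X.simpleObj s).IsGraded := (invObj_isGraded _).shift 1

theorem simpleObj_locLeft (s : B) : (X.simpleObj s).LocLeft := invObj_locLeft _

variable {X}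

/-- The induction principle for Soergel bimodules: a property of objects that is inherited by direct
summands of sums of shifts, holds for `R_e`, and passes from `N` to the `B_s ⊗ N`, holds for all
Soergel bimodules. -/
theorem IsSoergel.induction_of_tensor {N : PreObj.{u, v, max u v} X} (hN : X.IsSoergel N)
    (p : PreObj.{u, v, max u v} X → Prop) (hgr : ∀ N, p N → N.IsGraded)
    (hloc : ∀ N, p N → N.LocLeft)
    (retract : ∀ N P L, N.IsGraded → IsRetractOfPair N P L → p P → p L → p N)
    (unit : p (X.stdObj 1)) (simple : ∀ s N, p N → p ((X.simpleObj s).tensor N)) : p N := by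
  have hobj : ∀ N, X.IsSoergel N → N.IsGraded := by
    intro N hN
    induction hN with
    | unit => exact stdObj_isGraded 1
    | simple s => exact X.simpleObj_isGraded s
    | dsum _ _ h₁ h₂ => exact h₁.dsum h₂
    | shift k _ h => exact h.shift k
    | tensor _ _ h₁ h₂ => exact h₁.tensor h₂
    | summand _ hP _ _ _ _ => exact hP.isGraded
  have key : ∀ N, X.IsSoergel N → ∀ P, p P → p (N.tensor P) := by
    intro N hN
    induction hN with
    | unit =>
      intro P hP
      refine retract _ P P ((stdObj_isGraded 1).tensor (hgr P hP)) ?_ hP hP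
      refine isRetractOfPair_of_retract (d := 0)
        (isHom_leftUnit (hloc P hP) (hgr P hP).left_deg) isHom_tm_one_left fun z => ?_
      induction z using tensor_induction with
      | tm r n =>
        change tm (stdOne X 1) (P.left (unStd 1 r) n) = _
        rw [← smul_tm_left, unStd_smul_stdOne]
      | add a b ha hb => simp only [map_add, ha, hb]
    | simple s => exact fun P hP => simple s P hP
    | @dsum N₁ N₂ h₁ h₂ ih₁ ih₂ =>
      intro P hP
      exact retract _ _ _ (((hobj _ h₁).dsum (hobj _ h₂)).tensor (hgr P hP))
        ((isRetractOfPair_dsum N₁ N₂).tensor P) (ih₁ P hP) (ih₂ P hP)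
    | @shift N k h ih =>
      intro P hP
      exact retract _ _ _ (((hobj _ h).shift k).tensor (hgr P hP))
        ((isRetractOfPair_shift N k).tensor P) (ih P hP) (ih P hP)
    | @tensor N₁ N₂ h₁ h₂ ih₁ ih₂ =>
      intro P hP
      have h3 := ih₁ _ (ih₂ P hP)
      exact retract _ _ _ (((hobj _ h₁).tensor (hobj _ h₂)).tensor (hgr P hP))
        (isRetractOfPair_of_retract (d := 0) (isHom_assoc (hloc P hP)) isHom_assocInv
          assocInv_assoc) h3 h3
    | @summand N L h hL i q hq ih =>
      intro P hP
      exact retract _ _ _ (hL.isGraded.tensor (hgr P hP))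
        ((isRetractOfPair_of_retract (d := 0) i.isHom q.isHom hq).tensor P) (ih P hP) (ih P hP)
  have h1 := key N hN _ unit
  refine retract N _ _ (hobj N hN) (isRetractOfPair_of_retract (d := 0) isHom_tmOneRight
    (isHom_rightUnit (hobj N hN).right_deg) fun n => ?_) h1 h1
  change (1 : X.R) • n = n
  exact one_smul _ n

end CoxeterRealization

namespace CoxeterRealization

variable {K : Type u} {V : Type v} [CommRing K] [AddCommGroup V] [Module K V]
  {B W : Type*} [Group W] {M : CoxeterMatrix B} {cs : CoxeterSystem M W}

namespace PreObj

variable {X : CoxeterRealization K V cs} [IsDomain K] [Module.Free K V]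

/-! ### Evaluations of `R ⊗_{R^H} R` -/

/-- The action of `w ∈ H` on `R` as an `R^H`-linear map. -/
def actLin (X : CoxeterRealization K V cs) {H : Subgroup W} {w : W} (hw : w ∈ H) :
    X.R →ₗ[X.invariants H] X.R where
  toFun := X.actR w
  map_add' := map_add _
  map_smul' c f := by
    rw [Subalgebra.smul_def, smul_eq_mul, map_mul, X.actR_coe_invariants c hw]; rfl

@[simp] theorem actLin_apply {H : Subgroup W} {w : W} (hw : w ∈ H) (f : X.R) :
    actLin X hw f = X.actR w f := rfl

/-- The linear map `f ⊗ g ↦ μ(f) g`. -/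
def invLift {H : Subgroup W} (μ : X.R →ₗ[X.invariants H] X.R) :
    (X.invObj H).carrier →ₗ[X.R] X.R :=
  let φ : X.R ⊗[X.invariants H] X.R →ₗ[X.invariants H] X.R :=
    TensorProduct.lift ((LinearMap.mul (X.invariants H) X.R).comp μ)
  let φ' : (X.invObj H).carrier →+ X.R :=
    { toFun := fun z => φ z
      map_zero' := map_zero φ
      map_add' := fun a b => map_add φ a b }
  { φ' with
    map_smul' := fun r z => by
      change φ' (r • z) = r • φ' z
      induction z using inv_induction with
      | itm f g =>
        rw [smul_itm]
        change μ f * (r * g) = r * (μ f * g)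
        ring
      | add a b ha hb => rw [smul_add, map_add, ha, hb, map_add, smul_add] }

/-- The evaluation `f ⊗ g ↦ w⁻¹(f) g`, for `w ∈ H`. -/
def evInv (X : CoxeterRealization K V cs) {H : Subgroup W} {w : W} (hw : w ∈ H) :
    (X.invObj H).carrier →ₗ[X.R] X.R := invLift (actLin X (inv_mem hw))

@[simp] theorem evInv_itm {H : Subgroup W} {w : W} (hw : w ∈ H) (f g : X.R) :
    evInv X hw (itm X H f g) = X.actR w⁻¹ f * g := rfl

theorem evInv_left {H : Subgroup W} {w : W} (hw : w ∈ H) (r : X.R) (z : (X.invObj H).carrier) :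
    evInv X hw ((X.invObj H).left r z) = X.actR w⁻¹ r * evInv X hw z := by
  induction z using inv_induction with
  | itm f g => rw [left_itm, evInv_itm, evInv_itm, map_mul, mul_assoc]
  | add a b ha hb => simp only [map_add, ha, hb, mul_add]

theorem one_tmul_R_injective {f g : X.R}
    (h : (1 : X.Q) ⊗ₜ[X.R] f = (1 : X.Q) ⊗ₜ[X.R] g) : f = g := by
  rw [← sub_eq_zero, ← TensorProduct.tmul_sub, one_tmul_eq_zero_iff] at h
  obtain ⟨r, hr, h⟩ := h
  rw [smul_eq_mul, mul_eq_zero] at h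
  exact sub_eq_zero.1 (h.resolve_left (nonZeroDivisors.ne_zero hr))

/-- The evaluation at `w` vanishes on the eigenspaces for `x ≠ w`. -/
theorem evInv_eq_zero {H : Subgroup W} {w x : W} (hw : w ∈ H)
    (hx : x ∈ H → ∃ f, X.actR w⁻¹ f ≠ X.actR x⁻¹ f) {z : (X.invObj H).carrier}
    (hz : z ∈ (X.invObj H).locSub x) : evInv X hw z = 0 := by
  by_cases h : x ∈ H
  · obtain ⟨f, hf⟩ := hx h
    have := congrArg ((evInv X hw).baseChange X.Q) ((mem_invObj_locSub h).1 hz f)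
    rw [LinearMap.baseChange_tmul, LinearMap.baseChange_tmul] at this
    have := one_tmul_R_injective this
    rw [evInv_left, map_smul, smul_eq_mul, ← sub_eq_zero, ← sub_mul] at this
    exact (mul_eq_zero.1 this).resolve_left (sub_ne_zero.2 hf)
  · rw [mem_locSub, invObj_loc_of_not_mem h, Submodule.mem_bot] at hz
    have := congrArg ((evInv X hw).baseChange X.Q) hz
    rw [LinearMap.baseChange_tmul, map_zero, ← TensorProduct.tmul_zero X.R (1 : X.Q)] at this
    exact one_tmul_R_injective this

/-! ### The bimodules `B_s ⊗ N` -/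

variable {N : PreObj.{u, v, w₁} X} {P : PreObj.{u, v, w₂} X} {L : PreObj.{u, v, w₃} X}

/-- The element `f ⊗ g` of `B_s`. -/
def stm (X : CoxeterRealization K V cs) (s : B) (f g : X.R) : (X.simpleObj s).carrier :=
  itm X (cs.parabolic {s}) f g

section Ind

variable (s : B)

theorem simple_smul_stm (r f g : X.R) : r • stm X s f g = stm X s f (r * g) := smul_itm r f g

theorem simple_left_stm (r f g : X.R) :
    (X.simpleObj s).left r (stm X s f g) = stm X s (r * f) g := left_itm r f g

@[elab_as_elim]
theorem simple_induction {motive : (X.simpleObj s).carrier → Prop}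
    (z : (X.simpleObj s).carrier) (stm : ∀ f g, motive (stm X s f g))
    (add : ∀ a b, motive a → motive b → motive (a + b)) : motive z :=
  inv_induction (motive := motive) z stm add

theorem stm_mem_deg {i j k : ℤ} (hk : i + j = k + 1) {f g : X.R}
    (hf : f ∈ X.degR i) (hg : g ∈ X.degR j) : stm X s f g ∈ (X.simpleObj s).deg k :=
  itm_mem_deg hk hf hg

variable {s}

/-- The map `B_s ⊗ N → P`, `(f ⊗ g) ⊗ n ↦ μ(f) φ(g n)`. -/
def ind (μ : X.R →ₗ[X.invariants (cs.parabolic {s})] X.R) (φ : N.carrier →ₗ[X.R] P.carrier)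
    (hφ : ∀ c ∈ X.invariants (cs.parabolic {s}), ∀ n, φ (N.left c n) = P.left c (φ n)) :
    ((X.simpleObj s).tensor N).carrier →ₗ[X.R] P.carrier :=
  let h : X.R ⊗[X.invariants (cs.parabolic {s})] X.R →+ (N.carrier →ₗ[X.R] P.carrier) :=
    TensorProduct.liftAddHom
      { toFun := fun f =>
          { toFun := fun g => (P.left (μ f)) ∘ₗ φ ∘ₗ (N.left g)
            map_zero' := by rw [map_zero]; ext; simp
            map_add' := fun a b => by rw [map_add]; ext; simp }
        map_zero' := by
          ext g n
          change P.left (μ 0) (φ (N.left g n)) = 0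
          rw [map_zero, map_zero]; rfl
        map_add' := fun a b => by
          ext g n
          change P.left (μ (a + b)) (φ (N.left g n)) =
            P.left (μ a) (φ (N.left g n)) + P.left (μ b) (φ (N.left g n))
          rw [map_add, map_add]; rfl }
      (fun c f g => by
        ext n
        change P.left (μ (c • f)) (φ (N.left g n)) = P.left (μ f) (φ (N.left (c • g) n))
        rw [map_smul, Subalgebra.smul_def, Subalgebra.smul_def, smul_eq_mul, smul_eq_mul,
          mul_comm (c : X.R) (μ f), map_mul, map_mul, Module.End.mul_apply, Module.End.mul_apply,
          hφ c c.2])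
  let h' : (X.simpleObj s).carrier →+ (N.carrier →ₗ[X.R] P.carrier) :=
    { toFun := fun z => h z
      map_zero' := map_zero h
      map_add' := fun a b => map_add h a b }
  tensorLift h' (fun r z n => by
    induction z using simple_induction with
    | stm f g =>
      rw [simple_smul_stm]
      change P.left (μ f) (φ (N.left (r * g) n)) = P.left (μ f) (φ (N.left g (N.left r n)))
      rw [mul_comm, map_mul]; rfl
    | add a b ha hb =>
      rw [smul_add, map_add, LinearMap.add_apply, ha, hb, map_add, LinearMap.add_apply])

@[simp] theorem ind_tm (μ : X.R →ₗ[X.invariants (cs.parabolic {s})] X.R)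
    (φ : N.carrier →ₗ[X.R] P.carrier)
    (hφ : ∀ c ∈ X.invariants (cs.parabolic {s}), ∀ n, φ (N.left c n) = P.left c (φ n))
    (f g : X.R) (n : N.carrier) :
    ind μ φ hφ (tm (stm X s f g) n) = P.left (μ f) (φ (N.left g n)) := rfl

theorem tm_stm (f g : X.R) (n : N.carrier) :
    tm (stm X s f g) n = ((X.simpleObj s).tensor N).left f (tm (stm X s 1 1) (N.left g n)) := by
  rw [left_tm, simple_left_stm, ← smul_tm_left, simple_smul_stm, mul_one, mul_one]

@[elab_as_elim]
theorem simpleTensor_induction {motive : ((X.simpleObj s).tensor N).carrier → Prop}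
    (z : ((X.simpleObj s).tensor N).carrier) (tm : ∀ f g n, motive (tm (stm X s f g) n))
    (add : ∀ a b, motive a → motive b → motive (a + b)) : motive z := by
  induction z using tensor_induction with
  | tm b n =>
    induction b using simple_induction with
    | stm f g => exact tm f g n
    | add a b ha hb => rw [add_tm]; exact add _ _ ha hb
  | add a b ha hb => exact add a b ha hb

theorem ind_left (φ : N.carrier →ₗ[X.R] P.carrier)
    (hφ : ∀ c ∈ X.invariants (cs.parabolic {s}), ∀ n, φ (N.left c n) = P.left c (φ n))
    (r : X.R) (z : ((X.simpleObj s).tensor N).carrier) :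
    ind LinearMap.id φ hφ (((X.simpleObj s).tensor N).left r z) =
      P.left r (ind LinearMap.id φ hφ z) := by
  induction z using simpleTensor_induction with
  | tm f g n =>
    rw [left_tm, simple_left_stm, ind_tm, ind_tm, LinearMap.id_apply, LinearMap.id_apply, map_mul]
    rfl
  | add a b ha hb => simp only [map_add, ha, hb]

theorem ind_left_of_mem (μ : X.R →ₗ[X.invariants (cs.parabolic {s})] X.R)
    (φ : N.carrier →ₗ[X.R] P.carrier)
    (hφ : ∀ c ∈ X.invariants (cs.parabolic {s}), ∀ n, φ (N.left c n) = P.left c (φ n))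
    {c : X.R} (hc : c ∈ X.invariants (cs.parabolic {s}))
    (z : ((X.simpleObj s).tensor N).carrier) :
    ind μ φ hφ (((X.simpleObj s).tensor N).left c z) = P.left c (ind μ φ hφ z) := by
  induction z using simpleTensor_induction with
  | tm f g n =>
    rw [left_tm, simple_left_stm, ind_tm, ind_tm]
    have : μ (c * f) = c * μ f := μ.map_smul (⟨c, hc⟩ : X.invariants (cs.parabolic {s})) f
    rw [this, map_mul]
    rfl
  | add a b ha hb => simp only [map_add, ha, hb]

variable [X.IsRegular]

theorem left_of_mem {c : X.R} (hc : c ∈ X.invariants (cs.parabolic {s}))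
    (z : (X.simpleObj s).carrier) : (X.simpleObj s).left c z = c • z := by
  induction z using simple_induction with
  | stm f g =>
    rw [simple_left_stm, simple_smul_stm]
    exact mul_itm hc f g
  | add a b ha hb => rw [map_add, ha, hb, smul_add]

theorem stm_mul {c : X.R} (hc : c ∈ X.invariants (cs.parabolic {s})) (f g : X.R) :
    stm X s (c * f) g = stm X s f (c * g) := mul_itm hc f g

theorem stm_sub (f g g' : X.R) : stm X s f (g - g') = stm X s f g - stm X s f g' := itm_sub _ f g g'

theorem sub_stm (f f' g : X.R) : stm X s (f - f') g = stm X s f g - stm X s f' g := sub_itm _ f f' g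

theorem add_stm (f f' g : X.R) : stm X s (f + f') g = stm X s f g + stm X s f' g := add_itm _ f f' g

theorem stm_add (f g g' : X.R) : stm X s f (g + g') = stm X s f g + stm X s f g' := itm_add _ f g g'

theorem stm_eq (f g : X.R) : stm X s f g =
    stm X s 1 ((f - X.fund s * X.demazure s f) * g) + stm X s (X.fund s) (X.demazure s f * g) := by
  rw [← stm_mul (X.sub_fund_mul_demazure_mem s f), ← stm_mul (X.demazure_mem_invariants s f),
    ← add_stm]
  congr 1
  ring

variable (X s)

/-- The element `δ_s ⊗ 1 - 1 ⊗ s(δ_s)` of `B_s`, which spans `(B_s)_Q^e`. -/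
def cE : (X.simpleObj s).carrier :=
  stm X s (X.fund s) 1 - stm X s 1 (X.actR (cs.simple s) (X.fund s))

/-- The element `1 ⊗ δ_s - δ_s ⊗ 1` of `B_s`, which spans `(B_s)_Q^s`. -/
def cS : (X.simpleObj s).carrier := stm X s 1 (X.fund s) - stm X s (X.fund s) 1

theorem cE_mem_deg : cE X s ∈ (X.simpleObj s).deg 1 :=
  sub_mem (stm_mem_deg s (by norm_num) (X.fund_mem_degR s) X.one_mem_degR)
    (stm_mem_deg s (by norm_num) X.one_mem_degR (X.actR_mem_degR _ (X.fund_mem_degR s)))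

theorem cS_mem_deg : cS X s ∈ (X.simpleObj s).deg 1 :=
  sub_mem (stm_mem_deg s (by norm_num) X.one_mem_degR (X.fund_mem_degR s))
    (stm_mem_deg s (by norm_num) (X.fund_mem_degR s) X.one_mem_degR)

theorem stm_fund_sq (g : X.R) : stm X s (X.fund s * X.fund s) g =
    stm X s (X.fund s) ((X.fund s + X.actR (cs.simple s) (X.fund s)) * g) -
      stm X s 1 (X.fund s * X.actR (cs.simple s) (X.fund s) * g) := by
  have h1 : X.fund s + X.actR (cs.simple s) (X.fund s) ∈ X.invariants (cs.parabolic {s}) := by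
    rw [mem_invariants_singleton, map_add, X.actR_simple_simple, add_comm]
  have h2 : X.fund s * X.actR (cs.simple s) (X.fund s) ∈ X.invariants (cs.parabolic {s}) := by
    rw [mem_invariants_singleton, map_mul, X.actR_simple_simple, mul_comm]
  rw [← stm_mul h1, ← stm_mul h2, ← sub_stm]
  congr 1
  ring

theorem left_cE (f : X.R) : (X.simpleObj s).left f (cE X s) = f • cE X s := by
  have h : (X.simpleObj s).left (X.fund s) (cE X s) = X.fund s • cE X s := by
    rw [cE, map_sub, simple_left_stm, simple_left_stm, smul_sub, simple_smul_stm, simple_smul_stm,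
      stm_fund_sq, mul_one, mul_one, mul_one, stm_add]
    abel
  have hf : f = (f - X.fund s * X.demazure s f) + X.demazure s f * X.fund s := by ring
  rw [hf, map_add, LinearMap.add_apply, left_of_mem (X.sub_fund_mul_demazure_mem s f), map_mul,
    Module.End.mul_apply, h, left_of_mem (X.demazure_mem_invariants s f), smul_smul, ← add_smul]

theorem left_cS (f : X.R) :
    (X.simpleObj s).left f (cS X s) = X.actR (cs.simple s) f • cS X s := by
  have h : (X.simpleObj s).left (X.fund s) (cS X s) =
      X.actR (cs.simple s) (X.fund s) • cS X s := by
    rw [cS, map_sub, simple_left_stm, simple_left_stm, smul_sub, simple_smul_stm, simple_smul_stm,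
      stm_fund_sq]
    simp only [mul_one, stm_add]
    rw [mul_comm (X.fund s)]
    abel
  have hf : f = (f - X.fund s * X.demazure s f) + X.demazure s f * X.fund s := by ring
  conv_lhs => rw [hf]
  rw [map_add, LinearMap.add_apply, left_of_mem (X.sub_fund_mul_demazure_mem s f), map_mul,
    Module.End.mul_apply, h, left_of_mem (X.demazure_mem_invariants s f), smul_smul, ← add_smul]
  congr 1
  conv_rhs => rw [hf]
  rw [map_add, map_mul, actR_demazure,
    (X.mem_invariants_singleton s).1 (X.sub_fund_mul_demazure_mem s f)]

theorem simple_mem_parabolic_self : cs.simple s ∈ cs.parabolic {s} :=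
  (mem_parabolic_singleton s).2 (Or.inr rfl)

theorem cE_mem_locSub : cE X s ∈ (X.simpleObj s).locSub 1 :=
  (mem_invObj_locSub (X := X) (one_mem _)).2 fun f => by
    rw [inv_one, actR_one_apply]
    exact congrArg _ (left_cE X s f)

theorem cS_mem_locSub : cS X s ∈ (X.simpleObj s).locSub (cs.simple s) :=
  (mem_invObj_locSub (X := X) (simple_mem_parabolic_self s)).2 fun f => by
    rw [CoxeterSystem.inv_simple]
    exact congrArg _ (left_cS X s f)

variable {X s}

/-- The multiplication `B_s → R`, `f ⊗ g ↦ f g`. -/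
def evE (s : B) : (X.simpleObj s).carrier →ₗ[X.R] X.R := evInv X (one_mem (cs.parabolic {s}))

/-- The twisted multiplication `B_s → R`, `f ⊗ g ↦ s(f) g`. -/
def evS (s : B) : (X.simpleObj s).carrier →ₗ[X.R] X.R :=
  evInv X (simple_mem_parabolic_self (cs := cs) s)

@[simp] theorem evE_stm (f g : X.R) : evE s (stm X s f g) = f * g := by
  change X.actR (1 : W)⁻¹ f * g = _
  rw [inv_one, actR_one_apply]

@[simp] theorem evS_stm (f g : X.R) : evS s (stm X s f g) = X.actR (cs.simple s) f * g := by
  change X.actR (cs.simple s)⁻¹ f * g = _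
  rw [CoxeterSystem.inv_simple]

theorem actR_simple_fund_ne (s : B) : X.actR (cs.simple s) (X.fund s) ≠ X.fund s := by
  rw [actR_fund]
  intro h
  exact X.rootR_ne_zero s (by linear_combination -h)

theorem evE_eq_zero {x : W} (hx : x ≠ 1) {z : (X.simpleObj s).carrier}
    (hz : z ∈ (X.simpleObj s).locSub x) : evE s z = 0 := by
  refine evInv_eq_zero (X := X) _ (fun hxs => ⟨X.fund s, ?_⟩) hz
  obtain rfl := ((mem_parabolic_singleton s).1 hxs).resolve_left hx
  rw [inv_one, actR_one_apply, CoxeterSystem.inv_simple]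
  exact (actR_simple_fund_ne s).symm

theorem evS_eq_zero {x : W} (hx : x ≠ cs.simple s) {z : (X.simpleObj s).carrier}
    (hz : z ∈ (X.simpleObj s).locSub x) : evS s z = 0 := by
  refine evInv_eq_zero (X := X) _ (fun hxs => ⟨X.fund s, ?_⟩) hz
  obtain rfl := ((mem_parabolic_singleton s).1 hxs).resolve_right hx
  rw [inv_one, actR_one_apply, CoxeterSystem.inv_simple]
  exact actR_simple_fund_ne s

/-- The decomposition of an element of `B_s` into its components in `(B_s)_Q^e` and `(B_s)_Q^s`,
multiplied by `α_s`. -/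
theorem rootR_smul_eq (z : (X.simpleObj s).carrier) :
    X.rootR s • z = evE s z • cE X s + evS s z • cS X s := by
  induction z using simple_induction with
  | stm f g =>
    have hf := stm_eq (s := s) f g
    rw [hf, map_add, map_add, smul_add]
    simp only [evE_stm, evS_stm, cE, cS, smul_sub, simple_smul_stm, map_one, actR_fund]
    rw [← sub_eq_zero]
    have e1 : ∀ a b c d e f' : X.R,
        stm X s 1 a + stm X s (X.fund s) b - (stm X s (X.fund s) c - stm X s 1 d +
          (stm X s 1 e - stm X s (X.fund s) f')) =
        stm X s 1 (a + d - e) + stm X s (X.fund s) (b - c + f') := by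
      intro a b c d e f'
      rw [stm_sub, stm_add, stm_add, stm_sub]
      abel
    rw [e1]
    have z1 : ∀ a b : X.R, a = 0 → b = 0 → stm X s 1 a + stm X s (X.fund s) b = 0 := by
      rintro _ _ rfl rfl
      have h0 : ∀ f : X.R, stm X s f 0 = 0 := fun f => by
        rw [← zero_mul (1 : X.R), ← simple_smul_stm, zero_smul]
      rw [h0, h0, add_zero]
    apply z1 <;> ring
  | add a b ha hb => rw [smul_add, ha, hb, map_add, map_add, add_smul, add_smul]; abel

theorem tm_left_rootR (z : (X.simpleObj s).carrier) (n : N.carrier) :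
    tm z (N.left (X.rootR s) n) =
      tm (cE X s) (N.left (evE s z) n) + tm (cS X s) (N.left (evS s z) n) := by
  rw [← smul_tm_left, rootR_smul_eq, add_tm, smul_tm_left, smul_tm_left]

theorem tm_cE_left (f : X.R) (n : N.carrier) :
    tm (cE X s) (N.left f n) = ((X.simpleObj s).tensor N).left f (tm (cE X s) n) := by
  rw [left_tm, left_cE, smul_tm_left]

theorem tm_cS_left (f : X.R) (n : N.carrier) : tm (cS X s) (N.left f n) =
    ((X.simpleObj s).tensor N).left (X.actR (cs.simple s) f) (tm (cS X s) n) := by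
  rw [left_tm, left_cS, smul_tm_left, actR_simple_simple]

theorem tm_cE_add (n : N.carrier) :
    tm (cE X s) n + tm (cS X s) n = tm (stm X s 1 1) (N.left (X.rootR s) n) := by
  rw [tm_left_rootR, evE_stm, evS_stm]
  simp

theorem tm_cE_sub (n : N.carrier) : tm (cE X s) n - tm (cS X s) n =
    ((X.simpleObj s).tensor N).left (X.rootR s) (tm (stm X s 1 1) n) := by
  have h : stm X s (X.fund s) 1 + stm X s (X.actR (cs.simple s) (X.fund s)) 1 =
      stm X s 1 (X.fund s) + stm X s 1 (X.actR (cs.simple s) (X.fund s)) := by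
    rw [← add_stm, ← stm_add]
    have h1 : X.fund s + X.actR (cs.simple s) (X.fund s) ∈ X.invariants (cs.parabolic {s}) := by
      rw [mem_invariants_singleton, map_add, X.actR_simple_simple, add_comm]
    have := stm_mul h1 1 1
    rwa [mul_one] at this
  rw [left_tm, simple_left_stm, mul_one, ← sub_tm, cE, cS]
  congr 1
  have h2 : stm X s (X.rootR s) 1 =
      stm X s (X.fund s) 1 - stm X s (X.actR (cs.simple s) (X.fund s)) 1 := by
    rw [← sub_stm, actR_fund]
    congr 1
    ring
  rw [h2, eq_sub_of_add_eq' h]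
  abel

theorem ind_tm_cE (φ : N.carrier →ₗ[X.R] P.carrier)
    (hφ : ∀ c ∈ X.invariants (cs.parabolic {s}), ∀ n, φ (N.left c n) = P.left c (φ n))
    (n : N.carrier) : ind LinearMap.id φ hφ (tm (cE X s) n) =
      P.left (X.fund s) (φ n) - φ (N.left (X.actR (cs.simple s) (X.fund s)) n) := by
  rw [cE, sub_tm, map_sub, ind_tm, ind_tm, map_one, LinearMap.id_apply, LinearMap.id_apply,
    map_one]
  rfl

theorem ind_tm_cS (φ : N.carrier →ₗ[X.R] P.carrier)
    (hφ : ∀ c ∈ X.invariants (cs.parabolic {s}), ∀ n, φ (N.left c n) = P.left c (φ n))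
    (n : N.carrier) : ind LinearMap.id φ hφ (tm (cS X s) n) =
      φ (N.left (X.fund s) n) - P.left (X.fund s) (φ n) := by
  rw [cS, sub_tm, map_sub, ind_tm, ind_tm, LinearMap.id_apply, LinearMap.id_apply, map_one,
    map_one]
  rfl

/-- A criterion for a map out of `B_s ⊗ N` to respect localizations: it suffices to consider
the elements `c ⊗ n`, where `c` spans `(B_s)_Q^e` or `(B_s)_Q^s`. -/
theorem simpleTensor_map_loc (hN : N.LocLeft)
    {φ : ((X.simpleObj s).tensor N).carrier →ₗ[X.R] P.carrier} {x x' : W}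
    (h₁ : ∀ n ∈ N.locSub x, φ (tm (cE X s) n) ∈ P.locSub x')
    (h₂ : ∀ n ∈ N.locSub (cs.simple s * x), φ (tm (cS X s) n) ∈ P.locSub x') :
    ∀ z ∈ ((X.simpleObj s).tensor N).locSub x, φ z ∈ P.locSub x' := by
  refine tensor_map_loc fun y t hyt z hz n hn => ?_
  have hα : X.actR t⁻¹ (X.rootR s) ≠ 0 :=
    (map_ne_zero_iff _ (X.actR_injective t⁻¹)).2 (X.rootR_ne_zero s)
  refine mem_locSub_of_smul hα ?_
  have key : φ (tm z (N.left (X.rootR s) n)) ∈ P.locSub x' := by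
    rw [tm_left_rootR, map_add]
    refine add_mem ?_ ?_
    · by_cases hy : y = 1
      · subst hy
        rw [one_mul] at hyt
        subst hyt
        exact h₁ _ (hN.left_mem hn _)
      · rw [evE_eq_zero hy hz, map_zero, LinearMap.zero_apply, tm_zero, map_zero]
        exact zero_mem _
    · by_cases hy : y = cs.simple s
      · subst hy
        refine h₂ _ ?_
        rw [← hyt, CoxeterSystem.simple_mul_simple_cancel_left]
        exact hN.left_mem hn _
      · rw [evS_eq_zero hy hz, map_zero, LinearMap.zero_apply, tm_zero, map_zero]
        exact zero_mem _
  have := congrArg ((φ ∘ₗ tmulHom _ _ z).baseChange X.Q) (hN t n hn (X.rootR s))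
  rw [LinearMap.baseChange_tmul, LinearMap.baseChange_tmul, map_smul] at this
  rw [mem_locSub] at key ⊢
  change (1 : X.Q) ⊗ₜ[X.R] (X.actR t⁻¹ (X.rootR s) • (φ ∘ₗ tmulHom _ _ z) n) ∈ P.loc x'
  rw [← this]
  exact key

/-- When `(f ⊗ g) ⊗ n ↦ f φ(g n)` is a homomorphism `B_s ⊗ N → P`. -/
theorem isHom_ind (hN : N.LocLeft) (hNg : N.IsGraded) (hPg : P.IsGraded)
    (φ : N.carrier →ₗ[X.R] P.carrier)
    (hφ : ∀ c ∈ X.invariants (cs.parabolic {s}), ∀ n, φ (N.left c n) = P.left c (φ n))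
    {d e : ℤ} (hd : e + 1 = d) (hdeg : ∀ i, ∀ n ∈ N.deg i, φ n ∈ P.deg (i + e))
    (h₁ : ∀ x, ∀ n ∈ N.locSub x,
      P.left (X.fund s) (φ n) - φ (N.left (X.actR (cs.simple s) (X.fund s)) n) ∈ P.locSub x)
    (h₂ : ∀ x, ∀ n ∈ N.locSub (cs.simple s * x),
      φ (N.left (X.fund s) n) - P.left (X.fund s) (φ n) ∈ P.locSub x) :
    IsHom ((X.simpleObj s).tensor N) P d (ind LinearMap.id φ hφ) where
  map_left := ind_left φ hφ
  map_deg k := by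
    refine tensor_deg_le (S := (P.deg (k + d)).comap
      (ind LinearMap.id φ hφ).toAddMonoidHom) fun i j hij z hz n hn => ?_
    revert z
    refine invObj_deg_le (k := i + 1) (S := (P.deg (k + d)).comap
      ((ind LinearMap.id φ hφ).toAddMonoidHom.comp ((LinearMap.applyₗ n).toAddMonoidHom.comp
        (tmulHom (X.simpleObj s) N)))) fun a b hab f hf g hg => ?_
    have := hPg.left_deg _ _ f _ hf (hdeg _ _ (hNg.left_deg _ _ g n hg hn))
    rwa [show a + (b + j + e) = k + d by omega] at this
  map_loc x := simpleTensor_map_loc hN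
    (fun n hn => by rw [ind_tm_cE]; exact h₁ x n hn)
    (fun n hn => by rw [ind_tm_cS]; exact h₂ x n hn)

/-- As a right module, `B_s ⊗ N` is a sum of two copies of `N`. -/
theorem simpleTensor_eq (z : ((X.simpleObj s).tensor N).carrier) :
    tm (stm X s 1 1) (ind (P := N) (LinearMap.id - (LinearMap.mulLeft _ (X.fund s)) ∘ₗ X.demazure s)
      LinearMap.id (fun _ _ _ => rfl) z) +
    tm (stm X s (X.fund s) 1)
      (ind (P := N) (X.demazure s) LinearMap.id (fun _ _ _ => rfl) z) = z := by
  induction z using simpleTensor_induction with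
  | tm f g n =>
    rw [ind_tm, ind_tm, LinearMap.id_apply, ← smul_tm_left, ← smul_tm_left, simple_smul_stm,
      simple_smul_stm, ← smul_tm_left, ← smul_tm_left, simple_smul_stm, simple_smul_stm, ← add_tm,
      stm_eq f g]
    simp only [LinearMap.sub_apply, LinearMap.id_apply, LinearMap.comp_apply,
      LinearMap.mulLeft_apply, mul_one]
    congr 2 <;> congr 1 <;> ring
  | add a b ha hb =>
    conv_rhs => rw [← ha, ← hb]
    simp only [map_add, tm_add]
    abel

theorem TorsionFree.simpleTensor (hN : N.TorsionFree) (s : B) :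
    ((X.simpleObj s).tensor N).TorsionFree := by
  intro r z hz
  by_cases hr : r = 0
  · exact Or.inl hr
  · right
    rw [← simpleTensor_eq z]
    rw [(hN r (ind _ LinearMap.id (fun _ _ _ => rfl) z)
        (by rw [← map_smul, hz, map_zero])).resolve_left
      hr, (hN r (ind _ LinearMap.id (fun _ _ _ => rfl) z)
      (by rw [← map_smul, hz, map_zero])).resolve_left hr]
    simp

end Ind

end PreObj

end CoxeterRealization

namespace CoxeterRealization

variable {K : Type u} {V : Type v} [CommRing K] [AddCommGroup V] [Module K V]
  {B W : Type*} [Group W] {M : CoxeterMatrix B} {cs : CoxeterSystem M W}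

namespace PreObj

variable {X : CoxeterRealization K V cs} [IsDomain K] [Module.Free K V]
variable {N : PreObj.{u, v, w₁} X} {P : PreObj.{u, v, w₂} X} {L : PreObj.{u, v, w₃} X}

/-! ### Homomorphisms to the standard objects -/

/-- `ψ : N → R` is a homomorphism of degree `d` from `N` to `R_x`. -/
structure IsChar (N : PreObj.{u, v, w₁} X) (x : W) (d : ℤ) (ψ : N.carrier →ₗ[X.R] X.R) :
    Prop where
  map_left : ∀ f n, ψ (N.left f n) = X.actR x⁻¹ f * ψ n
  map_deg : ∀ i, ∀ n ∈ N.deg i, ψ n ∈ X.degR (i + d)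
  map_loc : ∀ y, y ≠ x → ∀ n ∈ N.locSub y, ψ n = 0

theorem IsHom.isChar {x : W} {d : ℤ} {φ : N.carrier →ₗ[X.R] (X.stdObj x).carrier}
    (h : IsHom N (X.stdObj x) d φ) : IsChar N x d ((unStd x).toLinearMap ∘ₗ φ) where
  map_left f n := congrArg (unStd x) (h.map_left f n)
  map_deg i n hn := h.map_deg i n hn
  map_loc y hy n hn := by
    have := (stdObj_mem_locSub.1 (h.map_loc y n hn)).resolve_left hy
    exact (congrArg (unStd x) this).trans (map_zero _)

namespace IsChar

variable {x : W} {d e : ℤ} {ψ ψ' : N.carrier →ₗ[X.R] X.R}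

theorem isHom (h : IsChar N x d ψ) :
    IsHom N (X.stdObj x) d ((unStd x).symm.toLinearMap ∘ₗ ψ) where
  map_left f n := (unStd x).injective (h.map_left f n)
  map_deg i n hn := h.map_deg i n hn
  map_loc y n hn := by
    by_cases hy : y = x
    · exact stdObj_mem_locSub.2 (Or.inl hy)
    · refine stdObj_mem_locSub.2 (Or.inr ?_)
      exact (congrArg (unStd x).symm (h.map_loc y hy n hn)).trans (map_zero _)

theorem sub (h : IsChar N x d ψ) (h' : IsChar N x d ψ') : IsChar N x d (ψ - ψ') where
  map_left f n := by
    rw [LinearMap.sub_apply, LinearMap.sub_apply, h.map_left, h'.map_left, mul_sub]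
  map_deg i n hn := sub_mem (h.map_deg i n hn) (h'.map_deg i n hn)
  map_loc y hy n hn := by
    rw [LinearMap.sub_apply, h.map_loc y hy n hn, h'.map_loc y hy n hn, sub_zero]

theorem comp {f : P.carrier →ₗ[X.R] N.carrier} (h : IsChar N x d ψ) (hf : IsHom P N e f) {k : ℤ}
    (hk : e + d = k) : IsChar P x k (ψ ∘ₗ f) where
  map_left r n := by rw [LinearMap.comp_apply, hf.map_left, h.map_left]; rfl
  map_deg i n hn := by
    rw [← hk, ← add_assoc]; exact h.map_deg _ _ (hf.map_deg i n hn)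
  map_loc y hy n hn := h.map_loc y hy _ (hf.map_loc y n hn)

section Simple

variable [X.IsRegular] {s : B} {φ : ((X.simpleObj s).tensor N).carrier →ₗ[X.R] X.R}

/-- The restriction of a homomorphism `B_s ⊗ N → R_x` to `c ⊗ N ≅ N`, where `c` spans
`(B_s)_Q^e`. -/
theorem cE (h : IsChar ((X.simpleObj s).tensor N) x d φ) :
    IsChar N x (d + 1) (φ ∘ₗ tmulHom _ _ (PreObj.cE X s)) where
  map_left f n := (congrArg φ (tm_cE_left f n)).trans (h.map_left _ _)
  map_deg i n hn := by
    have := h.map_deg _ _ (tm_mem_deg rfl (cE_mem_deg X s) hn)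
    rwa [show (1 + i + d : ℤ) = i + (d + 1) by ring] at this
  map_loc y hy n hn := h.map_loc y hy _ (tm_mem_locSub (one_mul y) (cE_mem_locSub X s) hn)

/-- The restriction of a homomorphism `B_s ⊗ N → R_x` to `c ⊗ N ≅ N`, where `c` spans
`(B_s)_Q^s`. -/
theorem cS (h : IsChar ((X.simpleObj s).tensor N) x d φ) :
    IsChar N (cs.simple s * x) (d + 1) (φ ∘ₗ tmulHom _ _ (PreObj.cS X s)) where
  map_left f n := by
    refine (congrArg φ (tm_cS_left f n)).trans ((h.map_left _ _).trans ?_)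
    rw [actR_mul_apply, mul_inv_rev, CoxeterSystem.inv_simple]
    rfl
  map_deg i n hn := by
    have := h.map_deg _ _ (tm_mem_deg rfl (cS_mem_deg X s) hn)
    rwa [show (1 + i + d : ℤ) = i + (d + 1) by ring] at this
  map_loc y hy n hn := by
    refine h.map_loc (cs.simple s * y) (fun hxy => hy ?_) _
      (tm_mem_locSub rfl (cS_mem_locSub X s) hn)
    rw [← hxy, CoxeterSystem.simple_mul_simple_cancel_left]

theorem rootR_mul (h : IsChar ((X.simpleObj s).tensor N) x d φ) (n : N.carrier) :
    X.actR x⁻¹ (X.rootR s) * φ (tm (stm X s 1 1) n) =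
      φ (tm (PreObj.cE X s) n) - φ (tm (PreObj.cS X s) n) := by
  rw [← map_sub, tm_cE_sub, h.map_left]

theorem rootR_ne (x : W) (s : B) : X.actR x⁻¹ (X.rootR s) ≠ 0 :=
  (map_ne_zero_iff _ (X.actR_injective x⁻¹)).2 (X.rootR_ne_zero s)

/-- A homomorphism `B_s ⊗ N → R_x` is determined by its values on the `(1 ⊗ 1) ⊗ n`. -/
theorem eq_zero_of_inOne (h : IsChar ((X.simpleObj s).tensor N) x d φ)
    (h1 : ∀ n, φ (tm (stm X s 1 1) n) = 0) : φ = 0 := by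
  ext z
  induction z using simpleTensor_induction with
  | tm f g n => rw [tm_stm, h.map_left, h1, mul_zero, LinearMap.zero_apply]
  | add a b ha hb => rw [map_add, ha, hb, map_add]

/-- A homomorphism `B_s ⊗ N → R_x` which vanishes on `c ⊗ N` for both `c` is zero. -/
theorem eq_zero (h : IsChar ((X.simpleObj s).tensor N) x d φ)
    (hE : ∀ n, φ (tm (PreObj.cE X s) n) = 0) (hS : ∀ n, φ (tm (PreObj.cS X s) n) = 0) :
    φ = 0 := by
  refine h.eq_zero_of_inOne fun n => ?_
  have := h.rootR_mul n
  rw [hE, hS, sub_zero] at this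
  exact (mul_eq_zero.1 this).resolve_left (rootR_ne x s)

theorem one_mem_simple_deg : stm X s 1 1 ∈ (X.simpleObj s).deg (-1) :=
  stm_mem_deg s (by norm_num) X.one_mem_degR X.one_mem_degR

theorem of_cS_eq_zero (h : IsChar ((X.simpleObj s).tensor N) x d φ)
    (hS : ∀ n, φ (tm (PreObj.cS X s) n) = 0) :
    IsChar N x (d - 1) (φ ∘ₗ tmulHom _ _ (stm X s 1 1)) where
  map_left f n := by
    apply mul_left_cancel₀ (rootR_ne x s)
    refine (h.rootR_mul _).trans ?_
    rw [hS, sub_zero, mul_left_comm]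
    have := h.rootR_mul n
    rw [hS, sub_zero] at this
    exact (h.cE.map_left f n).trans (congrArg _ this.symm)
  map_deg i n hn := by
    have := h.map_deg _ _ (tm_mem_deg rfl one_mem_simple_deg hn)
    rwa [show (-1 + i + d : ℤ) = i + (d - 1) by ring] at this
  map_loc y hy n hn := by
    have := h.rootR_mul n
    rw [hS, sub_zero] at this
    have h' : φ (tm (PreObj.cE X s) n) = 0 := h.cE.map_loc y hy n hn
    rw [h'] at this
    exact (mul_eq_zero.1 this).resolve_left (rootR_ne x s)

theorem of_cE_eq_zero (h : IsChar ((X.simpleObj s).tensor N) x d φ)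
    (hE : ∀ n, φ (tm (PreObj.cE X s) n) = 0) :
    IsChar N (cs.simple s * x) (d - 1) (φ ∘ₗ tmulHom _ _ (stm X s 1 1)) where
  map_left f n := by
    have key : ∀ n, φ (tm (PreObj.cS X s) n) =
        -(X.actR x⁻¹ (X.rootR s) * φ (tm (stm X s 1 1) n)) := fun n => by
      rw [h.rootR_mul, hE, zero_sub, neg_neg]
    apply mul_left_cancel₀ (neg_ne_zero.2 (rootR_ne x s))
    rw [neg_mul, neg_mul]
    refine (key (N.left f n)).symm.trans ((h.cS.map_left f n).trans ?_)
    change _ * φ (tm (PreObj.cS X s) n) = -(_ * (_ * φ (tm (stm X s 1 1) n)))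
    rw [key]
    ring
  map_deg i n hn := by
    have := h.map_deg _ _ (tm_mem_deg rfl one_mem_simple_deg hn)
    rwa [show (-1 + i + d : ℤ) = i + (d - 1) by ring] at this
  map_loc y hy n hn := by
    have := h.rootR_mul n
    rw [hE] at this
    have h' : φ (tm (PreObj.cS X s) n) = 0 := h.cS.map_loc y hy n hn
    rw [h', sub_zero] at this
    exact (mul_eq_zero.1 this).resolve_left (rootR_ne x s)

end Simple

end IsChar

/-! ### Bott-Samelson bimodules -/

variable (X)

theorem bsOne_cons (s : B) (l : List B) :
    X.bottSamelsonOne (s :: l) = tm (stm X s 1 1) (X.bottSamelsonOne l) := rfl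

theorem bs_isGraded : (l : List B) → (X.bottSamelson l).IsGraded
  | [] => stdObj_isGraded 1
  | s :: l => (X.simpleObj_isGraded s).tensor (bs_isGraded l)

theorem bs_locLeft : (l : List B) → (X.bottSamelson l).LocLeft
  | [] => stdObj_locLeft 1
  | s :: l => (X.simpleObj_locLeft s).tensor (bs_locLeft l)

variable [X.IsRegular]

theorem bs_torsionFree : (l : List B) → (X.bottSamelson l).TorsionFree
  | [] => stdObj_torsionFree 1
  | s :: l => (bs_torsionFree l).simpleTensor s

theorem bsOne_mem_deg : (l : List B) →
    X.bottSamelsonOne l ∈ (X.bottSamelson l).deg (-(l.length : ℤ))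
  | [] => by
    have := stdOne_mem_deg (X := X) 1
    rwa [show (0 : ℤ) = -(([] : List B).length : ℤ) by simp] at this
  | s :: l => tm_mem_deg (by rw [List.length_cons]; push_cast; ring) IsChar.one_mem_simple_deg
      (bsOne_mem_deg l)

/-- The projection from `B_{s₁} ⊗ ⋯ ⊗ B_{s_l}` to its component `R_x`, where `x = s₁ ⋯ s_l`,
together with its compatibility with the left action. -/
def canAux : (l : List B) → {c : (X.bottSamelson l).carrier →ₗ[X.R] X.R //
    ∀ f b, c ((X.bottSamelson l).left f b) = X.actR (cs.wordProd l)⁻¹ f * c b}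
  | [] => ⟨(unStd 1).toLinearMap, fun _ _ => rfl⟩
  | s :: l =>
    have h : ∀ c ∈ X.invariants (cs.parabolic {s}), ∀ b,
        ((unStd (X := X) (cs.wordProd (s :: l))).symm.toLinearMap ∘ₗ (canAux l).1)
          ((X.bottSamelson l).left c b) =
        (X.stdObj (cs.wordProd (s :: l))).left c
          (((unStd (X := X) (cs.wordProd (s :: l))).symm.toLinearMap ∘ₗ (canAux l).1) b) :=
      fun c hc b => (unStd (X := X) (cs.wordProd (s :: l))).injective <| by
        refine ((canAux l).2 c b).trans ?_
        rw [unStd_left, CoxeterSystem.wordProd_cons, mul_inv_rev, actR_mul,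
          CoxeterSystem.inv_simple, (X.mem_invariants_singleton s).1 hc]
        rfl
    ⟨(unStd (X := X) (cs.wordProd (s :: l))).toLinearMap ∘ₗ
      ind (P := X.stdObj (cs.wordProd (s :: l))) LinearMap.id
        ((unStd (X := X) (cs.wordProd (s :: l))).symm.toLinearMap ∘ₗ (canAux l).1) h,
      fun f b => congrArg (unStd (X := X) (cs.wordProd (s :: l))) (ind_left _ h f b)⟩

/-- The projection from `B_{s₁} ⊗ ⋯ ⊗ B_{s_l}` to its component `R_x`, where `x = s₁ ⋯ s_l`. -/
def can (l : List B) : (X.bottSamelson l).carrier →ₗ[X.R] X.R := (canAux X l).1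

theorem can_left (l : List B) (f : X.R) (b : (X.bottSamelson l).carrier) :
    can X l ((X.bottSamelson l).left f b) = X.actR (cs.wordProd l)⁻¹ f * can X l b :=
  (canAux X l).2 f b

theorem can_tm (s : B) (l : List B) (f g : X.R) (b : (X.bottSamelson l).carrier) :
    can X (s :: l) (tm (stm X s f g) b) =
      X.actR (cs.wordProd (s :: l))⁻¹ f * can X l ((X.bottSamelson l).left g b) := rfl

theorem can_tm_one (s : B) (l : List B) (b : (X.bottSamelson l).carrier) :
    can X (s :: l) (tm (stm X s 1 1) b) = can X l b := by
  rw [can_tm, map_one, one_mul, map_one]; rfl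

theorem can_one : (l : List B) → can X l (X.bottSamelsonOne l) = 1
  | [] => rfl
  | s :: l => by rw [bsOne_cons]; exact (can_tm_one X s l _).trans (can_one l)

theorem can_tm_cE (s : B) (l : List B) (b : (X.bottSamelson l).carrier) :
    can X (s :: l) (tm (cE X s) b) = 0 := by
  have h : can X (s :: l) (tm (cE X s) b) = can X (s :: l) (tm (stm X s (X.fund s) 1) b) -
      can X (s :: l) (tm (stm X s 1 (X.actR (cs.simple s) (X.fund s))) b) := by
    rw [cE, sub_tm]
    exact map_sub (can X (s :: l)) _ _
  rw [h, can_tm, can_tm, can_left, can_left, CoxeterSystem.wordProd_cons, mul_inv_rev,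
    actR_mul, CoxeterSystem.inv_simple]
  simp

theorem isChar_can : (l : List B) → IsChar (X.bottSamelson l) (cs.wordProd l) l.length (can X l)
  | [] => ⟨can_left X [], fun i n hn => by
        rw [List.length_nil, Nat.cast_zero, add_zero]; exact hn,
      fun y hy n hn => (congrArg (unStd (X := X) 1)
        ((stdObj_mem_locSub.1 hn).resolve_left hy)).trans (map_zero _)⟩
  | s :: l =>
    { map_left := can_left X (s :: l)
      map_deg := fun i => by
        refine tensor_deg_le (N := X.simpleObj s) (P := X.bottSamelson l)
          (S := (X.degR (i + (s :: l).length)).comap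
          (can X (s :: l)).toAddMonoidHom) fun a b hab z hz n hn => ?_
        revert z
        refine invObj_deg_le (k := a + 1) (S := (X.degR (i + (s :: l).length)).comap
          ((can X (s :: l)).toAddMonoidHom.comp ((LinearMap.applyₗ n).toAddMonoidHom.comp
            (tmulHom (X.simpleObj s) (X.bottSamelson l))))) fun p q hpq f hf g hg => ?_
        have h1 := (isChar_can l).map_deg _ _ ((bs_isGraded X l).left_deg q b g n hg hn)
        have h2 := X.mul_mem_degR (X.actR_mem_degR (cs.wordProd (s :: l))⁻¹ hf) h1
        rwa [show p + (q + b + (l.length : ℤ)) = i + (s :: l).length by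
          rw [List.length_cons]; push_cast; omega] at h2
      map_loc := fun y hy n hn => by
        have h := simpleTensor_map_loc (P := X.stdObj (cs.wordProd (s :: l)))
          (φ := (unStd (X := X) (cs.wordProd (s :: l))).symm.toLinearMap ∘ₗ can X (s :: l))
          (x := y) (x' := y) (bs_locLeft X l) (fun b _ => ?_) (fun b hb => ?_) n hn
        · exact (congrArg (unStd (X := X) _)
            ((stdObj_mem_locSub.1 h).resolve_left hy)).trans (map_zero _)
        · exact stdObj_mem_locSub.2 (Or.inr ((congrArg (unStd (X := X) _).symm
            (can_tm_cE X s l b)).trans (map_zero _)))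
        · refine stdObj_mem_locSub.2 (Or.inr ((congrArg (unStd (X := X) _).symm
            (?_ : can X (s :: l) (tm (cS X s) b) = 0)).trans (map_zero _)))
          have hb0 : can X l b = 0 := (isChar_can l).map_loc _ (fun h => hy (by
            rw [CoxeterSystem.wordProd_cons, ← h,
              CoxeterSystem.simple_mul_simple_cancel_left])) b hb
          have h1 : can X (s :: l) (tm (cE X s) b) + can X (s :: l) (tm (cS X s) b) =
              can X (s :: l) (tm (stm X s 1 1) ((X.bottSamelson l).left (X.rootR s) b)) := by
            rw [← tm_cE_add]
            exact (map_add (can X (s :: l)) _ _).symm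
          rwa [can_tm_cE, zero_add, can_tm_one, can_left, hb0, mul_zero] at h1 }

variable {X}

theorem stdObj_map_eq_zero {x : W} {C : Type*} [AddCommGroup C] [Module X.R C]
    {ψ : (X.stdObj x).carrier →ₗ[X.R] C} (h : ψ (stdOne X x) = 0) : ψ = 0 := by
  refine LinearMap.ext fun z => ?_
  rw [← unStd_smul_stdOne z, map_smul, h, smul_zero]
  rfl

/-- There are no homomorphisms from `B_{s₁} ⊗ ⋯ ⊗ B_{s_n}` to `R_y` if `n < ℓ(y)`. -/
theorem IsChar.eq_zero_of_length_lt {l : List B} {y : W} {d : ℤ}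
    {ψ : (X.bottSamelson l).carrier →ₗ[X.R] X.R} (h : IsChar (X.bottSamelson l) y d ψ)
    (hl : l.length < cs.length y) : ψ = 0 := by
  induction l generalizing y d with
  | nil =>
    have hy : (1 : W) ≠ y := by
      rintro rfl
      simp at hl
    have h1 : ψ (stdOne X 1) = 0 := h.map_loc 1 hy _ (stdOne_mem_locSub 1)
    exact stdObj_map_eq_zero h1
  | cons s l ih =>
    rw [List.length_cons] at hl
    have h' : IsChar ((X.simpleObj s).tensor (X.bottSamelson l)) y d ψ := h
    have h1 := ih h'.cE (by omega)
    have h2 := ih h'.cS (by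
      rcases cs.length_simple_mul y s with h | h <;> omega)
    exact h'.eq_zero (fun n => DFunLike.congr_fun h1 n) (fun n => DFunLike.congr_fun h2 n)

/-- For a reduced word with product `x`, homomorphisms from the Bott-Samelson bimodule to `R_x` are
determined by their value at `(1 ⊗ 1) ⊗ ⋯ ⊗ (1 ⊗ 1)`. -/
theorem IsChar.eq_zero_of_one {l : List B} (hl : cs.IsReduced l) {d : ℤ}
    {ψ : (X.bottSamelson l).carrier →ₗ[X.R] X.R}
    (h : IsChar (X.bottSamelson l) (cs.wordProd l) d ψ) (h1 : ψ (X.bottSamelsonOne l) = 0) :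
    ψ = 0 := by
  induction l generalizing d with
  | nil =>
    have h1 : ψ (stdOne X 1) = 0 := h1
    exact stdObj_map_eq_zero h1
  | cons s l ih =>
    obtain ⟨φ, rfl⟩ : ∃ φ : ((X.simpleObj s).tensor (X.bottSamelson l)).carrier →ₗ[X.R] X.R,
      φ = ψ := ⟨ψ, rfl⟩
    have h' : IsChar ((X.simpleObj s).tensor (X.bottSamelson l)) (cs.wordProd (s :: l)) d φ := h
    have hE := h'.cE.eq_zero_of_length_lt (by
      have : cs.length (cs.wordProd (s :: l)) = (s :: l).length := hl
      rw [this, List.length_cons]; omega)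
    have hS : IsChar (X.bottSamelson l) (cs.wordProd l) (d + 1)
        (φ ∘ₗ tmulHom (X.simpleObj s) (X.bottSamelson l) (PreObj.cS X s)) := by
      have := h'.cS
      rwa [CoxeterSystem.wordProd_cons, CoxeterSystem.simple_mul_simple_cancel_left] at this
    have h2 : φ (tm (stm X s 1 1) (X.bottSamelsonOne l)) = 0 := h1
    have h3 := h'.rootR_mul (X.bottSamelsonOne l)
    have h4 : φ (tm (PreObj.cE X s) (X.bottSamelsonOne l)) = 0 :=
      DFunLike.congr_fun hE (X.bottSamelsonOne l)
    rw [h2, h4, mul_zero, zero_sub, eq_comm, neg_eq_zero] at h3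
    have h5 := ih (hl.tail) hS h3
    exact h'.eq_zero (fun n => DFunLike.congr_fun hE n) (fun n => DFunLike.congr_fun h5 n)

/-! ### Homomorphisms between Bott-Samelson bimodules of the same element -/

theorem exists_bs_append (a l : List B) :
    (∃ φ, IsHom ((X.bottSamelson a).tensor (X.bottSamelson l)) (X.bottSamelson (a ++ l)) 0 φ ∧
      φ (tm (X.bottSamelsonOne a) (X.bottSamelsonOne l)) = X.bottSamelsonOne (a ++ l)) ∧
    (∃ φ, IsHom (X.bottSamelson (a ++ l)) ((X.bottSamelson a).tensor (X.bottSamelson l)) 0 φ ∧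
      φ (X.bottSamelsonOne (a ++ l)) = tm (X.bottSamelsonOne a) (X.bottSamelsonOne l)) := by
  induction a with
  | nil =>
    refine ⟨⟨_, isHom_leftUnit (bs_locLeft X l) (bs_isGraded X l).left_deg, ?_⟩,
      ⟨_, isHom_tm_one_left, rfl⟩⟩
    refine (leftUnit_tm (stdOne X 1) (X.bottSamelsonOne l)).trans ?_
    rw [unStd_stdOne, map_one]; rfl
  | cons s a ih =>
    obtain ⟨⟨φ, hφ, h1⟩, ψ, hψ, h2⟩ := ih
    refine ⟨⟨_, ((IsHom.id (N := X.simpleObj s)).tensorMap hφ (add_zero 0)).comp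
      (isHom_assoc (bs_locLeft X l)) (add_zero 0), ?_⟩,
      ⟨_, isHom_assocInv.comp ((IsHom.id (N := X.simpleObj s)).tensorMap hψ (add_zero 0))
        (add_zero 0), ?_⟩⟩
    · change tm (stm X s 1 1) (φ (tm (X.bottSamelsonOne a) (X.bottSamelsonOne l))) = _
      rw [h1]; rfl
    · change assocInv _ _ _ (tm (stm X s 1 1) (ψ (X.bottSamelsonOne (a ++ l)))) = _
      rw [h2]; rfl

theorem exists_bs_altWord (hbraid : X.HasBraidMorphisms) {s t : B} (hst : s ≠ t)
    (hm : M s t ≠ 0) : ∃ φ, IsHom (X.bottSamelson (CoxeterSystem.altWord s t (M s t)))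
      (X.bottSamelson (CoxeterSystem.altWord t s (M s t))) 0 φ ∧
      φ (X.bottSamelsonOne _) = X.bottSamelsonOne _ := by
  rw [CoxeterSystem.altWord_eq, CoxeterSystem.altWord_eq]
  by_cases h : Even (M s t)
  · obtain ⟨φ, hφ⟩ := hbraid s t hst hm
    rw [if_pos h, if_pos h]
    exact ⟨φ.toLin, φ.isHom, hφ⟩
  · obtain ⟨φ, hφ⟩ := hbraid t s hst.symm (by rwa [M.symmetric])
    rw [if_neg h, if_neg h, M.symmetric s t]
    exact ⟨φ.toLin, φ.isHom, hφ⟩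

/-- Bott-Samelson bimodules of reduced words with the same product are related by homomorphisms that
preserve `(1 ⊗ 1) ⊗ ⋯ ⊗ (1 ⊗ 1)`. -/
theorem exists_bs_hom (hbraid : X.HasBraidMorphisms) {l l' : List B} (hl : cs.IsReduced l)
    (hl' : cs.IsReduced l') (h : cs.wordProd l = cs.wordProd l') :
    ∃ φ, IsHom (X.bottSamelson l) (X.bottSamelson l') 0 φ ∧
      φ (X.bottSamelsonOne l) = X.bottSamelsonOne l' := by
  refine cs.matsumoto (r := fun l l' => ∃ φ, IsHom (X.bottSamelson l) (X.bottSamelson l') 0 φ ∧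
      φ (X.bottSamelsonOne l) = X.bottSamelsonOne l') ?_ ?_ ?_ ?_ hl hl' h
  · exact fun l => ⟨_, IsHom.id, rfl⟩
  · rintro l₁ l₂ l₃ ⟨φ, hφ, h1⟩ ⟨ψ, hψ, h2⟩
    exact ⟨_, hψ.comp hφ (add_zero 0), by rw [LinearMap.comp_apply, h1, h2]⟩
  · rintro s l₁ l₂ ⟨φ, hφ, h1⟩
    refine ⟨_, (IsHom.id (N := X.simpleObj s)).tensorMap hφ (add_zero 0), ?_⟩
    change tm (stm X s 1 1) (φ (X.bottSamelsonOne l₁)) = _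
    rw [h1]; rfl
  · intro s t hst hm l
    obtain ⟨φ, hφ, h1⟩ := exists_bs_altWord hbraid hst hm
    obtain ⟨-, α, hα, h2⟩ := exists_bs_append (X := X) (CoxeterSystem.altWord s t (M s t)) l
    obtain ⟨⟨β, hβ, h3⟩, -⟩ := exists_bs_append (X := X) (CoxeterSystem.altWord t s (M s t)) l
    refine ⟨_, hβ.comp ((hφ.tensorMap (IsHom.id (N := X.bottSamelson l)) (add_zero 0)).comp hα
      (add_zero 0)) (add_zero 0), ?_⟩
    change β (tensorMap φ LinearMap.id (IsHom.id (N := X.bottSamelson l)).map_left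
      (α (X.bottSamelsonOne _))) = _
    rw [h2, tensorMap_tm, h1, ← h3]; rfl

theorem exists_bs_hom_can (hbraid : X.HasBraidMorphisms) {l l' : List B} (hl : cs.IsReduced l)
    (hl' : cs.IsReduced l') (h : cs.wordProd l = cs.wordProd l') :
    ∃ φ, IsHom (X.bottSamelson l) (X.bottSamelson l') 0 φ ∧ ∀ b, can X l' (φ b) = can X l b := by
  obtain ⟨φ, hφ, h1⟩ := exists_bs_hom hbraid hl hl' h
  refine ⟨φ, hφ, ?_⟩
  have hlen : l.length = l'.length := by
    have e1 : cs.length (cs.wordProd l) = l.length := hl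
    have e2 : cs.length (cs.wordProd l') = l'.length := hl'
    rw [← e1, ← e2, h]
  have hc := (isChar_can X l').comp hφ (zero_add _)
  rw [← h, ← hlen] at hc
  have h0 := (hc.sub (isChar_can X l)).eq_zero_of_one hl (by
    rw [LinearMap.sub_apply, LinearMap.comp_apply, h1, can_one, can_one, sub_self])
  intro b
  exact sub_eq_zero.1 (DFunLike.congr_fun h0 b)

/-! ### Lifting homomorphisms to Bott-Samelson bimodules -/

/-- Each homomorphism from `N` to `R_x` factors through the Bott-Samelson bimodule of each reduced
word of `x`. -/
def Lifts (N : PreObj.{u, v, w₁} X) : Prop :=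
  ∀ l, cs.IsReduced l → ∀ d ψ, IsChar N (cs.wordProd l) d ψ →
    ∃ g, IsHom N (X.bottSamelson l) (d - l.length) g ∧ ∀ n, can X l (g n) = ψ n

theorem Lifts.of_retract (hP : P.Lifts) (hL : L.Lifts) (h : IsRetractOfPair N P L) : N.Lifts := by
  obtain ⟨d, p₁, p₂, j₁, j₂, hp₁, hp₂, hj₁, hj₂, h⟩ := h
  intro l hl e ψ hψ
  obtain ⟨g₁, hg₁, h1⟩ := hP l hl (-d + e) _ (hψ.comp hj₁ rfl)
  obtain ⟨g₂, hg₂, h2⟩ := hL l hl (-d + e) _ (hψ.comp hj₂ rfl)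
  refine ⟨_, (hg₁.comp hp₁ (by ring)).add (hg₂.comp hp₂ (by ring)), fun n => ?_⟩
  rw [LinearMap.add_apply, map_add, LinearMap.comp_apply, LinearMap.comp_apply, h1, h2,
    LinearMap.comp_apply, LinearMap.comp_apply, ← map_add, h]

theorem stdObj_one_lifts : (X.stdObj 1).Lifts := by
  intro l hl d ψ hψ
  by_cases hx : cs.wordProd l = 1
  · have : l = [] := by
      have e1 : cs.length (cs.wordProd l) = l.length := hl
      rw [hx, CoxeterSystem.length_one, eq_comm, List.length_eq_zero_iff] at e1
      exact e1
    subst this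
    have h' : IsHom (X.stdObj 1) (X.stdObj 1) d ((unStd 1).symm.toLinearMap ∘ₗ ψ) := hψ.isHom
    refine ⟨(unStd 1).symm.toLinearMap ∘ₗ ψ, ?_, fun n => rfl⟩
    rw [List.length_nil, Nat.cast_zero, sub_zero]
    exact h'
  · refine ⟨0, IsHom.zero, fun n => ?_⟩
    have h1 := hψ.map_loc 1 (Ne.symm hx) _ (stdOne_mem_locSub 1)
    have h2 : ψ (unStd (X := X) 1 n • stdOne X 1) = 0 := by rw [map_smul, h1, smul_zero]
    rw [unStd_smul_stdOne] at h2
    rw [h2]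
    exact map_zero _

section Step

variable {s : B} (φ : N.carrier →ₗ[X.R] P.carrier)
  (hφ : ∀ c ∈ X.invariants (cs.parabolic {s}), ∀ n, φ (N.left c n) = P.left c (φ n))

theorem left_left (a b : X.R) (n : N.carrier) : N.left a (N.left b n) = N.left (a * b) n := by
  rw [map_mul]; rfl

theorem left_sub_left (a b : X.R) (n : N.carrier) : N.left a n - N.left b n = N.left (a - b) n := by
  rw [map_sub]; rfl

/-- The commutator of `∂_s` with the multiplication by `δ_s`, twisted on the source. -/
theorem fund_ind_demazure_sub (z : ((X.simpleObj s).tensor N).carrier) :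
    P.left (X.fund s) (ind (X.demazure s) φ hφ z) - ind (X.demazure s) φ hφ
      (((X.simpleObj s).tensor N).left (X.actR (cs.simple s) (X.fund s)) z) =
    ind LinearMap.id φ hφ z := by
  induction z using simpleTensor_induction with
  | tm f g n =>
    rw [left_tm, simple_left_stm, ind_tm, ind_tm, ind_tm, left_left, left_sub_left]
    refine congrArg (fun t => P.left t (φ (N.left g n))) ?_
    have h1 : X.demazure s (X.actR (cs.simple s) (X.fund s)) = -1 := by
      apply mul_left_cancel₀ (X.rootR_ne_zero s)
      rw [rootR_mul_demazure, actR_simple_simple, actR_fund]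
      ring
    rw [demazure_mul, h1, actR_simple_simple, LinearMap.id_apply]
    ring
  | add a b ha hb =>
    simp only [map_add] at *
    rw [← ha, ← hb]
    abel

/-- The commutator of `∂_s` with the multiplication by `δ_s`, twisted on the target. -/
theorem ind_demazure_fund_sub (z : ((X.simpleObj s).tensor N).carrier) :
    ind (X.demazure s) φ hφ (((X.simpleObj s).tensor N).left (X.fund s) z) -
      P.left (X.fund s) (ind (X.demazure s) φ hφ z) =
    ind (actLin X (simple_mem_parabolic_self s)) φ hφ z := by
  induction z using simpleTensor_induction with
  | tm f g n =>
    rw [left_tm, simple_left_stm, ind_tm, ind_tm, ind_tm, left_left, left_sub_left]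
    refine congrArg (fun t => P.left t (φ (N.left g n))) ?_
    rw [demazure_mul, demazure_fund, actR_fund, actLin_apply]
    linear_combination -X.rootR_mul_demazure s f
  | add a b ha hb =>
    simp only [map_add] at *
    rw [← ha, ← hb]
    abel

theorem ind_demazure_mem_deg (hNg : N.IsGraded) (hPg : P.IsGraded) {e : ℤ}
    (hdeg : ∀ i, ∀ n ∈ N.deg i, φ n ∈ P.deg (i + e)) {i : ℤ} :
    ∀ z ∈ ((X.simpleObj s).tensor N).deg i, ind (X.demazure s) φ hφ z ∈ P.deg (i + e - 1) := by
  refine tensor_deg_le (S := (P.deg (i + e - 1)).comap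
      (ind (X.demazure s) φ hφ).toAddMonoidHom) fun a b hab z hz n hn => ?_
  revert z
  refine invObj_deg_le (k := a + 1) (S := (P.deg (i + e - 1)).comap
    ((ind (X.demazure s) φ hφ).toAddMonoidHom.comp ((LinearMap.applyₗ n).toAddMonoidHom.comp
      (tmulHom (X.simpleObj s) N)))) fun p q hpq f hf g hg => ?_
  have := hPg.left_deg _ _ _ _ (X.demazure_mem_degR s hf)
    (hdeg _ _ (hNg.left_deg q b g n hg hn))
  rwa [show p - 2 + (q + b + e) = i + e - 1 by omega] at this

/-- Composition of a homomorphism `t : L → B_s ⊗ N` with the map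
`(f ⊗ g) ⊗ n ↦ ∂_s(f) φ(g n)`, extended to `B_s ⊗ L`. On the components of `B_s ⊗ L` at `e` and `s`,
it is given by `(f ⊗ g) ⊗ n ↦ f φ(g n)` and by `(f ⊗ g) ⊗ n ↦ s(f) φ(g n)`. -/
theorem exists_isHom_ind_demazure (hL : L.LocLeft) (hLg : L.IsGraded) (hNg : N.IsGraded)
    (hPg : P.IsGraded) {d e k : ℤ} (hk : d + e = k)
    (hdeg : ∀ i, ∀ n ∈ N.deg i, φ n ∈ P.deg (i + e))
    (h₁ : ∀ x, ∀ z ∈ ((X.simpleObj s).tensor N).locSub x, ind LinearMap.id φ hφ z ∈ P.locSub x)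
    (h₂ : ∀ x, ∀ z ∈ ((X.simpleObj s).tensor N).locSub x,
      ind (actLin X (simple_mem_parabolic_self s)) φ hφ z ∈ P.locSub (cs.simple s * x))
    {t : L.carrier →ₗ[X.R] ((X.simpleObj s).tensor N).carrier} (ht : IsHom L _ d t) :
    ∃ G, IsHom ((X.simpleObj s).tensor L) P k G ∧
      (∀ l, G (tm (cE X s) l) = ind LinearMap.id φ hφ (t l)) ∧
      (∀ l, G (tm (cS X s) l) =
        ind (actLin X (simple_mem_parabolic_self s)) φ hφ (t l)) := by
  have hψ : ∀ c ∈ X.invariants (cs.parabolic {s}), ∀ l,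
      (ind (X.demazure s) φ hφ ∘ₗ t) (L.left c l) =
        P.left c ((ind (X.demazure s) φ hφ ∘ₗ t) l) := fun c hc l => by
    rw [LinearMap.comp_apply, ht.map_left, ind_left_of_mem _ _ _ hc]; rfl
  have e₁ : ∀ l, P.left (X.fund s) ((ind (X.demazure s) φ hφ ∘ₗ t) l) -
      (ind (X.demazure s) φ hφ ∘ₗ t) (L.left (X.actR (cs.simple s) (X.fund s)) l) =
      ind LinearMap.id φ hφ (t l) := fun l => by
    rw [LinearMap.comp_apply, LinearMap.comp_apply, ht.map_left, fund_ind_demazure_sub]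
  have e₂ : ∀ l, (ind (X.demazure s) φ hφ ∘ₗ t) (L.left (X.fund s) l) -
      P.left (X.fund s) ((ind (X.demazure s) φ hφ ∘ₗ t) l) =
      ind (actLin X (simple_mem_parabolic_self s)) φ hφ (t l) := fun l => by
    rw [LinearMap.comp_apply, LinearMap.comp_apply, ht.map_left, ind_demazure_fund_sub]
  refine ⟨_, isHom_ind (e := k - 1) hL hLg hPg _ hψ (by ring) (fun i l hl => ?_) (fun x l hl => ?_)
    (fun x l hl => ?_), fun l => ?_, fun l => ?_⟩
  · have := ind_demazure_mem_deg φ hφ hNg hPg hdeg _ (ht.map_deg i l hl)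
    rwa [show i + d + e - 1 = i + (k - 1) by omega] at this
  · rw [e₁]
    exact h₁ x _ (ht.map_loc x l hl)
  · rw [e₂]
    have := h₂ _ _ (ht.map_loc _ l hl)
    rwa [CoxeterSystem.simple_mul_simple_cancel_left] at this
  · rw [ind_tm_cE, e₁]
  · rw [ind_tm_cS, e₂]

/-- The map `(f ⊗ g) ⊗ n ↦ f (g n)`. -/
theorem isHom_ind_mul (hN : N.LocLeft) (hNg : N.IsGraded) :
    IsHom ((X.simpleObj s).tensor N) N 1
      (ind LinearMap.id LinearMap.id (fun _ _ _ => rfl)) :=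
  isHom_ind hN hNg hNg LinearMap.id (fun _ _ _ => rfl) (zero_add 1)
    (fun i n hn => by simpa using hn)
    (fun x n hn => sub_mem (hN.left_mem hn _) (hN.left_mem hn _))
    (fun x n hn => by
      rw [LinearMap.id_apply, LinearMap.id_apply, sub_self]; exact zero_mem _)

/-- The map `n ↦ (1 ⊗ 1) ⊗ n`. -/
def inOne (s : B) (N : PreObj.{u, v, w₁} X) :
    N.carrier →ₗ[X.R] ((X.simpleObj s).tensor N).carrier := tmulHom _ _ (stm X s 1 1)

theorem inOne_apply (n : N.carrier) : inOne s N n = tm (stm X s 1 1) n := rfl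

theorem inOne_left (c : X.R) (hc : c ∈ X.invariants (cs.parabolic {s})) (n : N.carrier) :
    inOne s N (N.left c n) = ((X.simpleObj s).tensor N).left c (inOne s N n) := by
  rw [inOne_apply, inOne_apply, left_tm, ← smul_tm_left, left_of_mem hc]

theorem ind_id_inOne (z : ((X.simpleObj s).tensor N).carrier) :
    ind LinearMap.id (inOne s N) inOne_left z = z := by
  induction z using simpleTensor_induction with
  | tm f g n => rw [ind_tm, LinearMap.id_apply, inOne_apply, ← tm_stm]
  | add a b ha hb => rw [map_add, ha, hb]

theorem stm_fund_add : stm X s (X.fund s) 1 + stm X s (X.actR (cs.simple s) (X.fund s)) 1 =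
    stm X s 1 (X.fund s) + stm X s 1 (X.actR (cs.simple s) (X.fund s)) := by
  rw [← add_stm, ← stm_add]
  have h1 : X.fund s + X.actR (cs.simple s) (X.fund s) ∈ X.invariants (cs.parabolic {s}) := by
    rw [mem_invariants_singleton, map_add, X.actR_simple_simple, add_comm]
  have := stm_mul h1 1 1
  rwa [mul_one] at this

/-- The twist `(f ⊗ g) ⊗ n ↦ (s(f) ⊗ g) ⊗ n` of `B_s ⊗ N` permutes the components. -/
theorem ind_actLin_inOne_mem (hN : N.LocLeft) (x : W) :
    ∀ z ∈ ((X.simpleObj s).tensor N).locSub x,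
      ind (actLin X (simple_mem_parabolic_self s)) (inOne s N) inOne_left z ∈
        ((X.simpleObj s).tensor N).locSub (cs.simple s * x) := by
  have h0 : ∀ f n, tm (stm X s 1 1) (N.left f n) = tm (stm X s 1 f) n := fun f n => by
    rw [← smul_tm_left, simple_smul_stm, mul_one]
  refine simpleTensor_map_loc hN (fun n hn => ?_) (fun n hn => ?_)
  · have : ind (actLin X (simple_mem_parabolic_self s)) (inOne s N) inOne_left (tm (cE X s) n) =
        tm (cS X s) n := by
      rw [cE, sub_tm, map_sub, ind_tm, ind_tm, actLin_apply, actLin_apply, map_one, map_one,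
        map_one, inOne_apply, inOne_apply, left_tm, simple_left_stm, h0, mul_one]
      simp only [Module.End.one_apply]
      rw [← sub_tm, cS, eq_sub_of_add_eq' stm_fund_add]
      congr 1
      abel
    rw [this]
    exact tm_mem_locSub rfl (cS_mem_locSub X s) hn
  · have : ind (actLin X (simple_mem_parabolic_self s)) (inOne s N) inOne_left (tm (cS X s) n) =
        tm (cE X s) n := by
      rw [cS, sub_tm, map_sub, ind_tm, ind_tm, actLin_apply, actLin_apply, map_one, map_one,
        map_one, inOne_apply, inOne_apply, left_tm, simple_left_stm, h0, mul_one]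
      simp only [Module.End.one_apply]
      rw [← sub_tm, cE, eq_sub_of_add_eq' stm_fund_add]
      congr 1
      abel
    rw [this]
    exact tm_mem_locSub (one_mul _) (cE_mem_locSub X s) hn

theorem ind_actLin_id_mem (hN : N.LocLeft) (x : W) :
    ∀ z ∈ ((X.simpleObj s).tensor N).locSub x,
      ind (P := N) (actLin X (simple_mem_parabolic_self s)) LinearMap.id (fun _ _ _ => rfl) z ∈
        N.locSub (cs.simple s * x) := by
  refine simpleTensor_map_loc hN (fun n _ => ?_) (fun n hn => ?_)
  · have : ind (P := N) (actLin X (simple_mem_parabolic_self s)) LinearMap.id (fun _ _ _ => rfl)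
        (tm (cE X s) n) = 0 := by
      rw [cE, sub_tm, map_sub, ind_tm, ind_tm, actLin_apply, actLin_apply, map_one, map_one,
        map_one]
      simp
    rw [this]
    exact zero_mem _
  · rw [cS, sub_tm, map_sub, ind_tm, ind_tm]
    exact sub_mem (hN.left_mem (hN.left_mem hn _) _) (hN.left_mem (hN.left_mem hn _) _)

theorem can_ind_actLin (l : List B) (z : ((X.simpleObj s).tensor (X.bottSamelson l)).carrier) :
    can X l (ind (P := X.bottSamelson l) (actLin X (simple_mem_parabolic_self s)) LinearMap.id
      (fun _ _ _ => rfl) z) = can X (s :: l) z := by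
  induction z using simpleTensor_induction with
  | tm f g n =>
    rw [ind_tm, can_left, can_tm, CoxeterSystem.wordProd_cons, mul_inv_rev, actR_mul _ _ _ f,
      CoxeterSystem.inv_simple]
    rfl
  | add a b ha hb => rw [map_add, map_add, ha, hb]; exact (map_add (can X (s :: l)) a b).symm

/-- The inductive step: if homomorphisms from `N` to the `R_x` can be lifted, then so can those from
`B_s ⊗ N`. If `s x < x`, the component of the homomorphism at `e ∈ {e, s}` is lifted first, else
the one at `s`; the remainder is then essentially a homomorphism `N → R_{sx}`, resp. `N → R_x`. -/
theorem Lifts.simpleTensor (hbraid : X.HasBraidMorphisms) (hN : N.LocLeft) (hNg : N.IsGraded)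
    (hlift : N.Lifts) (s : B) : ((X.simpleObj s).tensor N).Lifts := by
  intro l hl d ψ hψ
  have hlen : cs.length (cs.wordProd l) = l.length := hl
  rcases cs.length_simple_mul (cs.wordProd l) s with hx | hx
  · have hsl : cs.IsReduced (s :: l) := by
      change cs.length (cs.wordProd (s :: l)) = _
      rw [CoxeterSystem.wordProd_cons, hx, hlen, List.length_cons]
    obtain ⟨t, ht, htc⟩ : ∃ t : N.carrier →ₗ[X.R]
        ((X.simpleObj s).tensor (X.bottSamelson l)).carrier,
        IsHom N ((X.simpleObj s).tensor (X.bottSamelson l)) (d - l.length) t ∧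
        ∀ n, can X (s :: l) (t n) = ψ (tm (cS X s) n) := by
      have h := hψ.cS
      rw [← CoxeterSystem.wordProd_cons] at h
      obtain ⟨t, ht, htc⟩ := hlift (s :: l) hsl _ _ h
      refine ⟨t, ?_, htc⟩
      rw [List.length_cons] at ht
      rwa [show d - (l.length : ℤ) = d + 1 - ((l.length + 1 : ℕ) : ℤ) by push_cast; ring]
    obtain ⟨G, hG, -, hGS⟩ := exists_isHom_ind_demazure (P := X.bottSamelson l) LinearMap.id
      (fun _ _ _ => rfl) hN hNg (bs_isGraded X l) (bs_isGraded X l) (e := 0) (add_zero _)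
      (fun i n hn => by simpa using hn)
      (isHom_ind_mul (bs_locLeft X l) (bs_isGraded X l)).map_loc
      (ind_actLin_id_mem (bs_locLeft X l)) ht
    have h1 := hψ.sub ((isChar_can X l).comp hG (by ring))
    have h2 := h1.of_cS_eq_zero fun n => by
      rw [LinearMap.sub_apply, LinearMap.comp_apply, hGS, can_ind_actLin, htc, sub_self]
    obtain ⟨c, hc, hcc⟩ := hlift l hl _ _ h2
    have hF := (isHom_ind_mul (s := s) (bs_locLeft X l) (bs_isGraded X l)).comp
      ((IsHom.id (N := X.simpleObj s)).tensorMap hc (zero_add _)) (k := d - l.length) (by ring)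
    refine ⟨_, hG.add hF, fun z => ?_⟩
    have h3 := (h1.sub ((isChar_can X l).comp hF (by ring))).eq_zero_of_inOne fun n => by
      rw [LinearMap.sub_apply, LinearMap.comp_apply, LinearMap.comp_apply, tensorMap_tm,
        LinearMap.id_apply, ind_tm, LinearMap.id_apply, map_one]
      exact sub_eq_zero.2 (hcc n).symm
    have h4 := DFunLike.congr_fun h3 z
    rw [LinearMap.add_apply, map_add]
    simp only [LinearMap.sub_apply, LinearMap.zero_apply, LinearMap.comp_apply] at h4 ⊢
    linear_combination -h4
  · obtain ⟨l', hl', hw⟩ := cs.exists_isReduced (cs.simple s * cs.wordProd l)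
    have hw' : cs.wordProd (s :: l') = cs.wordProd l := by
      rw [CoxeterSystem.wordProd_cons, ← hw, CoxeterSystem.simple_mul_simple_cancel_left]
    have hlen' : l.length = l'.length + 1 := by
      have : cs.length (cs.wordProd l') = l'.length := hl'
      rw [← hw] at this
      omega
    have hsl : cs.IsReduced (s :: l') := by
      change cs.length (cs.wordProd (s :: l')) = _
      rw [hw', hlen, hlen', List.length_cons]
    obtain ⟨ρ, hρ, hρc⟩ := exists_bs_hom_can hbraid hsl hl hw'
    rw [← hw'] at hψ
    obtain ⟨t, ht, htc⟩ : ∃ t : N.carrier →ₗ[X.R]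
        ((X.simpleObj s).tensor (X.bottSamelson l')).carrier,
        IsHom N ((X.simpleObj s).tensor (X.bottSamelson l')) (d - l'.length) t ∧
        ∀ n, can X (s :: l') (t n) = ψ (tm (cE X s) n) := by
      obtain ⟨t, ht, htc⟩ := hlift (s :: l') hsl _ _ hψ.cE
      refine ⟨t, ?_, htc⟩
      rw [List.length_cons] at ht
      rwa [show d - (l'.length : ℤ) = d + 1 - ((l'.length + 1 : ℕ) : ℤ) by push_cast; ring]
    obtain ⟨G, hG, hGE, -⟩ := exists_isHom_ind_demazure (inOne s (X.bottSamelson l')) inOne_left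
      hN hNg (bs_isGraded X l') ((X.simpleObj_isGraded s).tensor (bs_isGraded X l')) (e := -1)
      (k := d - l.length) (by rw [hlen']; push_cast; ring)
      (fun i n hn => tm_mem_deg (add_comm _ _) IsChar.one_mem_simple_deg hn)
      (fun x z hz => by rwa [ind_id_inOne]) (ind_actLin_inOne_mem (bs_locLeft X l')) ht
    obtain ⟨cn, hcn⟩ : ∃ cn : ((X.simpleObj s).tensor (X.bottSamelson l')).carrier →ₗ[X.R] X.R,
        cn = can X (s :: l') := ⟨_, rfl⟩
    have hcan : IsChar ((X.simpleObj s).tensor (X.bottSamelson l')) (cs.wordProd (s :: l'))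
        l.length cn := by
      have := isChar_can X (s :: l')
      rw [List.length_cons, ← hlen'] at this
      rw [hcn]
      exact this
    have hcn' : ∀ z, can X (s :: l') z = cn z := fun z =>
      (DFunLike.congr_fun hcn z).symm
    have h1 := hψ.sub (hcan.comp hG (by ring))
    have h2 := h1.of_cE_eq_zero fun n => by
      rw [LinearMap.sub_apply, LinearMap.comp_apply, hGE, ind_id_inOne]
      exact sub_eq_zero.2 ((htc n).symm.trans (hcn' _))
    rw [CoxeterSystem.wordProd_cons, CoxeterSystem.simple_mul_simple_cancel_left] at h2
    obtain ⟨c, hc, hcc⟩ := hlift l' hl' _ _ h2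
    have hF := (IsHom.id (N := X.simpleObj s)).tensorMap hc (k := d - l.length)
      (by rw [hlen']; push_cast; ring)
    refine ⟨ρ ∘ₗ (G + tensorMap LinearMap.id c hc.map_left), hρ.comp (hG.add hF) (by ring),
      fun z => ?_⟩
    have h3 := (h1.sub (hcan.comp hF (by ring))).eq_zero_of_inOne fun n => by
      have h5 : cn (tm (stm X s 1 1) (c n)) = _ :=
        (hcn' _).symm.trans ((can_tm_one X s l' (c n)).trans (hcc n))
      rw [LinearMap.sub_apply, LinearMap.comp_apply, tensorMap_tm, LinearMap.id_apply]
      exact sub_eq_zero.2 h5.symm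
    have h4 := DFunLike.congr_fun h3 z
    have h6 : can X l ((ρ ∘ₗ (G + tensorMap LinearMap.id c hc.map_left)) z) =
        cn (G z) + cn (tensorMap LinearMap.id c hc.map_left z) :=
      ((hρc _).trans (hcn' _)).trans (map_add cn _ _)
    rw [h6]
    simp only [LinearMap.sub_apply, LinearMap.zero_apply, LinearMap.comp_apply] at h4 ⊢
    linear_combination -h4

end Step

variable {N : PreObj.{u, v, max u v} X}

/-- A Soergel bimodule is torsion free as a right module, and all homomorphisms from it to the
`R_x` lift to Bott-Samelson bimodules. -/
theorem _root_.CoxeterRealization.IsSoergel.torsionFree_and_lifts (hN : X.IsSoergel N)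
    (hbraid : X.HasBraidMorphisms) : N.TorsionFree ∧ N.Lifts := by
  have h := hN.induction_of_tensor (fun N => N.IsGraded ∧ N.LocLeft ∧ N.TorsionFree ∧ N.Lifts)
    (fun N h => h.1) (fun N h => h.2.1)
    (fun N P L hN h hP hL => ⟨hN, h.locLeft hP.2.1 hL.2.1, h.torsionFree hP.2.2.1 hL.2.2.1,
      hP.2.2.2.of_retract hL.2.2.2 h⟩)
    ⟨stdObj_isGraded 1, stdObj_locLeft 1, stdObj_torsionFree 1, stdObj_one_lifts⟩
    (fun s N h => ⟨(X.simpleObj_isGraded s).tensor h.1, (X.simpleObj_locLeft s).tensor h.2.1,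
      h.2.2.1.simpleTensor s, h.2.2.2.simpleTensor hbraid h.2.1 h.1 s⟩)
  exact h.2.2

end PreObj

end CoxeterRealization

/-! ### Linear forms in the symmetric algebra -/

/-- Dedekind's independence of characters, for ring homomorphisms to a domain. -/
theorem eq_zero_of_sum_mul_ringHom {A L ι : Type*} [CommRing A] [CommRing L] [IsDomain L]
    (s : Finset ι) {σ : ι → A →+* L} (hσ : Function.Injective σ) {a : ι → L}
    (h : ∀ f, ∑ i ∈ s, a i * σ i f = 0) : ∀ i ∈ s, a i = 0 := by
  have hinj : Function.Injective fun i => ((σ i : A →+* L) : A →* L) := fun i j hij =>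
    hσ (RingHom.ext fun x => DFunLike.congr_fun hij x)
  have := (linearIndependent_monoidHom A L).comp _ hinj
  refine linearIndependent_iff'.1 this s a (funext fun f => ?_)
  rw [Finset.sum_apply]
  exact h f

namespace CoxeterRealization

section Linear

variable {K : Type u} {V : Type v} [CommRing K] [AddCommGroup V] [Module K V]

theorem algHom_sub_mem {A : Type*} [CommRing A] [Algebra K A] (F G : SymmetricAlgebra K V →ₐ[K] A)
    (I : Ideal A) (h : ∀ v, F (SymmetricAlgebra.ι K V v) - G (SymmetricAlgebra.ι K V v) ∈ I)
    (f : SymmetricAlgebra K V) : F f - G f ∈ I := by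
  have : (Ideal.Quotient.mkₐ K I).comp F = (Ideal.Quotient.mkₐ K I).comp G := by
    apply SymmetricAlgebra.algHom_ext
    ext v
    exact Ideal.Quotient.eq.2 (h v)
  exact Ideal.Quotient.eq.1 (DFunLike.congr_fun this f)

/-- The algebra endomorphism of the symmetric algebra induced by `v ↦ v - φ(v) α`. -/
def shear (φ : V →ₗ[K] K) (α : V) : SymmetricAlgebra K V →ₐ[K] SymmetricAlgebra K V :=
  SymmetricAlgebra.lift (SymmetricAlgebra.ι K V ∘ₗ (LinearMap.id - φ.smulRight α))

variable {φ : V →ₗ[K] K} {α : V}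

theorem shear_ι (v : V) :
    shear φ α (SymmetricAlgebra.ι K V v) = SymmetricAlgebra.ι K V (v - φ v • α) := by
  simp [shear]

theorem shear_self (h : φ α = 1) : shear φ α (SymmetricAlgebra.ι K V α) = 0 := by
  rw [shear_ι, h, one_smul, sub_self, map_zero]

/-- Since `f ≡ shear φ α f` modulo `α`, the kernel of the retraction `shear φ α` is generated
by `α`. -/
theorem ι_dvd_iff (h : φ α = 1) {f : SymmetricAlgebra K V} :
    SymmetricAlgebra.ι K V α ∣ f ↔ shear φ α f = 0 := by
  constructor
  · rintro ⟨g, rfl⟩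
    rw [map_mul, shear_self h, zero_mul]
  · intro hf
    have := algHom_sub_mem (AlgHom.id K _) (shear φ α) (Ideal.span {SymmetricAlgebra.ι K V α})
      (fun v => by
        rw [shear_ι, AlgHom.id_apply, ← map_sub, sub_sub_cancel, map_smul, Algebra.smul_def]
        exact Ideal.mul_mem_left _ _ (Ideal.mem_span_singleton_self _)) f
    rwa [hf, sub_zero, AlgHom.id_apply, Ideal.mem_span_singleton] at this

variable [IsDomain K] [Module.Free K V]

theorem prime_ι (h : φ α = 1) : Prime (SymmetricAlgebra.ι K V α) := by
  refine ⟨fun h0 => ?_, fun hu => ?_, fun f g hfg => ?_⟩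
  · rw [ι_injective (h0.trans (map_zero _).symm), map_zero] at h
    exact zero_ne_one h
  · have := hu.map (shear φ α)
    rw [shear_self h] at this
    exact not_isUnit_zero this
  · rw [ι_dvd_iff h, map_mul, mul_eq_zero] at hfg
    rwa [ι_dvd_iff h, ι_dvd_iff h]

theorem eq_smul_of_ι_dvd_ι (h : φ α = 1) {β : V}
    (hd : SymmetricAlgebra.ι K V α ∣ SymmetricAlgebra.ι K V β) : β = φ β • α := by
  rw [ι_dvd_iff h, shear_ι] at hd
  exact sub_eq_zero.1 (ι_injective (hd.trans (map_zero _).symm))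

end Linear

variable {K : Type u} {V : Type v} [CommRing K] [AddCommGroup V] [Module K V]
  {B W : Type*} [Group W] {M : CoxeterMatrix B} {cs : CoxeterSystem M W}
  (X : CoxeterRealization K V cs)

/-! ### Roots of reflections -/

theorem exists_reflRoot {t : W} (ht : cs.IsReflection t) :
    ∃ w s, t = w * cs.simple s * w⁻¹ ∧ X.reflRoot t = X.act w (X.root s) :=
  ⟨ht.choose, ht.choose_spec.choose, ht.choose_spec.choose_spec, by simp [reflRoot, ht]⟩

theorem act_mul_apply (w w' : W) (v : V) : X.act (w * w') v = X.act w (X.act w' v) := by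
  rw [map_mul]; rfl

@[simp] theorem act_inv_act (w : W) (v : V) : X.act w⁻¹ (X.act w v) = v := by
  rw [← act_mul_apply, inv_mul_cancel, map_one]; rfl

@[simp] theorem act_act_inv (w : W) (v : V) : X.act w (X.act w⁻¹ v) = v := by
  rw [← act_mul_apply, mul_inv_cancel, map_one]; rfl

theorem act_conj (w : W) (s : B) (v : V) : X.act (w * cs.simple s * w⁻¹) v =
    v - X.coroot s (X.act w⁻¹ v) • X.act w (X.root s) := by
  rw [act_mul_apply, act_mul_apply, X.act_simple, map_sub, map_smul, act_act_inv]

theorem exists_act_reflection {t : W} (ht : cs.IsReflection t) (v : V) :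
    ∃ c : K, X.act t v = v - c • X.reflRoot t := by
  obtain ⟨w, s, rfl, h⟩ := X.exists_reflRoot ht
  exact ⟨_, by rw [h]; exact X.act_conj w s v⟩

theorem det_act_reflection [Module.Free K V] [Module.Finite K V] {t : W}
    (ht : cs.IsReflection t) : LinearMap.det (X.act t) = -1 := by
  obtain ⟨w, s, rfl⟩ := ht
  have h1 : LinearMap.det (X.act w) * LinearMap.det (X.act w⁻¹) = 1 := by
    rw [← map_mul, ← map_mul, mul_inv_cancel, map_one, map_one]
  have h2 : X.act (cs.simple s) = LinearMap.transvection (-X.coroot s) (X.root s) := by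
    ext v
    rw [X.act_simple]
    simp [LinearMap.transvection, sub_eq_add_neg]
  rw [map_mul, map_mul, map_mul, map_mul, mul_right_comm, h1, one_mul, h2,
    LinearMap.transvection.det, LinearMap.neg_apply, X.coroot_root]
  norm_num

section Regular

variable [IsDomain K] [Module.Free K V] [hX : X.IsRegular]

theorem act_root_ne_zero (w : W) (s : B) : X.act w (X.root s) ≠ 0 := fun h =>
  hX.root_ne_zero s (by rw [← X.act_inv_act w (X.root s), h, map_zero])

/-- The root `w(α_s)` depends on the reflection `w s w⁻¹` only, up to a unit. -/
theorem exists_act_root_eq_smul (w : W) (s : B) :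
    ∃ c : K, IsUnit c ∧ X.act w (X.root s) = c • X.reflRoot (w * cs.simple s * w⁻¹) := by
  obtain ⟨w', s', h, h'⟩ := X.exists_reflRoot (t := w * cs.simple s * w⁻¹) ⟨w, s, rfl⟩
  rw [h']
  have key : ∀ v, X.coroot s (X.act w⁻¹ v) • X.act w (X.root s) =
      X.coroot s' (X.act w'⁻¹ v) • X.act w' (X.root s') := fun v => by
    have h1 := X.act_conj w s v
    rw [h, act_conj] at h1
    exact (sub_right_injective h1).symm
  obtain ⟨a, ha⟩ := hX.coroot_surjective s 1
  obtain ⟨a', ha'⟩ := hX.coroot_surjective s' 1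
  have h1 := key (X.act w a)
  rw [act_inv_act, ha, one_smul] at h1
  have h2 := key (X.act w' a')
  rw [act_inv_act, ha', one_smul] at h2
  refine ⟨_, ?_, h1⟩
  refine IsUnit.of_mul_eq_one (X.coroot s (X.act w⁻¹ (X.act w' a'))) ?_
  have h3 : (1 - X.coroot s' (X.act w'⁻¹ (X.act w a)) * X.coroot s (X.act w⁻¹ (X.act w' a'))) •
      X.act w (X.root s) = 0 := by
    rw [sub_smul, one_smul, mul_smul, h2, ← h1, sub_self]
  exact (sub_eq_zero.1 ((smul_eq_zero.1 h3).resolve_right (X.act_root_ne_zero w s))).symm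

end Regular

/-! ### Antisymmetrization -/

/-- The algebra endomorphism of `R` induced by an endomorphism of `V`. -/
def symMap (φ : V →ₗ[K] V) : X.R →ₐ[K] X.R :=
  SymmetricAlgebra.lift (SymmetricAlgebra.ι K V ∘ₗ φ)

theorem symMap_ι (φ : V →ₗ[K] V) (v : V) :
    X.symMap φ (SymmetricAlgebra.ι K V v) = SymmetricAlgebra.ι K V (φ v) := by
  simp [symMap]

theorem symMap_act (w : W) : X.symMap (X.act w) = X.actR w := rfl

theorem symMap_comp (φ ψ : V →ₗ[K] V) (f : X.R) :
    X.symMap (φ ∘ₗ ψ) f = X.symMap φ (X.symMap ψ f) := by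
  have : X.symMap (φ ∘ₗ ψ) = (X.symMap φ).comp (X.symMap ψ) := by
    apply SymmetricAlgebra.algHom_ext
    ext v
    simp [symMap_ι]
  rw [this]; rfl

theorem symMap_injective [Module.Free K V] :
    Function.Injective fun φ => (X.symMap φ : X.R →+* X.R) := fun φ ψ h => by
  ext v
  refine ι_injective (K := K) ?_
  rw [← X.symMap_ι, ← X.symMap_ι]
  exact DFunLike.congr_fun h (SymmetricAlgebra.ι K V v)

variable (H : Subgroup W) [Finite H]

/-- The set of the endomorphisms of `V` by which the elements of `H` act. -/
def actImage : Finset (V →ₗ[K] V) := (Set.finite_range fun h : H => X.act h).toFinset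

variable {H}

theorem mem_actImage {φ : V →ₗ[K] V} : φ ∈ X.actImage H ↔ ∃ h ∈ H, X.act h = φ := by
  simp [actImage]

variable (H) in
/-- The antisymmetrization `f ↦ ∑ det(φ) φ(f)`; the sum is over the image of `H` in `GL(V)`, so
that no cancellation occurs if the action of `H` is not faithful. -/
def altSum : X.R →ₗ[K] X.R :=
  ∑ φ ∈ X.actImage H, LinearMap.det φ • (X.symMap φ).toLinearMap

theorem altSum_apply (f : X.R) : X.altSum H f =
    ∑ φ ∈ X.actImage H, algebraMap K X.R (LinearMap.det φ) * X.symMap φ f := by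
  simp [altSum, LinearMap.sum_apply, Algebra.smul_def]

theorem symMap_of_mem_invariants {c : X.R} (hc : c ∈ X.invariants H) {φ : V →ₗ[K] V}
    (hφ : φ ∈ X.actImage H) : X.symMap φ c = c := by
  obtain ⟨h, hh, rfl⟩ := X.mem_actImage.1 hφ
  exact hc h hh

theorem altSum_mul_of_mem {c : X.R} (hc : c ∈ X.invariants H) (f : X.R) :
    X.altSum H (c * f) = c * X.altSum H f := by
  rw [altSum_apply, altSum_apply, Finset.mul_sum]
  refine Finset.sum_congr rfl fun φ hφ => ?_
  rw [map_mul, X.symMap_of_mem_invariants hc hφ]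
  ring

theorem altSum_mem_degR {k : ℤ} {f : X.R} (hf : f ∈ X.degR k) : X.altSum H f ∈ X.degR k := by
  rw [altSum_apply]
  refine sum_mem fun φ hφ => ?_
  obtain ⟨h, hh, rfl⟩ := X.mem_actImage.1 hφ
  have := X.mul_mem_degR (X.algebraMap_mem_degR (LinearMap.det (X.act h))) (X.actR_mem_degR h hf)
  rwa [zero_add] at this

theorem isUnit_det_of_mem_actImage {φ : V →ₗ[K] V} (hφ : φ ∈ X.actImage H) :
    IsUnit (LinearMap.det φ) := by
  obtain ⟨h, hh, rfl⟩ := X.mem_actImage.1 hφ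
  refine IsUnit.of_mul_eq_one (LinearMap.det (X.act h⁻¹)) ?_
  rw [← map_mul, ← map_mul, mul_inv_cancel, map_one, map_one]

/-- The antisymmetrization is divisible by the root of each reflection `t`: the terms for `φ` and
`t φ` cancel modulo the root. -/
theorem ι_dvd_altSum {t : W} (htH : t ∈ H) (htt : t * t = 1) {φ : V →ₗ[K] K} {α : V}
    (hα : φ α = 1) (hact : ∀ v, ∃ c : K, X.act t v = v - c • α) (hne : X.act t ≠ 1)
    (hdet : LinearMap.det (X.act t) = -1) (f : X.R) :
    SymmetricAlgebra.ι K V α ∣ X.altSum H f := by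
  rw [ι_dvd_iff hα, altSum_apply, map_sum]
  have hshear : ∀ g, shear φ α (X.actR t g) = shear φ α g := fun g => by
    have : (shear φ α).comp (X.actR t) = shear φ α := by
      apply SymmetricAlgebra.algHom_ext
      ext v
      obtain ⟨c, hc⟩ := hact v
      change shear φ α (X.actR t (SymmetricAlgebra.ι K V v)) =
        shear φ α (SymmetricAlgebra.ι K V v)
      rw [actR_ι, hc, map_sub, map_smul, map_sub, map_smul, shear_self hα, smul_zero, sub_zero]
    exact DFunLike.congr_fun this g
  refine Finset.sum_involution (fun ψ _ => X.act t ∘ₗ ψ) (fun ψ _ => ?_) (fun ψ hψ _ => ?_)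
    (fun ψ hψ => ?_) (fun ψ _ => ?_)
  · rw [symMap_comp, symMap_act, LinearMap.det_comp, hdet, map_mul, map_mul, hshear]
    simp
  · obtain ⟨h, hh, rfl⟩ := X.mem_actImage.1 hψ
    intro h1
    apply hne
    ext v
    have := LinearMap.congr_fun h1 (X.act h⁻¹ v)
    simpa using this
  · obtain ⟨h, hh, rfl⟩ := X.mem_actImage.1 hψ
    exact X.mem_actImage.2 ⟨t * h, mul_mem htH hh, map_mul X.act t h⟩
  · ext v
    change X.act t (X.act t (ψ v)) = ψ v
    rw [← act_mul_apply, htt, map_one]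
    rfl

/-- Pairwise non-associated primes which divide `n` have a product which divides `n`. -/
theorem prod_dvd_of_prime {A ι : Type*} [CommRing A] (s : Finset ι) {p : ι → A} {n : A}
    (hp : ∀ i ∈ s, Prime (p i)) (hn : ∀ i ∈ s, ∀ j ∈ s, i ≠ j → ¬ p i ∣ p j)
    (h : ∀ i ∈ s, p i ∣ n) : ∏ i ∈ s, p i ∣ n := by
  classical
  induction s using Finset.induction_on with
  | empty => simp
  | insert a s ha ih =>
    obtain ⟨q, rfl⟩ := ih (fun i hi => hp i (Finset.mem_insert_of_mem hi))
      (fun i hi j hj => hn i (Finset.mem_insert_of_mem hi) j (Finset.mem_insert_of_mem hj))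
      (fun i hi => h i (Finset.mem_insert_of_mem hi))
    have hpa := hp a (Finset.mem_insert_self a s)
    rw [Finset.prod_insert ha, mul_comm (p a)]
    refine mul_dvd_mul_left _ (((hpa.dvd_or_dvd (h a (Finset.mem_insert_self a s)))).resolve_left
      fun h1 => ?_)
    obtain ⟨j, hj, h2⟩ := (hpa.dvd_finsetProd_iff p).1 h1
    exact hn a (Finset.mem_insert_self a s) j (Finset.mem_insert_of_mem hj)
      (fun h => ha (h ▸ hj)) h2

section Domain

variable [IsDomain K] [Module.Free K V]

theorem eq_zero_of_mul_mem_degR_lt {P q : X.R} {n d : ℕ} (hP : P ∈ X.degR (2 * n))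
    (h : P * q ∈ X.degR (2 * d)) (hd : d < n) : P * q = 0 := by
  rw [mem_degR_two_mul] at *
  rw [map_mul, hP] at h
  have h1 := congrArg (fun p => Polynomial.coeff p d) h
  simp only [Polynomial.coeff_monomial, if_true] at h1
  rw [← h1, ← Polynomial.C_mul_X_pow_eq_monomial, mul_right_comm, Polynomial.coeff_mul_X_pow',
    if_neg (by omega)]

theorem altSum_eq_zero_of_forall {a : (V →ₗ[K] V) → X.R}
    (h : ∀ f, ∑ φ ∈ X.actImage H, a φ * X.symMap φ f = 0) : ∀ φ ∈ X.actImage H, a φ = 0 :=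
  eq_zero_of_sum_mul_ringHom (X.actImage H) X.symMap_injective h

end Domain

/-- The determinant of a matrix with homogeneous entries, of degrees `r i + c j`, is
homogeneous. -/
theorem det_mem_degR {n : Type*} [Fintype n] [DecidableEq n]
    {S : Subalgebra K X.R} (G : Matrix n n S) (r c : n → ℤ)
    (h : ∀ i j, (G i j : X.R) ∈ X.degR (r i + c j)) :
    (G.det : X.R) ∈ X.degR (∑ i, r i + ∑ i, c i) := by
  rw [Matrix.det_apply]
  have : ((∑ σ : Equiv.Perm n, Equiv.Perm.sign σ • ∏ i, G (σ i) i : S) : X.R) =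
      ∑ σ : Equiv.Perm n, Equiv.Perm.sign σ • ∏ i, (G (σ i) i : X.R) := by
    rw [← S.val_apply, map_sum]
    refine Finset.sum_congr rfl fun σ _ => ?_
    rw [Units.smul_def, Units.smul_def, map_zsmul, map_prod]
    rfl
  rw [this]
  refine sum_mem fun σ _ => ?_
  rw [Units.smul_def]
  refine zsmul_mem ?_ _
  have h1 := X.prod_mem_degR Finset.univ (fun i => (G (σ i) i : X.R)) (fun i => r (σ i) + c i)
    fun i _ => h _ _
  rwa [Finset.sum_add_distrib, Equiv.sum_comp σ r] at h1

end CoxeterRealization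

theorem map_quantumNumber {K L : Type*} [CommRing K] [CommRing L] (f : K →+* L) (x y : K) (n : ℕ) :
    f (quantumNumber x y n) = quantumNumber (f x) (f y) n := by
  induction n using Nat.twoStepInduction generalizing x y with
  | zero => simp [quantumNumber]
  | one => simp [quantumNumber]
  | more n h1 h2 => simp only [quantumNumber, map_sub, map_mul, h1, h2]

namespace CoxeterRealization

/-! ### Reduction of the base ring -/

section Reduce

variable {K : Type u} {V : Type v} [CommRing K] [AddCommGroup V] [Module K V]
  {k : Type u} {V' : Type v} [CommRing k] [AddCommGroup V'] [Module k V']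
  [Algebra K k] [Module K V'] [IsScalarTower K k V']

/-- `q : V → V'` exhibits `V'` as the base change of `V` along the surjection `K → k`. -/
structure IsReduction (k : Type u) [CommRing k] [Algebra K k] (q : V →ₗ[K] V') : Prop where
  surjective_algebraMap : Function.Surjective (algebraMap K k)
  surjective : Function.Surjective q
  ker_eq : LinearMap.ker q = RingHom.ker (algebraMap K k) • (⊤ : Submodule K V)

namespace IsReduction

variable {q : V →ₗ[K] V'} (hq : IsReduction k q)

include hq in
theorem ker_le {C : Type*} [AddCommGroup C] [Module k C] [Module K C] [IsScalarTower K k C]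
    (f : V →ₗ[K] C) : LinearMap.ker q ≤ LinearMap.ker f := by
  rw [hq.ker_eq, Submodule.smul_le]
  intro a ha v _
  rw [RingHom.mem_ker] at ha
  rw [LinearMap.mem_ker, map_smul, ← algebraMap_smul k a (f v), ha, zero_smul]

/-- The `k`-linear map on `V'` induced by a `K`-linear map from `V` to a `k`-module. -/
def desc {C : Type*} [AddCommGroup C] [Module k C] [Module K C] [IsScalarTower K k C]
    (f : V →ₗ[K] C) : V' →ₗ[k] C :=
  LinearMap.extendScalarsOfSurjective hq.surjective_algebraMap
    ((LinearMap.ker q).liftQ f (hq.ker_le f) ∘ₗ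
      (q.quotKerEquivOfSurjective hq.surjective).symm.toLinearMap)

@[simp] theorem desc_apply {C : Type*} [AddCommGroup C] [Module k C] [Module K C]
    [IsScalarTower K k C] (f : V →ₗ[K] C) (v : V) : hq.desc f (q v) = f v := by
  have : (q.quotKerEquivOfSurjective hq.surjective).symm (q v) = (LinearMap.ker q).mkQ v := by
    rw [LinearEquiv.symm_apply_eq]
    rfl
  change (LinearMap.ker q).liftQ f (hq.ker_le f)
    ((q.quotKerEquivOfSurjective hq.surjective).symm (q v)) = f v
  rw [this]
  rfl

end IsReduction

variable {B W : Type*} [Group W] {M : CoxeterMatrix B} {cs : CoxeterSystem M W}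
  (X : CoxeterRealization K V cs) {q : V →ₗ[K] V'} (hq : IsReduction k q)

/-- The realization over `k` on the base change `V'` of `V`. -/
def reduce : CoxeterRealization k V' cs where
  act :=
    { toFun := fun w => hq.desc (q ∘ₗ X.act w)
      map_one' := LinearMap.ext fun v => by
        obtain ⟨v, rfl⟩ := hq.surjective v
        rw [hq.desc_apply, map_one]; rfl
      map_mul' := fun w w' => LinearMap.ext fun v => by
        obtain ⟨v, rfl⟩ := hq.surjective v
        rw [hq.desc_apply, map_mul, Module.End.mul_apply, hq.desc_apply, LinearMap.comp_apply,
          LinearMap.comp_apply, hq.desc_apply]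
        rfl }
  root s := q (X.root s)
  coroot s := hq.desc (Algebra.linearMap K k ∘ₗ X.coroot s)
  coroot_root s := by
    rw [hq.desc_apply, LinearMap.comp_apply, X.coroot_root, Algebra.linearMap_apply, map_ofNat]
  act_simple s v := by
    obtain ⟨v, rfl⟩ := hq.surjective v
    change hq.desc (q ∘ₗ X.act (cs.simple s)) (q v) = _
    rw [hq.desc_apply, hq.desc_apply, LinearMap.comp_apply, LinearMap.comp_apply, X.act_simple,
      map_sub, map_smul, Algebra.linearMap_apply, algebraMap_smul]
  quantum s t hst := by
    obtain ⟨h1, h2⟩ := X.quantum s t hst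
    rw [hq.desc_apply, hq.desc_apply, LinearMap.comp_apply, LinearMap.comp_apply,
      Algebra.linearMap_apply, Algebra.linearMap_apply, ← map_neg (algebraMap K k),
      ← map_neg (algebraMap K k), ← map_quantumNumber, ← map_quantumNumber, h1, h2, map_zero]
    exact ⟨rfl, rfl⟩

theorem reduce_act_apply (w : W) (v : V) : (X.reduce hq).act w (q v) = q (X.act w v) :=
  hq.desc_apply _ v

theorem reduce_reflRoot (t : W) : (X.reduce hq).reflRoot t = q (X.reflRoot t) := by
  by_cases h : cs.IsReflection t
  · simp only [reflRoot, h, dif_pos]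
    exact X.reduce_act_apply hq _ _
  · simp [reflRoot, h]

/-- The homomorphism `Sym(V) → Sym(V')`. -/
def redR : X.R →ₐ[K] (X.reduce hq).R :=
  SymmetricAlgebra.lift ((SymmetricAlgebra.ι k V').restrictScalars K ∘ₗ q)

theorem redR_ι (v : V) : X.redR hq (SymmetricAlgebra.ι K V v) = SymmetricAlgebra.ι k V' (q v) := by
  simp [redR]

theorem redR_algebraMap (c : K) : X.redR hq (algebraMap K X.R c) =
    algebraMap k (X.reduce hq).R (algebraMap K k c) := by
  rw [AlgHom.commutes]
  exact IsScalarTower.algebraMap_apply K k _ c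

theorem redR_surjective : Function.Surjective (X.redR hq) := by
  intro f
  induction f using SymmetricAlgebra.induction with
  | algebraMap c =>
    obtain ⟨c, rfl⟩ := hq.surjective_algebraMap c
    exact ⟨_, X.redR_algebraMap hq c⟩
  | ι v =>
    obtain ⟨v, rfl⟩ := hq.surjective v
    exact ⟨_, X.redR_ι hq v⟩
  | mul a b ha hb =>
    obtain ⟨a, rfl⟩ := ha
    obtain ⟨b, rfl⟩ := hb
    exact ⟨a * b, map_mul _ _ _⟩
  | add a b ha hb =>
    obtain ⟨a, rfl⟩ := ha
    obtain ⟨b, rfl⟩ := hb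
    exact ⟨a + b, map_add _ _ _⟩

theorem redR_actR (w : W) (f : X.R) :
    X.redR hq (X.actR w f) = (X.reduce hq).actR w (X.redR hq f) := by
  have : (X.redR hq).comp (X.actR w) =
      (((X.reduce hq).actR w).restrictScalars K).comp (X.redR hq) := by
    apply SymmetricAlgebra.algHom_ext
    ext v
    change X.redR hq (X.actR w (SymmetricAlgebra.ι K V v)) =
      (X.reduce hq).actR w (X.redR hq (SymmetricAlgebra.ι K V v))
    rw [actR_ι, redR_ι, redR_ι, actR_ι, reduce_act_apply]
  exact DFunLike.congr_fun this f

theorem mem_map_of_redR_eq_zero {f : X.R} (hf : X.redR hq f = 0) :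
    f ∈ (RingHom.ker (algebraMap K k)).map (algebraMap K X.R) := by
  set I := (RingHom.ker (algebraMap K k)).map (algebraMap K X.R) with hI
  have hker : LinearMap.ker q ≤
      LinearMap.ker ((Ideal.Quotient.mkₐ K I).toLinearMap ∘ₗ SymmetricAlgebra.ι K V) := by
    rw [hq.ker_eq, Submodule.smul_le]
    intro a ha v _
    change Ideal.Quotient.mk I (SymmetricAlgebra.ι K V (a • v)) = 0
    rw [map_smul, Algebra.smul_def, Ideal.Quotient.eq_zero_iff_mem]
    exact I.mul_mem_right _ (Ideal.mem_map_of_mem _ ha)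
  have hlift : ∀ a, algebraMap K k a = 0 → algebraMap K (X.R ⧸ I) a = 0 := fun a ha => by
    change Ideal.Quotient.mk I (algebraMap K X.R a) = 0
    rw [Ideal.Quotient.eq_zero_iff_mem]
    exact Ideal.mem_map_of_mem _ ha
  -- The inverse `Sym(V') → R / I` of the homomorphism induced by the reduction.
  let g : k →+* X.R ⧸ I := (algebraMap K k).liftOfRightInverse _
    (Function.rightInverse_surjInv hq.surjective_algebraMap) ⟨algebraMap K (X.R ⧸ I), hlift⟩
  have hg : ∀ a, g (algebraMap K k a) = algebraMap K (X.R ⧸ I) a := fun a =>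
    (algebraMap K k).liftOfRightInverse_comp_apply _
      (Function.rightInverse_surjInv hq.surjective_algebraMap) ⟨algebraMap K (X.R ⧸ I), hlift⟩ a
  let _ : Algebra k (X.R ⧸ I) := g.toAlgebra
  have : IsScalarTower K k (X.R ⧸ I) := IsScalarTower.of_algebraMap_eq fun a => (hg a).symm
  let j : (X.reduce hq).R →ₐ[k] X.R ⧸ I := SymmetricAlgebra.lift
    (hq.desc ((Ideal.Quotient.mkₐ K I).toLinearMap ∘ₗ SymmetricAlgebra.ι K V))
  have : ((j.restrictScalars K).comp (X.redR hq)) = Ideal.Quotient.mkₐ K I := by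
    apply SymmetricAlgebra.algHom_ext
    ext v
    change j (X.redR hq (SymmetricAlgebra.ι K V v)) = _
    rw [redR_ι, SymmetricAlgebra.lift_ι_apply, hq.desc_apply]
    rfl
  have h := DFunLike.congr_fun this f
  change j (X.redR hq f) = Ideal.Quotient.mk I f at h
  rw [hf, map_zero] at h
  exact Ideal.Quotient.eq_zero_iff_mem.1 h.symm

theorem redR_mem_degR {n : ℤ} {f : X.R} (hf : f ∈ X.degR n) :
    X.redR hq f ∈ (X.reduce hq).degR n := by
  rcases X.degR_cases hf with rfl | ⟨n, rfl⟩
  · simp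
  have : (((X.reduce hq).gradPoly).restrictScalars K).comp (X.redR hq) =
      (Polynomial.mapAlgHom (X.redR hq)).comp X.gradPoly := by
    apply SymmetricAlgebra.algHom_ext
    ext1 v
    change (X.reduce hq).gradPoly (X.redR hq (SymmetricAlgebra.ι K V v)) =
      (X.gradPoly (SymmetricAlgebra.ι K V v)).map (X.redR hq).toRingHom
    rw [redR_ι, gradPoly_ι, gradPoly_ι, Polynomial.map_monomial]
    congr 1
    exact (X.redR_ι hq v).symm
  have h := DFunLike.congr_fun this f
  change (X.reduce hq).gradPoly (X.redR hq f) =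
      (X.gradPoly f).map (X.redR hq).toRingHom at h
  rw [mem_degR_two_mul] at *
  rw [h, hf, Polynomial.map_monomial]
  rfl

theorem redR_mem_invariants {H : Subgroup W} {f : X.R} (hf : f ∈ X.invariants H) :
    X.redR hq f ∈ (X.reduce hq).invariants H := by
  intro w hw
  rw [← redR_actR, hf w hw]

/-- The coefficients, in a basis over the invariants, of an element with reduction `0` have
reduction `0`. -/
theorem redR_repr_eq_zero {H : Subgroup W} {ι : Type*}
    (b : Module.Basis ι (X.invariants H) X.R) {f : X.R} (hf : X.redR hq f = 0) (i : ι) :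
    X.redR hq (b.repr f i : X.R) = 0 := by
  have h := X.mem_map_of_redR_eq_zero hq hf
  suffices ∀ a, X.redR hq (b.repr (a * f) i : X.R) = 0 by simpa using this 1
  clear hf
  rw [Ideal.map] at h
  induction h using Submodule.span_induction with
  | zero => simp
  | add f g _ _ hf hg => intro a; simp [mul_add, hf, hg]
  | smul c f h hf => intro a; rw [smul_eq_mul, ← mul_assoc]; exact hf _
  | mem f hf =>
    obtain ⟨c, hc, rfl⟩ := hf
    intro a
    have h1 : a * algebraMap K X.R c = (algebraMap K (X.invariants H) c) • a := mul_comm _ _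
    rw [h1, map_smul, Finsupp.smul_apply, smul_eq_mul, MulMemClass.coe_mul, map_mul]
    change X.redR hq (algebraMap K X.R c) * _ = 0
    rw [redR_algebraMap, (RingHom.mem_ker).1 hc, map_zero, zero_mul]

/-- Over a local ring, vectors outside of `𝔪 V` take the value `1` under some linear form. -/
theorem exists_form_eq_one [IsLocalRing K] [Module.Free K V] {α : V}
    (hα : α ∉ (IsLocalRing.maximalIdeal K • ⊤ : Submodule K V)) :
    ∃ φ : V →ₗ[K] K, φ α = 1 := by
  let b := Module.Free.chooseBasis K V
  by_contra! h
  apply hα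
  rw [← b.linearCombination_repr α]
  refine sum_mem fun i _ => Submodule.smul_mem_smul ?_ trivial
  rw [IsLocalRing.mem_maximalIdeal, mem_nonunits_iff]
  rintro ⟨u, hu⟩
  refine h ((↑u⁻¹ : K) • b.coord i) ?_
  have hu : (u : K) = b.repr α i := hu
  rw [LinearMap.smul_apply, Module.Basis.coord_apply, ← hu, smul_eq_mul, Units.inv_mul]

theorem isReduction_mkQ (I : Ideal K) : IsReduction (K ⧸ I) (I • ⊤ : Submodule K V).mkQ where
  surjective_algebraMap := Ideal.Quotient.mk_surjective
  surjective := Submodule.mkQ_surjective _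
  ker_eq := by
    rw [Submodule.ker_mkQ]
    congr 1
    exact Ideal.mk_ker.symm

end Reduce

/-! ### Compositions of Demazure operators -/

section Demazure

variable {K : Type u} {V : Type v} [CommRing K] [AddCommGroup V] [Module K V]
  {B W : Type*} [Group W] {M : CoxeterMatrix B} {cs : CoxeterSystem M W}
  (X : CoxeterRealization K V cs) [IsDomain K] [Module.Free K V] [X.IsRegular]

/-- The composition `∂_{s_n} ⋯ ∂_{s_1}` of Demazure operators attached to a word. -/
def dem : List B → X.R →+ X.R
  | [] => AddMonoidHom.id X.R
  | s :: l => (dem l).comp (X.demazure s).toAddMonoidHom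

@[simp] theorem dem_nil (f : X.R) : X.dem [] f = f := rfl

@[simp] theorem dem_cons (s : B) (l : List B) (f : X.R) :
    X.dem (s :: l) f = X.dem l (X.demazure s f) := rfl

theorem dem_mem_degR (l : List B) {k : ℤ} {f : X.R} (hf : f ∈ X.degR k) :
    X.dem l f ∈ X.degR (k - 2 * l.length) := by
  induction l generalizing k f with
  | nil => simpa using hf
  | cons s l ih =>
    have := ih (X.demazure_mem_degR s hf)
    rwa [show k - 2 - 2 * (l.length : ℤ) = k - 2 * ((s :: l).length : ℤ) by
      rw [List.length_cons]; push_cast; ring] at this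

variable {S₀ : Set B}

theorem invariants_le_of_mem {s : B} (hs : s ∈ S₀) {c : X.R}
    (hc : c ∈ X.invariants (cs.parabolic S₀)) : c ∈ X.invariants (cs.parabolic {s}) := by
  rw [mem_invariants_singleton]
  exact hc _ (cs.simple_mem_parabolic hs)

theorem dem_mul_of_mem {l : List B} (hl : ∀ s ∈ l, s ∈ S₀) {c : X.R}
    (hc : c ∈ X.invariants (cs.parabolic S₀)) (f : X.R) :
    X.dem l (c * f) = c * X.dem l f := by
  induction l generalizing f with
  | nil => rfl
  | cons s l ih =>
    rw [dem_cons, dem_cons, X.demazure_mul_of_mem s (X.invariants_le_of_mem (hl s (by simp)) hc),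
      ih fun t ht => hl t (by simp [ht])]

section Coeff

variable {L : Type*} [Field L] (ψ : X.R →+* L)

open Classical in
/-- The coefficients of a composition of Demazure operators, as a combination of the
automorphisms `y⁻¹`. -/
def demCoeff : List B → W → L
  | [], y => if y = 1 then 1 else 0
  | s :: l, y => demCoeff l y / ψ (X.actR y⁻¹ (X.rootR s)) -
      demCoeff l (cs.simple s * y) / ψ (X.actR (cs.simple s * y)⁻¹ (X.rootR s))

/-- All roots of `W_{S₀}` are mapped to nonzero elements. -/
def RootsNeZero (S₀ : Set B) : Prop :=
  ∀ s ∈ S₀, ∀ y ∈ cs.parabolic S₀, ψ (X.actR y⁻¹ (X.rootR s)) ≠ 0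

variable {X ψ} [Fintype (cs.parabolic S₀)] (hψ : X.RootsNeZero ψ S₀)

include hψ in
theorem sum_demCoeff_cons {s : B} (hs : s ∈ S₀) (l : List B) (g g' : cs.parabolic S₀ → L)
    (h : ∀ y : cs.parabolic S₀, ψ (X.actR (y : W)⁻¹ (X.rootR s)) * g' y =
      g y - g (⟨cs.simple s, cs.simple_mem_parabolic hs⟩ * y)) :
    ∑ y : cs.parabolic S₀, X.demCoeff ψ (s :: l) y * g y =
      ∑ y : cs.parabolic S₀, X.demCoeff ψ l y * g' y := by
  let σ : cs.parabolic S₀ := ⟨cs.simple s, cs.simple_mem_parabolic hs⟩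
  have hσ : σ * σ = 1 := Subtype.ext (CoxeterSystem.simple_mul_simple_self cs s)
  have h1 : ∑ y : cs.parabolic S₀, X.demCoeff ψ l (cs.simple s * y) /
      ψ (X.actR (cs.simple s * (y : W))⁻¹ (X.rootR s)) * g y =
      ∑ y : cs.parabolic S₀, X.demCoeff ψ l y / ψ (X.actR (y : W)⁻¹ (X.rootR s)) * g (σ * y) := by
    refine Fintype.sum_equiv (Equiv.mulLeft σ) _ _ fun y => ?_
    rw [Equiv.coe_mulLeft, ← mul_assoc, hσ, one_mul]
    rfl
  simp only [demCoeff, sub_mul, Finset.sum_sub_distrib]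
  rw [h1, ← Finset.sum_sub_distrib]
  refine Finset.sum_congr rfl fun y _ => ?_
  rw [← mul_sub, ← h y]
  field_simp [hψ s hs y y.2]

include hψ in
theorem map_dem {l : List B} (hl : ∀ s ∈ l, s ∈ S₀) (f : X.R) :
    ψ (X.dem l f) = ∑ y : cs.parabolic S₀, X.demCoeff ψ l y * ψ (X.actR (y : W)⁻¹ f) := by
  induction l generalizing f with
  | nil =>
    rw [Finset.sum_eq_single 1]
    · simp [demCoeff]
    · intro y _ hy
      rw [demCoeff, if_neg (by simpa using hy), zero_mul]
    · simp
  | cons s l ih =>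
    rw [dem_cons, ih (fun t ht => hl t (by simp [ht])), sum_demCoeff_cons hψ (hl s (by simp)) l]
    intro y
    rw [← map_mul, ← map_mul, rootR_mul_demazure, map_sub, map_sub, Subgroup.coe_mul, mul_inv_rev,
      CoxeterSystem.inv_simple, actR_mul]

theorem demCoeff_support {l : List B} {y : W} (h : X.demCoeff ψ l y ≠ 0) :
    y = cs.wordProd l ∨ cs.length y < l.length := by
  induction l generalizing y with
  | nil =>
    left
    by_contra hy
    exact h (if_neg (by simpa using hy))
  | cons s l ih =>
    have hlen := cs.length_wordProd_le l
    rw [List.length_cons]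
    by_cases h1 : X.demCoeff ψ l y = 0
    · have h2 : X.demCoeff ψ l (cs.simple s * y) ≠ 0 := fun h2 => h (by
        rw [demCoeff, h1, h2]; simp)
      rcases ih h2 with h3 | h3
      · left
        rw [CoxeterSystem.wordProd_cons, ← h3, CoxeterSystem.simple_mul_simple_cancel_left]
      · right
        rcases cs.length_simple_mul y s with h4 | h4 <;> omega
    · right
      rcases ih h1 with rfl | h3 <;> omega

include hψ in
theorem demCoeff_wordProd_ne_zero {l : List B} (hl : ∀ s ∈ l, s ∈ S₀) (hr : cs.IsReduced l) :
    X.demCoeff ψ l (cs.wordProd l) ≠ 0 := by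
  induction l with
  | nil => simp [demCoeff]
  | cons s l ih =>
    have hl' : ∀ t ∈ l, t ∈ S₀ := fun t ht => hl t (by simp [ht])
    have h1 : X.demCoeff ψ l (cs.wordProd (s :: l)) = 0 := by
      have h2 : cs.length (cs.wordProd (s :: l)) = l.length + 1 := hr
      have h4 : cs.length (cs.wordProd l) = l.length := hr.tail
      by_contra h
      rcases demCoeff_support h with h3 | h3
      · rw [h3] at h2; omega
      · omega
    rw [demCoeff, h1, CoxeterSystem.wordProd_cons, CoxeterSystem.simple_mul_simple_cancel_left,
      zero_div, zero_sub, neg_ne_zero]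
    exact div_ne_zero (ih hl' hr.tail) (hψ s (hl s (by simp)) _ (cs.wordProd_mem_parabolic hl'))

end Coeff

end Demazure

end CoxeterRealization

namespace CoxeterRealization

/-! ### Faithfulness of the reduction -/

section Frobenius

variable {K : Type u} {V : Type v} [CommRing K] [AddCommGroup V] [Module K V]
  {k : Type u} {V' : Type v} [CommRing k] [AddCommGroup V'] [Module k V']
  [Algebra K k] [Module K V'] [IsScalarTower K k V']
  {B W : Type*} [Group W] {M : CoxeterMatrix B} {cs : CoxeterSystem M W}
  {X : CoxeterRealization K V cs} {q : V →ₗ[K] V'} (hq : IsReduction k q)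
  [IsDomain k] [Module.Free k V'] [Module.Finite k V']
  {H : Subgroup W} [Finite H]

theorem prod_root_dvd_altSum [IsDomain K] [Module.Free K V] [hX : X.IsRegular] (T : Finset W)
    (hT : ∀ t ∈ T, t ∈ H ∧ cs.IsReflection t)
    (hform : ∀ t ∈ T, ∃ φ : V →ₗ[K] K, φ (X.reflRoot t) = 1)
    (hind : ∀ t ∈ T, ∀ t' ∈ T, t ≠ t' → ∀ c : k, q (X.reflRoot t') ≠ c • q (X.reflRoot t))
    (f : (X.reduce hq).R) :
    ∏ t ∈ T, SymmetricAlgebra.ι k V' (q (X.reflRoot t)) ∣ (X.reduce hq).altSum H f := by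
  have hform' : ∀ t ∈ T, ∃ φ : V' →ₗ[k] k, φ (q (X.reflRoot t)) = 1 := fun t ht => by
    obtain ⟨φ, hφ⟩ := hform t ht
    exact ⟨hq.desc (Algebra.linearMap K k ∘ₗ φ), by
      rw [hq.desc_apply, LinearMap.comp_apply, hφ, Algebra.linearMap_apply, map_one]⟩
  refine prod_dvd_of_prime T (fun t ht => ?_) (fun t ht t' ht' hne hd => ?_) fun t ht => ?_
  · obtain ⟨φ, hφ⟩ := hform' t ht
    exact prime_ι hφ
  · obtain ⟨φ, hφ⟩ := hform' t ht
    exact hind t ht t' ht' hne _ (eq_smul_of_ι_dvd_ι hφ hd)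
  · obtain ⟨φ, hφ⟩ := hform' t ht
    obtain ⟨htH, hr⟩ := hT t ht
    refine (X.reduce hq).ι_dvd_altSum htH hr.mul_self hφ (fun v => ?_) (fun h1 => ?_)
      ((X.reduce hq).det_act_reflection hr) f
    · obtain ⟨c, hc⟩ := (X.reduce hq).exists_act_reflection hr v
      exact ⟨c, by rw [hc, reduce_reflRoot]⟩
    · obtain ⟨w, s, hts, hα⟩ := X.exists_reflRoot hr
      obtain ⟨a, ha⟩ := hX.coroot_surjective s 1
      have h2 := X.reduce_act_apply hq t (X.act w a)
      rw [h1, hts, act_conj, act_inv_act, ha, one_smul, ← hα, map_sub, Module.End.one_apply,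
        eq_comm, sub_eq_self] at h2
      rw [h2, map_zero] at hφ
      exact zero_ne_one hφ

variable {x₀ : H} (b : Module.Basis H (X.invariants H) X.R)

section Fintype
variable [Fintype H]

theorem altSum_redR (h0 : ∀ x, x ≠ x₀ → (X.reduce hq).altSum H (X.redR hq (b x)) = 0) (f : X.R) :
    (X.reduce hq).altSum H (X.redR hq f) =
      X.redR hq (b.repr f x₀ : X.R) * (X.reduce hq).altSum H (X.redR hq (b x₀)) := by
  conv_lhs => rw [← b.sum_repr f]
  rw [map_sum, map_sum, Finset.sum_eq_single x₀]
  · rw [Subalgebra.smul_def, smul_eq_mul, map_mul,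
      altSum_mul_of_mem _ (X.redR_mem_invariants hq (b.repr f x₀).2)]
  · intro x _ hx
    rw [Subalgebra.smul_def, smul_eq_mul, map_mul,
      altSum_mul_of_mem _ (X.redR_mem_invariants hq (b.repr f x).2), h0 x hx, mul_zero]
  · simp

theorem one_mem_actImage : (1 : V' →ₗ[k] V') ∈ (X.reduce hq).actImage H :=
  (mem_actImage _).2 ⟨1, one_mem H, map_one _⟩

theorem altSum_redR_ne_zero
    (h0 : ∀ x, x ≠ x₀ → (X.reduce hq).altSum H (X.redR hq (b x)) = 0) :
    (X.reduce hq).altSum H (X.redR hq (b x₀)) ≠ 0 := by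
  intro h1
  have h2 := (X.reduce hq).altSum_eq_zero_of_forall (H := H)
    (a := fun φ => algebraMap k _ (LinearMap.det φ)) (fun f => by
      obtain ⟨f, rfl⟩ := X.redR_surjective hq f
      rw [← altSum_apply, altSum_redR hq b h0, h1, mul_zero]) 1 (one_mem_actImage hq)
  rw [map_one, map_one] at h2
  exact one_ne_zero h2

/-- The image of `H` in `GL(V')` cannot be smaller than the rank of `R` over the invariants:
the vectors `(φ(b_x))_x` are independent, as is seen by applying the antisymmetrization, which has
values in the multiples of the reductions of invariants. -/
theorem reduce_act_injective
    (h0 : ∀ x, x ≠ x₀ → (X.reduce hq).altSum H (X.redR hq (b x)) = 0) :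
    Function.Injective fun h : H => (X.reduce hq).act h := by
  set Y := X.reduce hq with hY
  set e := Y.altSum H (X.redR hq (b x₀)) with he
  have he0 : e ≠ 0 := altSum_redR_ne_zero hq b h0
  let T : (H → Y.R) →ₗ[Y.R] ({φ // φ ∈ Y.actImage H} → Y.R) :=
    LinearMap.pi fun φ => ∑ x, Y.symMap φ (X.redR hq (b x)) • LinearMap.proj x
  have hT : ∀ a φ, T a φ = ∑ x, Y.symMap φ (X.redR hq (b x)) * a x := fun a φ => by
    simp [T, LinearMap.sum_apply]
  have hTinj : Function.Injective T := by
    rw [injective_iff_map_eq_zero]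
    intro a ha
    have h1 : ∀ h ∈ H, ∑ x, Y.actR h (a x) * X.redR hq (b x) = 0 := fun h hh => by
      have h2 := congrFun ha ⟨Y.act h⁻¹, Y.mem_actImage.2 ⟨_, inv_mem hh, rfl⟩⟩
      rw [hT] at h2
      have h3 := congrArg (Y.actR h) h2
      rw [map_sum, Pi.zero_apply, map_zero] at h3
      rw [← h3]
      refine Finset.sum_congr rfl fun x _ => ?_
      rw [map_mul, symMap_act, actR_actR_inv, mul_comm]
    have h2 : ∀ f, ∑ x, Y.altSum H (f * a x) * X.redR hq (b x) = 0 := fun f => by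
      simp only [altSum_apply, Finset.sum_mul]
      rw [Finset.sum_comm]
      refine Finset.sum_eq_zero fun φ hφ => ?_
      obtain ⟨h, hh, rfl⟩ := Y.mem_actImage.1 hφ
      have h3 := h1 h hh
      have h4 : ∑ x, algebraMap k Y.R (LinearMap.det (Y.act h)) * Y.symMap (Y.act h) (f * a x) *
          X.redR hq (b x) = algebraMap k Y.R (LinearMap.det (Y.act h)) * Y.actR h f *
          ∑ x, Y.actR h (a x) * X.redR hq (b x) := by
        rw [Finset.mul_sum]
        refine Finset.sum_congr rfl fun x _ => ?_
        rw [symMap_act, map_mul]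
        ring
      rw [h4, h3, mul_zero]
    have h3 : ∀ f x, Y.altSum H (f * a x) = 0 := fun f x => by
      choose g hg using fun x => X.redR_surjective hq (f * a x)
      have h4 : ∀ x, Y.altSum H (f * a x) = X.redR hq (b.repr (g x) x₀ : X.R) * e := fun x => by
        rw [← hg, altSum_redR hq b h0]
      have h5 : X.redR hq (∑ x, b.repr (g x) x₀ • b x) = 0 := by
        apply mul_left_cancel₀ he0
        rw [mul_zero, ← h2 f, map_sum, Finset.mul_sum]
        refine Finset.sum_congr rfl fun x _ => ?_
        rw [h4, Subalgebra.smul_def, smul_eq_mul, map_mul]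
        ring
      have h6 := X.redR_repr_eq_zero hq b h5 x
      rw [b.repr_sum_self] at h6
      rw [h4, h6, zero_mul]
    funext x
    have h4 := Y.altSum_eq_zero_of_forall (H := H)
      (a := fun φ => algebraMap k _ (LinearMap.det φ) * Y.symMap φ (a x)) (fun f => by
        rw [← h3 f x, altSum_apply]
        refine Finset.sum_congr rfl fun φ _ => ?_
        rw [map_mul]
        ring) 1 (one_mem_actImage hq)
    have h5 : Y.symMap 1 (a x) = a x := by
      have := symMap_act Y 1
      rw [map_one] at this
      rw [this, actR_one_apply]
    rw [map_one, map_one, one_mul, h5] at h4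
    exact h4
  have hcard := card_le_of_injective Y.R T hTinj
  have hsurj : Function.Surjective
      (fun h : H => (⟨Y.act h, Y.mem_actImage.2 ⟨h, h.2, rfl⟩⟩ : {φ // φ ∈ Y.actImage H})) := by
    rintro ⟨φ, hφ⟩
    obtain ⟨h, hh, rfl⟩ := Y.mem_actImage.1 hφ
    exact ⟨⟨h, hh⟩, rfl⟩
  have hbij := (Fintype.bijective_iff_surjective_and_card _).2
    ⟨hsurj, le_antisymm hcard (Fintype.card_le_of_surjective _ hsurj)⟩
  intro h h' hh
  exact hbij.1 (Subtype.ext hh)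

/-! ### Dual bases -/

/-- The Gram determinant of the basis `b`, for the symmetric form given by the coefficient at `x₀`,
has nonzero reduction. -/
theorem redR_gram_det_ne_zero [DecidableEq H]
    (h0 : ∀ x, x ≠ x₀ → (X.reduce hq).altSum H (X.redR hq (b x)) = 0) :
    X.redR hq ((Matrix.of fun x y => b.repr (b x * b y) x₀).det : X.invariants H) ≠ 0 := by
  have hinj := reduce_act_injective hq b h0
  set Y := X.reduce hq with hY
  set e := Y.altSum H (X.redR hq (b x₀)) with he
  have he0 : e ≠ 0 := altSum_redR_ne_zero hq b h0
  let U : Matrix H H Y.R := Matrix.of fun h x => Y.actR h (X.redR hq (b x))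
  let G : Matrix H H (X.invariants H) := Matrix.of fun x y => b.repr (b x * b y) x₀
  let ρ : X.invariants H →+* Y.R := (X.redR hq : X.R →+* Y.R).comp (X.invariants H).val.toRingHom
  let Δ : Matrix H H Y.R :=
    Matrix.diagonal fun h => algebraMap k Y.R (LinearMap.det (Y.act (h : W)))
  have hG : e • ρ.mapMatrix G = U.transpose * Δ * U := by
    ext x y
    have h1 : ρ.mapMatrix G x y = X.redR hq (b.repr (b x * b y) x₀ : X.R) := rfl
    rw [Matrix.smul_apply, h1, smul_eq_mul, mul_comm, ← altSum_redR hq b h0, altSum_apply,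
      Matrix.mul_apply]
    symm
    refine Finset.sum_bij (fun h _ => Y.act (h : W)) (fun h _ => Y.mem_actImage.2 ⟨h, h.2, rfl⟩)
      (fun h _ h' _ hh => hinj hh) (fun φ hφ => ?_) (fun h _ => ?_)
    · obtain ⟨h, hh, rfl⟩ := Y.mem_actImage.1 hφ
      exact ⟨⟨h, hh⟩, Finset.mem_univ _, rfl⟩
    · rw [Matrix.mul_diagonal, Matrix.transpose_apply, map_mul, map_mul, symMap_act]
      change Y.actR h (X.redR hq (b x)) * _ * Y.actR h (X.redR hq (b y)) = _
      ring
  have hU : U.det ≠ 0 := by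
    intro hU
    obtain ⟨v, hv0, hv⟩ := Matrix.exists_vecMul_eq_zero_iff.2 hU
    apply hv0
    have hσ : Function.Injective fun h : H => (Y.actR h : Y.R →+* Y.R) := fun h h' hh =>
      hinj (Y.symMap_injective hh)
    funext h
    refine eq_zero_of_sum_mul_ringHom Finset.univ hσ (a := v) (fun f => ?_) h (Finset.mem_univ h)
    obtain ⟨f, rfl⟩ := X.redR_surjective hq f
    rw [← b.sum_repr f, map_sum]
    simp only [map_sum, Finset.mul_sum]
    rw [Finset.sum_comm]
    refine Finset.sum_eq_zero fun x _ => ?_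
    have h1 := congrFun hv x
    rw [Matrix.vecMul, dotProduct] at h1
    have h2 : ∑ h : H, v h * (Y.actR h : Y.R →+* Y.R) (X.redR hq (b.repr f x • b x)) =
        X.redR hq (b.repr f x : X.R) * ∑ h : H, v h * U h x := by
      rw [Finset.mul_sum]
      refine Finset.sum_congr rfl fun h _ => ?_
      rw [Subalgebra.smul_def, smul_eq_mul, map_mul, map_mul]
      change v h * (Y.actR h (X.redR hq (b.repr f x : X.R)) * U h x) = _
      rw [X.redR_mem_invariants hq (b.repr f x).2 h h.2]
      ring
    rw [h2, h1, Pi.zero_apply, mul_zero]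
  have hdet := congrArg Matrix.det hG
  rw [Matrix.det_smul, Matrix.det_mul, Matrix.det_mul, Matrix.det_transpose, Matrix.det_diagonal,
    ← RingHom.map_det] at hdet
  intro h1
  have h2 : ρ G.det = 0 := h1
  rw [h2, mul_zero, eq_comm, mul_eq_zero, mul_eq_zero] at hdet
  rcases hdet with (h | h) | h
  · exact hU h
  · obtain ⟨x, -, hx⟩ := Finset.prod_eq_zero_iff.1 h
    have := (Y.isUnit_det_of_mem_actImage (H := H)
      (Y.mem_actImage.2 ⟨x, x.2, rfl⟩)).map (algebraMap k Y.R)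
    rw [hx] at this
    exact not_isUnit_zero this
  · exact hU h

end Fintype

end Frobenius

end CoxeterRealization

namespace CoxeterRealization

section Frobenius

variable {K : Type u} {V : Type v} [CommRing K] [AddCommGroup V] [Module K V]
  {B W : Type*} [Group W] {M : CoxeterMatrix B} {cs : CoxeterSystem M W}
  {X : CoxeterRealization K V cs}

/-- There are homogeneous elements `b_i`, `b'_i` with `deg b_i + deg b'_i = 2 N` and
`f = ∑ b_i D(b'_i f)` for all `f`: dual bases of `R` with respect to `D`. -/
def HasDualBases (D : X.R →+ X.R) (N : ℤ) : Prop :=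
  ∃ (m : ℕ) (b b' : Fin m → X.R) (d : Fin m → ℤ), (∀ i, b i ∈ X.degR (d i)) ∧
    (∀ i, b' i ∈ X.degR (2 * N - d i)) ∧ ∀ f, f = ∑ i, b i * D (b' i * f)

theorem hasDualBases_of_fintype {D : X.R →+ X.R} {N : ℤ} {ι : Type*} [Fintype ι] (b b' : ι → X.R)
    (d : ι → ℤ) (hb : ∀ i, b i ∈ X.degR (d i)) (hb' : ∀ i, b' i ∈ X.degR (2 * N - d i))
    (h : ∀ f, f = ∑ i, b i * D (b' i * f)) : X.HasDualBases D N := by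
  let e := (Fintype.equivFin ι).symm
  exact ⟨_, b ∘ e, b' ∘ e, d ∘ e, fun i => hb _, fun i => hb' _, fun f =>
    (h f).trans (Equiv.sum_comp e fun i => b i * D (b' i * f)).symm⟩

theorem adjugate_mem_degR {n : Type*} [Fintype n] [DecidableEq n]
    {S : Subalgebra K X.R} (G : Matrix n n S) (r c : n → ℤ)
    (h : ∀ i j, (G i j : X.R) ∈ X.degR (r i + c j)) (hrc : ∑ i, r i + ∑ i, c i = 0) (i j : n) :
    (G.adjugate i j : X.R) ∈ X.degR (-(r j + c i)) := by
  rw [Matrix.adjugate_apply]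
  have := X.det_mem_degR (G.updateRow j (Pi.single i 1)) (Function.update r j (-c i)) c
    fun i' j' => by
      by_cases hi' : i' = j
      · subst hi'
        rw [Matrix.updateRow_self, Function.update_self]
        by_cases hj' : j' = i
        · subst hj'
          rw [Pi.single_eq_same, neg_add_cancel]
          exact X.one_mem_degR
        · rw [Pi.single_eq_of_ne hj']
          exact zero_mem _
      · rw [Matrix.updateRow_ne hi', Function.update_of_ne hi']
        exact h i' j'
  have h1 := Finset.sum_update_of_mem (Finset.mem_univ j) r (-c i)
  have h2 := Finset.add_sum_erase Finset.univ r (Finset.mem_univ j)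
  rw [← Finset.erase_eq] at h1
  rwa [show ∑ i', Function.update r j (-c i) i' + ∑ i, c i = -(r j + c i) by
    rw [h1]; linarith] at this

theorem sum_length_mul_two {S₀ : Set B} {w₀ : W} (hw₀ : cs.IsLongest S₀ w₀)
    [Fintype (cs.parabolic S₀)] : ∑ x : cs.parabolic S₀, (2 * (cs.length (x : W) : ℤ)) =
      ∑ _x : cs.parabolic S₀, (cs.length w₀ : ℤ) := by
  let σ : cs.parabolic S₀ := ⟨w₀, hw₀.1⟩
  have h1 : ∑ x : cs.parabolic S₀, (cs.length (w₀ * (x : W)⁻¹) : ℤ) =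
      ∑ x : cs.parabolic S₀, (cs.length (x : W) : ℤ) :=
    Fintype.sum_equiv ((Equiv.inv _).trans (Equiv.mulLeft σ)) _ _ fun x => rfl
  have h2 : ∀ x : cs.parabolic S₀, (cs.length (w₀ * (x : W)⁻¹) : ℤ) + cs.length (x : W) =
      cs.length w₀ := fun x => by exact_mod_cast hw₀.length_mul x.2
  rw [← Finset.sum_congr rfl fun x _ => h2 x, Finset.sum_add_distrib, h1, ← Finset.mul_sum,
    two_mul]

variable [IsDomain K] [Module.Free K V] [X.IsRegular] {S₀ : Set B} [Finite (cs.parabolic S₀)]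
  {w₀ : W} {l : List B}
  (b : Module.Basis (cs.parabolic S₀) (X.invariants (cs.parabolic S₀)) X.R)

theorem dem_eq_repr_mul (hb : ∀ x : cs.parabolic S₀, b x ∈ X.degR (2 * cs.length (x : W)))
    (hw₀ : cs.IsLongest S₀ w₀) (hl : ∀ s ∈ l, s ∈ S₀) (hlen : l.length = cs.length w₀) :
    ∃ κ : K, ∀ f, X.dem l f = algebraMap K X.R κ * b.repr f ⟨w₀, hw₀.1⟩ := by
  have := Fintype.ofFinite (cs.parabolic S₀)
  have h1 : X.dem l (b ⟨w₀, hw₀.1⟩) ∈ X.degR 0 := by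
    have := X.dem_mem_degR l (hb ⟨w₀, hw₀.1⟩)
    rwa [hlen, sub_self] at this
  obtain ⟨κ, hκ⟩ := X.exists_of_mem_degR_zero h1
  refine ⟨κ, fun f => ?_⟩
  conv_lhs => rw [← b.sum_repr f]
  rw [map_sum, Finset.sum_eq_single ⟨w₀, hw₀.1⟩]
  · rw [Subalgebra.smul_def, smul_eq_mul, X.dem_mul_of_mem hl (b.repr f _).2, hκ, mul_comm]
  · intro x _ hx
    have h2 : X.dem l (b x) = 0 := X.eq_zero_of_mem_degR_neg (X.dem_mem_degR l (hb x)) (by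
      have := hw₀.length_lt x.2 (fun h => hx (Subtype.ext h))
      omega)
    rw [Subalgebra.smul_def, smul_eq_mul, X.dem_mul_of_mem hl (b.repr f _).2, h2, mul_zero]
  · simp

section Reduction

variable {k : Type u} {V' : Type v} [CommRing k] [AddCommGroup V'] [Module k V']
  [Algebra K k] [Module K V'] [IsScalarTower K k V'] {q : V →ₗ[K] V'} (hq : IsReduction k q)
  [IsDomain k] [Module.Free k V'] [Module.Finite k V']

theorem altSum_redR_eq_zero (hb : ∀ x : cs.parabolic S₀, b x ∈ X.degR (2 * cs.length (x : W)))
    (hw₀ : cs.IsLongest S₀ w₀) (hr : cs.IsReduced l) (hw : cs.wordProd l = w₀)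
    (hl : ∀ s ∈ l, s ∈ S₀)
    (hform : ∀ t ∈ cs.parabolic S₀, cs.IsReflection t → ∃ φ : V →ₗ[K] K, φ (X.reflRoot t) = 1)
    (hind : ∀ t ∈ cs.parabolic S₀, ∀ t' ∈ cs.parabolic S₀, cs.IsReflection t →
      cs.IsReflection t' → t ≠ t' → ∀ c : k, q (X.reflRoot t') ≠ c • q (X.reflRoot t))
    {x : cs.parabolic S₀} (hx : (x : W) ≠ w₀) :
    (X.reduce hq).altSum (cs.parabolic S₀) (X.redR hq (b x)) = 0 := by
  classical
  have hlen : cs.length w₀ = l.length := hw ▸ hr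
  set T := (cs.leftInvSeq l).toFinset
  have hT : ∀ t ∈ T, t ∈ cs.parabolic S₀ ∧ cs.IsReflection t := fun t ht => by
    rw [List.mem_toFinset] at ht
    refine ⟨?_, cs.isReflection_of_mem_leftInvSeq l ht⟩
    obtain ⟨j, hj, rfl⟩ := List.getElem_of_mem ht
    rw [CoxeterSystem.length_leftInvSeq] at hj
    have h1 := cs.getD_leftInvSeq_mul_wordProd l j
    have h2 : cs.wordProd (l.eraseIdx j) ∈ cs.parabolic S₀ :=
      cs.wordProd_mem_parabolic fun i hi => hl i (List.mem_of_mem_eraseIdx hi)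
    rw [← List.getD_eq_getElem _ 1]
    rw [eq_mul_inv_of_mul_eq h1]
    exact mul_mem h2 (inv_mem (cs.wordProd_mem_parabolic hl))
  have hcard : T.card = l.length := by
    rw [List.toFinset_card_of_nodup (CoxeterSystem.IsReduced.nodup_leftInvSeq cs hr),
      CoxeterSystem.length_leftInvSeq]
  obtain ⟨p, hp⟩ := prod_root_dvd_altSum hq T hT (fun t ht => hform t (hT t ht).1 (hT t ht).2)
    (fun t ht t' ht' => hind t (hT t ht).1 t' (hT t' ht').1 (hT t ht).2 (hT t' ht').2)
    (X.redR hq (b x))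
  rw [hp]
  refine eq_zero_of_mul_mem_degR_lt (X.reduce hq) (n := l.length) (d := cs.length (x : W)) ?_ ?_ ?_
  · have := (X.reduce hq).prod_mem_degR T
      (fun t => SymmetricAlgebra.ι k V' (q (X.reflRoot t))) (fun _ => 2)
      (fun t _ => (X.reduce hq).ι_mem_degR _)
    rwa [Finset.sum_const, hcard, nsmul_eq_mul, mul_comm] at this
  · rw [← hp]
    exact altSum_mem_degR _ (X.redR_mem_degR hq (hb x))
  · rw [← hlen]
    exact hw₀.length_lt x.2 hx

theorem rootsNeZero_redR
    (hform : ∀ t ∈ cs.parabolic S₀, cs.IsReflection t → ∃ φ : V →ₗ[K] K, φ (X.reflRoot t) = 1) :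
    X.RootsNeZero ((algebraMap (X.reduce hq).R (FractionRing (X.reduce hq).R)).comp
      (X.redR hq : X.R →+* (X.reduce hq).R)) S₀ := by
  intro s hs y hy h
  have h1 : X.redR hq (X.actR y⁻¹ (X.rootR s)) = 0 :=
    (IsFractionRing.injective (X.reduce hq).R (FractionRing (X.reduce hq).R))
      (h.trans (map_zero _).symm)
  rw [rootR, actR_ι, redR_ι] at h1
  have h2 : q (X.act y⁻¹ (X.root s)) = 0 := ι_injective (h1.trans (map_zero _).symm)
  obtain ⟨c, hc, hc'⟩ := X.exists_act_root_eq_smul y⁻¹ s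
  obtain ⟨φ, hφ⟩ := hform _ (mul_mem (mul_mem (inv_mem hy) (cs.simple_mem_parabolic hs))
    (inv_mem (inv_mem hy))) ⟨y⁻¹, s, rfl⟩
  have h3 : hq.desc (Algebra.linearMap K k ∘ₗ φ) (q (X.act y⁻¹ (X.root s))) = algebraMap K k c := by
    rw [hq.desc_apply, LinearMap.comp_apply, hc', map_smul, hφ, smul_eq_mul, mul_one,
      Algebra.linearMap_apply]
  rw [h2, map_zero] at h3
  have := hc.map (algebraMap K k)
  rw [← h3] at this
  exact not_isUnit_zero this

include hq in
/-- The existence of dual bases, by reduction to the residue field: the Gram determinant has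
degree `0`, so that it is a unit if its reduction is nonzero. -/
theorem hasDualBases_dem [IsLocalRing K] (hker : ∀ c : K, algebraMap K k c ≠ 0 → IsUnit c)
    (hb : ∀ x : cs.parabolic S₀, b x ∈ X.degR (2 * cs.length (x : W)))
    (hw₀ : cs.IsLongest S₀ w₀) (hr : cs.IsReduced l) (hw : cs.wordProd l = w₀)
    (hl : ∀ s ∈ l, s ∈ S₀)
    (hform : ∀ t ∈ cs.parabolic S₀, cs.IsReflection t → ∃ φ : V →ₗ[K] K, φ (X.reflRoot t) = 1)
    (hind : ∀ t ∈ cs.parabolic S₀, ∀ t' ∈ cs.parabolic S₀, cs.IsReflection t →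
      cs.IsReflection t' → t ≠ t' → ∀ c : k, q (X.reflRoot t') ≠ c • q (X.reflRoot t)) :
    X.HasDualBases (X.dem l) l.length := by
  classical
  have := Fintype.ofFinite (cs.parabolic S₀)
  have hlen : cs.length w₀ = l.length := hw ▸ hr
  set x₀ : cs.parabolic S₀ := ⟨w₀, hw₀.1⟩
  have h0 : ∀ x, x ≠ x₀ →
      (X.reduce hq).altSum (cs.parabolic S₀) (X.redR hq (b x)) = 0 := fun x hx =>
    altSum_redR_eq_zero b hq hb hw₀ hr hw hl hform hind fun h => hx (Subtype.ext h)
  obtain ⟨κ, hκ⟩ := dem_eq_repr_mul b hb hw₀ hl hlen.symm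
  -- The coefficient of `w₀⁻¹` in the composition of Demazure operators does not vanish after
  -- reduction.
  have hκu : IsUnit κ := by
    refine hker _ fun h => ?_
    set ψ := (algebraMap (X.reduce hq).R (FractionRing (X.reduce hq).R)).comp
      (X.redR hq : X.R →+* (X.reduce hq).R) with hψ
    have hR := rootsNeZero_redR (X := X) hq hform
    have hσ : Function.Injective fun y : cs.parabolic S₀ =>
        ψ.comp (X.actR (y : W)⁻¹ : X.R →+* X.R) := fun y y' hy => by
      have h1 : ∀ f, (X.reduce hq).actR (y : W)⁻¹ f = (X.reduce hq).actR (y' : W)⁻¹ f := fun f => by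
        obtain ⟨f, rfl⟩ := X.redR_surjective hq f
        rw [← redR_actR, ← redR_actR]
        exact (IsFractionRing.injective (X.reduce hq).R (FractionRing (X.reduce hq).R))
          (DFunLike.congr_fun hy f)
      have h2 := reduce_act_injective hq b h0 (a₁ := y⁻¹) (a₂ := y'⁻¹)
        ((X.reduce hq).symMap_injective (RingHom.ext h1))
      exact inv_injective h2
    refine demCoeff_wordProd_ne_zero hR hl hr (?_ : X.demCoeff ψ l (cs.wordProd l) = 0)
    have := eq_zero_of_sum_mul_ringHom Finset.univ hσ
      (a := fun y => X.demCoeff ψ l (y : W)) (fun f => by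
        refine (map_dem hR hl f).symm.trans ?_
        rw [hκ, map_mul]
        have : ψ (algebraMap K X.R κ) = 0 := by
          rw [hψ, RingHom.comp_apply]
          change algebraMap _ _ (X.redR hq (algebraMap K X.R κ)) = _
          rw [redR_algebraMap, h, map_zero, map_zero]
        rw [this, zero_mul]) x₀ (Finset.mem_univ _)
    rw [hw]
    exact this
  obtain ⟨κ, rfl⟩ := hκu
  have hrepr : ∀ f, (b.repr f x₀ : X.R) = algebraMap K X.R (↑κ⁻¹ : K) * X.dem l f := fun f => by
    rw [hκ, ← mul_assoc, ← map_mul, Units.inv_mul, map_one, one_mul]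
  let G : Matrix (cs.parabolic S₀) (cs.parabolic S₀) (X.invariants (cs.parabolic S₀)) :=
    Matrix.of fun x y => b.repr (b x * b y) x₀
  let r : cs.parabolic S₀ → ℤ := fun x => 2 * cs.length (x : W) - 2 * l.length
  let c : cs.parabolic S₀ → ℤ := fun x => 2 * cs.length (x : W)
  have hG : ∀ x y, (G x y : X.R) ∈ X.degR (r x + c y) := fun x y => by
    change (b.repr (b x * b y) x₀ : X.R) ∈ _
    rw [hrepr]
    have := X.mul_mem_degR (X.algebraMap_mem_degR (↑κ⁻¹ : K))
      (X.dem_mem_degR l (X.mul_mem_degR (hb x) (hb y)))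
    rwa [show 0 + (2 * (cs.length (x : W) : ℤ) + 2 * cs.length (y : W) - 2 * l.length) =
      r x + c y by simp only [r, c]; ring] at this
  have hrc : ∑ x, r x + ∑ x, c x = 0 := by
    have h1 := sum_length_mul_two (cs := cs) hw₀
    rw [hlen] at h1
    simp only [r, c, Finset.sum_sub_distrib]
    have h2 : ∑ _x : cs.parabolic S₀, (2 * (l.length : ℤ)) =
        2 * ∑ _x : cs.parabolic S₀, (l.length : ℤ) := (Finset.mul_sum _ _ _).symm
    rw [h2, h1]
    ring
  obtain ⟨γ, hγ⟩ := X.exists_of_mem_degR_zero (hrc ▸ X.det_mem_degR G r c hG)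
  have hγu : IsUnit γ := hker _ fun h => redR_gram_det_ne_zero hq b h0 (by
    change X.redR hq (G.det : X.R) = 0
    rw [hγ, redR_algebraMap, h, map_zero])
  obtain ⟨γ, rfl⟩ := hγu
  have hadj : ∀ x z, ∑ y, (G.adjugate x y : X.R) * (b.repr (b y * b z) x₀ : X.R) =
      if x = z then algebraMap K X.R γ else 0 := fun x z => by
    have h1 := congrFun (congrFun (Matrix.adjugate_mul G) x) z
    rw [Matrix.mul_apply, Matrix.smul_apply, Matrix.one_apply] at h1
    have h2 := congrArg (X.invariants (cs.parabolic S₀)).val h1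
    rw [map_sum] at h2
    refine h2.trans ?_
    split_ifs with h
    · rw [smul_eq_mul, mul_one]; exact hγ
    · simp
  refine hasDualBases_of_fintype b (fun x => ∑ y,
    algebraMap K X.R ((↑γ⁻¹ : K) * (↑κ⁻¹ : K)) * ((G.adjugate x y : X.R) * b y)) c hb (fun x => ?_)
    (fun f => ?_)
  · refine sum_mem fun y _ => ?_
    have := X.mul_mem_degR (X.algebraMap_mem_degR ((↑γ⁻¹ : K) * (↑κ⁻¹ : K)))
      (X.mul_mem_degR (adjugate_mem_degR G r c hG hrc x y) (hb y))
    rwa [show 0 + (-(r y + c x) + 2 * (cs.length (y : W) : ℤ)) = 2 * l.length - c x by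
      simp only [r, c]; ring] at this
  · have hmem : ∀ a : K, algebraMap K X.R a ∈ X.invariants (cs.parabolic S₀) := fun a =>
      Subalgebra.algebraMap_mem _ a
    have key : ∀ x, X.dem l ((∑ y, algebraMap K X.R ((↑γ⁻¹ : K) * (↑κ⁻¹ : K)) *
        ((G.adjugate x y : X.R) * b y)) * f) = b.repr f x := fun x => by
      have h1 : ∀ y, X.dem l (algebraMap K X.R ((↑γ⁻¹ : K) * (↑κ⁻¹ : K)) *
          ((G.adjugate x y : X.R) * b y) * f) = ∑ z, algebraMap K X.R (↑γ⁻¹ : K) *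
            (b.repr f z : X.R) * ((G.adjugate x y : X.R) * (b.repr (b y * b z) x₀ : X.R)) :=
        fun y => by
          conv_lhs => rw [← b.sum_repr f]
          rw [Finset.mul_sum, map_sum]
          refine Finset.sum_congr rfl fun z _ => ?_
          rw [Subalgebra.smul_def, smul_eq_mul,
            show algebraMap K X.R ((↑γ⁻¹ : K) * (↑κ⁻¹ : K)) * ((G.adjugate x y : X.R) * b y) *
              ((b.repr f z : X.R) * b z) = algebraMap K X.R ((↑γ⁻¹ : K) * (↑κ⁻¹ : K)) *
              ((b.repr f z : X.R) * ((G.adjugate x y : X.R) * (b y * b z))) by ring,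
            X.dem_mul_of_mem hl (hmem _), X.dem_mul_of_mem hl (b.repr f z).2,
            X.dem_mul_of_mem hl (G.adjugate x y).2, hrepr, map_mul]
          ring
      rw [Finset.sum_mul, map_sum, Finset.sum_congr rfl fun y _ => h1 y, Finset.sum_comm,
        Finset.sum_congr rfl fun z _ => (Finset.mul_sum _ _ _).symm,
        Finset.sum_congr rfl fun z _ => by rw [hadj x z], Finset.sum_eq_single x]
      · rw [if_pos rfl, mul_right_comm, ← map_mul, Units.inv_mul, map_one, one_mul]
      · intro z _ hz
        rw [if_neg hz.symm, mul_zero]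
      · simp
    conv_lhs => rw [← b.sum_repr f]
    refine Finset.sum_congr rfl fun x _ => ?_
    rw [key, Subalgebra.smul_def, smul_eq_mul, mul_comm]

end Reduction

end Frobenius

end CoxeterRealization

namespace CoxeterRealization

/-! ### Dual bases from the GKM condition -/

section GKM

variable {K : Type u} {V : Type v} [CommRing K] [AddCommGroup V] [Module K V]
  {B W : Type*} [Group W] {M : CoxeterMatrix B} {cs : CoxeterSystem M W}
  {X : CoxeterRealization K V cs}
  [IsDomain K] [Module.Free K V] [X.IsRegular] {S₀ : Set B} {w₀ : W} {l : List B}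

theorem hasDualBases_dem_nil : X.HasDualBases (X.dem []) (0 : ℕ) :=
  hasDualBases_of_fintype (ι := Unit) (fun _ => 1) (fun _ => 1) (fun _ => 0)
    (fun _ => X.one_mem_degR) (fun _ => by simpa using X.one_mem_degR) (fun f => by simp)

theorem hasDualBases_dem_singleton (s : B) : X.HasDualBases (X.dem [s]) (1 : ℕ) := by
  refine hasDualBases_of_fintype ![1, -X.actR (cs.simple s) (X.fund s)] ![X.fund s, 1] ![0, 2]
    (fun i => ?_) (fun i => ?_) (fun f => ?_)
  · fin_cases i
    · exact X.one_mem_degR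
    · exact neg_mem (X.actR_mem_degR _ (X.fund_mem_degR s))
  · fin_cases i
    · exact X.fund_mem_degR s
    · exact X.one_mem_degR
  · simp only [Fin.sum_univ_two, Matrix.cons_val_zero, Matrix.cons_val_one, dem_cons, dem_nil,
      one_mul]
    rw [X.demazure_mul, X.demazure_fund]
    ring

theorem exists_isReflection_ne_of_isReduced {s s' : B} (hs : s ∈ S₀) (hs' : s' ∈ S₀)
    (hr : cs.IsReduced (s :: s' :: l)) (t : W) :
    ∃ t' ∈ cs.parabolic S₀, cs.IsReflection t' ∧ t ≠ t' := by
  by_cases h : t = cs.simple s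
  · refine ⟨cs.simple s', cs.simple_mem_parabolic hs', cs.isReflection_simple s', fun h' => ?_⟩
    have h1 : cs.length (cs.wordProd (s :: s' :: l)) = l.length + 2 := hr
    rw [CoxeterSystem.wordProd_cons, CoxeterSystem.wordProd_cons, ← h, h',
      CoxeterSystem.simple_mul_simple_cancel_left] at h1
    have := cs.length_wordProd_le l
    omega
  · exact ⟨cs.simple s, cs.simple_mem_parabolic hs, cs.isReflection_simple s, h⟩

/-- If `W_{S₀}` contains another reflection, then the root of `t` is part of a basis of `V`. -/
theorem IsGKM.exists_form_eq_one [IsLocalRing K] (hGKM : X.IsGKM S₀) {t t' : W}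
    (ht : t ∈ cs.parabolic S₀) (ht' : t' ∈ cs.parabolic S₀) (hrt : cs.IsReflection t)
    (hrt' : cs.IsReflection t') (hne : t ≠ t') : ∃ φ : V →ₗ[K] K, φ (X.reflRoot t) = 1 := by
  refine CoxeterRealization.exists_form_eq_one fun h => ?_
  have := (hGKM t ht t' ht' hrt hrt' hne (IsLocalRing.maximalIdeal K) inferInstance).ne_zero 0
  exact this ((Submodule.Quotient.mk_eq_zero _).2 h)

theorem IsGKM.mkQ_ne_smul (hGKM : X.IsGKM S₀) {t t' : W}
    (ht : t ∈ cs.parabolic S₀) (ht' : t' ∈ cs.parabolic S₀) (hrt : cs.IsReflection t)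
    (hrt' : cs.IsReflection t') (hne : t ≠ t') (𝔪 : Ideal K) [h𝔪 : 𝔪.IsMaximal] (c : K ⧸ 𝔪) :
    (𝔪 • (⊤ : Submodule K V)).mkQ (X.reflRoot t') ≠
      c • (𝔪 • (⊤ : Submodule K V)).mkQ (X.reflRoot t) := fun h => by
  have := (LinearIndependent.pair_iff.1 (hGKM t ht t' ht' hrt hrt' hne 𝔪 h𝔪)) c (-1) (by
    rw [neg_smul, one_smul, ← h, add_neg_cancel])
  exact one_ne_zero (neg_eq_zero.1 this.2)

theorem hasDualBases_of_isGKM [IsLocalRing K] [Module.Finite K V] [Finite (cs.parabolic S₀)]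
    (b : Module.Basis (cs.parabolic S₀) (X.invariants (cs.parabolic S₀)) X.R)
    (hGKM : X.IsGKM S₀)
    (hb : ∀ x : cs.parabolic S₀, b x ∈ X.degR (2 * cs.length (x : W)))
    (hw₀ : cs.IsLongest S₀ w₀) (hr : cs.IsReduced l) (hw : cs.wordProd l = w₀)
    (hl : ∀ s ∈ l, s ∈ S₀) : X.HasDualBases (X.dem l) l.length := by
  match l, hr, hw, hl with
  | [], _, _, _ => exact hasDualBases_dem_nil
  | [s], _, _, _ => exact hasDualBases_dem_singleton s
  | s :: s' :: l, hr, hw, hl =>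
    let 𝔪 := IsLocalRing.maximalIdeal K
    let _ : Field (K ⧸ 𝔪) := Ideal.Quotient.field 𝔪
    have : Module.Finite (K ⧸ 𝔪) (V ⧸ (𝔪 • ⊤ : Submodule K V)) :=
      Module.Finite.of_restrictScalars_finite K _ _
    refine hasDualBases_dem b (isReduction_mkQ 𝔪) (fun c hc => ?_) hb hw₀ hr hw hl
      (fun t ht hrt => ?_) (fun t ht t' ht' hrt hrt' hne c => ?_)
    · by_contra h
      exact hc (Ideal.Quotient.eq_zero_iff_mem.2 ((IsLocalRing.mem_maximalIdeal c).2 h))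
    · obtain ⟨t', ht', hrt', hne⟩ :=
        exists_isReflection_ne_of_isReduced (hl s (by simp)) (hl s' (by simp)) hr t
      exact hGKM.exists_form_eq_one ht ht' hrt hrt' hne
    · exact hGKM.mkQ_ne_smul ht ht' hrt hrt' hne 𝔪 c

/-- The longest element has a reduced word `l` in `S₀`, for which `∂_l : R → R^{W_{S₀}}` is a
Frobenius form. -/
theorem exists_dem [IsLocalRing K] [Module.Finite K V] [Finite (cs.parabolic S₀)]
    (hGKM : X.IsGKM S₀) (hfree : X.IsGradedFreeOver S₀) (hw₀ : cs.IsLongest S₀ w₀) :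
    ∃ l : List B, cs.IsReduced l ∧ (∀ s ∈ l, s ∈ S₀) ∧ cs.wordProd l = w₀ ∧
      (∀ f, X.dem l f ∈ X.invariants (cs.parabolic S₀)) ∧
      X.HasDualBases (X.dem l) l.length := by
  obtain ⟨l, hr, hl, hw⟩ := cs.exists_isReduced_of_mem_parabolic hw₀.1
  obtain ⟨b, hb⟩ := hfree
  obtain ⟨κ, hκ⟩ := dem_eq_repr_mul b hb hw₀ hl (hw ▸ hr.symm)
  refine ⟨l, hr, hl, hw.symm, fun f => ?_, hasDualBases_of_isGKM b hGKM hb hw₀ hr hw.symm hl⟩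
  rw [hκ]
  exact mul_mem (Subalgebra.algebraMap_mem _ _) (b.repr f _).2

end GKM

end CoxeterRealization

namespace CoxeterRealization

variable {K : Type u} {V : Type v} [CommRing K] [AddCommGroup V] [Module K V]
  {B W : Type*} [Group W] {M : CoxeterMatrix B} {cs : CoxeterSystem M W}

/-! ### Frobenius forms and the decomposition of `R ⊗_{R^H} Q` -/

/-- A form `D : R → R^H` of degree `-2 N` with homogeneous dual bases, which is over `Q` a
combination of the automorphisms `y⁻¹`, `y ∈ H`. -/
structure FrobeniusForm (X : CoxeterRealization K V cs) (H : Subgroup W) [Fintype H] (N : ℤ) where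
  /-- The form. -/
  toLin : X.R →ₗ[X.invariants H] X.R
  mem : ∀ f, toLin f ∈ X.invariants H
  map_deg : ∀ k, ∀ f ∈ X.degR k, toLin f ∈ X.degR (k - 2 * N)
  /-- The number of elements of the dual bases. -/
  m : ℕ
  /-- The first of the dual bases. -/
  b : Fin m → X.R
  /-- The second of the dual bases. -/
  b' : Fin m → X.R
  /-- The degrees of the elements of the first basis. -/
  d : Fin m → ℤ
  b_mem : ∀ i, b i ∈ X.degR (d i)
  b'_mem : ∀ i, b' i ∈ X.degR (2 * N - d i)
  eq_sum : ∀ f, f = ∑ i, b i * toLin (b' i * f)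
  /-- The coefficients of the form as a combination of the automorphisms `y⁻¹`. -/
  coeff : H → X.Q
  map_eq : ∀ f, algebraMap X.R X.Q (toLin f) =
    ∑ y : H, coeff y * algebraMap X.R X.Q (X.actR (y : W)⁻¹ f)

/-- Distinct elements of `H` act differently on `R`. -/
def IsFaithful (X : CoxeterRealization K V cs) (H : Subgroup W) : Prop :=
  ∀ x ∈ H, ∀ y ∈ H, (∀ f, X.actR x⁻¹ f = X.actR y⁻¹ f) → x = y

theorem isFaithful_of_act [IsDomain K] [Module.Free K V] {X : CoxeterRealization K V cs}
    {H : Subgroup W} (h : ∀ w ∈ H, X.act w = LinearMap.id → w = 1) : X.IsFaithful H := by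
  intro x hx y hy hxy
  have h1 : ∀ v, X.act x⁻¹ v = X.act y⁻¹ v := fun v => ι_injective (K := K) (by
    rw [← actR_ι, ← actR_ι]; exact hxy _)
  have := h (y * x⁻¹) (mul_mem hy (inv_mem hx)) (LinearMap.ext fun v => by
    rw [map_mul, Module.End.mul_apply, h1, X.act_act_inv]; rfl)
  exact (mul_inv_eq_one.1 this).symm

namespace FrobeniusForm

variable {X : CoxeterRealization K V cs} [IsDomain K] [Module.Free K V]
  {H : Subgroup W} [Fintype H] {N : ℤ} (D : X.FrobeniusForm H N)

theorem toLin_mul_of_mem {c : X.R} (hc : c ∈ X.invariants H) (f : X.R) :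
    D.toLin (c * f) = c * D.toLin f :=
  D.toLin.map_smul (⟨c, hc⟩ : X.invariants H) f

open Classical in
/-- The matrices `(x⁻¹(b_i))` and `(coeff y * y⁻¹(b'_i))` are inverse to each other, by linear
independence of characters. -/
theorem coeff_mul_sum (hH : X.IsFaithful H) (x y : H) :
    D.coeff y * ∑ i, algebraMap X.R X.Q (X.actR (x : W)⁻¹ (D.b i)) *
      algebraMap X.R X.Q (X.actR (y : W)⁻¹ (D.b' i)) = if y = x then 1 else 0 := by
  have hσ : Function.Injective fun y : H =>
      (algebraMap X.R X.Q).comp (X.actR (y : W)⁻¹ : X.R →+* X.R) := fun y y' h =>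
    Subtype.ext (hH y y.2 y' y'.2 fun f =>
      IsFractionRing.injective X.R X.Q (DFunLike.congr_fun h f))
  have := eq_zero_of_sum_mul_ringHom Finset.univ hσ
    (a := fun y => D.coeff y * ∑ i, algebraMap X.R X.Q (X.actR (x : W)⁻¹ (D.b i)) *
      algebraMap X.R X.Q (X.actR (y : W)⁻¹ (D.b' i)) - if y = x then 1 else 0) (fun f => by
    have h1 : algebraMap X.R X.Q (X.actR (x : W)⁻¹ f) =
        ∑ i, algebraMap X.R X.Q (X.actR (x : W)⁻¹ (D.b i)) *
          ∑ y : H, D.coeff y * algebraMap X.R X.Q (X.actR (y : W)⁻¹ (D.b' i * f)) := by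
      conv_lhs => rw [D.eq_sum f]
      simp only [map_sum, map_mul]
      refine Finset.sum_congr rfl fun i _ => ?_
      rw [X.actR_coe_invariants ⟨_, D.mem (D.b' i * f)⟩ (inv_mem x.2), D.map_eq]
      simp only [map_mul]
    simp only [sub_mul, Finset.sum_sub_distrib, ite_mul, one_mul, zero_mul, Finset.sum_ite_eq',
      Finset.mem_univ, if_true]
    refine sub_eq_zero.2 (Eq.trans ?_ h1.symm)
    simp only [Finset.mul_sum, Finset.sum_mul]
    rw [Finset.sum_comm]
    refine Finset.sum_congr rfl fun i _ => Finset.sum_congr rfl fun y _ => ?_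
    simp only [RingHom.comp_apply, RingHom.coe_coe, map_mul]
    ring) y (Finset.mem_univ _)
  exact sub_eq_zero.1 this

end FrobeniusForm

namespace PreObj

variable {X : CoxeterRealization K V cs} [IsDomain K] [Module.Free K V]

/-- Direct summands of objects of `𝒞` are objects of `𝒞`. -/
theorem IsObj.of_retract {N : PreObj.{u, v, w₁} X} {P : PreObj.{u, v, w₂} X} (hN : N.IsObj)
    {i : P.carrier →ₗ[X.R] N.carrier} {p : N.carrier →ₗ[X.R] P.carrier}
    (hi : IsHom P N 0 i) (hp : IsHom N P 0 p) (h : ∀ z, p (i z) = z) : P.IsObj := by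
  classical
  have hiQ : ∀ ξ, p.baseChange X.Q (i.baseChange X.Q ξ) = ξ := fun ξ => by
    rw [← LinearMap.comp_apply, ← LinearMap.baseChange_comp,
      show p ∘ₗ i = LinearMap.id from LinearMap.ext h, LinearMap.baseChange_id]
    rfl
  constructor
  · exact DirectSum.isInternal_of_retract i.toAddMonoidHom p.toAddMonoidHom
      (fun k x hx => by simpa using hi.map_deg k x hx)
      (fun k x hx => by simpa using hp.map_deg k x hx) h hN.deg_internal
  · intro a b r n hr hn
    have h1 := hi.map_deg b n hn
    have h2 := hp.map_deg _ _ (hN.right_deg _ _ _ _ hr h1)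
    rw [map_smul, h] at h2
    simpa using h2
  · intro a b r n hr hn
    have h1 := hi.map_deg b n hn
    have h2 := hp.map_deg _ _ (hN.left_deg _ _ _ _ hr h1)
    rw [hp.map_left, h] at h2
    simpa using h2
  · exact DirectSum.isInternal_of_retract (i.baseChange X.Q).toAddMonoidHom
      (p.baseChange X.Q).toAddMonoidHom (fun x ξ hξ => baseChange_mem_loc (hi.map_loc x) hξ)
      (fun x ξ hξ => baseChange_mem_loc (hp.map_loc x) hξ) hiQ hN.loc_internal
  · intro x ξ hξ f
    have h1 := congrArg (p.baseChange X.Q)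
      (hN.left_loc x _ (baseChange_mem_loc (hi.map_loc x) hξ) f)
    rw [map_smul, hiQ, ← LinearMap.comp_apply, ← LinearMap.baseChange_comp,
      show p ∘ₗ N.left f = P.left f ∘ₗ p from LinearMap.ext (hp.map_left f),
      LinearMap.baseChange_comp, LinearMap.comp_apply, hiQ] at h1
    exact h1

variable {H : Subgroup W}

/-- The evaluation `R ⊗_{R^H} Q → Q`, `f ⊗ g ↦ w⁻¹(f) g`. -/
def evQ (X : CoxeterRealization K V cs) {w : W} (hw : w ∈ H) :
    X.Q ⊗[X.R] (X.invObj H).carrier →ₗ[X.Q] X.Q :=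
  (TensorProduct.AlgebraTensorModule.rid X.R X.Q X.Q).toLinearMap ∘ₗ
    (evInv X hw).baseChange X.Q

@[simp] theorem evQ_tmul {w : W} (hw : w ∈ H) (q : X.Q) (z : (X.invObj H).carrier) :
    evQ X hw (q ⊗ₜ z) = q * algebraMap X.R X.Q (evInv X hw z) := by
  change evInv X hw z • q = _
  rw [Algebra.smul_def, mul_comm]

theorem evQ_left {w : W} (hw : w ∈ H) (r : X.R) (ξ : X.Q ⊗[X.R] (X.invObj H).carrier) :
    evQ X hw (((X.invObj H).left r).baseChange X.Q ξ) =
      algebraMap X.R X.Q (X.actR w⁻¹ r) * evQ X hw ξ := by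
  induction ξ using TensorProduct.induction_on with
  | zero => simp
  | tmul q z =>
    rw [LinearMap.baseChange_tmul, evQ_tmul, evQ_tmul, evInv_left, map_mul]
    ring
  | add a b ha hb => simp only [map_add, ha, hb, mul_add]

theorem evQ_eq_zero (hH : X.IsFaithful H) {w x : W} (hw : w ∈ H) (hx : x ≠ w)
    {ξ : X.Q ⊗[X.R] (X.invObj H).carrier} (hξ : ξ ∈ (X.invObj H).loc x) : evQ X hw ξ = 0 := by
  by_cases h : x ∈ H
  · rw [invObj_loc_of_mem h] at hξ
    by_contra h0
    refine hx (hH x h w hw fun f => ?_)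
    have := congrArg (evQ X hw) (hξ f)
    rw [evQ_left, map_smul, smul_eq_mul] at this
    exact (IsFractionRing.injective X.R X.Q (mul_right_cancel₀ h0 this)).symm
  · rw [invObj_loc_of_not_mem h, Submodule.mem_bot] at hξ
    rw [hξ, map_zero]

section Idempotent

variable [Fintype H] {N : ℤ} (D : X.FrobeniusForm H N)

/-- The idempotent of `R ⊗_{R^H} Q` at `x ∈ H`. -/
def idem (x : H) : X.Q ⊗[X.R] (X.invObj H).carrier :=
  ∑ i, (D.coeff x * algebraMap X.R X.Q (X.actR (x : W)⁻¹ (D.b' i))) ⊗ₜ itm X H (D.b i) 1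

open Classical in
theorem evQ_idem (hH : X.IsFaithful H) (x y : H) :
    evQ X x.2 (idem D y) = if y = x then 1 else 0 := by
  rw [← D.coeff_mul_sum hH, idem, map_sum, Finset.mul_sum]
  refine Finset.sum_congr rfl fun i _ => ?_
  rw [evQ_tmul, evInv_itm, mul_one]
  ring

theorem itm_eq_sum (f g : X.R) :
    itm X H f g = ∑ i, itm X H (D.b i) (D.toLin (D.b' i * f) * g) := by
  conv_lhs => rw [D.eq_sum f]
  have h1 : ∀ s : Finset (Fin D.m), itm X H (∑ i ∈ s, D.b i * D.toLin (D.b' i * f)) g =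
      ∑ i ∈ s, itm X H (D.b i) (D.toLin (D.b' i * f) * g) := fun s => by
    classical
    induction s using Finset.induction_on with
    | empty => exact TensorProduct.zero_tmul (R := X.invariants H) X.R g
    | insert i s hi ih =>
      rw [Finset.sum_insert hi, Finset.sum_insert hi, add_itm, ih, mul_comm (D.b i),
        mul_itm (D.mem _)]
  exact h1 _

theorem sum_evQ_smul_idem (ξ : X.Q ⊗[X.R] (X.invObj H).carrier) :
    ∑ x : H, evQ X x.2 ξ • idem D x = ξ := by
  induction ξ using TensorProduct.induction_on with
  | zero => simp
  | tmul q z =>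
    have key : ∀ z : (X.invObj H).carrier, ∑ x : H, algebraMap X.R X.Q (evInv X x.2 z) •
        idem D x = (1 : X.Q) ⊗ₜ z := by
      intro z
      induction z using inv_induction with
      | itm f g =>
        simp only [idem, Finset.smul_sum, TensorProduct.smul_tmul', evInv_itm, smul_eq_mul]
        rw [Finset.sum_comm, itm_eq_sum D, TensorProduct.tmul_sum]
        refine Finset.sum_congr rfl fun i _ => ?_
        rw [← TensorProduct.sum_tmul, show itm X H (D.b i) (D.toLin (D.b' i * f) * g) =
          (D.toLin (D.b' i * f) * g) • itm X H (D.b i) 1 by rw [smul_itm, mul_one],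
          ← TensorProduct.smul_tmul, Algebra.smul_def, mul_one, map_mul, D.map_eq, Finset.sum_mul]
        congr 1
        refine Finset.sum_congr rfl fun x _ => ?_
        simp only [map_mul]
        ring
      | add a b ha hb => simp only [map_add, add_smul, Finset.sum_add_distrib, ha, hb,
          TensorProduct.tmul_add]
    have h1 := congrArg (q • ·) (key z)
    simp only [Finset.smul_sum, smul_smul, TensorProduct.smul_tmul', smul_eq_mul, mul_one] at h1
    simpa only [evQ_tmul] using h1
  | add a b ha hb => simp only [map_add, add_smul, Finset.sum_add_distrib, ha, hb]

include D in
theorem evQ_ext {ξ η : X.Q ⊗[X.R] (X.invObj H).carrier}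
    (h : ∀ x : H, evQ X x.2 ξ = evQ X x.2 η) : ξ = η := by
  rw [← sum_evQ_smul_idem D ξ, ← sum_evQ_smul_idem D η]
  exact Finset.sum_congr rfl fun x _ => by rw [h]

theorem idem_mem_loc (hH : X.IsFaithful H) (x : H) : idem D x ∈ (X.invObj H).loc x := by
  classical
  rw [invObj_loc_of_mem x.2]
  intro f
  refine evQ_ext D fun y => ?_
  change evQ X y.2 (((X.invObj H).left f).baseChange X.Q (idem D x)) = _
  rw [evQ_left, map_smul, smul_eq_mul, evQ_idem D hH]
  split_ifs with h
  · rw [h]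
  · rw [mul_zero, mul_zero]

include D in
theorem loc_internal_invObj [DecidableEq W] (hH : X.IsFaithful H) :
    DirectSum.IsInternal (X.invObj H).loc := by
  classical
  refine DirectSum.isInternal_of_proj
    (fun x ξ => if h : x ∈ H then evQ X h ξ • idem D ⟨x, h⟩ else 0) ?_ ?_ ?_ ?_
  · intro x ξ η
    split_ifs
    · rw [map_add, add_smul]
    · rw [add_zero]
  · intro x ξ hξ
    split_ifs with h
    · conv_rhs => rw [← sum_evQ_smul_idem D ξ]
      symm
      refine Finset.sum_eq_single (⟨x, h⟩ : H) (fun y _ hy => ?_)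
        fun h => absurd (Finset.mem_univ _) h
      rw [evQ_eq_zero hH y.2 (fun h => hy (Subtype.ext h.symm)) hξ, zero_smul]
    · rw [invObj_loc_of_not_mem h, Submodule.mem_bot] at hξ
      exact hξ.symm
  · intro x y hxy ξ hξ
    change (if h : y ∈ H then evQ X h ξ • idem D ⟨y, h⟩ else 0) = 0
    split_ifs with h
    · rw [evQ_eq_zero hH h hxy hξ, zero_smul]
    · rfl
  · intro ξ
    rw [← sum_evQ_smul_idem D ξ]
    exact sum_mem fun x _ => AddSubmonoid.subset_closure
      (Set.mem_iUnion.2 ⟨x, Submodule.smul_mem _ _ (idem_mem_loc D hH x)⟩)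

/-- The element `b ⊗ r`, as a function of `r`. -/
def itmHom (X : CoxeterRealization K V cs) (H : Subgroup W) (b : X.R) :
    X.R →+ (X.invObj H).carrier where
  toFun r := itm X H b r
  map_zero' := TensorProduct.tmul_zero (R := X.invariants H) X.R b
  map_add' := fun r r' => TensorProduct.tmul_add (R := X.invariants H) b r r'

include D in
theorem deg_internal_invObj [DecidableEq ℤ] : DirectSum.IsInternal (X.invObj H).deg := by
  have key : ∀ z : (X.invObj H).carrier, ∑ i, itmHom X H (D.b i)
      (invLift (D.toLin ∘ₗ LinearMap.mulLeft (X.invariants H) (D.b' i)) z) = z := by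
    intro z
    induction z using inv_induction with
    | itm f g => exact (itm_eq_sum D f g).symm
    | add a b ha hb => simp only [map_add, Finset.sum_add_distrib, ha, hb]
  refine DirectSum.isInternal_of_retract_family (A := fun i k => X.degR (k - D.d i))
    (fun i => (invLift (D.toLin ∘ₗ LinearMap.mulLeft (X.invariants H) (D.b' i))).toAddMonoidHom)
    (fun i => itmHom X H (D.b i)) (fun i k => ?_) (fun i k x hx => ?_) key
    (fun i => DirectSum.isInternal_reindex X.degR_internal (Equiv.subRight (D.d i)))
  · refine invObj_deg_le (S := (X.degR (k - D.d i)).comap (invLift (D.toLin ∘ₗ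
      LinearMap.mulLeft (X.invariants H) (D.b' i))).toAddMonoidHom) fun a c hac f hf g hg => ?_
    change D.toLin (D.b' i * f) * g ∈ X.degR (k - D.d i)
    have := X.mul_mem_degR (D.map_deg _ _ (X.mul_mem_degR (D.b'_mem i) hf)) hg
    rwa [show 2 * N - D.d i + a - 2 * N + c = k - D.d i by omega] at this
  · exact itm_mem_deg (by omega) (D.b_mem i) hx

include D in
theorem isObj_invObj (hH : X.IsFaithful H) : (X.invObj H).IsObj where
  deg_internal := deg_internal_invObj D
  right_deg := (invObj_isGraded H).right_deg
  left_deg := (invObj_isGraded H).left_deg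
  loc_internal := by classical exact loc_internal_invObj D hH
  left_loc x ξ hξ f := by
    by_cases h : x ∈ H
    · rw [invObj_loc_of_mem h] at hξ
      exact hξ f
    · rw [invObj_loc_of_not_mem h, Submodule.mem_bot] at hξ
      rw [hξ, map_zero, smul_zero]

end Idempotent

end PreObj

end CoxeterRealization

/-- Dedekind's independence of characters, with coefficients in a vector space. -/
theorem eq_zero_of_sum_smul_ringHom {A L ι E : Type*} [CommRing A] [Field L] [AddCommGroup E]
    [Module L E] (s : Finset ι) {σ : ι → A →+* L} (hσ : Function.Injective σ) {e : ι → E}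
    (h : ∀ f, ∑ i ∈ s, σ i f • e i = 0) : ∀ i ∈ s, e i = 0 := by
  intro i hi
  rw [← Module.forall_dual_apply_eq_zero_iff L]
  intro lam
  refine eq_zero_of_sum_mul_ringHom s hσ (a := fun i => lam (e i)) (fun f => ?_) i hi
  have := congrArg lam (h f)
  rw [map_sum, map_zero] at this
  rw [← this]
  exact Finset.sum_congr rfl fun j _ => by rw [map_smul, smul_eq_mul, mul_comm]

namespace CoxeterRealization

variable {K : Type u} {V : Type v} [CommRing K] [AddCommGroup V] [Module K V]
  {B W : Type*} [Group W] {M : CoxeterMatrix B} {cs : CoxeterSystem M W}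

namespace PreObj

variable {X : CoxeterRealization K V cs} [IsDomain K] [Module.Free K V]
variable {N : PreObj.{u, v, w₁} X} {P : PreObj.{u, v, w₂} X} {H : Subgroup W}

/-! ### Homomorphisms out of `R ⊗_{R^H} R` -/

theorem LocLeft.left_loc (hN : N.LocLeft) {x : W} {ξ : X.Q ⊗[X.R] N.carrier} (hξ : ξ ∈ N.loc x)
    (f : X.R) : (N.left f).baseChange X.Q ξ = algebraMap X.R X.Q (X.actR x⁻¹ f) • ξ := by
  rw [loc_eq_span] at hξ
  induction hξ using Submodule.span_induction with
  | mem ξ hξ =>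
    obtain ⟨n, hn, rfl⟩ := hξ
    rw [LinearMap.baseChange_tmul, algebraMap_smul_tmul]
    exact hN x n hn f
  | zero => simp
  | add a b _ _ ha hb => rw [map_add, ha, hb, smul_add]
  | smul q a _ ha => rw [map_smul, ha, smul_comm]

/-- `N_Q` is the sum of its components for `x ∈ H`. -/
def LocSpans (N : PreObj.{u, v, w₁} X) (H : Subgroup W) : Prop :=
  ∀ ξ : X.Q ⊗[X.R] N.carrier, ξ ∈ ⨆ x : H, N.loc x

/-- If the support lies in a group acting faithfully, the `N_Q^x` are the full eigenspaces: this is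
linear independence of characters. -/
theorem mem_loc_of_eigen (hH : X.IsFaithful H) (hN : N.LocLeft) (hs : N.LocSpans H) {x : W}
    (hx : x ∈ H) {ξ : X.Q ⊗[X.R] N.carrier}
    (h : ∀ f, (N.left f).baseChange X.Q ξ = algebraMap X.R X.Q (X.actR x⁻¹ f) • ξ) :
    ξ ∈ N.loc x := by
  classical
  obtain ⟨η, hη, hsum⟩ := (Submodule.mem_iSup_iff_exists_finsupp _ _).1 (hs ξ)
  let x' : H := ⟨x, hx⟩
  have hσ : Function.Injective fun y : H =>
      (algebraMap X.R X.Q).comp (X.actR (y : W)⁻¹ : X.R →+* X.R) := fun y y' h =>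
    Subtype.ext (hH y y.2 y' y'.2 fun f =>
      IsFractionRing.injective X.R X.Q (DFunLike.congr_fun h f))
  let ζ : H →₀ X.Q ⊗[X.R] N.carrier := η - Finsupp.single x' ξ
  have hζ : ζ.sum (fun _ a => a) = 0 := by
    rw [Finsupp.sum_sub_index (fun _ _ _ => rfl), Finsupp.sum_single_index rfl]
    exact sub_eq_zero.2 hsum
  have hleft : ∀ y f, (N.left f).baseChange X.Q (ζ y) =
      algebraMap X.R X.Q (X.actR (y : W)⁻¹ f) • ζ y := fun y f => by
    rw [Finsupp.sub_apply, map_sub, hN.left_loc (hη y), smul_sub]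
    by_cases hy : x' = y
    · rw [← hy, Finsupp.single_eq_same, h]
    · rw [Finsupp.single_eq_of_ne (Ne.symm hy), map_zero, smul_zero]
  have hzero : ζ x' = 0 := by
    by_cases hxs : x' ∈ ζ.support
    · refine eq_zero_of_sum_smul_ringHom ζ.support hσ (e := ζ) (fun f => ?_) x' hxs
      have h1 := congrArg ((N.left f).baseChange X.Q) hζ
      rw [Finsupp.sum, map_sum, map_zero] at h1
      exact (Finset.sum_congr rfl fun y _ => (hleft y f).symm).trans h1
    · exact Finsupp.notMem_support_iff.1 hxs
  rw [Finsupp.sub_apply, Finsupp.single_eq_same, sub_eq_zero] at hzero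
  rw [← hzero]
  exact hη x'

/-- The map `R ⊗_{R^H} R → N`, `f ⊗ g ↦ f n g`. -/
def invMap (n : N.carrier) (hn : ∀ c ∈ X.invariants H, N.left c n = c • n) :
    (X.invObj H).carrier →ₗ[X.R] N.carrier :=
  let φ : X.R ⊗[X.invariants H] X.R →+ N.carrier :=
    TensorProduct.liftAddHom
      { toFun := fun f =>
          { toFun := fun g => g • N.left f n
            map_zero' := zero_smul _ _
            map_add' := fun a b => add_smul _ _ _ }
        map_zero' := by
          ext g
          change g • N.left 0 n = 0
          rw [map_zero, LinearMap.zero_apply, smul_zero]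
        map_add' := fun a b => by
          ext g
          change g • N.left (a + b) n = g • N.left a n + g • N.left b n
          rw [map_add, LinearMap.add_apply, smul_add] }
      (fun c f g => by
        change g • N.left (c • f) n = (c • g) • N.left f n
        rw [Subalgebra.smul_def, Subalgebra.smul_def, smul_eq_mul, smul_eq_mul, mul_comm (c : X.R),
          map_mul, Module.End.mul_apply, hn c c.2, map_smul, smul_smul, mul_comm])
  let φ' : (X.invObj H).carrier →+ N.carrier :=
    { toFun := fun z => φ z
      map_zero' := map_zero φ
      map_add' := fun a b => map_add φ a b }
  { φ' with
    map_smul' := fun r z => by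
      change φ' (r • z) = r • φ' z
      induction z using inv_induction with
      | itm f g =>
        rw [smul_itm]
        change (r * g) • N.left f n = r • g • N.left f n
        rw [mul_smul]
      | add a b ha hb => rw [smul_add, map_add, ha, hb, map_add, smul_add] }

@[simp] theorem invMap_itm (n : N.carrier) (hn : ∀ c ∈ X.invariants H, N.left c n = c • n)
    (f g : X.R) : invMap n hn (itm X H f g) = g • N.left f n := rfl

theorem invMap_left (n : N.carrier) (hn : ∀ c ∈ X.invariants H, N.left c n = c • n)
    (r : X.R) (z : (X.invObj H).carrier) :
    invMap n hn ((X.invObj H).left r z) = N.left r (invMap n hn z) := by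
  induction z using inv_induction with
  | itm f g => rw [left_itm, invMap_itm, invMap_itm, map_smul, map_mul]; rfl
  | add a b ha hb => simp only [map_add, ha, hb]

theorem isHom_invMap (hH : X.IsFaithful H) (hN : N.LocLeft) (hs : N.LocSpans H)
    (hNg : N.IsGraded) {k : ℤ} {n : N.carrier} (hnk : n ∈ N.deg k)
    (hn : ∀ c ∈ X.invariants H, N.left c n = c • n) :
    IsHom (X.invObj H) N k (invMap n hn) where
  map_left := invMap_left n hn
  map_deg i := by
    refine invObj_deg_le (S := (N.deg (i + k)).comap (invMap n hn).toAddMonoidHom)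
      fun a b hab f hf g hg => ?_
    change g • N.left f n ∈ N.deg (i + k)
    have := hNg.right_deg _ _ _ _ hg (hNg.left_deg _ _ _ _ hf hnk)
    rwa [show b + (a + k) = i + k by omega] at this
  map_loc x z hz := by
    by_cases hx : x ∈ H
    · refine mem_loc_of_eigen hH hN hs hx fun f => ?_
      have := congrArg ((invMap n hn).baseChange X.Q) ((mem_invObj_locSub hx).1 hz f)
      rw [LinearMap.baseChange_tmul, LinearMap.baseChange_tmul, invMap_left, map_smul] at this
      rw [TensorProduct.mk_apply, LinearMap.baseChange_tmul, algebraMap_smul_tmul, this]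
    · rw [mem_locSub, invObj_loc_of_not_mem hx, Submodule.mem_bot] at hz
      have := congrArg ((invMap n hn).baseChange X.Q) hz
      rw [LinearMap.baseChange_tmul, map_zero] at this
      rw [mem_locSub, this]
      exact zero_mem _

/-! ### The localization of Bott-Samelson bimodules -/

variable {S₀ : Set B}

variable (X) in
theorem bs_isSoergel : (l : List B) → X.IsSoergel (X.bottSamelson l)
  | [] => .unit
  | s :: l => .tensor (.simple s) (bs_isSoergel l)

variable [X.IsRegular]

theorem simpleObj_torsionFree (s : B) : (X.simpleObj s).TorsionFree := fun r n h => by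
  have h1 : r • (tm n (stdOne X 1) : ((X.simpleObj s).tensor (X.stdObj 1)).carrier) = 0 := by
    have h2 : r • stdOne X 1 = (X.stdObj 1).left r (stdOne X 1) := by
      change r * 1 = X.actR (1 : W)⁻¹ r * 1
      rw [inv_one, actR_one_apply]
    rw [smul_tm, h2, ← smul_tm_left, h, zero_tm]
  refine ((stdObj_torsionFree 1).simpleTensor s r _ h1).imp_right fun h2 => ?_
  have h3 := congrArg (rightUnit (X.simpleObj s)) h2
  rw [rightUnit_tm, map_zero] at h3
  exact (one_smul X.R n).symm.trans h3

theorem simpleTensor_loc_of_not_mem {s : B} (hs : cs.simple s ∈ H) (hN : N.TorsionFree)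
    (h : ∀ x ∉ H, N.loc x = ⊥) {x : W} (hx : x ∉ H) : ((X.simpleObj s).tensor N).loc x = ⊥ := by
  rw [eq_bot_iff]
  refine Submodule.span_le.2 ?_
  rintro _ ⟨y, z, n, p, rfl, hn, hp, rfl⟩
  have h0 : tm n p = (0 : ((X.simpleObj s).tensor N).carrier) := by
    by_cases hz : z ∈ H
    · have hy : y ∉ cs.parabolic {s} := fun hy => hx (mul_mem (by
        rcases (mem_parabolic_singleton s).1 hy with rfl | rfl
        · exact one_mem _
        · exact hs) hz)
      have h2 : (1 : X.Q) ⊗ₜ[X.R] n = 0 :=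
        (Submodule.mem_bot X.Q).1 ((invObj_loc_of_not_mem (X := X) hy).le hn)
      rw [(simpleObj_torsionFree s).one_tmul_injective
        (h2.trans (TensorProduct.tmul_zero _ _).symm), zero_tm]
    · rw [h z hz, Submodule.mem_bot] at hp
      rw [hN.one_tmul_injective (hp.trans (TensorProduct.tmul_zero _ _).symm), tm_zero]
  change (1 : X.Q) ⊗ₜ[X.R] (tm n p : ((X.simpleObj s).tensor N).carrier) ∈ (⊥ : Submodule X.Q _)
  rw [h0, TensorProduct.tmul_zero]
  exact zero_mem _

theorem LocSpans.simpleTensor {s : B} (hs : cs.simple s ∈ H) (hN : N.TorsionFree)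
    (hL : N.LocLeft) (h : N.LocSpans H) : ((X.simpleObj s).tensor N).LocSpans H := by
  let T : Submodule X.Q (X.Q ⊗[X.R] ((X.simpleObj s).tensor N).carrier) :=
    ⨆ x : H, ((X.simpleObj s).tensor N).loc x
  have hL' := (X.simpleObj_locLeft s).tensor hL
  have hleft : ∀ f, ∀ ξ ∈ T, (((X.simpleObj s).tensor N).left f).baseChange X.Q ξ ∈ T := fun f => by
    change T ≤ T.comap _
    refine iSup_le fun x ξ hξ => Submodule.mem_iSup_of_mem x ?_
    rw [LocLeft.left_loc hL' hξ]
    exact Submodule.smul_mem _ _ hξ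
  have key : ∀ η : X.Q ⊗[X.R] N.carrier, (inOne s N).baseChange X.Q η ∈ T := fun η => by
    refine (iSup_le fun x => ?_ : (⨆ x : H, N.loc x) ≤
      T.comap ((inOne s N).baseChange X.Q)) (h η)
    rw [loc_eq_span]
    refine Submodule.span_le.2 ?_
    rintro _ ⟨n, hn, rfl⟩
    change (inOne s N).baseChange X.Q ((1 : X.Q) ⊗ₜ n) ∈ T
    rw [LinearMap.baseChange_tmul]
    -- `x⁻¹(α_s)` times this element is the sum of its components for `x` and `s x`.
    have h1 : X.actR (x : W)⁻¹ (X.rootR s) ≠ 0 :=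
      (map_ne_zero_iff _ (X.actR_injective _)).2 (X.rootR_ne_zero s)
    have h2 : algebraMap X.R X.Q (X.actR (x : W)⁻¹ (X.rootR s)) •
        ((1 : X.Q) ⊗ₜ[X.R] inOne s N n) ∈ T := by
      rw [algebraMap_smul_tmul, ← map_smul, ← hL.left_eq hN hn, inOne_apply, ← tm_cE_add,
        TensorProduct.tmul_add]
      let σ : H := ⟨cs.simple s, hs⟩
      exact add_mem
        (Submodule.mem_iSup_of_mem x (tm_mem_locSub (one_mul _) (cE_mem_locSub X s) hn))
        (Submodule.mem_iSup_of_mem (σ * x) (tm_mem_locSub rfl (cS_mem_locSub X s) hn))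
    have := T.smul_mem (algebraMap X.R X.Q (X.actR (x : W)⁻¹ (X.rootR s)))⁻¹ h2
    rwa [inv_smul_smul₀ (algebraMap_Q_ne_zero h1)] at this
  intro ξ
  change ξ ∈ T
  induction ξ using TensorProduct.induction_on with
  | zero => exact zero_mem _
  | add a b ha hb => exact add_mem ha hb
  | tmul q z =>
    rw [show q ⊗ₜ[X.R] z = q • ((1 : X.Q) ⊗ₜ[X.R] z) by
      rw [TensorProduct.smul_tmul', smul_eq_mul, mul_one]]
    refine Submodule.smul_mem _ _ ?_
    induction z using simpleTensor_induction with
    | tm f g n =>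
      rw [tm_stm, ← LinearMap.baseChange_tmul]
      refine hleft f _ ?_
      rw [← inOne_apply, ← LinearMap.baseChange_tmul]
      exact key _
    | add a b ha hb =>
      rw [TensorProduct.tmul_add]
      exact add_mem ha hb

theorem bs_loc_of_not_mem : ∀ {l : List B} (_ : ∀ s ∈ l, s ∈ S₀), ∀ x ∉ cs.parabolic S₀,
    (X.bottSamelson l).loc x = ⊥
  | [], _, _, hx => stdObj_loc_of_ne fun h => hx (h ▸ one_mem _)
  | s :: l, hl, _, hx => simpleTensor_loc_of_not_mem (N := X.bottSamelson l)
    (cs.simple_mem_parabolic (hl s (by simp))) (bs_torsionFree X l)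
    (bs_loc_of_not_mem fun t ht => hl t (by simp [ht])) hx

theorem stdObj_one_locSpans : (X.stdObj 1).LocSpans H := fun ξ => by
  have : ξ ∈ (X.stdObj 1).loc 1 := by
    rw [stdObj_loc_self]
    trivial
  exact Submodule.mem_iSup_of_mem (1 : H) this

theorem bs_locSpans : ∀ {l : List B} (_ : ∀ s ∈ l, s ∈ S₀),
    (X.bottSamelson l).LocSpans (cs.parabolic S₀)
  | [], _ => stdObj_one_locSpans
  | s :: l, hl => LocSpans.simpleTensor (N := X.bottSamelson l)
    (cs.simple_mem_parabolic (hl s (by simp))) (bs_torsionFree X l) (bs_locLeft X l)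
    (bs_locSpans fun t ht => hl t (by simp [ht]))

theorem bsOne_left {l : List B} (hl : ∀ s ∈ l, s ∈ S₀) {c : X.R}
    (hc : c ∈ X.invariants (cs.parabolic S₀)) :
    (X.bottSamelson l).left c (X.bottSamelsonOne l) = c • X.bottSamelsonOne l := by
  induction l with
  | nil =>
    change X.actR (1 : W)⁻¹ c * 1 = c * 1
    rw [inv_one, actR_one_apply]
  | cons s l ih =>
    have h1 := inOne_left (N := X.bottSamelson l) (s := s) c
      (X.invariants_le_of_mem (hl s (by simp)) hc) (X.bottSamelsonOne l)
    rw [ih fun t ht => hl t (by simp [ht]), map_smul] at h1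
    exact h1.symm

/-- `R ⊗_{R^H} R → B_{s₁} ⊗ ⋯ ⊗ B_{s_l}`, `1 ⊗ 1 ↦ (1 ⊗ 1) ⊗ ⋯ ⊗ (1 ⊗ 1)`. -/
def toBS {l : List B} (hl : ∀ s ∈ l, s ∈ S₀) :
    (X.invObj (cs.parabolic S₀)).carrier →ₗ[X.R] (X.bottSamelson l).carrier :=
  invMap (X.bottSamelsonOne l) fun _ hc => bsOne_left hl hc

theorem isHom_toBS (hH : X.IsFaithful (cs.parabolic S₀)) {l : List B} (hl : ∀ s ∈ l, s ∈ S₀) :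
    IsHom (X.invObj (cs.parabolic S₀)) (X.bottSamelson l) (-(l.length : ℤ)) (toBS hl) :=
  isHom_invMap hH (bs_locLeft X l) (bs_locSpans hl) (bs_isGraded X l) (bsOne_mem_deg X l) _

end PreObj

end CoxeterRealization

namespace CoxeterRealization

variable {K : Type u} {V : Type v} [CommRing K] [AddCommGroup V] [Module K V]
  {B W : Type*} [Group W] {M : CoxeterMatrix B} {cs : CoxeterSystem M W}

/-! ### `R ⊗_{R^H} R` as a direct summand of a Bott-Samelson bimodule -/

section FrobeniusForm

variable {X : CoxeterRealization K V cs} [IsDomain K] [Module.Free K V] {S₀ : Set B} {w₀ : W}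

/-- The composition of Demazure operators along a reduced word of the longest element is a
Frobenius form. -/
theorem exists_frobeniusForm [X.IsRegular] [IsLocalRing K] [Module.Finite K V]
    [Fintype (cs.parabolic S₀)] (hGKM : X.IsGKM S₀) (hfree : X.IsGradedFreeOver S₀)
    (hw₀ : cs.IsLongest S₀ w₀) :
    ∃ l : List B, cs.IsReduced l ∧ (∀ s ∈ l, s ∈ S₀) ∧ cs.wordProd l = w₀ ∧
      ∃ D : X.FrobeniusForm (cs.parabolic S₀) l.length, (∀ f, D.toLin f = X.dem l f) ∧
        ∀ y, D.coeff y = X.demCoeff (algebraMap X.R X.Q) l y := by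
  obtain ⟨l, hr, hl, hw, hinv, m, b, b', d, hb, hb', h⟩ := exists_dem hGKM hfree hw₀
  refine ⟨l, hr, hl, hw, ⟨⟨⟨X.dem l, map_add _⟩, fun c f => X.dem_mul_of_mem hl c.2 f⟩, hinv,
    fun k f hf => X.dem_mem_degR l hf, m, b, b', d, hb, hb', h,
    fun y => X.demCoeff (algebraMap X.R X.Q) l y, fun f => map_dem (fun s _ y _ => ?_) hl f⟩,
    fun _ => rfl, fun _ => rfl⟩
  exact (map_ne_zero_iff _ (IsFractionRing.injective X.R X.Q)).2
    ((map_ne_zero_iff _ (X.actR_injective _)).2 (X.rootR_ne_zero s))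

theorem FrobeniusForm.sum_toLin_mul {H : Subgroup W} [Fintype H] {N : ℤ}
    (D : X.FrobeniusForm H N) (g : X.R) : ∑ j, D.toLin (g * D.b j) * D.b' j = g := by
  rw [← sub_eq_zero]
  set h := ∑ j, D.toLin (g * D.b j) * D.b' j - g with hh
  have key : ∀ k, D.toLin (D.b' k * h) = 0 := fun k => by
    have e1 : D.toLin (D.b' k * ∑ j, D.toLin (g * D.b j) * D.b' j) =
        ∑ j, D.toLin (g * D.b j) * D.toLin (D.b' k * D.b' j) := by
      rw [Finset.mul_sum, map_sum]
      exact Finset.sum_congr rfl fun j _ => by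
        rw [mul_left_comm, D.toLin_mul_of_mem (D.mem _)]
    have e2 : D.toLin (D.b' k * g) = ∑ j, D.toLin (g * D.b j) * D.toLin (D.b' k * D.b' j) := by
      conv_lhs => rw [D.eq_sum (D.b' k), Finset.sum_mul, map_sum]
      exact Finset.sum_congr rfl fun j _ => by
        rw [show D.b j * D.toLin (D.b' j * D.b' k) * g =
          D.toLin (D.b' j * D.b' k) * (g * D.b j) by ring, D.toLin_mul_of_mem (D.mem _),
          mul_comm, mul_comm (D.b' j)]
    rw [hh, mul_sub, map_sub, e1, e2, sub_self]
  rw [D.eq_sum h]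
  exact Finset.sum_eq_zero fun k _ => by rw [key, mul_zero]

end FrobeniusForm

namespace PreObj

variable {X : CoxeterRealization K V cs} [IsDomain K] [Module.Free K V]
variable {N : PreObj.{u, v, w₁} X} {P : PreObj.{u, v, w₂} X} {H : Subgroup W}

section Coordinates

variable [Fintype H] {ν : ℤ} (D : X.FrobeniusForm H ν)

/-- The map `N → R ⊗_{R^H} R`, `n ↦ ∑ b_i ⊗ τ(b'_i n)`, induced by `τ : N → R`. -/
def toInv (τ : N.carrier →ₗ[X.R] X.R) : N.carrier →ₗ[X.R] (X.invObj H).carrier where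
  toFun n := ∑ i, itm X H (D.b i) (τ (N.left (D.b' i) n))
  map_add' a b := by simp only [map_add, itm_add, Finset.sum_add_distrib]
  map_smul' r a := by
    simp only [map_smul, smul_eq_mul, ← smul_itm, Finset.smul_sum, RingHom.id_apply]

theorem toInv_apply (τ : N.carrier →ₗ[X.R] X.R) (n : N.carrier) :
    toInv D τ n = ∑ i, itm X H (D.b i) (τ (N.left (D.b' i) n)) := rfl

theorem itm_sum {ι : Type*} (s : Finset ι) (f : X.R) (g : ι → X.R) :
    itm X H f (∑ i ∈ s, g i) = ∑ i ∈ s, itm X H f (g i) :=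
  TensorProduct.tmul_sum (R := X.invariants H) f s g

variable {τ : N.carrier →ₗ[X.R] X.R}
  (hτ : ∀ c ∈ X.invariants H, ∀ n, τ (N.left c n) = c * τ n)

include hτ in
theorem toInv_left (f : X.R) (n : N.carrier) :
    toInv D τ (N.left f n) = (X.invObj H).left f (toInv D τ n) := by
  simp only [toInv_apply, map_sum, left_itm]
  have h1 : ∀ j, itm X H (f * D.b j) (τ (N.left (D.b' j) n)) =
      ∑ i, itm X H (D.b i) (τ (N.left (D.toLin (D.b' i * (f * D.b j)) * D.b' j) n)) := fun j => by
    rw [itm_eq_sum D]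
    refine Finset.sum_congr rfl fun i _ => ?_
    rw [map_mul N.left, Module.End.mul_apply, hτ _ (D.mem _)]
  simp only [h1]
  rw [Finset.sum_comm]
  refine Finset.sum_congr rfl fun i _ => ?_
  rw [← itm_sum, ← map_sum, ← LinearMap.sum_apply, ← map_sum]
  simp only [← mul_assoc]
  rw [D.sum_toLin_mul, map_mul]
  rfl

include hτ in
theorem isHom_toInv (hN : N.LocLeft) (hNT : N.TorsionFree) (hNg : N.IsGraded)
    (hsupp : ∀ x ∉ H, N.loc x = ⊥) {e k : ℤ} (hk : 2 * ν + e = k)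
    (hdeg : ∀ i, ∀ n ∈ N.deg i, τ n ∈ X.degR (i + e)) :
    IsHom N (X.invObj H) k (toInv D τ) where
  map_left := toInv_left D hτ
  map_deg i n hn := by
    rw [toInv_apply]
    refine sum_mem fun j _ => ?_
    have := hdeg _ _ (hNg.left_deg _ _ _ _ (D.b'_mem j) hn)
    exact itm_mem_deg (by omega) (D.b_mem j) this
  map_loc x n hn := by
    by_cases hx : x ∈ H
    · refine (mem_invObj_locSub hx).2 fun f => ?_
      rw [← toInv_left D hτ, hN.left_eq hNT hn, map_smul]
    · rw [mem_locSub, hsupp x hx, Submodule.mem_bot] at hn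
      rw [hNT.one_tmul_injective (hn.trans (TensorProduct.tmul_zero _ _).symm), map_zero]
      exact zero_mem _

end Coordinates

variable [X.IsRegular]

/-- The form `τ` on a Bott-Samelson bimodule with `τ(f (1 ⊗ 1 ⊗ ⋯ ⊗ 1)) = ∂_l(f)`. -/
def bsForm (X : CoxeterRealization K V cs) [X.IsRegular] :
    (l : List B) → (X.bottSamelson l).carrier →ₗ[X.R] X.R
  | [] => (unStd 1).toLinearMap
  | s :: l => bsForm X l ∘ₗ
    (ind (N := X.bottSamelson l) (P := X.bottSamelson l) (X.demazure s) LinearMap.id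
      fun _ _ _ => rfl)

theorem bsForm_cons (s : B) (l : List B)
    (z : ((X.simpleObj s).tensor (X.bottSamelson l)).carrier) : bsForm X (s :: l) z =
      bsForm X l (ind (N := X.bottSamelson l) (P := X.bottSamelson l) (X.demazure s) LinearMap.id
        (fun _ _ _ => rfl) z) := rfl

theorem bsForm_left_one (l : List B) (f : X.R) :
    bsForm X l ((X.bottSamelson l).left f (X.bottSamelsonOne l)) = X.dem l f := by
  induction l generalizing f with
  | nil =>
    change X.actR (1 : W)⁻¹ f * 1 = f
    rw [inv_one, actR_one_apply, mul_one]
  | cons s l ih =>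
    have h1 : ((X.simpleObj s).tensor (X.bottSamelson l)).left f
        (tm (stm X s 1 1) (X.bottSamelsonOne l)) = tm (stm X s f 1) (X.bottSamelsonOne l) := by
      rw [left_tm, simple_left_stm, mul_one]
    refine (congrArg (bsForm X (s :: l)) h1).trans ((bsForm_cons s l _).trans ?_)
    rw [ind_tm, map_one]
    exact ih _

theorem bsForm_left_of_mem {S₀ : Set B} {l : List B} (hl : ∀ s ∈ l, s ∈ S₀) {c : X.R}
    (hc : c ∈ X.invariants (cs.parabolic S₀)) (z : (X.bottSamelson l).carrier) :
    bsForm X l ((X.bottSamelson l).left c z) = c * bsForm X l z := by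
  induction l with
  | nil =>
    change X.actR (1 : W)⁻¹ c * unStd 1 z = c * unStd 1 z
    rw [inv_one, actR_one_apply]
  | cons s l ih =>
    refine (bsForm_cons s l _).trans (Eq.trans (congrArg _ ?_)
      (ih (fun t ht => hl t (by simp [ht])) _))
    exact (ind_left_of_mem (N := X.bottSamelson l) (P := X.bottSamelson l)
      (X.demazure s) LinearMap.id (fun _ _ _ => rfl)
      (X.invariants_le_of_mem (hl s (by simp)) hc) z)

theorem bsForm_mem_deg (l : List B) {i : ℤ} {z : (X.bottSamelson l).carrier}
    (hz : z ∈ (X.bottSamelson l).deg i) : bsForm X l z ∈ X.degR (i + -(l.length : ℤ)) := by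
  induction l generalizing i with
  | nil =>
    rw [List.length_nil, Nat.cast_zero, neg_zero, add_zero]
    exact hz
  | cons s l ih =>
    have h1 := ih (ind_demazure_mem_deg (N := X.bottSamelson l) (P := X.bottSamelson l) (s := s)
      LinearMap.id (fun _ _ _ => rfl) (bs_isGraded X l) (bs_isGraded X l) (e := 0)
      (fun i n hn => by rw [add_zero]; exact hn) z hz)
    rw [List.length_cons]
    push_cast
    rw [show i + 0 - 1 + -(l.length : ℤ) = i + -((l.length : ℤ) + 1) by ring] at h1
    exact h1

section Summand

variable {S₀ : Set B} [Fintype (cs.parabolic S₀)] {l : List B} (hl : ∀ s ∈ l, s ∈ S₀)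
  (D : X.FrobeniusForm (cs.parabolic S₀) l.length)

/-- The projection of a Bott-Samelson bimodule to `R ⊗_{R^H} R`. -/
def ofBS : (X.bottSamelson l).carrier →ₗ[X.R] (X.invObj (cs.parabolic S₀)).carrier :=
  toInv D (bsForm X l)

include hl in
theorem isHom_ofBS : IsHom (X.bottSamelson l) (X.invObj (cs.parabolic S₀)) l.length (ofBS D) :=
  isHom_toInv D (fun _ hc z => bsForm_left_of_mem hl hc z) (bs_locLeft X l) (bs_torsionFree X l)
    (bs_isGraded X l) (bs_loc_of_not_mem hl) (by ring) fun _ _ => bsForm_mem_deg l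

variable (hD : ∀ f, D.toLin f = X.dem l f)

include hD in
theorem ofBS_one : ofBS D (X.bottSamelsonOne l) = itm X (cs.parabolic S₀) 1 1 := by
  rw [itm_eq_sum D]
  refine (toInv_apply D _ _).trans (Finset.sum_congr rfl fun i _ => ?_)
  rw [bsForm_left_one, hD, mul_one, mul_one]

include hD in
theorem ofBS_toBS (z : (X.invObj (cs.parabolic S₀)).carrier) : ofBS D (toBS hl z) = z := by
  induction z using inv_induction with
  | itm f g =>
    rw [toBS, invMap_itm, map_smul, (isHom_ofBS hl D).map_left, ofBS_one D hD, left_itm, smul_itm,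
      mul_one, mul_one]
  | add a b ha hb => rw [map_add, map_add, ha, hb]

include hl hD in
theorem isSoergel_invObj (hH : X.IsFaithful (cs.parabolic S₀)) :
    X.IsSoergel (X.invObj (cs.parabolic S₀)) := by
  refine IsSoergel.summand (.shift (-(l.length : ℤ)) (bs_isSoergel X l)) (isObj_invObj D hH)
    (IsHom.toHom₀ ((isHom_unshift (-(l.length : ℤ))).comp (isHom_toBS hH hl) ?_))
    (IsHom.toHom₀ ((isHom_ofBS hl D).comp (isHom_shift (-(l.length : ℤ))) ?_))
    (ofBS_toBS hl D hD)
  · ring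
  · ring

end Summand

end PreObj

end CoxeterRealization

namespace CoxeterRealization

variable {K : Type u} {V : Type v} [CommRing K] [AddCommGroup V] [Module K V]
  {B W : Type*} [Group W] {M : CoxeterMatrix B} {cs : CoxeterSystem M W}

namespace PreObj

variable {X : CoxeterRealization K V cs} [IsDomain K] [Module.Free K V]
variable {N : PreObj.{u, v, w₁} X} {P : PreObj.{u, v, w₂} X} {H : Subgroup W}

/-! ### Direct summands and indecomposability -/

theorem IsObj.shift (hN : N.IsObj) (k : ℤ) : (N.shift k).IsObj where
  deg_internal := DirectSum.isInternal_reindex hN.deg_internal (Equiv.addRight k)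
  right_deg i j r n hr hn := by
    have := hN.right_deg i (j + k) r n hr hn
    rwa [← add_assoc] at this
  left_deg i j r n hr hn := by
    have := hN.left_deg i (j + k) r n hr hn
    rwa [← add_assoc] at this
  loc_internal := hN.loc_internal
  left_loc := hN.left_loc

/-- The object with underlying bimodule the kernel of `q`. -/
def kerObj (q : N.carrier →ₗ[X.R] P.carrier) (hq : ∀ r n, q (N.left r n) = P.left r (q n)) :
    PreObj.{u, v, w₁} X where
  carrier := LinearMap.ker q
  left :=
    { toFun := fun r => (N.left r).restrict fun n hn => by
        rw [LinearMap.mem_ker, hq, LinearMap.mem_ker.1 hn, map_zero]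
      map_one' := by ext n; simp
      map_mul' := fun a b => by ext n; simp
      map_zero' := by ext n; simp
      map_add' := fun a b => by ext n; simp }
  deg := fun i => (N.deg i).comap (LinearMap.ker q).subtype.toAddMonoidHom
  loc := fun x => (N.loc x).comap ((LinearMap.ker q).subtype.baseChange X.Q)

section Retract

variable {i : P.carrier →ₗ[X.R] N.carrier} {q : N.carrier →ₗ[X.R] P.carrier}

/-- The inclusion of the kernel. -/
def kerIncl (hq : ∀ r n, q (N.left r n) = P.left r (q n)) :
    (kerObj q hq).carrier →ₗ[X.R] N.carrier := (LinearMap.ker q).subtype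

theorem isHom_kerIncl (hq : ∀ r n, q (N.left r n) = P.left r (q n)) :
    IsHom (kerObj q hq) N 0 (kerIncl hq) where
  map_left _ _ := rfl
  map_deg k n hn := by rw [add_zero]; exact hn
  map_loc _ _ hn := hn

/-- The projection to the kernel along the image of a section. -/
def kerProj (hq : ∀ r n, q (N.left r n) = P.left r (q n)) (h : ∀ z, q (i z) = z) :
    N.carrier →ₗ[X.R] (kerObj q hq).carrier :=
  (LinearMap.id - i ∘ₗ q).codRestrict (LinearMap.ker q) fun n => by
    rw [LinearMap.mem_ker, LinearMap.sub_apply, map_sub, LinearMap.comp_apply, h]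
    exact sub_self _

theorem kerIncl_kerProj (hq : ∀ r n, q (N.left r n) = P.left r (q n)) (h : ∀ z, q (i z) = z)
    (n : N.carrier) : kerIncl hq (kerProj hq h n) = n - i (q n) := rfl

theorem isHom_kerProj (hi : IsHom P N 0 i) (hq : IsHom N P 0 q) (h : ∀ z, q (i z) = z) :
    IsHom N (kerObj q hq.map_left) 0 (kerProj hq.map_left h) := by
  have h1 : IsHom N N 0 (LinearMap.id - i ∘ₗ q) := IsHom.id.sub (hi.comp hq (add_zero 0))
  exact ⟨fun r n => Subtype.ext (h1.map_left r n), h1.map_deg, h1.map_loc⟩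

/-- An indecomposable object is isomorphic to its nonzero direct summands. -/
theorem Indecomposable.nonempty_iso {P : PreObj.{u, v, w₁} X} {i : P.carrier →ₗ[X.R] N.carrier}
    {q : N.carrier →ₗ[X.R] P.carrier} (hN : N.IsObj) (hind : N.Indecomposable)
    (hP : Nontrivial P.carrier) (hi : IsHom P N 0 i) (hq : IsHom N P 0 q)
    (h : ∀ z, q (i z) = z) : Nonempty (Iso N P) := by
  let C := kerObj q hq.map_left
  have hι : ∀ z : C.carrier, q (kerIncl hq.map_left z) = 0 := fun z => z.2
  have hker : ∀ z : C.carrier, kerProj hq.map_left h (kerIncl hq.map_left z) = z := fun z =>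
    Subtype.ext ((congrArg (kerIncl hq.map_left z - i ·) (hι z)).trans (by
      rw [map_zero, sub_zero]; rfl))
  have hproj : ∀ z, kerProj hq.map_left h (i z) = 0 := fun z =>
    Subtype.ext ((kerIncl_kerProj hq.map_left h (i z)).trans (by rw [h, sub_self]; rfl))
  have hC : C.IsObj := hN.of_retract (isHom_kerIncl hq.map_left) (isHom_kerProj hi hq h) hker
  have hPo : P.IsObj := hN.of_retract hi hq h
  have hdinl := isHom_dinl (N := P) (P := C)
  have hdinr := isHom_dinr (N := P) (P := C)
  have e : Iso N (P.dsum C) :=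
    { hom := ((hdinl.comp hq (add_zero 0)).add
        (hdinr.comp (isHom_kerProj hi hq h) (add_zero 0))).toHom₀
      inv := ((hi.comp isHom_dfst (add_zero 0)).add
        ((isHom_kerIncl hq.map_left).comp isHom_dsnd (add_zero 0))).toHom₀
      hom_inv := fun n => by
        change i (q n + 0) + kerIncl hq.map_left (0 + kerProj hq.map_left h n) = n
        rw [add_zero, zero_add, kerIncl_kerProj, add_sub_cancel]
      inv_hom := fun z => by
        obtain ⟨a, b⟩ := z
        refine Prod.ext ?_ ?_
        · change q (i a + kerIncl hq.map_left b) + 0 = a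
          rw [map_add, h, hι, add_zero, add_zero]
        · change 0 + kerProj hq.map_left h (i a + kerIncl hq.map_left b) = b
          rw [map_add, hproj, hker, zero_add, zero_add] }
  rcases hind.2 P C hPo hC ⟨e⟩ with h1 | h1
  · exact absurd h1 (not_subsingleton P.carrier)
  · refine ⟨⟨hq.toHom₀, hi.toHom₀, fun n => ?_, h⟩⟩
    have h2 := kerIncl_kerProj hq.map_left h n
    rw [Subsingleton.elim (kerProj hq.map_left h n) 0, map_zero] at h2
    exact (sub_eq_zero.1 h2.symm).symm

end Retract

theorem indecomposable_of_idempotent (hN : Nontrivial N.carrier)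
    (h : ∀ e : N.carrier →ₗ[X.R] N.carrier, IsHom N N 0 e → (∀ z, e (e z) = e z) →
      (∀ z, e z = 0) ∨ ∀ z, e z = z) : N.Indecomposable := by
  refine ⟨hN, fun P P' _ _ ⟨φ⟩ => ?_⟩
  have hdinl := isHom_dinl (N := P) (P := P')
  have hdfst := isHom_dfst (N := P) (P := P')
  have he := φ.inv.isHom.comp ((hdinl.comp hdfst (add_zero 0)).comp φ.hom.isHom (add_zero 0))
    (add_zero 0)
  have hφ := φ.inv_hom
  rcases h _ he (fun z => by
    simp only [LinearMap.comp_apply]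
    rw [hφ]
    rfl) with h1 | h1
  · refine Or.inl ⟨fun a b => ?_⟩
    have h2 : ∀ a : P.carrier, a = 0 := fun a => by
      have h3 := h1 (φ.inv.toLin (dinl P P' a))
      simp only [LinearMap.comp_apply] at h3
      rw [hφ] at h3
      have h4 := congrArg φ.hom.toLin h3
      rw [hφ, map_zero] at h4
      exact congrArg Prod.fst h4
    rw [h2 a, h2 b]
  · refine Or.inr ⟨fun a b => ?_⟩
    have h2 : ∀ a : P'.carrier, a = 0 := fun a => by
      have h3 := h1 (φ.inv.toLin (dinr P P' a))
      simp only [LinearMap.comp_apply] at h3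
      rw [hφ, dfst_dinr, map_zero, map_zero] at h3
      have h4 := congrArg φ.hom.toLin h3
      rw [hφ, map_zero] at h4
      exact (congrArg Prod.snd h4).symm
    rw [h2 a, h2 b]

/-! ### The degree `0` part of `R ⊗_{R^H} R` -/

theorem exists_of_mem_invObj_deg_zero {z : (X.invObj H).carrier} (hz : z ∈ (X.invObj H).deg 0) :
    ∃ c : X.R, z = c • itm X H 1 1 := by
  suffices h : (X.invObj H).deg 0 ≤ (Submodule.span X.R {itm X H 1 1}).toAddSubgroup by
    obtain ⟨c, hc⟩ := Submodule.mem_span_singleton.1 (h hz)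
    exact ⟨c, hc.symm⟩
  refine invObj_deg_le fun i j hij f hf g hg => ?_
  rcases lt_trichotomy i 0 with h | rfl | h
  · rw [X.eq_zero_of_mem_degR_neg hf h]
    have : itm X H 0 g = 0 := TensorProduct.zero_tmul (R := X.invariants H) X.R g
    rw [this]
    exact zero_mem _
  · obtain ⟨c, rfl⟩ := X.exists_of_mem_degR_zero hf
    refine Submodule.mem_span_singleton.2 ⟨algebraMap K X.R c * g, ?_⟩
    rw [smul_itm, mul_one, ← mul_itm (Subalgebra.algebraMap_mem _ c), mul_one]
  · rw [X.eq_zero_of_mem_degR_neg hg (by omega)]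
    have : itm X H f 0 = 0 := TensorProduct.tmul_zero (R := X.invariants H) X.R f
    rw [this]
    exact zero_mem _

theorem itm_one_eq_zero {c : X.R} (h : c • itm X H 1 1 = 0) : c = 0 := by
  have := congrArg (evInv X (one_mem H)) h
  rw [map_smul, evInv_itm, map_one, mul_one, map_zero, smul_eq_mul, mul_one] at this
  exact this

theorem invObj_idempotent {e : (X.invObj H).carrier →ₗ[X.R] (X.invObj H).carrier}
    (he : IsHom (X.invObj H) (X.invObj H) 0 e) (hee : ∀ z, e (e z) = e z) :
    (∀ z, e z = 0) ∨ ∀ z, e z = z := by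
  have h1 := he.map_deg 0 (itm X H 1 1) (itm_mem_deg (add_zero 0) X.one_mem_degR X.one_mem_degR)
  rw [add_zero] at h1
  obtain ⟨c, hc⟩ := exists_of_mem_invObj_deg_zero h1
  have h2 : ∀ z, e z = c • z := fun z => by
    induction z using inv_induction with
    | itm f g =>
      have : itm X H f g = g • (X.invObj H).left f (itm X H 1 1) := by
        rw [left_itm, smul_itm, mul_one, mul_one]
      rw [this, map_smul, he.map_left, hc, map_smul, smul_comm]
    | add a b ha hb => rw [map_add, ha, hb, smul_add]
  have h3 : c * (c - 1) = 0 := by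
    refine itm_one_eq_zero (H := H) ?_
    have := hee (itm X H 1 1)
    rw [h2, h2, smul_smul] at this
    rw [mul_sub, mul_one, sub_smul, this, sub_self]
  rcases mul_eq_zero.1 h3 with h | h
  · exact Or.inl fun z => by rw [h2, h, zero_smul]
  · exact Or.inr fun z => by rw [h2, sub_eq_zero.1 h, one_smul]

theorem invObj_nontrivial : Nontrivial (X.invObj H).carrier :=
  ⟨itm X H 1 1, 0, fun h => one_ne_zero (itm_one_eq_zero (X := X) (H := H)
    ((one_smul _ _).trans h))⟩

theorem invObj_indecomposable : (X.invObj H).Indecomposable :=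
  indecomposable_of_idempotent invObj_nontrivial fun _ he hee => invObj_idempotent he hee

theorem IsHom.of_shift {k : ℤ} {e : N.carrier →ₗ[X.R] N.carrier}
    (he : IsHom (N.shift k) (N.shift k) 0 e) : IsHom N N 0 e where
  map_left := he.map_left
  map_deg i n hn := by
    have h1 : (n : (N.shift k).carrier) ∈ (N.shift k).deg (i - k) := by
      change n ∈ N.deg (i - k + k)
      rwa [sub_add_cancel]
    have h2 : e n ∈ N.deg (i - k + 0 + k) := he.map_deg _ _ h1
    rwa [add_zero, sub_add_cancel, ← add_zero i] at h2
  map_loc := he.map_loc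

theorem invObj_shift_indecomposable (k : ℤ) : ((X.invObj H).shift k).Indecomposable :=
  indecomposable_of_idempotent (N := (X.invObj H).shift k) (invObj_nontrivial (X := X) (H := H))
    fun _ he hee => invObj_idempotent (IsHom.of_shift he) hee

/-! ### The quotient concentrated in a single element -/

theorem IsChar.eq_zero_of_mem_kerUpper {x : W} {d : ℤ} {ψ : N.carrier →ₗ[X.R] X.R}
    (hψ : IsChar N x d ψ) {n : N.carrier} (hn : n ∈ N.kerUpper {x}) : ψ n = 0 := by
  change (1 : X.Q) ⊗ₜ[X.R] n ∈ (⨆ (y : W) (_ : y ∉ ({x} : Set W)), N.loc y) at hn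
  have h1 : (⨆ (y : W) (_ : y ∉ ({x} : Set W)), N.loc y) ≤
      LinearMap.ker (ψ.baseChange X.Q) := by
    refine iSup₂_le fun y hy => ?_
    rw [loc_eq_span]
    refine Submodule.span_le.2 ?_
    rintro _ ⟨n, hn, rfl⟩
    change ψ.baseChange X.Q ((1 : X.Q) ⊗ₜ n) = 0
    rw [LinearMap.baseChange_tmul, hψ.map_loc y hy n hn, TensorProduct.tmul_zero]
  have h2 := h1 hn
  rw [LinearMap.mem_ker, LinearMap.baseChange_tmul,
    ← TensorProduct.tmul_zero X.R (1 : X.Q)] at h2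
  exact one_tmul_R_injective h2

theorem IsObj.mkQ_mem_map_loc (hN : N.IsObj) (x : W) (ξ : X.Q ⊗[X.R] N.carrier) :
    (N.kerUpper {x}).mkQ.baseChange X.Q ξ ∈
      (N.loc x).map ((N.kerUpper {x}).mkQ.baseChange X.Q) := by
  classical
  induction ξ using hN.loc_internal.induction with
  | zero => rw [map_zero]; exact zero_mem _
  | add a b ha hb => rw [map_add]; exact add_mem ha hb
  | mem y ξ hξ =>
    by_cases hy : y = x
    · subst hy
      exact Submodule.mem_map_of_mem hξ
    · have h1 : N.loc y ≤ LinearMap.ker ((N.kerUpper {x}).mkQ.baseChange X.Q) := by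
        rw [loc_eq_span]
        refine Submodule.span_le.2 ?_
        rintro _ ⟨n, hn, rfl⟩
        change (N.kerUpper {x}).mkQ.baseChange X.Q ((1 : X.Q) ⊗ₜ n) = 0
        have h2 : n ∈ N.kerUpper {x} :=
          Submodule.mem_iSup_of_mem (p := fun y => ⨆ (_ : y ∉ ({x} : Set W)), N.loc y) y
            (Submodule.mem_iSup_of_mem hy hn)
        rw [LinearMap.baseChange_tmul, Submodule.mkQ_apply,
          (Submodule.Quotient.mk_eq_zero _).2 h2, TensorProduct.tmul_zero]
      rw [LinearMap.mem_ker.1 (h1 hξ)]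
      exact zero_mem _

/-- A homomorphism `ψ : N → R_x` induces an isomorphism on `N^x` if it takes the value `1` and its
kernel is as small as possible. -/
theorem IsChar.nonempty_iso_upper {x : W} {d : ℤ} {ψ : N.carrier →ₗ[X.R] X.R}
    (hψ : IsChar N x d ψ) (hN : N.IsObj) (hker : ∀ n, ψ n = 0 → n ∈ N.kerUpper {x})
    {n₁ : N.carrier} (hn₁ : n₁ ∈ N.deg (-d)) (h1 : ψ n₁ = 1) :
    Nonempty (Iso (N.upper hN {x}) ((X.stdObj x).shift d)) := by
  let ψ' : (N.carrier ⧸ N.kerUpper {x}) →ₗ[X.R] X.R :=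
    (N.kerUpper {x}).liftQ ψ fun n hn => hψ.eq_zero_of_mem_kerUpper hn
  let σ : X.R →ₗ[X.R] N.carrier ⧸ N.kerUpper {x} :=
    (N.kerUpper {x}).mkQ ∘ₗ LinearMap.toSpanSingleton X.R N.carrier n₁
  have hψσ : ∀ r, ψ' (σ r) = r := fun r => by
    change ψ (r • n₁) = r
    rw [map_smul, h1, smul_eq_mul, mul_one]
  have hinj : Function.Injective ψ' := by
    rw [injective_iff_map_eq_zero]
    intro z hz
    obtain ⟨n, rfl⟩ := (N.kerUpper {x}).mkQ_surjective z
    exact (Submodule.Quotient.mk_eq_zero _).2 (hker n hz)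
  have hσψ : ∀ z, σ (ψ' z) = z := fun z => hinj (hψσ _)
  have hleft : ∀ f z, ψ' ((N.upper hN {x}).left f z) = X.actR x⁻¹ f * ψ' z := by
    intro f z
    obtain ⟨n, rfl⟩ := (N.kerUpper {x}).mkQ_surjective z
    exact hψ.map_left f n
  have hσleft : ∀ f r : X.R, σ (X.actR x⁻¹ f * r) = (N.upper hN {x}).left f (σ r) := fun f r =>
    hinj ((hψσ _).trans ((hleft f (σ r)).trans (by rw [hψσ])).symm)
  have hσloc : ∀ ξ : X.Q ⊗[X.R] X.R, σ.baseChange X.Q ξ ∈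
      (N.loc x).map ((N.kerUpper {x}).mkQ.baseChange X.Q) := fun ξ => by
    rw [LinearMap.baseChange_comp]
    exact hN.mkQ_mem_map_loc x _
  refine ⟨⟨⟨ψ', hleft, ?_, ?_⟩, ⟨σ, hσleft, ?_, ?_⟩, hσψ, hψσ⟩⟩
  · rintro i _ ⟨n, hn, rfl⟩
    exact hψ.map_deg i n hn
  · rintro y _ ⟨η, hη, rfl⟩
    have h2 := baseChange_mem_loc (hψ.isHom.map_loc y) hη
    have h3 : ψ'.baseChange X.Q ((N.kerUpper {x}).mkQ.baseChange X.Q η) = ψ.baseChange X.Q η := by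
      rw [← LinearMap.comp_apply, ← LinearMap.baseChange_comp]
      rfl
    exact (congrArg (· ∈ (X.stdObj x).loc y) h3).mpr h2
  · intro i (r : X.R) hr
    refine ⟨r • n₁, ?_, rfl⟩
    have := hN.right_deg _ _ _ _ hr hn₁
    rwa [show i + d + -d = i by ring] at this
  · intro y ξ hξ
    by_cases hy : y = x
    · subst hy
      exact hσloc ξ
    · have h2 : ξ ∈ (⊥ : Submodule X.Q _) := (stdObj_loc_of_ne (X := X) hy).le hξ
      rw [Submodule.mem_bot] at h2
      rw [h2]
      exact (congrArg (· ∈ (N.upper hN {x}).loc y) (map_zero (σ.baseChange X.Q))).mpr (zero_mem _)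

end PreObj

end CoxeterRealization

namespace CoxeterRealization

variable {K : Type u} {V : Type v} [CommRing K] [AddCommGroup V] [Module K V]
  {B W : Type*} [Group W] {M : CoxeterMatrix B} {cs : CoxeterSystem M W}

namespace PreObj

variable {X : CoxeterRealization K V cs} [IsDomain K] [Module.Free K V]
variable {N : PreObj.{u, v, w₁} X} {P : PreObj.{u, v, w₂} X} {H : Subgroup W}

/-! ### The characterization of `B(w₀)` -/

theorem isChar_evInv (hH : X.IsFaithful H) {w : W} (hw : w ∈ H) :
    IsChar (X.invObj H) w 0 (evInv X hw) where
  map_left := evInv_left hw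
  map_deg i := by
    refine invObj_deg_le (S := (X.degR (i + 0)).comap (evInv X hw).toAddMonoidHom)
      fun a b hab f hf g hg => ?_
    change X.actR w⁻¹ f * g ∈ X.degR (i + 0)
    have := X.mul_mem_degR (X.actR_mem_degR w⁻¹ hf) hg
    rwa [hab, ← add_zero i] at this
  map_loc y hy z hz := evInv_eq_zero hw (fun hyH => by
    by_contra! h
    exact hy (hH w hw y hyH h).symm) hz

theorem mem_kerUpper_of_evInv_eq_zero [Fintype H] {ν : ℤ} (D : X.FrobeniusForm H ν)
    (hH : X.IsFaithful H) {w : W} (hw : w ∈ H) {z : (X.invObj H).carrier}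
    (hz : evInv X hw z = 0) : z ∈ (X.invObj H).kerUpper {w} := by
  change (1 : X.Q) ⊗ₜ[X.R] z ∈ (⨆ (y : W) (_ : y ∉ ({w} : Set W)), (X.invObj H).loc y)
  rw [← sum_evQ_smul_idem D ((1 : X.Q) ⊗ₜ[X.R] z)]
  refine sum_mem fun y _ => ?_
  by_cases hy : (y : W) = w
  · subst hy
    rw [evQ_tmul, hz, map_zero, mul_zero, zero_smul]
    exact zero_mem _
  · exact Submodule.mem_iSup_of_mem (p := fun y => ⨆ (_ : y ∉ ({w} : Set W)), (X.invObj H).loc y)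
      (y : W) (Submodule.mem_iSup_of_mem hy (Submodule.smul_mem _ _ (idem_mem_loc D hH y)))

theorem nonempty_iso_upper_invObj [Fintype H] {ν : ℤ} (D : X.FrobeniusForm H ν)
    (hH : X.IsFaithful H) {w : W} (hw : w ∈ H) (k : ℤ) (hN : ((X.invObj H).shift k).IsObj) :
    Nonempty (Iso (((X.invObj H).shift k).upper hN {w}) ((X.stdObj w).shift k)) := by
  have h1 : IsChar ((X.invObj H).shift k) w k (evInv X hw ∘ₗ LinearMap.id) :=
    (isChar_evInv hH hw).comp (isHom_shift k) (add_zero k)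
  refine h1.nonempty_iso_upper hN (n₁ := itm X H 1 1)
    (fun n hn => mem_kerUpper_of_evInv_eq_zero D hH hw hn) ?_ ?_
  · change itm X H 1 1 ∈ (X.invObj H).deg (-k + k)
    exact itm_mem_deg (by ring) X.one_mem_degR X.one_mem_degR
  · change evInv X hw (itm X H 1 1) = 1
    rw [evInv_itm, map_one, mul_one]

theorem left_eq_smul_of_mem_invariants (hN : N.IsObj) (hNT : N.TorsionFree)
    (hsupp : ∀ x ∉ H, N.loc x = ⊥) {c : X.R} (hc : c ∈ X.invariants H) (n : N.carrier) :
    N.left c n = c • n := by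
  classical
  refine hNT.one_tmul_injective ?_
  rw [← LinearMap.baseChange_tmul, ← algebraMap_smul_tmul]
  generalize (1 : X.Q) ⊗ₜ[X.R] n = ξ
  induction ξ using hN.loc_internal.induction with
  | zero => rw [map_zero, smul_zero]
  | add a b ha hb => rw [map_add, ha, hb, smul_add]
  | mem x ξ hξ =>
    by_cases hx : x ∈ H
    · rw [hN.left_loc x ξ hξ, hc _ (inv_mem hx)]
    · rw [hsupp x hx, Submodule.mem_bot] at hξ
      rw [hξ, map_zero, smul_zero]

theorem IsObj.locSpans (hN : N.IsObj) (hsupp : ∀ x ∉ H, N.loc x = ⊥) : N.LocSpans H := by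
  classical
  intro ξ
  induction ξ using hN.loc_internal.induction with
  | zero => exact zero_mem _
  | add a b ha hb => exact add_mem ha hb
  | mem x ξ hξ =>
    by_cases hx : x ∈ H
    · exact Submodule.mem_iSup_of_mem (p := fun x : H => N.loc x) ⟨x, hx⟩ hξ
    · rw [hsupp x hx, Submodule.mem_bot] at hξ
      rw [hξ]
      exact zero_mem _

end PreObj

open PreObj

section Main

variable {X : CoxeterRealization K V cs} [IsDomain K] [Module.Free K V] [X.IsRegular]
  {S₀ : Set B} [Fintype (cs.parabolic S₀)] {w₀ : W} {l : List B}
  (hl : ∀ s ∈ l, s ∈ S₀) (D : X.FrobeniusForm (cs.parabolic S₀) l.length)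
  (hD : ∀ f, D.toLin f = X.dem l f) (hH : X.IsFaithful (cs.parabolic S₀))

include hl hD hH in
theorem isB_invObj (hw₀ : cs.IsLongest S₀ w₀) (k : ℤ) (hk : k = cs.length w₀) :
    X.IsB w₀ ((X.invObj (cs.parabolic S₀)).shift k) := by
  refine ⟨.shift _ (isSoergel_invObj hl D hD hH), invObj_shift_indecomposable _, fun y hy => ?_,
    (isObj_invObj D hH).shift _, ?_⟩
  · by_cases hyH : y ∈ cs.parabolic S₀
    · exact hw₀.bruhatLE hyH
    · exact absurd (invObj_loc_of_not_mem hyH) hy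
  · subst hk
    exact nonempty_iso_upper_invObj D hH hw₀.1 _ _

include hl hD hH in
/-- Evaluation at `w₀` is, after the projection to `R ⊗_{R^H} R`, the canonical homomorphism from
the Bott-Samelson bimodule to `R_{w₀}`. -/
theorem evInv_ofBS (hr : cs.IsReduced l) (hw : cs.wordProd l ∈ cs.parabolic S₀)
    (z : (X.bottSamelson l).carrier) : evInv X hw (ofBS D z) = can X l z := by
  have h1 := ((isChar_evInv hH hw).comp (isHom_ofBS hl D) (add_zero _)).sub (isChar_can X l)
  have h2 := h1.eq_zero_of_one hr (by
    rw [LinearMap.sub_apply, LinearMap.comp_apply, ofBS_one D hD, evInv_itm, map_one, mul_one,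
      can_one, sub_self])
  exact sub_eq_zero.1 (DFunLike.congr_fun h2 z)

include hl hD hH in
theorem IsB.nonempty_iso (hbraid : X.HasBraidMorphisms) (hw₀ : cs.IsLongest S₀ w₀)
    (hr : cs.IsReduced l) (hw : cs.wordProd l = w₀) {N : PreObj.{u, v, max u v} X}
    (hB : X.IsB w₀ N) :
    Nonempty (Iso N ((X.invObj (cs.parabolic S₀)).shift (cs.length w₀))) := by
  obtain ⟨hS, hind, hsupp, hN, ⟨e⟩⟩ := hB
  subst hw
  have hlen : cs.length (cs.wordProd l) = l.length := hr
  obtain ⟨hNT, hlift⟩ := hS.torsionFree_and_lifts hbraid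
  have hloc : ∀ x ∉ cs.parabolic S₀, N.loc x = ⊥ := fun x hx => by
    by_contra h
    exact hx (cs.mem_parabolic_of_bruhatLE (hsupp x h) hw₀.1)
  -- The homomorphism from `N` to its quotient `R_{w₀}(ℓ(w₀))`, and a generator of the quotient.
  let ψ₀ : N.carrier →ₗ[X.R] ((X.stdObj (cs.wordProd l)).shift (cs.length
    (cs.wordProd l))).carrier := e.hom.toLin ∘ₗ (N.kerUpper {cs.wordProd l}).mkQ
  have hψ₀ : IsHom N ((X.stdObj (cs.wordProd l)).shift (cs.length (cs.wordProd l))) 0 ψ₀ := by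
    refine ⟨fun f n => e.hom.map_left f ((N.kerUpper {cs.wordProd l}).mkQ n), fun i n hn => ?_,
      fun x n hn => ?_⟩
    · rw [add_zero]
      exact e.hom.map_deg i _ ⟨n, hn, rfl⟩
    · have := e.hom.map_loc x _ ⟨_, hn, rfl⟩
      exact this
  have hψ := ((isHom_shift (cs.length (cs.wordProd l) : ℤ)).comp hψ₀ (zero_add _)).isChar
  set ψ := (unStd (cs.wordProd l)).toLinearMap ∘ₗ LinearMap.id ∘ₗ ψ₀ with hψdef
  obtain ⟨n₁, hn₁, hn₁'⟩ := e.inv.map_deg (-(cs.length (cs.wordProd l) : ℤ)) (1 : X.R) (by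
    change (1 : X.R) ∈ X.degR (-(cs.length (cs.wordProd l) : ℤ) + cs.length (cs.wordProd l))
    rw [neg_add_cancel]
    exact X.one_mem_degR)
  have hψ1 : ψ n₁ = 1 := (congrArg e.hom.toLin hn₁').trans (e.inv_hom (1 : X.R))
  obtain ⟨g, hg, hgψ⟩ := hlift l hr _ ψ hψ
  have hq : IsHom N (X.invObj (cs.parabolic S₀)) l.length (ofBS D ∘ₗ g) :=
    (isHom_ofBS hl D).comp hg (by rw [hlen]; ring)
  have hqψ : ∀ n, evInv X hw₀.1 (ofBS D (g n)) = ψ n := fun n => by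
    rw [evInv_ofBS hl D hD hH hr, hgψ]
  -- The image of the generator has degree `0`, so that it is `1 ⊗ 1`.
  have hq1 : ofBS D (g n₁) = itm X (cs.parabolic S₀) 1 1 := by
    have h1 := hq.map_deg _ _ hn₁
    rw [hlen, neg_add_cancel] at h1
    obtain ⟨c, hc⟩ := exists_of_mem_invObj_deg_zero h1
    have h2 := hqψ n₁
    rw [← LinearMap.comp_apply (ofBS D) g, hc, map_smul, evInv_itm, map_one, mul_one, hψ1,
      smul_eq_mul, mul_one] at h2
    rw [h2, one_smul] at hc
    exact hc
  have hφ := isHom_invMap hH hN.locLeft (hN.locSpans hloc) hN.isGraded hn₁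
    fun c hc => left_eq_smul_of_mem_invariants hN hNT hloc hc n₁
  set φ := invMap n₁ fun c hc => left_eq_smul_of_mem_invariants hN hNT hloc hc n₁ with hφdef
  have hqφ : ∀ z, ofBS D (g (φ z)) = z := fun z => by
    have h1 : ∀ f n, ofBS D (g (N.left f n)) =
      (X.invObj (cs.parabolic S₀)).left f (ofBS D (g n)) := hq.map_left
    induction z using inv_induction with
    | itm f h =>
      rw [hφdef, invMap_itm, map_smul, map_smul, h1, hq1, left_itm, smul_itm, mul_one, mul_one]
    | add a b ha hb => simp only [map_add, ha, hb]
  exact hind.nonempty_iso (P := (X.invObj (cs.parabolic S₀)).shift _) hN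
    (invObj_nontrivial (X := X)) (hφ.comp (isHom_shift _) (by ring))
    ((isHom_unshift (N := X.invObj (cs.parabolic S₀)) (cs.length (cs.wordProd l) : ℤ)).comp hq
      (by rw [hlen]; ring)) hqφ

end Main

end CoxeterRealization

namespace CoxeterRealization

variable {K : Type u} {V : Type v} [CommRing K] [AddCommGroup V] [Module K V]
  {B W : Type*} [Group W] {M : CoxeterMatrix B} {cs : CoxeterSystem M W}

/-! ### Demazure operators on `𝒵` -/

section ZMod

variable {X : CoxeterRealization K V cs} [IsDomain K] [Module.Free K V] {S₀ : Set B}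

theorem mem_zMod {z : cs.parabolic S₀ → X.R} : z ∈ X.zMod S₀ ↔ ∀ x t : cs.parabolic S₀,
    cs.IsReflection (t : W) → SymmetricAlgebra.ι K V (X.reflRoot t) ∣ z (x * t) - z x :=
  forall_congr' fun _ => forall_congr' fun _ => forall_congr' fun _ =>
    Ideal.mem_span_singleton

theorem mem_degR_sub_two_of_mul_mem {i : ℤ} {f g : X.R} (hf : f ∈ X.degR 2) (hf0 : f ≠ 0)
    (h : f * g ∈ X.degR i) : g ∈ X.degR (i - 2) := by
  have hf' : f ∈ X.degR (2 * (1 : ℕ)) := hf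
  rcases X.degR_cases h with h0 | ⟨n, rfl⟩
  · rw [(mul_eq_zero.1 h0).resolve_left hf0]
    exact zero_mem _
  rcases n with - | n
  · have h1 := congrArg (Polynomial.coeff · 0) ((X.mem_degR_two_mul).1 h)
    rw [map_mul, (X.mem_degR_two_mul).1 hf'] at h1
    have h2 : f * g = 0 := by simpa [mul_assoc, mul_comm, mul_left_comm] using h1.symm
    rw [(mul_eq_zero.1 h2).resolve_left hf0]
    exact zero_mem _
  · rw [show (2 * ((n + 1 : ℕ) : ℤ) - 2) = 2 * (n : ℤ) by push_cast; ring]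
    refine X.mem_degR_of_mul_mem hf' hf0 ?_
    rwa [Nat.add_comm]

variable [X.IsRegular]

/-- `x⁻¹(α_s)` divides `z_x - z_{sx}`. -/
theorem rootR_dvd_of_mem_zMod {z : cs.parabolic S₀ → X.R} (hz : z ∈ X.zMod S₀) {s : B}
    (hs : s ∈ S₀) (x : cs.parabolic S₀) : X.actR (x : W)⁻¹ (X.rootR s) ∣
      z x - z (⟨cs.simple s, cs.simple_mem_parabolic hs⟩ * x) := by
  let σ : cs.parabolic S₀ := ⟨cs.simple s, cs.simple_mem_parabolic hs⟩
  let t : cs.parabolic S₀ := x⁻¹ * σ * x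
  obtain ⟨c, hc, h⟩ := X.exists_act_root_eq_smul (x : W)⁻¹ s
  have ht : (x : W)⁻¹ * cs.simple s * ((x : W)⁻¹)⁻¹ = t := by rw [inv_inv]; rfl
  have hrt : cs.IsReflection (t : W) := ht ▸ ⟨(x : W)⁻¹, s, rfl⟩
  have h1 := mem_zMod.1 hz x t hrt
  have h2 : x * t = σ * x := by
    simp only [t]; group
  rw [h2] at h1
  rw [rootR, actR_ι, h, ht, map_smul, Algebra.smul_def, dvd_sub_comm]
  exact ((hc.map (algebraMap K X.R)).mul_left_dvd).2 h1

/-- The operator `z ↦ ((z_x - z_{sx}) / x⁻¹(α_s))_x` preserves `𝒵`: this is where linear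
independence of the roots modulo the maximal ideal is used. -/
theorem exists_zMod_demazure [IsLocalRing K] (hGKM : X.IsGKM S₀) {z : cs.parabolic S₀ → X.R}
    (hz : z ∈ X.zMod S₀) {s : B} (hs : s ∈ S₀) :
    ∃ z' ∈ X.zMod S₀, ∀ x : cs.parabolic S₀, X.actR (x : W)⁻¹ (X.rootR s) * z' x =
      z x - z (⟨cs.simple s, cs.simple_mem_parabolic hs⟩ * x) := by
  let σ : cs.parabolic S₀ := ⟨cs.simple s, cs.simple_mem_parabolic hs⟩
  have hσσ : σ * σ = 1 := Subtype.ext (cs.simple_mul_simple_self s)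
  choose z' hz' using rootR_dvd_of_mem_zMod hz hs
  change ∀ x : cs.parabolic S₀, z x - z (σ * x) = X.actR (x : W)⁻¹ (X.rootR s) * z' x at hz'
  refine ⟨z', mem_zMod.2 fun x t ht => ?_, fun x => (hz' x).symm⟩
  have hne : X.actR (x : W)⁻¹ (X.rootR s) ≠ 0 :=
    (map_ne_zero_iff _ (X.actR_injective _)).2 (X.rootR_ne_zero s)
  obtain ⟨c, hc, h⟩ := X.exists_act_root_eq_smul (x : W)⁻¹ s
  by_cases htx : (t : W) = (x : W)⁻¹ * cs.simple s * ((x : W)⁻¹)⁻¹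
  · have h1 : x * t = σ * x := Subtype.ext (by
      rw [Subgroup.coe_mul, htx, inv_inv, Subgroup.coe_mul]
      group
      rfl)
    have h2 := hz' (σ * x)
    have h3 : X.actR ((σ * x : cs.parabolic S₀) : W)⁻¹ (X.rootR s) =
        -X.actR (x : W)⁻¹ (X.rootR s) := by
      rw [Subgroup.coe_mul, mul_inv_rev]
      change X.actR ((x : W)⁻¹ * (cs.simple s)⁻¹) _ = _
      rw [CoxeterSystem.inv_simple, actR_mul, X.actR_simple_rootR, map_neg]
    rw [← mul_assoc, hσσ, one_mul, h3] at h2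
    have h4 : z' (σ * x) = z' x := mul_left_cancel₀ hne (by
      linear_combination (hz' x) + h2)
    rw [h1, h4, sub_self]
    exact dvd_zero _
  · set tx : W := (x : W)⁻¹ * cs.simple s * ((x : W)⁻¹)⁻¹ with htxdef
    have htxm : tx ∈ cs.parabolic S₀ :=
      mul_mem (mul_mem (inv_mem x.2) σ.2) (inv_mem (inv_mem x.2))
    have htxr : cs.IsReflection tx := ⟨(x : W)⁻¹, s, rfl⟩
    obtain ⟨φ, hφ⟩ := hGKM.exists_form_eq_one t.2 htxm ht htxr htx
    -- `α_t` is prime and does not divide `x⁻¹(α_s)`.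
    refine ((prime_ι hφ).dvd_or_dvd (a := X.actR (x : W)⁻¹ (X.rootR s)) ?_).resolve_left
      fun hd => ?_
    · have h1 : SymmetricAlgebra.ι K V (X.reflRoot t) ∣
          X.actR ((x * t : cs.parabolic S₀) : W)⁻¹ (X.rootR s) -
            X.actR (x : W)⁻¹ (X.rootR s) := by
        rw [Subgroup.coe_mul, mul_inv_rev, ht.inv, actR_mul]
        exact Ideal.mem_span_singleton.1 (X.actR_sub_mem ht _)
      have h2 := mem_zMod.1 hz x t ht
      have h3 := mem_zMod.1 hz (σ * x) t ht
      have h4 := hz' (x * t)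
      rw [← mul_assoc] at h4
      have h5 := dvd_sub (dvd_sub h2 h3) (h1.mul_right (z' (x * t)))
      refine (congrArg (_ ∣ ·) ?_).mp h5
      linear_combination h4 - hz' x
    · rw [rootR, actR_ι] at hd
      have h1 := eq_smul_of_ι_dvd_ι hφ hd
      rw [h] at h1
      obtain ⟨u, rfl⟩ := hc
      have h2 : X.reflRoot tx = ((↑u⁻¹ : K) * φ ((u : K) • X.reflRoot tx)) • X.reflRoot t := by
        rw [mul_smul, ← h1, smul_smul, Units.inv_mul, one_smul]
      refine hGKM.mkQ_ne_smul t.2 htxm ht htxr htx (IsLocalRing.maximalIdeal K)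
        (Ideal.Quotient.mk _ ((↑u⁻¹ : K) * φ ((u : K) • X.reflRoot tx))) ?_
      conv_lhs => rw [h2, map_smul]
      rfl

/-- Hence the Frobenius form extends to `𝒵`. -/
theorem exists_zMod_form [IsLocalRing K] [Fintype (cs.parabolic S₀)] (hGKM : X.IsGKM S₀)
    {l : List B} (hl : ∀ s ∈ l, s ∈ S₀) {z : cs.parabolic S₀ → X.R} (hz : z ∈ X.zMod S₀) :
    ∃ r : X.R, algebraMap X.R X.Q r = ∑ y : cs.parabolic S₀,
        X.demCoeff (algebraMap X.R X.Q) l y * algebraMap X.R X.Q (z y) ∧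
      ∀ i, (∀ x, z x ∈ X.degR i) → r ∈ X.degR (i - 2 * l.length) := by
  have hψ : X.RootsNeZero (algebraMap X.R X.Q) S₀ := fun s _ y _ =>
    (map_ne_zero_iff _ (IsFractionRing.injective X.R X.Q)).2
      ((map_ne_zero_iff _ (X.actR_injective _)).2 (X.rootR_ne_zero s))
  induction l generalizing z with
  | nil =>
    refine ⟨z 1, ?_, fun i hi => by simpa using hi 1⟩
    rw [Finset.sum_eq_single 1]
    · simp [demCoeff]
    · intro y _ hy
      rw [demCoeff, if_neg (by simpa using hy), zero_mul]
    · simp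
  | cons s l ih =>
    obtain ⟨z', hz', h⟩ := exists_zMod_demazure hGKM hz (hl s (by simp))
    obtain ⟨r, hr, hdeg⟩ := ih (fun t ht => hl t (by simp [ht])) hz'
    refine ⟨r, ?_, fun i hi => ?_⟩
    · rw [hr, sum_demCoeff_cons hψ (hl s (by simp)) l]
      intro y
      rw [← map_mul, h, map_sub]
    · have := hdeg (i - 2) fun x => by
        refine mem_degR_sub_two_of_mul_mem (X.actR_mem_degR (x : W)⁻¹ (X.ι_mem_degR (X.root s)))
          ((map_ne_zero_iff _ (X.actR_injective _)).2 (X.rootR_ne_zero s)) (i := i) ?_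
        exact (congrArg (· ∈ X.degR i) (h x)).mpr (sub_mem (hi _) (hi _))
      rwa [show i - 2 - 2 * (l.length : ℤ) = i - 2 * ((s :: l).length : ℤ) by
        rw [List.length_cons]; push_cast; ring] at this

end ZMod

namespace PreObj

/-! ### The isomorphism of `R ⊗_{R^H} R` and `𝒵` -/

variable {X : CoxeterRealization K V cs} [IsDomain K] [Module.Free K V] {S₀ : Set B}

/-- The component of an element of `𝒵` at `y`. -/
def zcoord (y : cs.parabolic S₀) : (X.zObj S₀).carrier →ₗ[X.R] X.R := X.zEval S₀ y

theorem zext {z z' : (X.zObj S₀).carrier} (h : ∀ y, zcoord y z = zcoord y z') : z = z' :=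
  Subtype.ext (funext h)

theorem zcoord_left (y : cs.parabolic S₀) (f : X.R) (z : (X.zObj S₀).carrier) :
    zcoord y ((X.zObj S₀).left f z) = X.actR (y : W)⁻¹ f * zcoord y z := rfl

theorem mem_zObj_deg {i : ℤ} {z : (X.zObj S₀).carrier} :
    z ∈ (X.zObj S₀).deg i ↔ ∀ y, zcoord y z ∈ X.degR i := Iff.rfl

theorem mem_zObj_locSub {x : W} {z : (X.zObj S₀).carrier} :
    z ∈ (X.zObj S₀).locSub x ↔ ∀ y : cs.parabolic S₀, (y : W) ≠ x → zcoord y z = 0 := by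
  have h1 : z ∈ (X.zObj S₀).locSub x ↔ ∀ y : cs.parabolic S₀, (y : W) ≠ x →
      (zcoord y).baseChange X.Q ((1 : X.Q) ⊗ₜ[X.R] z) = 0 := by
    change (1 : X.Q) ⊗ₜ[X.R] z ∈ (⨅ (y : cs.parabolic S₀) (_ : (y : W) ≠ x),
      LinearMap.ker ((zcoord y).baseChange X.Q)) ↔ _
    simp only [Submodule.mem_iInf, LinearMap.mem_ker]
  rw [h1]
  refine forall_congr' fun y => forall_congr' fun _ => ?_
  rw [LinearMap.baseChange_tmul, ← TensorProduct.tmul_zero X.R (1 : X.Q)]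
  exact ⟨one_tmul_R_injective, fun h => by rw [h]⟩

theorem zObj_locLeft : (X.zObj S₀).LocLeft := fun x z hz f => by
  congr 1
  refine zext fun y => ?_
  rw [zcoord_left, map_smul, smul_eq_mul]
  by_cases hy : (y : W) = x
  · rw [hy]
  · rw [mem_zObj_locSub.1 hz y hy, mul_zero, mul_zero]

theorem zObj_torsionFree : (X.zObj S₀).TorsionFree := fun r z h => by
  by_cases hr : r = 0
  · exact Or.inl hr
  · refine Or.inr (zext fun y => ?_)
    have := congrArg (zcoord y) h
    rw [map_smul, map_zero, smul_eq_mul] at this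
    rw [map_zero]
    exact (mul_eq_zero.1 this).resolve_left hr

theorem zObj_isGraded : (X.zObj S₀).IsGraded where
  right_deg _ _ _ _ hr hz := fun y => X.mul_mem_degR hr (hz y)
  left_deg _ _ _ _ hr hz := fun y => X.mul_mem_degR (X.actR_mem_degR _ hr) (hz y)

theorem zObj_loc_of_not_mem {x : W} (hx : x ∉ cs.parabolic S₀) : (X.zObj S₀).loc x = ⊥ := by
  rw [loc_eq_span, eq_bot_iff]
  refine Submodule.span_le.2 ?_
  rintro _ ⟨z, hz, rfl⟩
  have : z = 0 := zext fun y => by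
    rw [mem_zObj_locSub.1 hz y fun h => hx (h ▸ y.2), map_zero]
  change (1 : X.Q) ⊗ₜ[X.R] z ∈ (⊥ : Submodule X.Q _)
  rw [this, TensorProduct.tmul_zero]
  exact zero_mem _

/-- The unit of `𝒵`. -/
def zOne (X : CoxeterRealization K V cs) (S₀ : Set B) : (X.zObj S₀).carrier :=
  ⟨fun _ => 1, fun x t _ => by rw [sub_self]; exact zero_mem _⟩

theorem zOne_left {c : X.R} (hc : c ∈ X.invariants (cs.parabolic S₀)) :
    (X.zObj S₀).left c (zOne X S₀) = c • zOne X S₀ :=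
  zext fun y => by
    rw [zcoord_left, map_smul, hc _ (inv_mem y.2)]
    rfl

/-- The map `R ⊗_{R^H} R → 𝒵`, `f ⊗ g ↦ (x⁻¹(f) g)_x`. -/
def invToZ (X : CoxeterRealization K V cs) (S₀ : Set B) :
    (X.invObj (cs.parabolic S₀)).carrier →ₗ[X.R] (X.zObj S₀).carrier :=
  invMap (zOne X S₀) fun _ hc => zOne_left hc

theorem zcoord_invToZ (y : cs.parabolic S₀) (z : (X.invObj (cs.parabolic S₀)).carrier) :
    zcoord y (invToZ X S₀ z) = evInv X y.2 z := by
  induction z using inv_induction with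
  | itm f g =>
    rw [invToZ, invMap_itm, map_smul, zcoord_left, evInv_itm, smul_eq_mul, mul_comm g]
    exact congrArg (· * g) (mul_one _)
  | add a b ha hb => simp only [map_add, ha, hb]

theorem isHom_invToZ (hH : X.IsFaithful (cs.parabolic S₀)) :
    IsHom (X.invObj (cs.parabolic S₀)) (X.zObj S₀) 0 (invToZ X S₀) where
  map_left := invMap_left _ _
  map_deg i z hz := mem_zObj_deg.2 fun y => by
    rw [zcoord_invToZ]
    exact (isChar_evInv hH y.2).map_deg i z hz
  map_loc x z hz := mem_zObj_locSub.2 fun y hy => by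
    rw [zcoord_invToZ]
    exact (isChar_evInv hH y.2).map_loc x hy.symm z hz

section Form

variable [X.IsRegular] [IsLocalRing K] [Fintype (cs.parabolic S₀)] (hGKM : X.IsGKM S₀)
  {l : List B} (hl : ∀ s ∈ l, s ∈ S₀) {D : X.FrobeniusForm (cs.parabolic S₀) l.length}
  (hD : ∀ y, D.coeff y = X.demCoeff (algebraMap X.R X.Q) l y)

include hGKM hl hD in
/-- The Frobenius form on `𝒵`. -/
theorem exists_zForm : ∃ τ : (X.zObj S₀).carrier →ₗ[X.R] X.R,
    (∀ z, algebraMap X.R X.Q (τ z) =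
      ∑ y, D.coeff y * algebraMap X.R X.Q (zcoord y z)) ∧
    ∀ i, ∀ z ∈ (X.zObj S₀).deg i, τ z ∈ X.degR (i - 2 * l.length) := by
  choose τ hτ hdeg using fun z : (X.zObj S₀).carrier => exists_zMod_form hGKM hl z.2
  have hτ' : ∀ z, algebraMap X.R X.Q (τ z) =
      ∑ y, D.coeff y * algebraMap X.R X.Q (zcoord y z) := fun z =>
    (hτ z).trans (Finset.sum_congr rfl fun y _ => by rw [hD]; rfl)
  have hinj := IsFractionRing.injective X.R X.Q
  refine ⟨⟨⟨τ, fun a b => hinj ?_⟩, fun r a => hinj ?_⟩, hτ', fun i z hz => hdeg z i hz⟩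
  · rw [map_add, hτ', hτ', hτ', ← Finset.sum_add_distrib]
    exact Finset.sum_congr rfl fun y _ => by rw [map_add, map_add, mul_add]
  · rw [smul_eq_mul, RingHom.id_apply, map_mul, hτ', hτ', Finset.mul_sum]
    exact Finset.sum_congr rfl fun y _ => by
      rw [map_smul, smul_eq_mul, map_mul, mul_left_comm]

include hGKM hl hD in
theorem exists_zToInv (hH : X.IsFaithful (cs.parabolic S₀)) :
    ∃ ρ : (X.zObj S₀).carrier →ₗ[X.R] (X.invObj (cs.parabolic S₀)).carrier,
      IsHom (X.zObj S₀) (X.invObj (cs.parabolic S₀)) 0 ρ ∧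
      (∀ z, invToZ X S₀ (ρ z) = z) ∧ ∀ z, ρ (invToZ X S₀ z) = z := by
  obtain ⟨τ, hτ, hdeg⟩ := exists_zForm hGKM hl hD
  have hinj := IsFractionRing.injective X.R X.Q
  refine ⟨toInv D τ, isHom_toInv D (fun c hc z => hinj ?_) zObj_locLeft zObj_torsionFree
    zObj_isGraded (fun x hx => zObj_loc_of_not_mem hx) (add_neg_cancel _) hdeg, fun z => ?_,
    fun z => ?_⟩
  · rw [map_mul, hτ, hτ, Finset.mul_sum]
    exact Finset.sum_congr rfl fun y _ => by
      rw [zcoord_left, hc _ (inv_mem y.2), map_mul, mul_left_comm]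
  · classical
    refine zext fun x => hinj ?_
    rw [zcoord_invToZ, toInv_apply, map_sum, map_sum]
    have h1 : ∀ y, algebraMap X.R X.Q (zcoord y z) * (D.coeff y *
        ∑ i, algebraMap X.R X.Q (X.actR (x : W)⁻¹ (D.b i)) *
          algebraMap X.R X.Q (X.actR (y : W)⁻¹ (D.b' i))) =
        if y = x then algebraMap X.R X.Q (zcoord y z) else 0 := fun y => by
      rw [D.coeff_mul_sum hH, mul_ite, mul_one, mul_zero]
    have h2 := Finset.sum_congr (rfl : (Finset.univ : Finset (cs.parabolic S₀)) = _)
      fun y _ => h1 y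
    rw [Finset.sum_ite_eq' Finset.univ x, if_pos (Finset.mem_univ _)] at h2
    rw [← h2]
    simp only [evInv_itm, map_mul, hτ, zcoord_left, Finset.mul_sum]
    rw [Finset.sum_comm]
    exact Finset.sum_congr rfl fun y _ => Finset.sum_congr rfl fun i _ => by ring
  · induction z using inv_induction with
    | itm f g =>
      refine (toInv_apply D τ _).trans (Eq.trans ?_ (itm_eq_sum D f g).symm)
      refine Finset.sum_congr rfl fun i _ => congrArg _ (hinj ?_)
      rw [hτ, map_mul, D.map_eq, Finset.sum_mul]
      refine Finset.sum_congr rfl fun y _ => ?_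
      rw [zcoord_left, zcoord_invToZ, evInv_itm, map_mul, map_mul, map_mul, map_mul]
      ring
    | add a b ha hb => simp only [map_add, ha, hb]

end Form

end PreObj

end CoxeterRealization

end

theorem mainTheorem5
    {K : Type*} {V : Type*} {B : Type*} {W : Type*}
    [CommRing K] [IsDomain K] [IsNoetherianRing K] [IsLocalRing K]
    [IsAdicComplete (IsLocalRing.maximalIdeal K) K]
    [AddCommGroup V] [Module K V] [Module.Free K V] [Module.Finite K V]
    [Group W] {M : CoxeterMatrix B} (cs : CoxeterSystem M W)
    (X : CoxeterRealization K V cs)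
    (hroot : ∀ s, X.root s ≠ 0)
    (hcoroot : ∀ s, Function.Surjective (X.coroot s))
    (S₀ : Set B)
    (hfin : Finite (cs.parabolic S₀))
    (hfaithful : ∀ w ∈ cs.parabolic S₀, X.act w = LinearMap.id → w = 1)
    (hGKM : X.IsGKM S₀)
    (hfree : X.IsGradedFreeOver S₀)
    (hbraid : X.HasBraidMorphisms)
    (w₀ : W) (hw₀ : cs.IsLongest S₀ w₀) :
    (X.invObj (cs.parabolic S₀)).IsObj ∧ (X.zObj S₀).IsObj ∧
    X.IsB w₀ ((X.invObj (cs.parabolic S₀)).shift (cs.length w₀)) ∧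
    (∀ N, X.IsB w₀ N →
      Nonempty (CoxeterRealization.PreObj.Iso N
        ((X.invObj (cs.parabolic S₀)).shift (cs.length w₀)))) ∧
    Nonempty (CoxeterRealization.PreObj.Iso
      ((X.invObj (cs.parabolic S₀)).shift (cs.length w₀))
      ((X.zObj S₀).shift (cs.length w₀))) ∧
    X.IsSoergel (X.invObj (cs.parabolic S₀)) ∧
    (X.invObj (cs.parabolic S₀)).Indecomposable := by
  have : X.IsRegular := ⟨hroot, hcoroot⟩
  have := Fintype.ofFinite (cs.parabolic S₀)
  have hH := CoxeterRealization.isFaithful_of_act hfaithful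
  obtain ⟨l, hr, hl, hw, D, hD, hcoeff⟩ :=
    CoxeterRealization.exists_frobeniusForm hGKM hfree hw₀
  obtain ⟨ρ, hρ, hρ₁, hρ₂⟩ :=
    CoxeterRealization.PreObj.exists_zToInv hGKM hl hcoeff hH
  have hι := CoxeterRealization.PreObj.isHom_invToZ (X := X) (S₀ := S₀) hH
  have hinv := CoxeterRealization.PreObj.isObj_invObj D hH
  exact ⟨hinv, hinv.of_retract hρ hι hρ₁,
    CoxeterRealization.isB_invObj hl D hD hH hw₀ _ rfl,
    fun N hN => hN.nonempty_iso hl D hD hH hbraid hw₀ hr hw,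
    ⟨⟨hι.toHom _ _ (add_zero _), hρ.toHom _ _ (add_zero _), hρ₂, hρ₁⟩⟩,
    CoxeterRealization.PreObj.isSoergel_invObj hl D hD hH,
    CoxeterRealization.PreObj.invObj_indecomposable⟩
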